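/- Let $n\ge 2$ and let $Q=\{z\in\mathbb C^{n+1}: z_0^2+\dots+z_n^2=1\}$ be the complex sphere, with the holomorphic $n$-form $\Omega$ defined by $\Omega\wedge d(z_0^2+\dots+z_n^2)=dz_0\wedge\dots\wedge dz_n$ and with a Stenzel metric, that is, a Kähler metric with Kähler form $\omega=i\partial\bar\partial u(|z|^2)$, $u$ smooth, such that $\omega^n$ is a constant multiple of $\Omega\wedge\bar\Omega$. A submanifold of $Q$ of real dimension $n$ is special Lagrangian if $\omega$ and $\operatorname{Im}\Omega$ vanish on it. Fix a unit vector $p\in\mathbb R^{n+1}$ (for instance $p=(1,0,\dots,0)$). For $\Gamma\subset\mathbb C$ put $$L_\Gamma=\{\gamma p+\sqrt{1-\gamma^2}\,y:\ \gamma\in\Gamma,\ y\in S^n\cap p^\perp\}\subset Q .$$ For $k\in\mathbb Z/(2n-2)$ let $\theta_k=k\pi/(n-1)$ if $n$ is even and $\theta_k=k\pi/(n-1)+\pi/(2(n-1))$ if $n$ is odd. A curve in $\mathbb C$ going to infinity is called asymptotic to the half-line $\{\arg z=\theta\}$ if its direction $\gamma/|\gamma|$ tends to $e^{i\theta}$ and,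 when $n\ge3$, its distance to the half-line tends to $0$. Then there are the following curves in $\mathbb C$, which depend only on $n$. (a) There are $2n-2$ injective curves (branches) $\beta_k:[0,\infty)\to\mathbb C$, continuous, smooth and regular on $(0,\infty)$, with $\beta_k$ asymptotic to $\{\arg z=\theta_k\}$. They start from $\pm1$, meet $[-1,1]$ only at their starting point, and the sets $\beta_k((0,\infty))$ are pairwise disjoint. Exactly $n-1$ of them start from $1$, in the directions $e^{i(2j\pi/n+\pi)}$, $1\le j\le n-1$, and $n-1$ start from $-1$, in the directions $e^{2ij\pi/n}$, $1\le j\le n-1$; if $\beta_k$ and $\beta_{k+1}$ start from the same point, the starting direction of $\beta_{k+1}$ is that of $\beta_k$ rotated by $2\pi/n$. (b) For each $k$ there is a one-parameter family of regular curves $\Phi_{k,c}:\mathbb R\to\mathbb C$, $c>0$, with $\Phi_{k,c}(s)$ smooth in $(c,s)$, such that $(k,c,s)\mapsto\Phi_{k,c}(s)$ is a bijection onto the complement of the union of $[-1,1]$ and of all the branches. The ends of $\Phi_{k,c}$ are asymptotic to the successive half-lines $\{\arg z=\theta_k\}$ (as $s\to-\infty$) and $\{\arg z=\theta_{k+1}\}$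 (as $s\to+\infty$). For every Stenzel metric and every $p$, the special Lagrangians of the form $L_\Gamma$ fall into three kinds: 1. $L_{[-1,1]}$ is the real sphere $Q\cap\mathbb R^{n+1}$, and it is a smooth special Lagrangian submanifold. 2. The $2n-2$ sets $L_{\beta_k([0,\infty))}$ are smooth special Lagrangian submanifolds, and each meets the real sphere in exactly one point, namely the north pole $p$ if $\beta_k$ starts from $1$ and the south pole $-p$ if $\beta_k$ starts from $-1$. 3. For all $k$ and $c>0$, the set $L_{\Phi_{k,c}(\mathbb R)}$ is a smooth special Lagrangian submanifold, whose two ends are asymptotic to the two successive members $L_{\beta_k([0,\infty))}$ and $L_{\beta_{k+1}([0,\infty))}$ of the second kind: the distance in $\mathbb C^{n+1}$ from a point $z$ of the end to that member is $o(|z|)$, and it tends to $0$ if $n\ge3$. There are no others: if $\gamma:\mathbb R\to\mathbb C\setminus\{\pm1\}$ is a regular $C^1$ curve, then the immersion $(s,y)\mapsto\gamma(s)p+\sqrt{1-\gamma(s)^2}\,y$ of $\mathbb R\times(S^n\cap p^\perp)$ (with a continuous choice of the square root) is special Lagrangian if and only if the image of $\gamma$ is contained in $(-1,1)$, in some $\beta_k((0,\infty))$,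 or in some $\Phi_{k,c}(\mathbb R)$. -/

import Mathlib

open scoped ContDiff Topology

noncomputable section

namespace ComplexSphere

/-- The ambient space `ℂ^{n+1}`, with coordinates `z 0, …, z n` and its Hermitian norm. -/
abbrev CSpace (n : ℕ) : Type := EuclideanSpace ℂ (Fin (n + 1))

/-- The real space `ℝ^{n+1}`. -/
abbrev RSpace (n : ℕ) : Type := EuclideanSpace ℝ (Fin (n + 1))

/-- The inclusion `ℝ^{n+1} ⊂ ℂ^{n+1}`. -/
def complexify (n : ℕ) : RSpace n →ₗ[ℝ] CSpace n where
  toFun x := WithLp.toLp 2 fun j => (x j : ℂ)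
  map_add' x y := by ext j; simp
  map_smul' c x := by ext j; simp

/-- The complex sphere `Q = {z : z₀² + ⋯ + zₙ² = 1}`. -/
def quadric (n : ℕ) : Set (CSpace n) := {z | ∑ j, z j ^ 2 = 1}

/-- The (complex) tangent space of the complex sphere at `z`, the kernel of
`d(z₀² + ⋯ + zₙ²)`. -/
def tangent {n : ℕ} (z : CSpace n) : Submodule ℂ (CSpace n) where
  carrier := {v | ∑ j, z j * v j = 0}
  add_mem' {v w} hv hw := by
    simp only [Set.mem_ofPred_eq] at hv hw ⊢
    simp [mul_add, Finset.sum_add_distrib, hv, hw]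
  zero_mem' := by simp
  smul_mem' c v hv := by
    simp only [Set.mem_ofPred_eq] at hv ⊢
    simp [mul_left_comm _ c, ← Finset.mul_sum, hv]

/-- The real sphere, that is the set of real points of the complex sphere. -/
def realSphere (n : ℕ) : Set (CSpace n) := {z | ∃ x : RSpace n, ‖x‖ = 1 ∧ z = complexify n x}

/-! ### The holomorphic volume form -/

/-- The holomorphic `(n,0)`-form `Ω` on the complex sphere, determined on tangent vectors by
`Ω ∧ dF = dz₀ ∧ ⋯ ∧ dzₙ` with `F = z₀² + ⋯ + zₙ² - 1`.  As `dF(z) = 2` at a point `z` of the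
complex sphere, `Ω(v₁, …, vₙ)` is half of `(dz₀ ∧ ⋯ ∧ dzₙ)(v₁, …, vₙ, z)`;
see `volForm_mul_dF`. -/
def volForm {n : ℕ} (z : CSpace n) (v : Fin n → CSpace n) : ℂ :=
  Matrix.det (Matrix.of fun i j => (Fin.snoc v z : Fin (n + 1) → CSpace n) i j) / 2

theorem volForm_mul_dF {n : ℕ} {z : CSpace n} (hz : z ∈ quadric n) (v : Fin n → CSpace n)
    (hv : ∀ i, v i ∈ tangent z) (w : CSpace n) :
    volForm z v * (2 * ∑ j, z j * w j) =
      Matrix.det (Matrix.of fun i j => (Fin.snoc v w : Fin (n + 1) → CSpace n) i j) := by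
  have hz' : ∑ j, z j ^ 2 = 1 := hz
  set s : ℂ := ∑ j, z j * w j with hs
  have key : ∀ x : CSpace n, (Matrix.of fun i j => (Fin.snoc v x : Fin (n + 1) → CSpace n) i j) =
      Matrix.updateRow (Matrix.of fun i j => (Fin.snoc v z : Fin (n + 1) → CSpace n) i j)
        (Fin.last n) x := by
    intro x
    ext i j
    refine Fin.lastCases ?_ (fun i => ?_) i
    · simp
    · rw [Matrix.updateRow_ne (Fin.castSucc_lt_last i).ne]; simp
  have h0 : Matrix.det (Matrix.of fun i j =>
      (Fin.snoc v (w - s • z) : Fin (n + 1) → CSpace n) i j) = 0 := by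
    apply Matrix.exists_mulVec_eq_zero_iff.1
    refine ⟨fun j => z j, ?_, ?_⟩
    · intro h
      have : ∀ j, z j = 0 := fun j => congrFun h j
      simp [this] at hz'
    · funext i
      refine Fin.lastCases ?_ (fun i => ?_) i
      · simp only [Matrix.mulVec, dotProduct, Matrix.of_apply, Fin.snoc_last, PiLp.sub_apply,
          PiLp.smul_apply, smul_eq_mul, Pi.zero_apply, sub_mul, Finset.sum_sub_distrib]
        have : ∑ j, s * z j * z j = s := by
          simp_rw [mul_assoc, ← Finset.mul_sum, ← sq, hz', mul_one]
        rw [this, hs]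
        simp [mul_comm]
      · have := hv i
        simp only [Matrix.mulVec, dotProduct, Matrix.of_apply, Fin.snoc_castSucc, Pi.zero_apply]
        rw [← show ∑ j, z j * v i j = 0 from this]
        simp [mul_comm]
  rw [key] at h0 ⊢
  have hw : (w : Fin (n+1) → ℂ) = ((w - s • z : CSpace n) : Fin (n+1) → ℂ) + s • (z : Fin (n+1) → ℂ) := by
    funext j; simp
  rw [hw, Matrix.det_updateRow_add, Matrix.det_updateRow_smul, h0, ← key, volForm]
  ring

/-! ### The Stenzel metric -/

/-- The Wirtinger derivative `∂f/∂z_j`. -/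
def dZ {n : ℕ} (j : Fin (n + 1)) (f : CSpace n → ℂ) (z : CSpace n) : ℂ :=
  (fderiv ℝ f z (EuclideanSpace.single j 1) -
    Complex.I * fderiv ℝ f z (EuclideanSpace.single j Complex.I)) / 2

/-- The Wirtinger derivative `∂f/∂z̄_j`. -/
def dZbar {n : ℕ} (j : Fin (n + 1)) (f : CSpace n → ℂ) (z : CSpace n) : ℂ :=
  (fderiv ℝ f z (EuclideanSpace.single j 1) +
    Complex.I * fderiv ℝ f z (EuclideanSpace.single j Complex.I)) / 2

/-- The function `u(r²)` on `ℂ^{n+1}`, where `r² = |z₀|² + ⋯ + |zₙ|²`. -/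
def potential {n : ℕ} (u : ℝ → ℝ) (z : CSpace n) : ℂ := (u (‖z‖ ^ 2) : ℂ)

/-- The Hermitian form `∑ ∂²u(r²)/∂z_j∂z̄_k v_j w̄_k` at `z`. -/
def leviForm {n : ℕ} (u : ℝ → ℝ) (z v w : CSpace n) : ℂ :=
  ∑ j, ∑ k, dZ j (dZbar k (potential u)) z * v j * star (w k)

/-- The two-form `i ∂∂̄ u(r²) = i ∑ ∂²u(r²)/∂z_j∂z̄_k dz_j ∧ dz̄_k` at `z`. -/
def kahlerForm {n : ℕ} (u : ℝ → ℝ) (z v w : CSpace n) : ℂ :=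
  Complex.I * (leviForm u z v w - leviForm u z w v)

/-- `u` is a potential of the Stenzel metric: `u` is smooth (`r² ≥ 1` on the complex sphere),
`ω = i ∂∂̄ u(r²)` is the Kähler form of a metric on the complex sphere (`ω(v, iv) > 0` for all
tangent `v ≠ 0`), and this metric is Ricci-flat, in the sense that its volume form `ωⁿ/n!` is a
constant multiple of `Ω ∧ Ω̄`. -/
structure IsStenzelPotential (n : ℕ) (u : ℝ → ℝ) : Prop where
  smooth : ContDiffOn ℝ ∞ u (Set.Ioi 0)
  kahler : ∀ z ∈ quadric n, ∀ v ∈ tangent z, v ≠ 0 → 0 < (kahlerForm u z v (Complex.I • v)).re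
  calabiYau : ∃ c : ℝ, 0 < c ∧ ∀ z ∈ quadric n, ∀ v : Fin n → CSpace n, (∀ i, v i ∈ tangent z) →
    Matrix.det (Matrix.of fun i j => leviForm u z (v i) (v j)) = ((c * ‖volForm z v‖ ^ 2 : ℝ) : ℂ)

section Existence

/-! #### Existence of the Stenzel metric -/

open Complex

theorem norm_sq_line {n : ℕ} (z v : CSpace n) (t : ℝ) :
    ‖z + t • v‖ ^ 2 = ‖z‖ ^ 2 + t * (2 * (∑ j, star (z j) * v j).re) + t ^ 2 * ‖v‖ ^ 2 := by
  simp only [EuclideanSpace.norm_sq_eq, Complex.re_sum, Finset.mul_sum, ← Finset.sum_add_distrib]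
  refine Finset.sum_congr rfl fun j _ => ?_
  simp [Complex.sq_norm, Complex.normSq_apply]
  ring

theorem differentiableAt_radial {n : ℕ} {g : ℝ → ℝ} {z : CSpace n}
    (hg : DifferentiableAt ℝ g (‖z‖ ^ 2)) :
    DifferentiableAt ℝ (fun z : CSpace n => ((g (‖z‖ ^ 2) : ℝ) : ℂ)) z := by
  have h1 : DifferentiableAt ℝ (fun z : CSpace n => ‖z‖ ^ 2) z :=
    ((contDiff_norm_sq ℂ (n := 1)).differentiable one_ne_zero) z
  exact Complex.ofRealCLM.differentiableAt.comp z (DifferentiableAt.comp z hg h1)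

theorem fderiv_radial {n : ℕ} {g : ℝ → ℝ} {z : CSpace n}
    (hg : DifferentiableAt ℝ g (‖z‖ ^ 2)) (v : CSpace n) :
    fderiv ℝ (fun z : CSpace n => ((g (‖z‖ ^ 2) : ℝ) : ℂ)) z v =
      ((deriv g (‖z‖ ^ 2) * (2 * (∑ j, star (z j) * v j).re) : ℝ) : ℂ) := by
  rw [← (differentiableAt_radial hg).lineDeriv_eq_fderiv, lineDeriv]
  have h1 : HasDerivAt (fun t : ℝ => ‖z + t • v‖ ^ 2) (2 * (∑ j, star (z j) * v j).re) 0 := by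
    simp only [norm_sq_line]
    generalize (2 * (∑ j, star (z j) * v j).re) = a
    have h := (((hasDerivAt_id (0:ℝ)).mul_const a).const_add (‖z‖^2)).fun_add
      (((hasDerivAt_id (0:ℝ)).fun_pow 2).mul_const (‖v‖^2))
    refine (h.congr_deriv (by simp)).congr_of_eventuallyEq (Filter.Eventually.of_forall fun t => ?_)
    simp
  have h2 : HasDerivAt g (deriv g (‖z‖ ^ 2)) (‖z + (0:ℝ) • v‖ ^ 2) := by
    simpa using hg.hasDerivAt
  exact (HasDerivAt.ofReal_comp (HasDerivAt.comp (0:ℝ) h2 h1)).deriv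

theorem dZbar_potential {n : ℕ} {u : ℝ → ℝ} (hu : ContDiffOn ℝ ∞ u (Set.Ioi 0)) {z : CSpace n}
    (hz : z ≠ 0) (k : Fin (n + 1)) :
    dZbar k (potential u) z = ((deriv u (‖z‖ ^ 2) : ℝ) : ℂ) * z k := by
  have hpos : (0:ℝ) < ‖z‖ ^ 2 := by positivity
  have hd : DifferentiableAt ℝ u (‖z‖ ^ 2) :=
    (hu.contDiffAt (Ioi_mem_nhds hpos)).differentiableAt (by simp)
  have e : (potential u : CSpace n → ℂ) = fun z => ((u (‖z‖ ^ 2) : ℝ) : ℂ) := rfl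
  rw [dZbar, e, fderiv_radial hd, fderiv_radial hd]
  simp [-ofReal_mul]
  apply Complex.ext <;> simp <;> ring

theorem leviForm_eq {n : ℕ} {u : ℝ → ℝ} (hu : ContDiffOn ℝ ∞ u (Set.Ioi 0)) {z : CSpace n}
    (hz : z ≠ 0) (v w : CSpace n) :
    leviForm u z v w = ((deriv u (‖z‖ ^ 2) : ℝ) : ℂ) * ∑ j, v j * star (w j) +
      ((deriv (deriv u) (‖z‖ ^ 2) : ℝ) : ℂ) * ((∑ j, star (z j) * v j) * ∑ k, z k * star (w k)) := by
  have hpos : (0:ℝ) < ‖z‖ ^ 2 := by positivity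
  have hd : DifferentiableAt ℝ (deriv u) (‖z‖ ^ 2) := by
    have h2 : ContDiffOn ℝ ∞ (deriv u) (Set.Ioi 0) :=
      ((contDiffOn_infty_iff_deriv_of_isOpen isOpen_Ioi).1 hu).2
    exact (h2.contDiffAt (Ioi_mem_nhds hpos)).differentiableAt (by simp)
  have key : ∀ j k, dZ j (dZbar k (potential u)) z =
      ((deriv u (‖z‖ ^ 2) : ℝ) : ℂ) * (if j = k then 1 else 0) +
      ((deriv (deriv u) (‖z‖ ^ 2) : ℝ) : ℂ) * (star (z j) * z k) := by
    intro j k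
    have heq : dZbar k (potential u) =ᶠ[𝓝 z]
        fun z => ((deriv u (‖z‖ ^ 2) : ℝ) : ℂ) * z k := by
      filter_upwards [isOpen_ne.mem_nhds hz] with x hx
      exact dZbar_potential hu hx k
    have hf : ∀ v : CSpace n, fderiv ℝ (dZbar k (potential u)) z v =
        ((deriv u (‖z‖ ^ 2) : ℝ) : ℂ) * v k +
        z k * ((deriv (deriv u) (‖z‖ ^ 2) * (2 * (∑ j, star (z j) * v j).re) : ℝ) : ℂ) := by
      intro v
      have hp : HasFDerivAt (fun x : CSpace n => x k)
          ((EuclideanSpace.proj k : CSpace n →L[ℂ] ℂ).restrictScalars ℝ) z :=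
        ((EuclideanSpace.proj k : CSpace n →L[ℂ] ℂ).restrictScalars ℝ).hasFDerivAt
      rw [heq.fderiv_eq, ((differentiableAt_radial hd).hasFDerivAt.fun_mul hp).fderiv]
      simp [fderiv_radial hd]
    rw [dZ, hf, hf]
    by_cases hjk : j = k
    · subst hjk
      simp [-ofReal_mul]
      apply Complex.ext <;> simp <;> ring
    · have hkj : k ≠ j := fun h => hjk h.symm
      simp [hjk, hkj, -ofReal_mul]
      apply Complex.ext <;> simp <;> ring
  rw [Finset.sum_mul_sum]
  simp only [leviForm, key, Finset.mul_sum, add_mul, Finset.sum_add_distrib]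
  congr 1
  · refine Finset.sum_congr rfl fun j _ => ?_
    simp [mul_assoc]
  · refine Finset.sum_congr rfl fun j _ => Finset.sum_congr rfl fun k _ => ?_
    ring

/-- The integral used for the potential. -/
def stenzelJ (a b t : ℝ) : ℝ := ∫ x in (0:ℝ)..1, x ^ a * (2 + (t - 1) * x) ^ b

theorem base_ge {t x : ℝ} (ht : 0 < t) (h0 : 0 ≤ x) (h1 : x ≤ 1) : 1 ≤ 2 + (t - 1) * x := by
  nlinarith

theorem stenzelJ_cont {a : ℝ} (ha : 0 ≤ a) (b : ℝ) {t : ℝ} (ht : 0 < t) :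
    ContinuousOn (fun x : ℝ => x ^ a * (2 + (t - 1) * x) ^ b) (Set.Icc 0 1) := by
  refine ContinuousOn.mul (fun x _ => ?_) (ContinuousOn.rpow_const (by fun_prop) fun x hx => ?_)
  · exact (Real.continuousAt_rpow_const _ _ (Or.inr ha)).continuousWithinAt
  · exact Or.inl (by linarith [base_ge ht hx.1 hx.2])

theorem stenzelJ_integrable {a : ℝ} (ha : 0 ≤ a) (b : ℝ) {t : ℝ} (ht : 0 < t) :
    IntervalIntegrable (fun x : ℝ => x ^ a * (2 + (t - 1) * x) ^ b) MeasureTheory.volume 0 1 := by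
  apply ContinuousOn.intervalIntegrable
  rw [Set.uIcc_of_le zero_le_one]
  exact stenzelJ_cont ha b ht

theorem hasDerivAt_stenzelJ {a : ℝ} (ha : 0 ≤ a) (b : ℝ) {t : ℝ} (ht : 0 < t) :
    HasDerivAt (stenzelJ a b) (b * stenzelJ (a + 1) (b - 1) t) t := by
  have hu : Set.uIoc (0:ℝ) 1 = Set.Ioc 0 1 := Set.uIoc_of_le zero_le_one
  have hmeas : ∀ a b s : ℝ, 0 ≤ a → 0 < s → MeasureTheory.AEStronglyMeasurable
      (fun x : ℝ => x ^ a * (2 + (s - 1) * x) ^ b)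
      (MeasureTheory.volume.restrict (Set.uIoc 0 1)) := fun a b s h h' =>
    (stenzelJ_integrable h b h').aestronglyMeasurable_restrict_uIoc
  have := (intervalIntegral.hasDerivAt_integral_of_dominated_loc_of_deriv_le
    (μ := MeasureTheory.volume) (a := (0:ℝ)) (b := 1)
    (F := fun s x : ℝ => x ^ a * (2 + (s - 1) * x) ^ b)
    (F' := fun s x : ℝ => b * (x ^ (a + 1) * (2 + (s - 1) * x) ^ (b - 1)))
    (x₀ := t) (s := Set.Ioo 0 (t + 1)) (bound := fun _ => |b| * (t + 2) ^ |b - 1|)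
    (Ioo_mem_nhds ht (by linarith)) ?_ (stenzelJ_integrable ha b ht) ?_ ?_ ?_ ?_).2
  · simp only [intervalIntegral.integral_const_mul] at this
    exact this
  · filter_upwards [Ioi_mem_nhds ht] with s hs using hmeas a b s ha hs
  · exact (hmeas (a + 1) (b - 1) t (by linarith) ht).const_mul b
  · refine Filter.Eventually.of_forall fun x hx s hs => ?_
    rw [hu] at hx
    have h1 := base_ge hs.1 hx.1.le hx.2
    have h2 : 2 + (s - 1) * x ≤ t + 2 := by nlinarith [hs.1, hs.2, hx.1, hx.2]
    rw [norm_mul, Real.norm_eq_abs, Real.norm_eq_abs]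
    refine mul_le_mul_of_nonneg_left ?_ (abs_nonneg b)
    have e1 : 0 ≤ x ^ (a + 1) := Real.rpow_nonneg hx.1.le _
    have e2 : 0 ≤ (2 + (s - 1) * x) ^ (b - 1) := Real.rpow_nonneg (by linarith) _
    rw [abs_of_nonneg (mul_nonneg e1 e2)]
    calc x ^ (a + 1) * (2 + (s - 1) * x) ^ (b - 1) ≤ 1 * (2 + (s - 1) * x) ^ |b - 1| := by
          gcongr
          · exact Real.rpow_le_one hx.1.le hx.2 (by linarith)
          · exact le_abs_self _
      _ ≤ (t + 2) ^ |b - 1| := by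
          rw [one_mul]
          exact Real.rpow_le_rpow (by linarith) h2 (abs_nonneg _)
  · exact intervalIntegrable_const
  · refine Filter.Eventually.of_forall fun x hx s hs => ?_
    rw [hu] at hx
    have h1 := base_ge hs.1 hx.1.le hx.2
    have h3 : HasDerivAt (fun s : ℝ => 2 + (s - 1) * x) x s := by
      simpa using (((hasDerivAt_id s).sub_const 1).mul_const x).const_add 2
    have h4 := (h3.rpow_const (p := b) (Or.inl (by linarith))).const_mul (x ^ a)
    refine h4.congr_deriv ?_
    rw [Real.rpow_add_one hx.1.ne']
    ring

theorem contDiffOn_stenzelJ (m : ℕ) : ∀ {a : ℝ}, 0 ≤ a → ∀ b,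
    ContDiffOn ℝ m (stenzelJ a b) (Set.Ioi 0) := by
  induction m with
  | zero =>
    intro a ha b
    refine contDiffOn_zero.2 fun t ht => ?_
    exact (hasDerivAt_stenzelJ ha b ht).continuousAt.continuousWithinAt
  | succ m ih =>
    intro a ha b
    rw [show ((m + 1 : ℕ) : ℕ∞ω) = (m : ℕ∞ω) + 1 by push_cast; rfl]
    refine (contDiffOn_succ_iff_deriv_of_isOpen isOpen_Ioi).2 ⟨fun t ht => ?_, fun h => ?_, ?_⟩
    · exact (hasDerivAt_stenzelJ ha b ht).differentiableAt.differentiableWithinAt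
    · exact absurd h (by simp)
    · refine ContDiffOn.congr (f := fun t => b * stenzelJ (a + 1) (b - 1) t) ?_
        fun t ht => (hasDerivAt_stenzelJ ha b ht).deriv
      exact contDiffOn_const.mul (ih (by linarith) _)

theorem stenzelJ_identity {a : ℝ} (ha : 0 ≤ a) {t : ℝ} (ht : 0 < t) :
    (a + 1) * stenzelJ a a t + (t - 1) * (a * stenzelJ (a + 1) (a - 1) t) = (t + 1) ^ a := by
  have h := intervalIntegral.integral_eq_sub_of_hasDerivAt
    (f := fun x : ℝ => x ^ (a + 1) * (2 + (t - 1) * x) ^ a)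
    (f' := fun x : ℝ => (a + 1) * (x ^ a * (2 + (t - 1) * x) ^ a) +
      ((t - 1) * a) * (x ^ (a + 1) * (2 + (t - 1) * x) ^ (a - 1))) (a := 0) (b := 1) ?_ ?_
  · rw [intervalIntegral.integral_add ((stenzelJ_integrable ha a ht).const_mul _)
      ((stenzelJ_integrable (by linarith) _ ht).const_mul _),
      intervalIntegral.integral_const_mul, intervalIntegral.integral_const_mul] at h
    rw [stenzelJ, stenzelJ, ← mul_assoc (t - 1), h]
    rw [Real.zero_rpow (by linarith), Real.one_rpow]
    ring_nf
  · intro x hx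
    rw [Set.uIcc_of_le zero_le_one] at hx
    have h1 := base_ge ht hx.1 hx.2
    have h3 : HasDerivAt (fun x : ℝ => 2 + (t - 1) * x) (t - 1) x := by
      simpa using ((hasDerivAt_id x).const_mul (t - 1)).const_add 2
    have h4 := h3.rpow_const (p := a) (Or.inl (by linarith))
    have h5 := (Real.hasDerivAt_rpow_const (x := x) (p := a + 1) (Or.inr (by linarith))).fun_mul h4
    refine h5.congr_deriv ?_
    rw [add_sub_cancel_right]
    ring
  · exact ((stenzelJ_integrable ha a ht).const_mul _).add
      ((stenzelJ_integrable (by linarith) _ ht).const_mul _)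

theorem stenzelJ_pos {a : ℝ} (ha : 0 ≤ a) (b : ℝ) {t : ℝ} (ht : 0 < t) : 0 < stenzelJ a b t := by
  refine intervalIntegral.intervalIntegral_pos_of_pos_on (stenzelJ_integrable ha b ht) ?_
    zero_lt_one
  intro x hx
  have h1 := base_ge ht hx.1.le hx.2.le
  have := hx.1
  positivity

/-- The derivative of the potential. -/
def stenzelDeriv (n : ℕ) (t : ℝ) : ℝ :=
  (n * stenzelJ (n / 2 - 1) (n / 2 - 1) t) ^ (1 / n : ℝ) * (t + 1) ^ (-(1 / 2) : ℝ)

/-- The potential `u` of the Stenzel metric, as the solution with `u(1) = 0` of the equation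
`(u')^{n-1} (t u' + (t² - 1) u'') = 1`. -/
def stenzelPotential (n : ℕ) (t : ℝ) : ℝ := ∫ x in (1:ℝ)..t, stenzelDeriv n x

theorem stenzelDeriv_pos {n : ℕ} (hn : 2 ≤ n) {t : ℝ} (ht : 0 < t) : 0 < stenzelDeriv n t := by
  have hn' : (2:ℝ) ≤ n := by exact_mod_cast hn
  have := stenzelJ_pos (a := n / 2 - 1) (by linarith) (n / 2 - 1) ht
  have : 0 < t + 1 := by linarith
  rw [stenzelDeriv]
  positivity

theorem contDiffOn_stenzelDeriv {n : ℕ} (hn : 2 ≤ n) :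
    ContDiffOn ℝ ∞ (stenzelDeriv n) (Set.Ioi 0) := by
  have hn' : (2:ℝ) ≤ n := by exact_mod_cast hn
  have hJ : ContDiffOn ℝ ∞ (stenzelJ (n / 2 - 1) (n / 2 - 1)) (Set.Ioi 0) :=
    contDiffOn_infty.2 fun m => contDiffOn_stenzelJ m (by linarith) _
  refine ContDiffOn.mul (ContDiffOn.rpow_const_of_ne (contDiffOn_const.mul hJ) fun t ht => ?_)
    (ContDiffOn.rpow_const_of_ne (by fun_prop) fun t ht => ?_)
  · have := stenzelJ_pos (a := n / 2 - 1) (by linarith) (n / 2 - 1) ht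
    positivity
  · have : (0:ℝ) < t := ht
    positivity

theorem stenzelDeriv_ode {n : ℕ} (hn : 2 ≤ n) {t : ℝ} (ht : 0 < t) :
    stenzelDeriv n t ^ (n - 1) *
      (t * stenzelDeriv n t + (t ^ 2 - 1) * deriv (stenzelDeriv n) t) = 1 := by
  have hn' : (2:ℝ) ≤ n := by exact_mod_cast hn
  have ha : (0:ℝ) ≤ n / 2 - 1 := by linarith
  have hJ := stenzelJ_pos ha (n / 2 - 1) ht
  have ht1 : 0 < t + 1 := by linarith
  have hid := stenzelJ_identity ha ht
  have hd := hasDerivAt_stenzelJ ha (n / 2 - 1) ht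
  set J := stenzelJ (n / 2 - 1) (n / 2 - 1) t with hJdef
  set J' := (n / 2 - 1 : ℝ) * stenzelJ (n / 2 - 1 + 1) (n / 2 - 1 - 1) t with hJ'
  have hg := stenzelDeriv_pos hn ht
  have hder : HasDerivAt (stenzelDeriv n)
      (stenzelDeriv n t * (J' / (n * J) - 1 / (2 * (t + 1)))) t := by
    have h1 := (hd.const_mul (n:ℝ)).rpow_const (p := (1 / n : ℝ)) (Or.inl (by positivity))
    have h2 := ((hasDerivAt_id t).add_const 1).rpow_const (p := (-(1 / 2) : ℝ))
      (Or.inl (by simpa using ht1.ne'))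
    refine (h1.fun_mul h2).congr_deriv ?_
    simp only [id]
    rw [stenzelDeriv, ← hJdef, Real.rpow_sub_one (by positivity), Real.rpow_sub_one (by positivity)]
    field_simp
    ring
  have hpow : stenzelDeriv n t ^ n = n * J * ((t + 1) ^ (n / 2 : ℝ))⁻¹ := by
    rw [stenzelDeriv, mul_pow, ← Real.rpow_natCast, ← Real.rpow_natCast, ← Real.rpow_mul
      (by positivity), ← Real.rpow_mul (by positivity), ← Real.rpow_neg (by positivity)]
    congr 1
    · rw [one_div_mul_cancel (by positivity), Real.rpow_one]
    · congr 1; ring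
  rw [hder.deriv]
  have e : stenzelDeriv n t ^ (n - 1) * (t * stenzelDeriv n t + (t ^ 2 - 1) *
      (stenzelDeriv n t * (J' / (n * J) - 1 / (2 * (t + 1))))) =
      stenzelDeriv n t ^ n * (t + (t ^ 2 - 1) * (J' / (n * J) - 1 / (2 * (t + 1)))) := by
    rw [show stenzelDeriv n t ^ n = stenzelDeriv n t ^ (n - 1) * stenzelDeriv n t by
      rw [← pow_succ]; congr 1; omega]
    ring
  have hsplit : (t + 1) ^ (n / 2 : ℝ) = (t + 1) ^ (n / 2 - 1 : ℝ) * (t + 1) := by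
    rw [Real.rpow_sub_one ht1.ne']; field_simp
  rw [e, hpow, hsplit]
  have hS : 0 < (t + 1) ^ (n / 2 - 1 : ℝ) := by positivity
  generalize (t + 1) ^ (n / 2 - 1 : ℝ) = S at *
  have e2 : t + (t ^ 2 - 1) * (J' / (n * J) - 1 / (2 * (t + 1))) = (t + 1) * S / (n * J) := by
    rw [← hid]
    field_simp
    ring
  rw [e2]
  field_simp

theorem deriv_stenzelPotential {n : ℕ} (hn : 2 ≤ n) {t : ℝ} (ht : 0 < t) :
    HasDerivAt (stenzelPotential n) (stenzelDeriv n t) t := by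
  have hc := (contDiffOn_stenzelDeriv hn).continuousOn
  refine intervalIntegral.integral_hasDerivAt_right ?_ ?_ ?_
  · apply ContinuousOn.intervalIntegrable
    refine hc.mono fun x hx => ?_
    have := hx.1
    exact lt_of_lt_of_le (lt_min one_pos ht) this
  · exact hc.stronglyMeasurableAtFilter isOpen_Ioi _ ht
  · exact hc.continuousAt (Ioi_mem_nhds ht)

/-- The vector `z̄ - r⁻² z`, whose inner product with a tangent vector is that of `z`. -/
def radialVec {n : ℕ} (z : CSpace n) : CSpace n :=
  WithLp.toLp 2 fun j => z j - ((‖z‖ ^ 2 : ℝ) : ℂ)⁻¹ * star (z j)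

theorem sum_star_mul {n : ℕ} (z : CSpace n) : ∑ j, star (z j) * z j = ((‖z‖ ^ 2 : ℝ) : ℂ) := by
  rw [EuclideanSpace.norm_sq_eq, Complex.ofReal_sum]
  refine Finset.sum_congr rfl fun j _ => ?_
  rw [mul_comm, Complex.star_def, Complex.mul_conj, Complex.normSq_eq_norm_sq]

theorem quadric_ne {n : ℕ} {z : CSpace n} (hz : z ∈ quadric n) : z ≠ 0 := by
  rintro rfl
  simp [quadric] at hz

theorem radialVec_tangent {n : ℕ} {z v : CSpace n} (hv : v ∈ tangent z) :
    ∑ j, star (radialVec z j) * v j = ∑ j, star (z j) * v j := by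
  have hv' : ∑ j, z j * v j = 0 := hv
  have : ∑ j, star (radialVec z j) * v j =
      ∑ j, star (z j) * v j - ((‖z‖ ^ 2 : ℝ) : ℂ)⁻¹ * ∑ j, z j * v j := by
    rw [Finset.mul_sum, ← Finset.sum_sub_distrib]
    refine Finset.sum_congr rfl fun j _ => ?_
    simp [radialVec, -Complex.ofReal_pow]
    ring
  rw [this, hv']; simp

theorem radialVec_conj {n : ℕ} {z : CSpace n} (hz : z ∈ quadric n) :
    ∑ j, star (radialVec z j) * star (z j) = 0 := by
  have hz' : ∑ j, z j ^ 2 = 1 := hz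
  have hr : ((‖z‖ ^ 2 : ℝ) : ℂ) ≠ 0 := by
    have := norm_pos_iff.2 (quadric_ne hz)
    exact_mod_cast (by positivity : ‖z‖ ^ 2 ≠ 0)
  have : ∑ j, star (radialVec z j) * star (z j) =
      star (∑ j, z j ^ 2) - ((‖z‖ ^ 2 : ℝ) : ℂ)⁻¹ * ∑ j, star (z j) * z j := by
    rw [Finset.mul_sum, star_sum, ← Finset.sum_sub_distrib]
    refine Finset.sum_congr rfl fun j _ => ?_
    simp [radialVec, -Complex.ofReal_pow]
    ring
  rw [this, hz', sum_star_mul, inv_mul_cancel₀ hr]; simp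

theorem radialVec_norm {n : ℕ} {z : CSpace n} (hz : z ∈ quadric n) :
    ∑ j, star (radialVec z j) * radialVec z j = ((‖z‖ ^ 2 - (‖z‖ ^ 2)⁻¹ : ℝ) : ℂ) := by
  have h1 := radialVec_conj hz
  have hz' : ∑ j, z j ^ 2 = 1 := hz
  have h2 : ∑ j, star (radialVec z j) * z j = ((‖z‖ ^ 2 - (‖z‖ ^ 2)⁻¹ : ℝ) : ℂ) := by
    have : ∑ j, star (radialVec z j) * z j =
        ∑ j, star (z j) * z j - ((‖z‖ ^ 2 : ℝ) : ℂ)⁻¹ * ∑ j, z j ^ 2 := by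
      rw [Finset.mul_sum, ← Finset.sum_sub_distrib]
      refine Finset.sum_congr rfl fun j _ => ?_
      simp [radialVec, -Complex.ofReal_pow]
      ring
    rw [this, hz', sum_star_mul]
    push_cast
    ring
  rw [← h2]
  have : ∑ j, star (radialVec z j) * radialVec z j = ∑ j, star (radialVec z j) * z j -
      ((‖z‖ ^ 2 : ℝ) : ℂ)⁻¹ * ∑ j, star (radialVec z j) * star (z j) := by
    rw [Finset.mul_sum, ← Finset.sum_sub_distrib]
    refine Finset.sum_congr rfl fun j _ => ?_
    simp [radialVec, -Complex.ofReal_pow]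
    ring
  rw [this, h1]; simp

theorem det_leviForm {n : ℕ} {u : ℝ → ℝ} (hu : ContDiffOn ℝ ∞ u (Set.Ioi 0)) {z : CSpace n}
    (hz : z ∈ quadric n) {v : Fin n → CSpace n} (hv : ∀ i, v i ∈ tangent z)
    (hα : deriv u (‖z‖ ^ 2) ≠ 0) :
    Matrix.det (Matrix.of fun i j => leviForm u z (v i) (v j)) *
      ((deriv u (‖z‖ ^ 2) * ‖z‖ ^ 2 : ℝ) : ℂ) =
    ((4 * (‖z‖ ^ 2) ^ 2 * ‖volForm z v‖ ^ 2 * deriv u (‖z‖ ^ 2) ^ n * (deriv u (‖z‖ ^ 2) +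
      deriv (deriv u) (‖z‖ ^ 2) * (‖z‖ ^ 2 - (‖z‖ ^ 2)⁻¹)) : ℝ) : ℂ) := by
  set α := deriv u (‖z‖ ^ 2) with hαd
  set β := deriv (deriv u) (‖z‖ ^ 2) with hβd
  set zb : CSpace n := WithLp.toLp 2 fun j => star (z j) with hzb
  set N : Matrix (Fin (n + 1)) (Fin (n + 1)) ℂ :=
    Matrix.of fun i j => (Fin.snoc v zb : Fin (n + 1) → CSpace n) i j with hN
  set q := radialVec z with hq
  set K : Matrix (Fin (n + 1)) (Fin (n + 1)) ℂ := (α : ℂ) • (1 +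
    Matrix.replicateCol Unit (fun j => ((β / α : ℝ) : ℂ) * star (q j)) *
    Matrix.replicateRow Unit (fun j => q j)) with hK
  have hαC : (α : ℂ) ≠ 0 := by exact_mod_cast hα
  have hKval : ∀ a b : CSpace n, ∑ j, (∑ k, a k * K k j) * star (b j) =
      (α : ℂ) * ∑ j, a j * star (b j) +
      (β : ℂ) * ((∑ j, star (q j) * a j) * ∑ j, q j * star (b j)) := by
    intro a b
    have hKk : ∀ k j, K k j = (α : ℂ) * (if k = j then 1 else 0) + (β : ℂ) * star (q k) * q j := by
      intro k j
      simp only [hK, Matrix.smul_apply, Matrix.add_apply, Matrix.one_apply, Matrix.mul_apply,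
        Matrix.replicateCol_apply, Matrix.replicateRow_apply, Finset.univ_unique,
        Finset.sum_singleton, smul_eq_mul]
      push_cast
      field_simp
    have : ∀ j, ∑ k, a k * K k j = α * a j + β * (∑ k, star (q k) * a k) * q j := by
      intro j
      simp only [hKk, mul_add, Finset.sum_add_distrib]
      congr 1
      · simp [mul_comm]
      · rw [Finset.mul_sum, Finset.sum_mul]
        exact Finset.sum_congr rfl fun k _ => by ring
    simp only [this, add_mul, Finset.sum_add_distrib]
    generalize ∑ k, star (q k) * a k = S
    rw [Finset.mul_sum, Finset.mul_sum, Finset.mul_sum]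
    congr 1
    · exact Finset.sum_congr rfl fun k _ => by ring
    · exact Finset.sum_congr rfl fun k _ => by ring
  have hmul : ∀ a b, (N * K * N.conjTranspose) a b = ∑ j, (∑ k, N a k * K k j) * star (N b j) := by
    intro a b
    simp [Matrix.mul_apply, Matrix.conjTranspose_apply]
  have hconj : ∀ (a b : CSpace n), ∑ j, a j * star (b j) = star (∑ j, star (a j) * b j) := by
    intro a b; simp [star_sum, mul_comm]
  have hzbq : ∑ j, star (q j) * zb j = 0 := radialVec_conj hz
  have hzbv : ∀ i, ∑ j, v i j * star (zb j) = 0 := by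
    intro i
    rw [← show ∑ j, z j * v i j = 0 from hv i]
    simp [hzb, mul_comm]
  have hvz : ∀ i, ∑ j, zb j * star (v i j) = 0 := by
    intro i
    have := congrArg star (hzbv i)
    simpa [star_sum, mul_comm] using this
  have hblock : Matrix.det (N * K * N.conjTranspose) =
      Matrix.det (Matrix.of fun i j => leviForm u z (v i) (v j)) * ((α * ‖z‖ ^ 2 : ℝ) : ℂ) := by
    rw [Matrix.det_succ_row _ (Fin.last n), Fin.sum_univ_castSucc]
    have h0 : ∀ i : Fin n, (N * K * N.conjTranspose) (Fin.last n) i.castSucc = 0 := by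
      intro i
      rw [hmul]
      simp only [hN, Matrix.of_apply, Fin.snoc_last, Fin.snoc_castSucc]
      rw [hKval, hzbq, hvz]; simp
    have h1 : (N * K * N.conjTranspose) (Fin.last n) (Fin.last n) = ((α * ‖z‖ ^ 2 : ℝ) : ℂ) := by
      rw [hmul]
      simp only [hN, Matrix.of_apply, Fin.snoc_last]
      rw [hKval, hzbq, zero_mul, mul_zero, add_zero, Complex.ofReal_mul, ← sum_star_mul]
      simp [hzb]
    have h2 : (N * K * N.conjTranspose).submatrix (Fin.last n).succAbove (Fin.last n).succAbove =
        Matrix.of fun i j => leviForm u z (v i) (v j) := by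
      ext i j
      rw [Matrix.submatrix_apply, hmul]
      simp only [hN, Matrix.of_apply, Fin.succAbove_last, Fin.snoc_castSucc]
      rw [hKval, leviForm_eq hu (quadric_ne hz), radialVec_tangent (hv i), hconj q,
        hconj z, radialVec_tangent (hv j)]
    simp only [h0, h1, h2, mul_zero, zero_mul, Finset.sum_const_zero, zero_add]
    rw [Even.neg_one_pow (by simp)]
    ring
  have hdetN : Matrix.det N = volForm z v * (2 * ((‖z‖ ^ 2 : ℝ) : ℂ)) := by
    rw [hN, ← volForm_mul_dF hz v hv zb, ← sum_star_mul]
    simp [hzb, mul_comm]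
  have hdetK : Matrix.det K = (α : ℂ) ^ (n + 1) *
      (1 + ((β / α : ℝ) : ℂ) * ((‖z‖ ^ 2 - (‖z‖ ^ 2)⁻¹ : ℝ) : ℂ)) := by
    rw [hK, Matrix.det_smul, Fintype.card_fin, Matrix.det_one_add_replicateCol_mul_replicateRow,
      ← radialVec_norm hz]
    congr 2
    rw [dotProduct, Finset.mul_sum]
    exact Finset.sum_congr rfl fun j _ => by simp only [← hq]; ring_nf
  rw [← hblock, Matrix.det_mul, Matrix.det_mul, Matrix.det_conjTranspose, hdetN, hdetK]
  have hns : volForm z v * star (volForm z v) = ((‖volForm z v‖ ^ 2 : ℝ) : ℂ) := by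
    rw [Complex.star_def, Complex.mul_conj, Complex.normSq_eq_norm_sq]
  have hs : star (volForm z v * (2 * ((‖z‖ ^ 2 : ℝ) : ℂ))) =
      star (volForm z v) * (2 * ((‖z‖ ^ 2 : ℝ) : ℂ)) := by
    simp
  rw [hs, pow_succ]
  have hcan : (α : ℂ) * (1 + ((β / α : ℝ) : ℂ) * ((‖z‖ ^ 2 - (‖z‖ ^ 2)⁻¹ : ℝ) : ℂ)) =
      ((α + β * (‖z‖ ^ 2 - (‖z‖ ^ 2)⁻¹) : ℝ) : ℂ) := by
    push_cast
    field_simp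
  calc _ = (volForm z v * star (volForm z v)) * (2 * ((‖z‖ ^ 2 : ℝ) : ℂ)) ^ 2 * (α : ℂ) ^ n *
        ((α : ℂ) * (1 + ((β / α : ℝ) : ℂ) * ((‖z‖ ^ 2 - (‖z‖ ^ 2)⁻¹ : ℝ) : ℂ))) := by ring_nf
    _ = _ := by
      rw [hns, hcan]
      push_cast
      ring

/-- The metric with potential `stenzelPotential n` is Kähler and Ricci-flat. -/
theorem isStenzelPotential_stenzelPotential {n : ℕ} (hn : 2 ≤ n) :
    IsStenzelPotential n (stenzelPotential n) := by
  have hd : ∀ t, 0 < t → deriv (stenzelPotential n) t = stenzelDeriv n t :=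
    fun t ht => (deriv_stenzelPotential hn ht).deriv
  have hsm : ContDiffOn ℝ ∞ (stenzelPotential n) (Set.Ioi 0) := by
    refine (contDiffOn_infty_iff_deriv_of_isOpen isOpen_Ioi).2 ⟨fun t ht => ?_, ?_⟩
    · exact (deriv_stenzelPotential hn ht).differentiableAt.differentiableWithinAt
    · exact (contDiffOn_stenzelDeriv hn).congr fun t ht => hd t ht
  have hdd : ∀ t, 0 < t → deriv (deriv (stenzelPotential n)) t = deriv (stenzelDeriv n) t := by
    intro t ht
    apply Filter.EventuallyEq.deriv_eq
    filter_upwards [Ioi_mem_nhds ht] with s hs using hd s hs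
  have hode : ∀ t, 0 < t → stenzelDeriv n t ^ (n - 1) * (stenzelDeriv n t +
      deriv (stenzelDeriv n) t * (t - t⁻¹)) = t⁻¹ := by
    intro t ht
    have := stenzelDeriv_ode hn ht
    field_simp
    linear_combination this
  refine ⟨hsm, ?_, 4, by norm_num, ?_⟩
  · intro z hz v hv hv0
    have hz0 := quadric_ne hz
    have ht : 0 < ‖z‖ ^ 2 := by positivity
    set t := ‖z‖ ^ 2 with htd
    have hα := stenzelDeriv_pos hn ht
    have hq1 : ‖radialVec z‖ ^ 2 = t - t⁻¹ := by
      have := radialVec_norm hz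
      rw [sum_star_mul] at this
      exact_mod_cast this
    have hL : leviForm (stenzelPotential n) z v v = ((stenzelDeriv n t * ‖v‖ ^ 2 +
        deriv (stenzelDeriv n) t * ‖∑ j, star (z j) * v j‖ ^ 2 : ℝ) : ℂ) := by
      rw [leviForm_eq hsm hz0, hd _ ht, hdd _ ht]
      have e1 : ∑ j, v j * star (v j) = ((‖v‖ ^ 2 : ℝ) : ℂ) := by
        rw [← sum_star_mul]; exact Finset.sum_congr rfl fun j _ => mul_comm _ _
      have e2 : ∑ j, z j * star (v j) = star (∑ j, star (z j) * v j) := by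
        simp [star_sum, mul_comm]
      rw [e1, e2, Complex.star_def, Complex.mul_conj, Complex.normSq_eq_norm_sq]
      push_cast
      rfl
    have hL1 : leviForm (stenzelPotential n) z v (Complex.I • v) =
        -Complex.I * leviForm (stenzelPotential n) z v v := by
      simp only [leviForm, Finset.mul_sum]
      refine Finset.sum_congr rfl fun j _ => Finset.sum_congr rfl fun k _ => ?_
      simp
      ring
    have hL2 : leviForm (stenzelPotential n) z (Complex.I • v) v =
        Complex.I * leviForm (stenzelPotential n) z v v := by
      simp only [leviForm, Finset.mul_sum]
      refine Finset.sum_congr rfl fun j _ => Finset.sum_congr rfl fun k _ => ?_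
      simp
      ring
    have hk : kahlerForm (stenzelPotential n) z v (Complex.I • v) =
        2 * leviForm (stenzelPotential n) z v v := by
      rw [kahlerForm, hL1, hL2]
      linear_combination (-2 * leviForm (stenzelPotential n) z v v) * Complex.I_sq
    rw [hk, hL]
    have hcs : ‖∑ j, star (z j) * v j‖ ^ 2 ≤ (t - t⁻¹) * ‖v‖ ^ 2 := by
      rw [← radialVec_tangent hv, ← hq1, ← mul_pow]
      refine pow_le_pow_left₀ (norm_nonneg _) ?_ 2
      have := norm_inner_le_norm (𝕜 := ℂ) (radialVec z) v
      rw [PiLp.inner_apply] at this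
      simpa [mul_comm] using this
    have hv2 : 0 < ‖v‖ ^ 2 := by positivity
    have hpos : 0 < stenzelDeriv n t + deriv (stenzelDeriv n) t * (t - t⁻¹) := by
      have h1 := hode t ht
      have h2 : 0 < stenzelDeriv n t ^ (n - 1) := by positivity
      refine pos_of_mul_pos_right (a := stenzelDeriv n t ^ (n - 1)) ?_ h2.le
      rw [h1]; positivity
    have : 0 < stenzelDeriv n t * ‖v‖ ^ 2 +
        deriv (stenzelDeriv n) t * ‖∑ j, star (z j) * v j‖ ^ 2 := by
      rcases le_or_gt 0 (deriv (stenzelDeriv n) t) with h | h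
      · positivity
      · nlinarith [mul_le_mul_of_nonpos_left hcs h.le, mul_pos hpos hv2]
    have e : (2 * ((stenzelDeriv n t * ‖v‖ ^ 2 +
        deriv (stenzelDeriv n) t * ‖∑ j, star (z j) * v j‖ ^ 2 : ℝ) : ℂ)).re =
        2 * (stenzelDeriv n t * ‖v‖ ^ 2 +
        deriv (stenzelDeriv n) t * ‖∑ j, star (z j) * v j‖ ^ 2) := by
      rw [← Complex.ofReal_ofNat, ← Complex.ofReal_mul, Complex.ofReal_re]
    rw [e]
    linarith
  · intro z hz v hv
    have hz0 := quadric_ne hz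
    have ht : 0 < ‖z‖ ^ 2 := by positivity
    have hα := stenzelDeriv_pos hn ht
    have h := det_leviForm hsm hz hv (by rw [hd _ ht]; exact hα.ne')
    rw [hd _ ht, hdd _ ht] at h
    have h1 := hode _ ht
    set t := ‖z‖ ^ 2 with htd
    have hne : ((stenzelDeriv n t * t : ℝ) : ℂ) ≠ 0 := by
      exact_mod_cast (mul_pos hα ht).ne'
    apply mul_right_cancel₀ hne
    rw [h, ← Complex.ofReal_mul]
    congr 1
    have hp : stenzelDeriv n t ^ n = stenzelDeriv n t ^ (n - 1) * stenzelDeriv n t := by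
      rw [← pow_succ]; congr 1; omega
    rw [hp]
    have : t ^ 2 * t⁻¹ = t := by field_simp
    linear_combination (4 * t ^ 2 * ‖volForm z v‖ ^ 2 * stenzelDeriv n t) * h1 +
      4 * ‖volForm z v‖ ^ 2 * stenzelDeriv n t * this

end Existence

/-! ### Special Lagrangian submanifolds -/

/-- A real `n`-plane `T` tangent to the complex sphere at `z` on which `ω` and `Im Ω` vanish. -/
structure IsSpecialLagrangianPlane (n : ℕ) (u : ℝ → ℝ) (z : CSpace n)
    (T : Submodule ℝ (CSpace n)) : Prop where
  finrank_eq : Module.finrank ℝ T = n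
  tangent : ∀ v ∈ T, v ∈ tangent z
  lagrangian : ∀ v ∈ T, ∀ w ∈ T, kahlerForm u z v w = 0
  special : ∀ v : Fin n → CSpace n, (∀ i, v i ∈ T) → (volForm z v).im = 0

/-- `L` is a smooth (embedded) special Lagrangian submanifold of the complex sphere: near each of
its points, `L` is parametrized by a smooth immersion `ψ` of an open subset of `ℝⁿ`, which is a
homeomorphism onto an open subset of `L`, and all of whose tangent spaces are special
Lagrangian. -/
def IsSpecialLagrangian (n : ℕ) (u : ℝ → ℝ) (L : Set (CSpace n)) : Prop :=
  L ⊆ quadric n ∧ ∀ q ∈ L, ∃ (V : Set (EuclideanSpace ℝ (Fin n)))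
    (ψ : EuclideanSpace ℝ (Fin n) → CSpace n),
    IsOpen V ∧ q ∈ ψ '' V ∧ ContDiffOn ℝ ∞ ψ V ∧ Set.InjOn ψ V ∧
    (∀ V' ⊆ V, IsOpen V' → ∃ U, IsOpen U ∧ ψ '' V' = L ∩ U) ∧
    ∀ x ∈ V, IsSpecialLagrangianPlane n u (ψ x) (LinearMap.range (fderiv ℝ ψ x).toLinearMap)

/-! ### The ansatz -/

/-- The subset `{γ p + √(1 - γ²) y : γ ∈ Γ, y ∈ Sⁿ ∩ p^⊥}` of the complex sphere defined by a
subset `Γ` of `ℂ`; it does not depend on the choice of the square roots. -/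
def ansatzSet {n : ℕ} (p : RSpace n) (Γ : Set ℂ) : Set (CSpace n) :=
  {z | ∃ γ ∈ Γ, ∃ w : ℂ, w ^ 2 = 1 - γ ^ 2 ∧ ∃ y : RSpace n, ‖y‖ = 1 ∧ inner ℝ p y = 0 ∧
    z = γ • complexify n p + w • complexify n y}

/-- The map `X(s, y) = γ(s) p + √(1 - γ(s)²) y`, where `w(s)` is the chosen square root. -/
def ansatzMap {n : ℕ} (p : RSpace n) (γ w : ℝ → ℂ) (s : ℝ) (y : RSpace n) : CSpace n :=
  γ s • complexify n p + w s • complexify n y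

/-- The image of the differential of `X : ℝ × (Sⁿ ∩ p^⊥) → ℂ^{n+1}` at `(s, y)`: it is spanned by
`∂X/∂s` and by the derivatives `w(s) η` of `X` along the vectors `η` tangent to `Sⁿ ∩ p^⊥`
at `y`. -/
def ansatzTangent {n : ℕ} (p : RSpace n) (γ w : ℝ → ℂ) (s : ℝ) (y : RSpace n) :
    Submodule ℝ (CSpace n) :=
  Submodule.span ℝ ({deriv (fun t => ansatzMap p γ w t y) s} ∪
    {v | ∃ η : RSpace n, inner ℝ p η = 0 ∧ inner ℝ y η = 0 ∧ v = w s • complexify n η})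

/-- The map `X : ℝ × (Sⁿ ∩ p^⊥) → Q` is a special Lagrangian immersion. -/
def IsSpecialLagrangianAnsatz (n : ℕ) (u : ℝ → ℝ) (p : RSpace n) (γ w : ℝ → ℂ) : Prop :=
  ∀ (s : ℝ) (y : RSpace n), ‖y‖ = 1 → inner ℝ p y = 0 →
    IsSpecialLagrangianPlane n u (ansatzMap p γ w s y) (ansatzTangent p γ w s y)

/-! ### The phase portrait -/

/-- The angles `kπ/(n-1)`, shifted by `π/(2(n-1))` if `n` is odd. -/
def rayAngle (n : ℕ) (k : ZMod (2 * n - 2)) : ℝ :=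
  (k.val : ℝ) * Real.pi / (n - 1) + if Odd n then Real.pi / (2 * (n - 1)) else 0

/-- The half-line `arg z = θ`. -/
def ray (θ : ℝ) : Set ℂ := {z | ∃ r : ℝ, 0 ≤ r ∧ z = r * Complex.exp (θ * Complex.I)}

/-- The end of the curve `γ` along the filter `l` goes to infinity and is asymptotic to the
half-line `arg z = θ`: its direction tends to that of the half-line, and, except for `n = 2`
(where the curves are horizontal lines), its distance to the half-line tends to `0`. -/
def IsAsymptoticToRay (n : ℕ) (θ : ℝ) (γ : ℝ → ℂ) (l : Filter ℝ) : Prop :=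
  Filter.Tendsto (fun s => ‖γ s‖) l Filter.atTop ∧
  Filter.Tendsto (fun s => γ s / (‖γ s‖ : ℂ)) l (𝓝 (Complex.exp (θ * Complex.I))) ∧
  (3 ≤ n → Filter.Tendsto (fun s => Metric.infDist (γ s) (ray θ)) l (𝓝 0))

/-- The end along the filter `l` of the submanifold defined by the curve `γ` is asymptotic to
`L`: the distance to `L` of its points `z` is `o(|z|)`, and tends to `0` if `n ≥ 3`. -/
def IsAsymptoticTo (n : ℕ) (p : RSpace n) (γ : ℝ → ℂ) (l : Filter ℝ) (L : Set (CSpace n)) :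
    Prop :=
  ∀ ε : ℝ, 0 < ε → ∀ᶠ s in l, ∀ z ∈ ansatzSet p {γ s},
    Metric.infDist z L ≤ ε * ‖z‖ ∧ (3 ≤ n → Metric.infDist z L ≤ ε)

/-- The real segment `[-1, 1]` of the complex plane. -/
def realSegment : Set ℂ := Complex.ofReal '' Set.Icc (-1) 1

/-- `β : [0, ∞) → ℂ` parametrizes a branch: an injective curve which is smooth and regular for
`t > 0`, starts from `a` in the direction of the unit complex number `d`, meets the segment
`[-1, 1]` at `t = 0` only, and is asymptotic to the half-line `arg z = θ`. -/
structure IsBranch (n : ℕ) (a d : ℂ) (θ : ℝ) (β : ℝ → ℂ) : Prop where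
  start : β 0 = a
  continuousOn : ContinuousOn β (Set.Ici 0)
  smooth : ContDiffOn ℝ ∞ β (Set.Ioi 0)
  regular : ∀ t, 0 < t → deriv β t ≠ 0
  injOn : Set.InjOn β (Set.Ici 0)
  notMem_segment : ∀ t, 0 < t → β t ∉ realSegment
  direction : Filter.Tendsto (fun t => (β t - a) / (‖β t - a‖ : ℂ)) (𝓝[>] 0) (𝓝 d)
  asymptotic : IsAsymptoticToRay n θ β Filter.atTop

end ComplexSphere

end

open ComplexSphere

open scoped ContDiff Topology

noncomputable section

namespace ComplexSphere

open Complex Set Filter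
open scoped ComplexConjugate

/-! Rotations fixing $p$ act on $L_\Gamma$, so its tangent planes are described by the curve alone.
The Levi form of any function of $|z|^2$ is symmetric on these planes, so $\omega$ vanishes on them
automatically. The form $\Omega$ evaluates there to a real number times $\gamma' w^{n-2}$ with
$w^2=1-\gamma^2$. Hence $L_\Gamma$ is special Lagrangian exactly when
$\gamma'^2(1-\gamma^2)^{n-2}\ge 0$: the curves are the horizontal trajectories of the quadratic
differential $(1-z^2)^{n-2}dz^2$, locally the level curves of $\operatorname{Im}F$, where
$F'=(1-z^2)^{(n-2)/2}$. At $\pm1$ this differential has $n$ prongs, one of which is the segment; the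
$2n-2$ others are the branches, and they cut the plane into cells. The task is to show that each
cell is mapped bijectively onto the upper half-plane by a primitive, so that its trajectories are
preimages of horizontal lines.

The global tool is one conformal map of the right half-plane. Substituting $\zeta^2=1+r^2(z^2-1)$ in
$2\int_1^z(\zeta^2-1)^{(n-2)/2}d\zeta$ gives $(z^2-1)^{n/2}H(z)$, where $H$ (`hInt`) is an integral
of functions with positive real part, so $\operatorname{Re}H>0$ and $K=(z^2-1)H^{2/n}$ (`kFun`) is
holomorphic, even at $1$. In the coordinate $\zeta=\log\frac{z-1}{z+1}$, which ranges over the left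
half-plane, $\log K$ becomes `gFun`, with derivative $\frac2n H^{-1}$ (`hasDerivAt_gFun`). A
derivative of positive real part on a convex domain makes `gFun` a strictly monotone operator
(`gFun_mono`); injectivity of $K$ follows (`kFun_injOn`).

The same monotonicity, passed to the limit at the imaginary axis, shows that $K$ misses the
half-lines issuing outward from its boundary values (`kFun_ne_mul_kB`). Since $K\to\infty$ at
infinity, nothing else is missed (`mem_range_kFun_or`). On the imaginary axis $2(F(1)-F)$ lies on a
vertical line, so the missed half-lines have arguments within $\pi/n$ of $\pi$ and $K$ covers the
sector $|\arg|\le\pi-\pi/n$. The branches at $1$ are the preimages of the half-lines of argument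
$-\pi+2\pi j/n$, $1\le j\le n-1$, and $K^{n/2}$ maps the region between two consecutive ones onto a
half-plane (`isChart_secE`). The remaining cells cross the imaginary axis; there $2F$ is the chart,
thanks to the reflection $z\mapsto-\bar z$ (`isChart_crossD`). The map $z\mapsto-z$ supplies the
other half of the portrait.

At infinity $K^{n/2}$ is $\frac{2}{n-1}z^{n-1}$ up to a relative error bounded by a multiple of
$|z|^{-(n-1)}+|z|^{-3/2}$ (`exists_norm_asyFun_le`). This gives the asymptotic directions, and
convergence of distances to zero when $n\ge3$. The submanifolds are parametrized by $x\mapsto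
a(|x|^2)p+b(|x|^2)x$ with $x\in\mathbb R^n$ (`exists_parametrization`): stereographic projection for
the real sphere, $r=|K|$ for the branches, which makes the pole a regular point, and polar
coordinates for the other curves. Completeness of the list is a connectedness argument: the portrait
partitions $\mathbb C\setminus\{\pm1\}$ into local level sets, and a connected trajectory cannot
leave one of them (`curve_mem_leaf_iff`). -/

/-! ### The principal square root -/

/-- The principal square root. -/
def csqrt (u : ℂ) : ℂ := exp (log u / 2)

theorem csqrt_ne_zero (u : ℂ) : csqrt u ≠ 0 := exp_ne_zero _

theorem csqrt_sq {u : ℂ} (hu : u ≠ 0) : csqrt u ^ 2 = u := by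
  rw [csqrt, ← exp_nat_mul]
  push_cast
  rw [mul_div_cancel₀ _ two_ne_zero, exp_log hu]

theorem exp_re_pos {w : ℂ} (h : |w.im| < Real.pi / 2) : 0 < (exp w).re := by
  rw [exp_re]
  have := Real.cos_pos_of_mem_Ioo (abs_lt.1 h)
  positivity

theorem csqrt_re_pos {u : ℂ} (hu : u ∈ slitPlane) : 0 < (csqrt u).re := by
  apply exp_re_pos
  have h1 := neg_pi_lt_arg u
  have h2 := arg_le_pi u
  have h3 : u.arg ≠ Real.pi := (mem_slitPlane_iff_arg.1 hu).1
  have : (log u / 2).im = u.arg / 2 := by simp [log_im]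
  rw [this, abs_lt]
  constructor
  · linarith
  · linarith [lt_of_le_of_ne h2 h3]

theorem eq_of_sq_eq_sq_of_re_pos {a b : ℂ} (h : a ^ 2 = b ^ 2) (ha : 0 < a.re) (hb : 0 < b.re) :
    a = b := by
  rcases sq_eq_sq_iff_eq_or_eq_neg.1 h with h | h
  · exact h
  · rw [h] at ha; simp at ha; linarith

theorem eq_csqrt {a u : ℂ} (hu : u ∈ slitPlane) (ha : 0 < a.re) (h : a ^ 2 = u) : a = csqrt u :=
  eq_of_sq_eq_sq_of_re_pos (by rw [h, csqrt_sq (slitPlane_ne_zero hu)]) ha (csqrt_re_pos hu)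

theorem hasDerivAt_csqrt {u : ℂ} (hu : u ∈ slitPlane) :
    HasDerivAt csqrt (1 / (2 * csqrt u)) u := by
  have h := (((hasDerivAt_id u).clog hu).div_const 2).cexp
  refine h.congr_deriv ?_
  have h0 := csqrt_ne_zero u
  have h2 := csqrt_sq (slitPlane_ne_zero hu)
  have h3 := slitPlane_ne_zero hu
  change csqrt u * (1 / u / 2) = _
  field_simp
  rw [h2]

theorem hasDerivAt_csqrt_comp {f : ℂ → ℂ} {f' z : ℂ} (hf : HasDerivAt f f' z)
    (hz : f z ∈ slitPlane) : HasDerivAt (fun z => csqrt (f z)) (1 / (2 * csqrt (f z)) * f') z :=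
  HasDerivAt.comp (h₂ := csqrt) z (hasDerivAt_csqrt hz) hf

theorem continuousOn_csqrt : ContinuousOn csqrt slitPlane := fun _ hu =>
  (hasDerivAt_csqrt hu).continuousAt.continuousWithinAt

theorem csqrt_conj {u : ℂ} (hu : u ∈ slitPlane) : csqrt (conj u) = conj (csqrt u) := by
  rw [csqrt, log_conj _ (mem_slitPlane_iff_arg.1 hu).1, csqrt, ← exp_conj, map_div₀, map_ofNat]

theorem csqrt_ofReal {x : ℝ} (hx : 0 < x) : csqrt (x : ℂ) = (Real.sqrt x : ℂ) :=
  (eq_csqrt (ofReal_mem_slitPlane.2 hx) (by simpa using hx)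
    (by rw [← ofReal_pow, Real.sq_sqrt hx.le])).symm

/-! ### Holomorphic parametric integrals -/

/-- The dominating function is a constant: the maximum of $|f'|$ on the product of a small closed
ball and $[0,1]$, which is compact. -/
theorem hasDerivAt_unitIntegral {f f' : ℂ → ℝ → ℂ} {U : Set ℂ} (hU : IsOpen U)
    (hf : ContinuousOn (Function.uncurry f) (U ×ˢ Icc 0 1))
    (hf' : ContinuousOn (Function.uncurry f') (U ×ˢ Icc 0 1))
    (hd : ∀ z ∈ U, ∀ t ∈ Icc (0 : ℝ) 1, HasDerivAt (fun z => f z t) (f' z t) z) {z : ℂ}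
    (hz : z ∈ U) :
    HasDerivAt (fun z => ∫ t in (0 : ℝ)..1, f z t) (∫ t in (0 : ℝ)..1, f' z t) z := by
  have hu : Set.uIoc (0:ℝ) 1 = Set.Ioc 0 1 := Set.uIoc_of_le zero_le_one
  have slice : ∀ {h : ℂ → ℝ → ℂ}, ContinuousOn (Function.uncurry h) (U ×ˢ Icc 0 1) →
      ∀ x ∈ U, IntervalIntegrable (h x) MeasureTheory.volume 0 1 := by
    intro h hh x hx
    apply ContinuousOn.intervalIntegrable
    rw [uIcc_of_le zero_le_one]
    exact hh.comp (f := fun t => (x, t)) (by fun_prop) fun t ht => ⟨hx, ht⟩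
  obtain ⟨r, hr, hball⟩ := Metric.nhds_basis_closedBall.mem_iff.1 (hU.mem_nhds hz)
  have hK : IsCompact (Metric.closedBall z r ×ˢ Icc (0:ℝ) 1) :=
    (isCompact_closedBall z r).prod isCompact_Icc
  obtain ⟨C, hC⟩ := hK.exists_bound_of_continuousOn
    (hf'.mono (prod_mono hball subset_rfl))
  refine (intervalIntegral.hasDerivAt_integral_of_dominated_loc_of_deriv_le
    (bound := fun _ => C) (Metric.closedBall_mem_nhds z hr) ?_ (slice hf z hz)
    (slice hf' z hz).aestronglyMeasurable_restrict_uIoc ?_ intervalIntegrable_const ?_).2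
  · filter_upwards [hU.mem_nhds hz] with x hx using
      (slice hf x hx).aestronglyMeasurable_restrict_uIoc
  · refine Eventually.of_forall fun t ht x hx => ?_
    rw [hu] at ht
    exact hC (x, t) ⟨hx, ht.1.le, ht.2⟩
  · refine Eventually.of_forall fun t ht x hx => ?_
    rw [hu] at ht
    exact hd x (hball hx) t ⟨ht.1.le, ht.2⟩

/-! ### The function `H` -/

/-- The right half-plane. -/
def rightHalf : Set ℂ := {z | 0 < z.re}

theorem isOpen_rightHalf : IsOpen rightHalf := isOpen_lt continuous_const continuous_re

theorem sq_mem_slitPlane {z : ℂ} (hz : 0 < z.re) : z ^ 2 ∈ slitPlane := by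
  rw [mem_slitPlane_iff]
  simp only [sq, mul_re, mul_im]
  rcases eq_or_ne z.im 0 with h | h
  · left; rw [h]; nlinarith
  · right; intro h'; apply h; nlinarith

/-- The slit plane is star-shaped about $1$, and the point in question lies on the segment from $1$
to $z^2$. So the integrand of `hInt` uses the principal root away from its cut. -/
theorem one_add_mem_slitPlane {z : ℂ} (hz : 0 < z.re) {r : ℝ} (hr : r ∈ Icc (0 : ℝ) 1) :
    1 + (r : ℂ) ^ 2 * (z ^ 2 - 1) ∈ slitPlane := by
  have h := StarConvex.add_smul_mem starConvex_one_slitPlane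
    (show 1 + (z ^ 2 - 1) ∈ slitPlane by simpa using sq_mem_slitPlane hz)
    (show 0 ≤ r ^ 2 by positivity) (show r ^ 2 ≤ 1 from pow_le_one₀ hr.1 hr.2)
  simpa using h

/-- The function `H(z) = ∫₀¹ 2 r^{n-1} (1 + r² (z² - 1))^{-1/2} dr`. -/
def hInt (n : ℕ) (z : ℂ) : ℂ :=
  ∫ r in (0 : ℝ)..1, 2 * (r : ℂ) ^ (n - 1) * (csqrt (1 + (r : ℂ) ^ 2 * (z ^ 2 - 1)))⁻¹

theorem continuousOn_hInt_base :
    ContinuousOn (fun x : ℂ × ℝ => csqrt (1 + (x.2 : ℂ) ^ 2 * (x.1 ^ 2 - 1)))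
      (rightHalf ×ˢ Icc 0 1) :=
  continuousOn_csqrt.comp (by fun_prop) fun _ hx => one_add_mem_slitPlane hx.1 hx.2

theorem hasDerivAt_hInt_aux (n : ℕ) {z : ℂ} (hz : 0 < z.re) :
    HasDerivAt (hInt n) (∫ r in (0 : ℝ)..1, 2 * (r : ℂ) ^ (n - 1) *
      (-((r : ℂ) ^ 2 * z) / csqrt (1 + (r : ℂ) ^ 2 * (z ^ 2 - 1)) ^ 3)) z := by
  refine hasDerivAt_unitIntegral (f := fun z r => 2 * (r : ℂ) ^ (n - 1) *
    (csqrt (1 + (r : ℂ) ^ 2 * (z ^ 2 - 1)))⁻¹) (f' := fun z r => 2 * (r : ℂ) ^ (n - 1) *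
      (-((r : ℂ) ^ 2 * z) / csqrt (1 + (r : ℂ) ^ 2 * (z ^ 2 - 1)) ^ 3)) isOpen_rightHalf ?_ ?_ ?_ hz
  · exact ContinuousOn.mul (by fun_prop)
      (continuousOn_hInt_base.inv₀ fun _ _ => csqrt_ne_zero _)
  · exact ContinuousOn.mul (by fun_prop) (ContinuousOn.div (by fun_prop)
      (continuousOn_hInt_base.pow 3) fun _ _ => pow_ne_zero _ (csqrt_ne_zero _))
  · intro z hz t ht
    have hm := one_add_mem_slitPlane hz ht
    have h1 : HasDerivAt (fun z : ℂ => 1 + (t : ℂ) ^ 2 * (z ^ 2 - 1)) ((t : ℂ) ^ 2 * (2 * z)) z := by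
      have := (((hasDerivAt_pow 2 z).sub_const 1).const_mul ((t:ℂ)^2)).const_add 1
      simpa using this
    have h2 := hasDerivAt_csqrt_comp h1 hm
    refine ((h2.fun_inv (csqrt_ne_zero _)).const_mul (2 * (t : ℂ) ^ (n - 1))).congr_deriv ?_
    have h0 := csqrt_ne_zero (1 + (t : ℂ) ^ 2 * (z ^ 2 - 1))
    field_simp

/-- Integrate over $[0,1]$ the derivative in $r$ of $2zr^n(1+r^2(z^2-1))^{-1/2}$: it splits into
$nz$ times the integrand of $H$ and $z^2-1$ times the integrand of $H'$. The boundary term is $2$,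
since at $r=1$ the principal root of $z^2$ is $z$ when $\operatorname{Re}z>0$. This linear equation
simplifies every later derivative that involves $H$. -/
theorem hInt_deriv_eq {n : ℕ} (hn : 1 ≤ n) {z : ℂ} (hz : 0 < z.re) :
    (z ^ 2 - 1) * deriv (hInt n) z = 2 - n * z * hInt n z := by
  have hz0 : z ≠ 0 := by rintro rfl; simp at hz
  have c1 : ContinuousOn (fun r : ℝ => csqrt (1 + (r : ℂ) ^ 2 * (z ^ 2 - 1))) (Icc 0 1) :=
    continuousOn_hInt_base.comp (f := fun t : ℝ => (z, t)) (by fun_prop) fun t ht => ⟨hz, ht⟩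
  have i1 : IntervalIntegrable (fun r : ℝ => 2 * (r : ℂ) ^ (n - 1) *
      (csqrt (1 + (r : ℂ) ^ 2 * (z ^ 2 - 1)))⁻¹) MeasureTheory.volume 0 1 := by
    apply ContinuousOn.intervalIntegrable
    rw [uIcc_of_le zero_le_one]
    exact ContinuousOn.mul (by fun_prop) (c1.inv₀ fun _ _ => csqrt_ne_zero _)
  have i2 : IntervalIntegrable (fun r : ℝ => 2 * (r : ℂ) ^ (n - 1) *
      (-((r : ℂ) ^ 2 * z) / csqrt (1 + (r : ℂ) ^ 2 * (z ^ 2 - 1)) ^ 3))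
      MeasureTheory.volume 0 1 := by
    apply ContinuousOn.intervalIntegrable
    rw [uIcc_of_le zero_le_one]
    exact ContinuousOn.mul (by fun_prop) (ContinuousOn.div (by fun_prop)
      (c1.pow 3) fun _ _ => pow_ne_zero _ (csqrt_ne_zero _))
  have key := intervalIntegral.integral_eq_sub_of_hasDerivAt
    (f := fun r : ℝ => 2 * z * (r : ℂ) ^ n * (csqrt (1 + (r : ℂ) ^ 2 * (z ^ 2 - 1)))⁻¹)
    (f' := fun r : ℝ => n * z * (2 * (r : ℂ) ^ (n - 1) *
      (csqrt (1 + (r : ℂ) ^ 2 * (z ^ 2 - 1)))⁻¹) + (z ^ 2 - 1) * (2 * (r : ℂ) ^ (n - 1) *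
      (-((r : ℂ) ^ 2 * z) / csqrt (1 + (r : ℂ) ^ 2 * (z ^ 2 - 1)) ^ 3))) (a := 0) (b := 1) ?_
      ((i1.const_mul _).add (i2.const_mul _))
  · rw [intervalIntegral.integral_add (i1.const_mul _) (i2.const_mul _),
      intervalIntegral.integral_const_mul, intervalIntegral.integral_const_mul,
      ← (hasDerivAt_hInt_aux n hz).deriv] at key
    rw [← hInt] at key
    have e : csqrt (z ^ 2) = z := (eq_csqrt (sq_mem_slitPlane hz) hz rfl).symm
    have hn0 : n ≠ 0 := by omega
    simp [e, hn0, hz0] at key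
    linear_combination key
  · intro t ht
    rw [uIcc_of_le zero_le_one] at ht
    have hm := one_add_mem_slitPlane hz ht
    have h0 := csqrt_ne_zero (1 + (t : ℂ) ^ 2 * (z ^ 2 - 1))
    have h1 : HasDerivAt (fun t : ℂ => 1 + t ^ 2 * (z ^ 2 - 1)) (2 * (t : ℂ) * (z ^ 2 - 1)) t := by
      have := (((hasDerivAt_pow 2 (t : ℂ)).mul_const (z ^ 2 - 1))).const_add 1
      simpa using this
    have h2 := hasDerivAt_csqrt_comp h1 hm
    refine ((((hasDerivAt_pow n (t : ℂ)).const_mul (2 * z)).fun_mul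
      (h2.fun_inv (csqrt_ne_zero _))).comp_ofReal).congr_deriv ?_
    have hp : (t : ℂ) ^ n = (t : ℂ) ^ (n - 1) * t := by
      rw [← pow_succ]; congr 1; omega
    rw [hp]
    field_simp

theorem hasDerivAt_hInt {n : ℕ} {z : ℂ} (hz : 0 < z.re) :
    HasDerivAt (hInt n) (deriv (hInt n) z) z :=
  (hasDerivAt_hInt_aux n hz).differentiableAt.hasDerivAt

theorem unitIntegral_re_pos {f : ℝ → ℂ} (hf : ContinuousOn f (Icc 0 1))
    (hpos : ∀ r ∈ Ioo (0 : ℝ) 1, 0 < (f r).re) : 0 < (∫ r in (0 : ℝ)..1, f r).re := by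
  have hi : IntervalIntegrable f MeasureTheory.volume 0 1 := by
    apply ContinuousOn.intervalIntegrable
    rwa [uIcc_of_le zero_le_one]
  have e := intervalIntegral.intervalIntegral_re hi
  simp only [RCLike.re_to_complex] at e
  rw [← e]
  refine intervalIntegral.intervalIntegral_pos_of_pos_on ?_ hpos zero_lt_one
  apply ContinuousOn.intervalIntegrable
  rw [uIcc_of_le zero_le_one]
  exact continuous_re.comp_continuousOn hf

theorem continuousOn_hInt_integrand (n : ℕ) {z : ℂ} (hz : 0 < z.re) :
    ContinuousOn (fun r : ℝ => 2 * (r : ℂ) ^ (n - 1) *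
      (csqrt (1 + (r : ℂ) ^ 2 * (z ^ 2 - 1)))⁻¹) (Icc 0 1) :=
  ContinuousOn.mul (by fun_prop) (ContinuousOn.inv₀ (continuousOn_hInt_base.comp
    (f := fun t : ℝ => (z, t)) (by fun_prop) fun t ht => ⟨hz, ht⟩) fun _ _ => csqrt_ne_zero _)

theorem inv_re_pos {u : ℂ} (hu : 0 < u.re) : 0 < (u⁻¹).re := by
  rw [inv_re]
  have : u ≠ 0 := by rintro rfl; simp at hu
  have := normSq_pos.2 this
  positivity

/-- Principal roots have positive real part, and so do their inverses. This positivity is the source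
of the injectivity of $K$ and of the choice of the principal branch of $\log H$. -/
theorem hInt_re_pos (n : ℕ) {z : ℂ} (hz : 0 < z.re) : 0 < (hInt n z).re := by
  refine unitIntegral_re_pos (continuousOn_hInt_integrand n hz) fun r hr => ?_
  have h := inv_re_pos (csqrt_re_pos (one_add_mem_slitPlane hz ⟨hr.1.le, hr.2.le⟩))
  have e : 2 * (r : ℂ) ^ (n - 1) = ((2 * r ^ (n - 1) : ℝ) : ℂ) := by push_cast; rfl
  rw [e, re_ofReal_mul]
  have := hr.1
  positivity

theorem hInt_conj (n : ℕ) {z : ℂ} (hz : 0 < z.re) : hInt n (conj z) = conj (hInt n z) := by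
  rw [hInt, hInt, ← intervalIntegral.intervalIntegral_conj]
  refine intervalIntegral.integral_congr fun r hr => ?_
  rw [uIcc_of_le zero_le_one] at hr
  have := csqrt_conj (one_add_mem_slitPlane hz hr)
  simp only [map_mul, map_add, map_sub, map_pow, map_inv₀, map_one, conj_ofReal, map_ofNat]
    at this ⊢
  rw [this]

theorem hInt_ne_zero (n : ℕ) {z : ℂ} (hz : 0 < z.re) : hInt n z ≠ 0 := by
  intro h
  have := hInt_re_pos n hz
  simp [h] at this

/-! ### The function `F` -/

/-- The plane slit along `(-∞, -1]` and `[1, ∞)`. -/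
def slitDom : Set ℂ := {z | 1 - z ^ 2 ∈ slitPlane}

theorem isOpen_slitDom : IsOpen slitDom :=
  isOpen_slitPlane.preimage (by fun_prop : Continuous fun z : ℂ => 1 - z ^ 2)

theorem mem_slitDom_of_im {z : ℂ} (hz : z.im ≠ 0) : z ∈ slitDom := by
  change 1 - z ^ 2 ∈ slitPlane
  rw [mem_slitPlane_iff]
  simp only [sq, sub_re, sub_im, one_re, one_im, mul_re, mul_im]
  rcases eq_or_ne z.re 0 with h | h
  · left; rw [h]; nlinarith [mul_self_nonneg z.im]
  · right; intro h'; apply h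
    have : z.re * z.im = 0 := by linarith
    exact (mul_eq_zero.1 this).resolve_right hz

theorem mem_slitDom_of_re {z : ℂ} (hz : |z.re| < 1) : z ∈ slitDom := by
  rcases eq_or_ne z.im 0 with h | h
  · change 1 - z ^ 2 ∈ slitPlane
    rw [mem_slitPlane_iff]
    left
    simp only [sq, sub_re, one_re, mul_re, h]
    nlinarith [abs_lt.1 hz]
  · exact mem_slitDom_of_im h

theorem one_sub_mem_slitPlane {z : ℂ} (hz : z ∈ slitDom) {t : ℝ} (ht : t ∈ Icc (0 : ℝ) 1) :
    1 - (t : ℂ) ^ 2 * z ^ 2 ∈ slitPlane := by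
  have h := StarConvex.add_smul_mem starConvex_one_slitPlane
    (show 1 + -z ^ 2 ∈ slitPlane by have : 1 - z ^ 2 ∈ slitPlane := hz; rwa [sub_eq_add_neg] at this)
    (show 0 ≤ t ^ 2 by positivity) (show t ^ 2 ≤ 1 from pow_le_one₀ ht.1 ht.2)
  simpa [sub_eq_add_neg] using h

/-- The primitive `F(z) = ∫₀ᶻ (1 - ζ²)^{(n-2)/2} dζ`. -/
def fInt (n : ℕ) (z : ℂ) : ℂ :=
  ∫ t in (0 : ℝ)..1, z * csqrt (1 - (t : ℂ) ^ 2 * z ^ 2) ^ (n - 2)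

theorem continuousOn_fInt_base :
    ContinuousOn (fun x : ℂ × ℝ => csqrt (1 - (x.2 : ℂ) ^ 2 * x.1 ^ 2))
      (slitDom ×ˢ Icc 0 1) :=
  continuousOn_csqrt.comp (by fun_prop) fun _ hx => one_sub_mem_slitPlane hx.1 hx.2

/-- The derivative in $z$ of the integrand equals the derivative in $t$ of $t(1-t^2z^2)^{(n-2)/2}$,
so the differentiated integral reduces to the boundary term at $t=1$. -/
theorem hasDerivAt_fInt (n : ℕ) {z : ℂ} (hz : z ∈ slitDom) :
    HasDerivAt (fInt n) (csqrt (1 - z ^ 2) ^ (n - 2)) z := by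
  set m := n - 2 with hm
  have h := hasDerivAt_unitIntegral (f := fun z t => z * csqrt (1 - (t : ℂ) ^ 2 * z ^ 2) ^ m)
    (f' := fun z t => csqrt (1 - (t : ℂ) ^ 2 * z ^ 2) ^ m +
      z * (m * csqrt (1 - (t : ℂ) ^ 2 * z ^ 2) ^ (m - 1) *
        (-((t : ℂ) ^ 2 * z) / csqrt (1 - (t : ℂ) ^ 2 * z ^ 2)))) isOpen_slitDom ?_ ?_ ?_ hz
  · refine h.congr_deriv ?_
    have c1 : ContinuousOn (fun t : ℝ => csqrt (1 - (t : ℂ) ^ 2 * z ^ 2)) (Icc 0 1) :=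
      continuousOn_fInt_base.comp (f := fun t : ℝ => (z, t)) (by fun_prop) fun t ht => ⟨hz, ht⟩
    have key := intervalIntegral.integral_eq_sub_of_hasDerivAt
      (f := fun t : ℝ => (t : ℂ) * csqrt (1 - (t : ℂ) ^ 2 * z ^ 2) ^ m)
      (f' := fun t => csqrt (1 - (t : ℂ) ^ 2 * z ^ 2) ^ m +
      z * (m * csqrt (1 - (t : ℂ) ^ 2 * z ^ 2) ^ (m - 1) *
        (-((t : ℂ) ^ 2 * z) / csqrt (1 - (t : ℂ) ^ 2 * z ^ 2)))) (a := 0) (b := 1) ?_ ?_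
    · rw [key]; simp
    · intro t ht
      rw [uIcc_of_le zero_le_one] at ht
      have h1 : HasDerivAt (fun t : ℂ => 1 - t ^ 2 * z ^ 2) (-(2 * (t : ℂ) * z ^ 2)) t := by
        have := (((hasDerivAt_pow 2 (t : ℂ)).mul_const (z ^ 2))).const_sub 1
        simpa using this
      have h2 := (hasDerivAt_id (t : ℂ)).fun_mul
        (((hasDerivAt_csqrt (one_sub_mem_slitPlane hz ht)).comp (t : ℂ) h1).fun_pow m)
      refine (h2.comp_ofReal).congr_deriv ?_
      have h0 := csqrt_ne_zero (1 - (t : ℂ) ^ 2 * z ^ 2)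
      simp only [Function.comp, id]
      field_simp
    · apply ContinuousOn.intervalIntegrable
      rw [uIcc_of_le zero_le_one]
      exact (c1.pow m).add (ContinuousOn.mul (by fun_prop) (ContinuousOn.mul
        (ContinuousOn.mul (by fun_prop) (c1.pow _))
        (ContinuousOn.div (by fun_prop) c1 fun _ _ => csqrt_ne_zero _)))
  · exact ContinuousOn.mul (by fun_prop) (continuousOn_fInt_base.pow m)
  · exact (continuousOn_fInt_base.pow m).add (ContinuousOn.mul (by fun_prop) (ContinuousOn.mul
        (ContinuousOn.mul (by fun_prop) (continuousOn_fInt_base.pow _))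
        (ContinuousOn.div (by fun_prop) continuousOn_fInt_base fun _ _ => csqrt_ne_zero _)))
  · intro z hz t ht
    have h1 : HasDerivAt (fun z : ℂ => 1 - (t : ℂ) ^ 2 * z ^ 2) (-((t : ℂ) ^ 2 * (2 * z))) z := by
      have := (((hasDerivAt_pow 2 z).const_mul ((t:ℂ) ^ 2))).const_sub 1
      simpa using this
    have h2 := (hasDerivAt_id z).fun_mul
      (((hasDerivAt_csqrt (one_sub_mem_slitPlane hz ht)).comp z h1).fun_pow m)
    refine h2.congr_deriv ?_
    have h0 := csqrt_ne_zero (1 - (t : ℂ) ^ 2 * z ^ 2)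
    simp only [Function.comp, id]
    field_simp

theorem fInt_neg (n : ℕ) (z : ℂ) : fInt n (-z) = -fInt n z := by
  rw [fInt, fInt, ← intervalIntegral.integral_neg]
  simp

theorem fInt_conj (n : ℕ) {z : ℂ} (hz : z ∈ slitDom) : fInt n (conj z) = conj (fInt n z) := by
  rw [fInt, fInt, ← intervalIntegral.intervalIntegral_conj]
  refine intervalIntegral.integral_congr fun r hr => ?_
  rw [uIcc_of_le zero_le_one] at hr
  have := csqrt_conj (one_sub_mem_slitPlane hz hr)
  simp only [map_mul, map_sub, map_pow, map_one, conj_ofReal] at this ⊢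
  rw [this]

/-! #### `F` on the imaginary axis -/

/-- The function `T(y) = ∫₀^y (1 + τ²)^{(n-2)/2} dτ`, which is `F(iy)/i`. -/
def tInt (n : ℕ) (y : ℝ) : ℝ := ∫ t in (0 : ℝ)..1, y * √(1 + t ^ 2 * y ^ 2) ^ (n - 2)

theorem fInt_I_mul (n : ℕ) (y : ℝ) : fInt n (y * I) = tInt n y * I := by
  rw [fInt, tInt, ← intervalIntegral.integral_ofReal, ← intervalIntegral.integral_mul_const]
  refine intervalIntegral.integral_congr fun r hr => ?_
  have e : 1 - (r : ℂ) ^ 2 * (y * I) ^ 2 = ((1 + r ^ 2 * y ^ 2 : ℝ) : ℂ) := by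
    push_cast
    rw [mul_pow, I_sq]; ring
  simp only [e]
  rw [csqrt_ofReal (by positivity)]
  push_cast
  ring

theorem I_mul_mem_slitDom (y : ℝ) : (y : ℂ) * I ∈ slitDom := mem_slitDom_of_re (by simp)

theorem hasDerivAt_tInt (n : ℕ) (y : ℝ) : HasDerivAt (tInt n) (√(1 + y ^ 2) ^ (n - 2)) y := by
  have h1 : HasDerivAt (fun w : ℂ => w * I) I (y : ℂ) := by
    simpa using (hasDerivAt_id (y : ℂ)).mul_const I
  have h2 := ((hasDerivAt_fInt n (I_mul_mem_slitDom y)).comp (y : ℂ) h1).mul_const (-I)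
  have h3 := h2.real_of_complex
  have e : ∀ x : ℝ, ((fInt n ∘ fun w => w * I) ↑x * -I).re = tInt n x := by
    intro x
    simp only [Function.comp, fInt_I_mul]
    simp
  have e2 : 1 - ((y : ℂ) * I) ^ 2 = ((1 + y ^ 2 : ℝ) : ℂ) := by
    push_cast
    rw [mul_pow, I_sq]; ring
  simp only [e] at h3
  refine h3.congr_deriv ?_
  rw [e2, csqrt_ofReal (by positivity), mul_assoc]
  rw [show I * -I = 1 by simp, mul_one, ← ofReal_pow, ofReal_re]

theorem tInt_strictMono (n : ℕ) : StrictMono (tInt n) := by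
  refine strictMono_of_deriv_pos fun y => ?_
  rw [(hasDerivAt_tInt n y).deriv]
  positivity

theorem tInt_zero (n : ℕ) : tInt n 0 = 0 := by simp [tInt]

theorem tInt_neg (n : ℕ) (y : ℝ) : tInt n (-y) = -tInt n y := by
  rw [tInt, tInt, ← intervalIntegral.integral_neg]
  simp

theorem le_tInt (n : ℕ) {y : ℝ} (hy : 0 ≤ y) : y ≤ tInt n y := by
  have h : Monotone fun y => tInt n y - y := by
    refine monotone_of_deriv_nonneg (fun y => ((hasDerivAt_tInt n y).sub
      (hasDerivAt_id y)).differentiableAt) fun y => ?_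
    have : HasDerivAt (fun y => tInt n y - y) _ y := (hasDerivAt_tInt n y).fun_sub (hasDerivAt_id y)
    rw [this.deriv, sub_nonneg]
    exact one_le_pow₀ (by rw [Real.one_le_sqrt]; nlinarith [sq_nonneg y])
  have := h hy
  simp only [tInt_zero] at this
  linarith

theorem tInt_surjective (n : ℕ) : Function.Surjective (tInt n) := by
  have hc : Continuous (tInt n) :=
    continuous_iff_continuousAt.2 fun y => (hasDerivAt_tInt n y).continuousAt
  refine hc.surjective ?_ ?_
  · refine tendsto_atTop_mono' _ ?_ tendsto_id
    filter_upwards [eventually_ge_atTop 0] with y hy using le_tInt n hy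
  · refine tendsto_atBot_mono' _ ?_ tendsto_id
    filter_upwards [eventually_le_atBot 0] with y hy
    have := le_tInt n (neg_nonneg.2 hy)
    rw [tInt_neg] at this
    simp only [id]
    linarith

/-! #### The relation between `F` and `H` -/

/-- The value `F(1) = ∫₀¹ (1 - ζ²)^{(n-2)/2} dζ`. -/
def aConst (n : ℕ) : ℝ :=
  (fInt n ((1 / 2 : ℝ) : ℂ) +
    csqrt (1 - ((1 / 2 : ℝ) : ℂ) ^ 2) ^ n * hInt n ((1 / 2 : ℝ) : ℂ) / 2).re

theorem aConst_pos (n : ℕ) : 0 < aConst n := by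
  have hs : (((1 / 2 : ℝ) : ℂ)) ∈ slitDom := mem_slitDom_of_re (by rw [ofReal_re]; norm_num [abs_lt])
  have hR : 0 < (((1 / 2 : ℝ) : ℂ)).re := by rw [ofReal_re]; norm_num
  rw [aConst, add_re]
  refine add_pos ?_ ?_
  · refine unitIntegral_re_pos ?_ fun t ht => ?_
    · exact ContinuousOn.mul (by fun_prop) (ContinuousOn.pow (continuousOn_fInt_base.comp
        (f := fun t : ℝ => (_, t)) (by fun_prop) fun t ht => ⟨hs, ht⟩) _)
    · have h1 : 0 < 1 - t ^ 2 * (1 / 2) ^ 2 := by nlinarith [ht.1, ht.2]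
      have e : 1 - (t : ℂ) ^ 2 * ((1 / 2 : ℝ) : ℂ) ^ 2 = ((1 - t ^ 2 * (1 / 2) ^ 2 : ℝ) : ℂ) := by
        push_cast; ring
      rw [e, csqrt_ofReal h1, ← ofReal_pow, ← ofReal_mul, ofReal_re]
      positivity
  · have e : 1 - ((1 / 2 : ℝ) : ℂ) ^ 2 = ((1 - (1 / 2) ^ 2 : ℝ) : ℂ) := by push_cast; ring
    have h1 : (0:ℝ) < 1 - (1 / 2) ^ 2 := by norm_num
    rw [e, csqrt_ofReal h1, ← ofReal_pow, mul_div_assoc, re_ofReal_mul]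
    have := hInt_re_pos n hR
    have h2 : (hInt n ((1 / 2 : ℝ) : ℂ) / 2).re = (hInt n ((1 / 2 : ℝ) : ℂ)).re / 2 := by simp
    rw [h2]
    positivity

theorem starConvex_rightHalf_slitDom :
    StarConvex ℝ ((1 / 2 : ℝ) : ℂ) (rightHalf ∩ slitDom) := by
  rintro z ⟨hz, hs⟩ a b ha hb hab
  have hz' : 0 < z.re := hz
  have hre : (a • ((1 / 2 : ℝ) : ℂ) + b • z).re = a / 2 + b * z.re := by simp; ring
  have him : (a • ((1 / 2 : ℝ) : ℂ) + b • z).im = b * z.im := by simp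
  have hpos : 0 < (a • ((1 / 2 : ℝ) : ℂ) + b • z).re := by
    rw [hre]
    rcases ha.eq_or_lt with h | h
    · have : b = 1 := by linarith
      rw [← h, this]; linarith
    · nlinarith [mul_nonneg hb hz'.le]
  refine ⟨hpos, ?_⟩
  by_cases h : b * z.im = 0
  · rcases mul_eq_zero.1 h with h | h
    · apply mem_slitDom_of_re
      rw [hre, h]
      have : a = 1 := by linarith
      rw [this]; norm_num [abs_lt]
    · apply mem_slitDom_of_re
      have h1 : 1 - z ^ 2 ∈ slitPlane := hs
      rw [mem_slitPlane_iff] at h1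
      simp only [sq, sub_re, sub_im, one_re, one_im, mul_re, mul_im, h] at h1
      have h2 : 0 < 1 - z.re * z.re := by
        rcases h1 with h1 | h1
        · linarith
        · exact absurd (by ring) h1
      have h3 : z.re < 1 := by nlinarith
      rw [hre, abs_lt]
      constructor <;> nlinarith
  · exact mem_slitDom_of_im (by rwa [him])

/-- By `hInt_deriv_eq`, $F+(1-z^2)^{n/2}H/2$ has zero derivative on a domain that is star-shaped
about $1/2$. Its constant value is read off at $1/2$, because $1$ is a branch point; conjugation
symmetry makes it real, hence equal to `aConst n`. -/
theorem hInt_eq {n : ℕ} (hn : 2 ≤ n) {z : ℂ} (hz : 0 < z.re) (hs : z ∈ slitDom) :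
    csqrt (1 - z ^ 2) ^ n * hInt n z = 2 * (aConst n - fInt n z) := by
  have hs2 : (((1 / 2 : ℝ) : ℂ)) ∈ slitDom := mem_slitDom_of_re (by rw [ofReal_re]; norm_num [abs_lt])
  have hR2 : 0 < (((1 / 2 : ℝ) : ℂ)).re := by rw [ofReal_re]; norm_num
  have hd : ∀ z ∈ rightHalf ∩ slitDom, HasDerivAt
      (fun z => fInt n z + csqrt (1 - z ^ 2) ^ n * hInt n z / 2) 0 z := by
    rintro z ⟨hz, hs⟩
    have h1 : HasDerivAt (fun z : ℂ => 1 - z ^ 2) (-(2 * z)) z := by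
      simpa using (hasDerivAt_pow 2 z).const_sub 1
    have h2 := hasDerivAt_csqrt_comp h1 hs
    refine ((hasDerivAt_fInt n hs).fun_add (((h2.fun_pow n).fun_mul
      (hasDerivAt_hInt hz)).div_const 2)).congr_deriv ?_
    have h0 := csqrt_ne_zero (1 - z ^ 2)
    have hq := csqrt_sq (slitPlane_ne_zero hs)
    have hH := hInt_deriv_eq (n := n) (by omega) hz
    generalize hInt n z = h at *
    generalize deriv (hInt n) z = h' at *
    generalize csqrt (1 - z ^ 2) = q at *
    have e1 : q ^ (n - 1) = q ^ (n - 2) * q := by rw [← pow_succ]; congr 1; omega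
    have e2 : q ^ n = q ^ (n - 2) * q ^ 2 := by rw [← pow_add]; congr 1; omega
    rw [e1, e2, hq]
    field_simp
    linear_combination (-q ^ (n - 2)) * hH
  have hconst := (isOpen_rightHalf.inter isOpen_slitDom).is_const_of_deriv_eq_zero
    (starConvex_rightHalf_slitDom.isPathConnected ⟨hR2, hs2⟩).isConnected.isPreconnected
    (fun z hz => (hd z hz).differentiableAt.differentiableWithinAt)
    (fun z hz => (hd z hz).deriv) ⟨hz, hs⟩ ⟨hR2, hs2⟩
  have hreal : ((aConst n : ℝ) : ℂ) = fInt n ((1 / 2 : ℝ) : ℂ) +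
      csqrt (1 - ((1 / 2 : ℝ) : ℂ) ^ 2) ^ n * hInt n ((1 / 2 : ℝ) : ℂ) / 2 := by
    rw [aConst, ← conj_eq_iff_re]
    have e : conj (1 - ((1 / 2 : ℝ) : ℂ) ^ 2) = 1 - ((1 / 2 : ℝ) : ℂ) ^ 2 := by
      simp only [map_sub, map_one, map_pow, conj_ofReal]
    have h1 := fInt_conj n hs2
    have h2 := hInt_conj n hR2
    have h3 := csqrt_conj hs2
    rw [conj_ofReal] at h1 h2
    rw [e] at h3
    rw [map_add, map_div₀, map_mul, map_pow, ← h1, ← h2, ← h3, map_ofNat]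
  rw [hreal]
  linear_combination 2 * hconst

/-! ### The conformal map `K` of the right half-plane -/

/-- The map `ζ ↦ (1 + e^ζ) / (1 - e^ζ)` from the left half-plane to the right half-plane. -/
def zOf (ζ : ℂ) : ℂ := (1 + exp ζ) / (1 - exp ζ)

/-- The Möbius map `z ↦ (z - 1) / (z + 1)`. -/
def mob (z : ℂ) : ℂ := (z - 1) / (z + 1)

/-- A logarithm of `kFun`, as a function on the left half-plane. -/
def gFun (n : ℕ) (ζ : ℂ) : ℂ := ζ + 2 * log (zOf ζ + 1) + (2 / n) * log (hInt n (zOf ζ))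

/-- The function `K` with `K^{n/2} = 2 ∫₁ᶻ (ζ² - 1)^{(n-2)/2} dζ`. -/
def kFun (n : ℕ) (z : ℂ) : ℂ := (z ^ 2 - 1) * exp ((2 / n) * log (hInt n z))

/-- The principal logarithm of `kFun`. -/
def lFun (n : ℕ) (z : ℂ) : ℂ :=
  log (mob z) + 2 * log (z + 1) + (2 / n) * log (hInt n z)

theorem one_sub_exp_ne_zero {ζ : ℂ} (h : ζ.re < 0) : 1 - exp ζ ≠ 0 := by
  intro h'
  have : ‖exp ζ‖ < 1 := by rw [norm_exp]; exact Real.exp_lt_one_iff.2 h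
  rw [← sub_eq_zero.1 h'] at this
  simp at this

theorem zOf_re (ζ : ℂ) : (zOf ζ).re = (1 - ‖exp ζ‖ ^ 2) / normSq (1 - exp ζ) := by
  rw [zOf, div_re, ← add_div, Complex.sq_norm, normSq_apply (exp ζ)]
  congr 1
  simp
  ring

theorem zOf_re_pos {ζ : ℂ} (h : ζ.re < 0) : 0 < (zOf ζ).re := by
  rw [zOf_re]
  have h1 : ‖exp ζ‖ < 1 := by rw [norm_exp]; exact Real.exp_lt_one_iff.2 h
  have h2 := normSq_pos.2 (one_sub_exp_ne_zero h)
  have h3 := norm_nonneg (exp ζ)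
  apply div_pos _ h2
  nlinarith

theorem add_one_ne_zero {z : ℂ} (hz : 0 ≤ z.re) : z + 1 ≠ 0 := by
  intro h
  have := congrArg re h
  simp at this
  linarith

theorem add_one_mem_slitPlane {z : ℂ} (hz : 0 ≤ z.re) : z + 1 ∈ slitPlane := by
  rw [mem_slitPlane_iff]; left; simp; linarith

theorem zOf_mob {z ζ : ℂ} (hz : z + 1 ≠ 0) (h : exp ζ = mob z) : zOf ζ = z := by
  rw [zOf, h, mob]
  field_simp
  ring

theorem mob_ne_zero {z : ℂ} (hz : 0 ≤ z.re) (h1 : z ≠ 1) : mob z ≠ 0 :=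
  div_ne_zero (sub_ne_zero.2 h1) (add_one_ne_zero hz)

theorem norm_mob_lt {z : ℂ} (hz : 0 < z.re) : ‖mob z‖ < 1 := by
  have h0 := add_one_ne_zero hz.le
  rw [mob, norm_div, div_lt_one (norm_pos_iff.2 h0)]
  refine lt_of_pow_lt_pow_left₀ 2 (norm_nonneg _) ?_
  rw [Complex.sq_norm, Complex.sq_norm, normSq_apply, normSq_apply]
  simp
  nlinarith

theorem log_mob_re {z : ℂ} (hz : 0 < z.re) (h1 : z ≠ 1) : (log (mob z)).re < 0 := by
  rw [log_re]
  exact Real.log_neg (norm_pos_iff.2 (mob_ne_zero hz.le h1)) (norm_mob_lt hz)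

theorem zOf_log_mob {z : ℂ} (hz : 0 < z.re) (h1 : z ≠ 1) : zOf (log (mob z)) = z :=
  zOf_mob (add_one_ne_zero hz.le) (exp_log (mob_ne_zero hz.le h1))

theorem hasDerivAt_zOf {ζ : ℂ} (h : 1 - exp ζ ≠ 0) :
    HasDerivAt zOf ((zOf ζ ^ 2 - 1) / 2) ζ := by
  have h1 := ((hasDerivAt_exp ζ).const_add 1).fun_div ((hasDerivAt_exp ζ).const_sub 1) h
  refine h1.congr_deriv ?_
  rw [zOf]
  field_simp
  ring

theorem slitPlane_of_re_pos {u : ℂ} (h : 0 < u.re) : u ∈ slitPlane :=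
  mem_slitPlane_iff.2 (Or.inl h)

theorem hasDerivAt_log_hInt {n : ℕ} {z : ℂ} (hz : 0 < z.re) :
    HasDerivAt (fun z => log (hInt n z)) (deriv (hInt n) z / hInt n z) z :=
  (hasDerivAt_hInt hz).clog (slitPlane_of_re_pos (hInt_re_pos n hz))

/-- The differential equation of $H$ collapses the three contributions into one multiple of
$H^{-1}$, whose real part is positive. -/
theorem hasDerivAt_gFun {n : ℕ} (hn : 2 ≤ n) {ζ : ℂ} (h : ζ.re < 0) :
    HasDerivAt (gFun n) ((2 / n) * (hInt n (zOf ζ))⁻¹) ζ := by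
  have hz := zOf_re_pos h
  have h1 := hasDerivAt_zOf (one_sub_exp_ne_zero h)
  have h2 := (h1.add_const 1).clog (add_one_mem_slitPlane hz.le)
  have h3 : HasDerivAt (fun ζ => log (hInt n (zOf ζ))) _ ζ :=
    HasDerivAt.comp (h₂ := fun z => log (hInt n z)) ζ (hasDerivAt_log_hInt hz) h1
  refine (((hasDerivAt_id ζ).fun_add (h2.const_mul 2)).fun_add (h3.const_mul (2 / n : ℂ))).congr_deriv ?_
  have hH := hInt_deriv_eq (n := n) (by omega) hz
  have h0 := hInt_ne_zero n hz
  have hz1 := add_one_ne_zero hz.le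
  have hn0 : (n : ℂ) ≠ 0 := by exact_mod_cast (by omega : n ≠ 0)
  generalize zOf ζ = z at *
  generalize hInt n z = a at *
  generalize deriv (hInt n) z = b at *
  field_simp
  linear_combination (z + 1) * hH

/-- The map `gFun` is strictly monotone, in the sense of monotone operators. -/
theorem gFun_mono {n : ℕ} (hn : 2 ≤ n) {ζ₁ ζ₂ : ℂ} (h1 : ζ₁.re < 0) (h2 : ζ₂.re < 0)
    (hne : ζ₁ ≠ ζ₂) : 0 < ((gFun n ζ₂ - gFun n ζ₁) * conj (ζ₂ - ζ₁)).re := by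
  set Δ := ζ₂ - ζ₁ with hΔ
  have hΔ0 : Δ ≠ 0 := sub_ne_zero.2 hne.symm
  have hre : ∀ t ∈ Icc (0:ℝ) 1, (ζ₁ + t * Δ).re < 0 := by
    intro t ht
    have : (ζ₁ + t * Δ).re = (1 - t) * ζ₁.re + t * ζ₂.re := by simp [hΔ]; ring
    rw [this]
    rcases ht.1.eq_or_lt with h | h
    · rw [← h]; simpa using h1
    · nlinarith [ht.2]
  -- Along the segment from $\zeta_1$ to $\zeta_2$, which stays in the convex left half-plane, the
  -- derivative is $\frac2n|\Delta|^2\operatorname{Re}(1/H)>0$.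
  have hd : ∀ t ∈ Icc (0:ℝ) 1, HasDerivAt (fun t : ℝ => (gFun n (ζ₁ + t * Δ) * conj Δ).re)
      (((2 / n) * (hInt n (zOf (ζ₁ + t * Δ)))⁻¹ * Δ * conj Δ).re) t := by
    intro t ht
    have h3 : HasDerivAt (fun t : ℂ => ζ₁ + t * Δ) Δ (t : ℂ) := by
      simpa using ((hasDerivAt_id (t:ℂ)).mul_const Δ).const_add ζ₁
    have h4 : HasDerivAt (fun t : ℂ => gFun n (ζ₁ + t * Δ)) _ (t : ℂ) :=
      HasDerivAt.comp (h₂ := gFun n) (t : ℂ) (hasDerivAt_gFun hn (hre t ht)) h3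
    exact (h4.mul_const (conj Δ)).real_of_complex
  have hmono : StrictMonoOn (fun t : ℝ => (gFun n (ζ₁ + t * Δ) * conj Δ).re) (Icc 0 1) := by
    refine strictMonoOn_of_deriv_pos (convex_Icc 0 1)
      (fun t ht => (hd t ht).continuousAt.continuousWithinAt) fun t ht => ?_
    rw [interior_Icc] at ht
    rw [(hd t (Ioo_subset_Icc_self ht)).deriv, mul_assoc, mul_conj]
    have hp := inv_re_pos (hInt_re_pos n (zOf_re_pos (hre t (Ioo_subset_Icc_self ht))))
    have e : (2 / (n : ℂ)) = ((2 / n : ℝ) : ℂ) := by push_cast; rfl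
    have hn0 : (0:ℝ) < n := by exact_mod_cast (by omega : 0 < n)
    rw [re_mul_ofReal, e, re_ofReal_mul]
    have := normSq_pos.2 hΔ0
    positivity
  have := hmono (by simp) (by simp) (zero_lt_one)
  simp only [ofReal_zero, zero_mul, add_zero, ofReal_one, one_mul] at this
  rw [show ζ₁ + Δ = ζ₂ by rw [hΔ]; ring] at this
  rw [sub_mul, sub_re]
  linarith

theorem zOf_sq_sub_one {ζ : ℂ} (h : 1 - exp ζ ≠ 0) :
    zOf ζ ^ 2 - 1 = exp ζ * (zOf ζ + 1) ^ 2 := by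
  rw [zOf]; field_simp; ring

theorem exp_two_mul_log {u : ℂ} (h : u ≠ 0) : exp (2 * log u) = u ^ 2 := by
  have := exp_nat_mul (log u) 2
  rw [exp_log h] at this
  exact_mod_cast this

theorem exp_gFun (n : ℕ) {ζ : ℂ} (h : ζ.re < 0) : exp (gFun n ζ) = kFun n (zOf ζ) := by
  rw [gFun, exp_add, exp_add, kFun, zOf_sq_sub_one (one_sub_exp_ne_zero h),
    exp_two_mul_log (add_one_ne_zero (zOf_re_pos h).le)]

theorem zOf_add (ζ : ℂ) (k : ℤ) : zOf (ζ + k * (2 * Real.pi * I)) = zOf ζ := by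
  rw [zOf, exp_periodic.int_mul, zOf]

/-- Commuting with the translations by $2\pi i$ is what lets injectivity descend from the logarithm
`gFun` to $K$ itself. -/
theorem gFun_add (n : ℕ) (ζ : ℂ) (k : ℤ) :
    gFun n (ζ + k * (2 * Real.pi * I)) = gFun n ζ + k * (2 * Real.pi * I) := by
  rw [gFun, zOf_add, gFun]; ring

theorem sq_sub_one_ne_zero {z : ℂ} (hz : 0 ≤ z.re) (h1 : z ≠ 1) : z ^ 2 - 1 ≠ 0 := by
  rw [show z ^ 2 - 1 = (z - 1) * (z + 1) by ring]
  exact mul_ne_zero (sub_ne_zero.2 h1) (add_one_ne_zero hz)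

theorem kFun_ne_zero (n : ℕ) {z : ℂ} (hz : 0 ≤ z.re) (h1 : z ≠ 1) : kFun n z ≠ 0 :=
  mul_ne_zero (sq_sub_one_ne_zero hz h1) (exp_ne_zero _)

theorem kFun_one (n : ℕ) : kFun n 1 = 0 := by simp [kFun]

theorem gFun_injOn {n : ℕ} (hn : 2 ≤ n) {ζ₁ ζ₂ : ℂ} (h1 : ζ₁.re < 0) (h2 : ζ₂.re < 0)
    (h : gFun n ζ₁ = gFun n ζ₂) : ζ₁ = ζ₂ := by
  by_contra hne
  have := gFun_mono hn h1 h2 hne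
  simp [h] at this

/-- If $K$ takes the same value twice, the two values of `gFun` differ by a multiple of $2\pi i$;
this multiple can be absorbed into the argument of `gFun` without changing the point $z$. The point
$1$, the only zero of $K$, has no logarithmic coordinate and is treated apart. -/
theorem kFun_injOn {n : ℕ} (hn : 2 ≤ n) : InjOn (kFun n) rightHalf := by
  intro z hz w hw h
  have hz' : 0 < z.re := hz
  have hw' : 0 < w.re := hw
  by_cases hz1 : z = 1
  · by_contra hne
    rw [hz1, kFun_one] at h
    exact kFun_ne_zero n hw'.le (fun h' => hne (hz1.trans h'.symm)) h.symm
  by_cases hw1 : w = 1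
  · rw [hw1, kFun_one] at h
    exact absurd h (kFun_ne_zero n hz'.le hz1)
  have h1 := log_mob_re hz' hz1
  have h2 := log_mob_re hw' hw1
  have e : exp (gFun n (log (mob z))) = exp (gFun n (log (mob w))) := by
    rw [exp_gFun n h1, exp_gFun n h2, zOf_log_mob hz' hz1, zOf_log_mob hw' hw1, h]
  obtain ⟨k, hk⟩ := exp_eq_exp_iff_exists_int.1 e
  rw [← gFun_add] at hk
  have h3 := gFun_injOn hn h1 (by simpa using h2) hk
  rw [← zOf_log_mob hz' hz1, h3, zOf_add, zOf_log_mob hw' hw1]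

theorem hasDerivAt_kFun {n : ℕ} (hn : 2 ≤ n) {z : ℂ} (hz : 0 < z.re) :
    HasDerivAt (kFun n) ((4 / n) * exp ((2 / n) * log (hInt n z)) / hInt n z) z := by
  have h := ((hasDerivAt_pow 2 z).sub_const 1).fun_mul
    (((hasDerivAt_log_hInt (n := n) hz).const_mul (2 / n : ℂ)).cexp)
  refine h.congr_deriv ?_
  have hH := hInt_deriv_eq (n := n) (by omega) hz
  have h0 := hInt_ne_zero n hz
  have hn0 : (n : ℂ) ≠ 0 := by exact_mod_cast (by omega : n ≠ 0)
  generalize exp ((2 / n) * log (hInt n z)) = e at *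
  generalize hInt n z = a at *
  generalize deriv (hInt n) z = b at *
  field_simp
  push_cast
  linear_combination 2 * e * hH

theorem kFun_deriv_ne_zero {n : ℕ} (hn : 2 ≤ n) {z : ℂ} (hz : 0 < z.re) :
    (4 / n : ℂ) * exp ((2 / n) * log (hInt n z)) / hInt n z ≠ 0 := by
  have h0 := hInt_ne_zero n hz
  have hn0 : (n : ℂ) ≠ 0 := by exact_mod_cast (by omega : n ≠ 0)
  exact div_ne_zero (mul_ne_zero (div_ne_zero (by norm_num) hn0) (exp_ne_zero _)) h0

theorem lFun_eq_gFun (n : ℕ) {z : ℂ} (hz : 0 < z.re) (h1 : z ≠ 1) :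
    lFun n z = gFun n (log (mob z)) := by
  rw [lFun, gFun, zOf_log_mob hz h1]

theorem exp_lFun (n : ℕ) {z : ℂ} (hz : 0 < z.re) (h1 : z ≠ 1) : exp (lFun n z) = kFun n z := by
  rw [lFun_eq_gFun n hz h1, exp_gFun n (log_mob_re hz h1), zOf_log_mob hz h1]

theorem mob_im {z : ℂ} : (mob z).im = 2 * z.im / normSq (z + 1) := by
  rw [mob, div_im, ← sub_div]
  congr 1
  simp
  ring

theorem mob_im_pos {z : ℂ} (hz : 0 < z.re) (hi : 0 < z.im) : 0 < (mob z).im := by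
  rw [mob_im]
  have := normSq_pos.2 (add_one_ne_zero hz.le)
  positivity

theorem ne_one_of_im {z : ℂ} (h : z.im ≠ 0) : z ≠ 1 := by rintro rfl; simp at h

theorem arg_mem_of_im_pos {u : ℂ} (h : 0 < u.im) : 0 < u.arg ∧ u.arg < Real.pi := by
  refine ⟨lt_of_le_of_ne (arg_nonneg_iff.2 h.le) fun h' => ?_,
    lt_of_le_of_ne (arg_le_pi u) fun h' => ?_⟩
  · rw [eq_comm, arg_eq_zero_iff] at h'
    linarith [h'.2]
  · rw [arg_eq_pi_iff] at h'
    linarith [h'.2]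

theorem hInt_im_eq_zero (n : ℕ) {z : ℂ} (hz : 0 < z.re) (hi : z.im = 0) : (hInt n z).im = 0 := by
  have := hInt_conj n hz
  rw [conj_eq_iff_im.2 hi] at this
  exact conj_eq_iff_im.1 this.symm

theorem log_im_eq_zero {u : ℂ} (h : 0 < u.re) (h' : u.im = 0) : (log u).im = 0 := by
  rw [log_im, arg_eq_zero_iff]; exact ⟨h.le, h'⟩

theorem two_div_mul_im (n : ℕ) (w : ℂ) : ((2 / n : ℂ) * w).im = 2 / n * w.im := by
  rw [show (2 / n : ℂ) = ((2 / n : ℝ) : ℂ) by push_cast; rfl, im_ofReal_mul]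

theorem two_mul_im (w : ℂ) : ((2 : ℂ) * w).im = 2 * w.im := by
  rw [← ofReal_ofNat, im_ofReal_mul]

theorem gFun_im_of_real (n : ℕ) {ζ : ℂ} (h : ζ.re < 0) (hi : (zOf ζ).im = 0) :
    (gFun n ζ).im = ζ.im := by
  have hz := zOf_re_pos h
  rw [gFun, add_im, add_im, two_div_mul_im, two_mul_im,
    log_im_eq_zero (hInt_re_pos n hz) (hInt_im_eq_zero n hz hi),
    log_im_eq_zero (by simp; linarith) (by simpa using hi)]
  simp

theorem lFun_im_of_real (n : ℕ) {z : ℂ} (hz : 0 < z.re) (h1 : z ≠ 1) (hi : z.im = 0) :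
    (lFun n z).im = (mob z).arg := by
  rw [lFun_eq_gFun n hz h1, gFun_im_of_real n (log_mob_re hz h1) (by rwa [zOf_log_mob hz h1]),
    log_im]

/-- On the lines $\operatorname{Im}\zeta=0$ and $\operatorname{Im}\zeta=\pi$ the point $z$ is real
and `gFun` preserves imaginary parts. Monotonicity of `gFun` in the vertical direction compares
$\zeta$ with the points of these two lines that have the same real part. -/
theorem lFun_im_pos {n : ℕ} (hn : 2 ≤ n) {z : ℂ} (hz : 0 < z.re) (hi : 0 < z.im) :
    0 < (lFun n z).im ∧ (lFun n z).im < Real.pi := by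
  have h1 := ne_one_of_im hi.ne'
  have hr := log_mob_re hz h1
  obtain ⟨ha, ha'⟩ := arg_mem_of_im_pos (mob_im_pos hz hi)
  rw [lFun_eq_gFun n hz h1]
  rw [← log_im] at ha ha'
  set ζ := log (mob z)
  have hreal : ∀ k : ℝ, exp ((k : ℂ) * I) = 1 ∨ exp ((k : ℂ) * I) = -1 →
      (gFun n (ζ.re + k * I)).im = k := by
    intro k hk
    have hre : ((ζ.re : ℂ) + k * I).re < 0 := by simpa using hr
    rw [gFun_im_of_real n hre]
    · simp
    · have : exp ((ζ.re : ℂ) + k * I) = (Real.exp ζ.re : ℂ) ∨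
          exp ((ζ.re : ℂ) + k * I) = ((-Real.exp ζ.re : ℝ) : ℂ) := by
        rw [exp_add]
        rcases hk with h | h <;> rw [h] <;> simp
      rw [zOf]
      rcases this with h | h <;> rw [h, ← ofReal_one, ← ofReal_add, ← ofReal_sub, ← ofReal_div,
        ofReal_im]
  have hcmp : ∀ k : ℝ, ζ.im ≠ k → 0 < ((gFun n ζ).im - (gFun n (ζ.re + k * I)).im) * (ζ.im - k) := by
    intro k hk
    have hre : ((ζ.re : ℂ) + k * I).re < 0 := by simpa using hr
    have h := gFun_mono hn hre hr (by intro h; apply hk; rw [← h]; simp)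
    have e : ζ - (ζ.re + k * I) = ((ζ.im - k : ℝ) : ℂ) * I := by
      apply Complex.ext <;> simp
    rw [e, map_mul, conj_ofReal, conj_I] at h
    convert h using 1
    simp
  constructor
  · have := hcmp 0 ha.ne'
    rw [hreal 0 (by simp)] at this
    nlinarith
  · have := hcmp Real.pi ha'.ne
    rw [hreal Real.pi (by simp)] at this
    nlinarith

/-- In the first quadrant $\arg\frac{z-1}{z+1}$ and $2\arg(z+1)$ both lie in $(0,\pi)$. Their sum
minus $\pi$ lies in $(-\pi,\pi)$, so it is the principal argument of $1-z^2=-(z^2-1)$. -/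
theorem lFun_sub_pi (n : ℕ) {z : ℂ} (hz : 0 < z.re) (hi : 0 < z.im) :
    lFun n z - Real.pi * I = log (1 - z ^ 2) + (2 / n) * log (hInt n z) := by
  have h1 := ne_one_of_im hi.ne'
  obtain ⟨ha, ha'⟩ := arg_mem_of_im_pos (mob_im_pos hz hi)
  have hb : 0 < (z + 1).arg := (arg_mem_of_im_pos (by simpa using hi)).1
  have hb' : (z + 1).arg < Real.pi / 2 :=
    (abs_lt.1 (abs_arg_lt_pi_div_two_iff.2 (Or.inl (by simp; linarith)))).2
  have hw : log (mob z) + 2 * log (z + 1) - Real.pi * I = log (1 - z ^ 2) := by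
    have him : (log (mob z) + 2 * log (z + 1) - Real.pi * I).im =
        (mob z).arg + 2 * (z + 1).arg - Real.pi := by
      rw [sub_im, add_im, two_mul_im, log_im, log_im]; simp
    rw [← log_exp (x := log (mob z) + 2 * log (z + 1) - Real.pi * I) (by rw [him]; linarith)
      (by rw [him]; linarith), exp_sub, exp_add, exp_log (mob_ne_zero hz.le h1),
      exp_two_mul_log (add_one_ne_zero hz.le), exp_pi_mul_I, mob]
    congr 1
    have := add_one_ne_zero hz.le
    field_simp
    ring
  rw [lFun, ← hw]; ring

theorem csqrt_pow (n : ℕ) (u : ℂ) : csqrt u ^ n = exp ((n / 2) * log u) := by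
  rw [csqrt, ← exp_nat_mul]; congr 1; ring

/-- This is the bridge between the two primitives: the one based at $1$, through $K$, and the one
based at $0$, which continues across the imaginary axis. -/
theorem exp_lFun_sub {n : ℕ} (hn : 2 ≤ n) {z : ℂ} (hz : 0 < z.re) (hi : 0 < z.im) :
    exp ((n / 2) * (lFun n z - Real.pi * I)) = 2 * (aConst n - fInt n z) := by
  have hn0 : (n : ℂ) ≠ 0 := by exact_mod_cast (by omega : n ≠ 0)
  rw [lFun_sub_pi n hz hi, ← hInt_eq hn hz (mem_slitDom_of_im hi.ne'), csqrt_pow,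
    mul_add, exp_add, ← mul_assoc, show (n / 2 : ℂ) * (2 / n) = 1 by field_simp, one_mul,
    exp_log (hInt_ne_zero n hz)]

theorem kFun_conj (n : ℕ) {z : ℂ} (hz : 0 < z.re) : kFun n (conj z) = conj (kFun n z) := by
  have hs := (mem_slitPlane_iff_arg.1 (slitPlane_of_re_pos (hInt_re_pos n hz))).1
  simp only [kFun, hInt_conj n hz, log_conj _ hs, map_mul, map_sub, map_pow, map_one,
    ← exp_conj, map_div₀, map_ofNat, map_natCast]

/-- The right half-plane slit along `(0, 1]`. -/
def cutHalf : Set ℂ := {z | 0 < z.re ∧ (z.im ≠ 0 ∨ 1 < z.re)}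

theorem mob_mem_slitPlane {z : ℂ} (hz : z ∈ cutHalf) : mob z ∈ slitPlane := by
  rw [mem_slitPlane_iff]
  rcases eq_or_ne z.im 0 with h | h
  · left
    have h1 : 1 < z.re := hz.2.resolve_left (by simpa using h)
    have : z = (z.re : ℂ) := by apply Complex.ext <;> simp [h]
    rw [mob, this, ← ofReal_one, ← ofReal_add, ← ofReal_sub, ← ofReal_div, ofReal_re]
    apply div_pos <;> linarith
  · right
    rw [mob_im]
    have := normSq_pos.2 (add_one_ne_zero hz.1.le)
    positivity

theorem ne_one_of_mem_cutHalf {z : ℂ} (hz : z ∈ cutHalf) : z ≠ 1 := by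
  rintro rfl
  have := hz.2
  simp at this

theorem isOpen_cutHalf : IsOpen cutHalf :=
  (isOpen_lt continuous_const continuous_re).inter
    ((isOpen_ne_fun continuous_im continuous_const).union
      (isOpen_lt continuous_const continuous_re))

theorem conj_mem_cutHalf {z : ℂ} (hz : z ∈ cutHalf) : conj z ∈ cutHalf := by
  simpa [cutHalf] using hz

theorem lFun_conj (n : ℕ) {z : ℂ} (hz : z ∈ cutHalf) : lFun n (conj z) = conj (lFun n z) := by
  have h1 := (mem_slitPlane_iff_arg.1 (slitPlane_of_re_pos (hInt_re_pos n hz.1))).1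
  have h2 := (mem_slitPlane_iff_arg.1 (add_one_mem_slitPlane hz.1.le)).1
  have h3 := (mem_slitPlane_iff_arg.1 (mob_mem_slitPlane hz)).1
  have e1 : conj z + 1 = conj (z + 1) := by simp
  have e2 : mob (conj z) = conj (mob z) := by simp [mob]
  rw [lFun, lFun, hInt_conj n hz.1, e1, e2, log_conj _ h1, log_conj _ h2, log_conj _ h3]
  simp only [map_add, map_mul, map_div₀, map_ofNat, map_natCast]

theorem abs_lFun_im_lt {n : ℕ} (hn : 2 ≤ n) {z : ℂ} (hz : z ∈ cutHalf) :
    |(lFun n z).im| < Real.pi := by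
  rcases lt_trichotomy z.im 0 with h | h | h
  · have := lFun_im_pos hn (z := conj z) (by simpa using hz.1) (by simpa using h)
    rw [lFun_conj n hz, conj_im] at this
    rw [abs_lt]; constructor <;> linarith
  · rw [lFun_im_of_real n hz.1 (ne_one_of_mem_cutHalf hz) h, abs_lt]
    exact ⟨neg_pi_lt_arg _, lt_of_le_of_ne (arg_le_pi _)
      (mem_slitPlane_iff_arg.1 (mob_mem_slitPlane hz)).1⟩
  · have := lFun_im_pos hn hz.1 h
    rw [abs_lt]; constructor <;> linarith [Real.pi_pos]

theorem lFun_eq_log {n : ℕ} (hn : 2 ≤ n) {z : ℂ} (hz : z ∈ cutHalf) :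
    lFun n z = log (kFun n z) := by
  have := abs_lt.1 (abs_lFun_im_lt hn hz)
  rw [← exp_lFun n hz.1 (ne_one_of_mem_cutHalf hz), log_exp this.1 this.2.le]

theorem mob_arg_eq_pi {z : ℂ} (hz : 0 < z.re) (hi : z.im = 0) (h1 : z.re < 1) :
    (mob z).arg = Real.pi := by
  rw [arg_eq_pi_iff]
  have : z = (z.re : ℂ) := by apply Complex.ext <;> simp [hi]
  rw [mob, this, ← ofReal_one, ← ofReal_add, ← ofReal_sub, ← ofReal_div, ofReal_re, ofReal_im]
  exact ⟨div_neg_of_neg_of_pos (by linarith) (by linarith), rfl⟩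

/-- On the segment `(0, 1)` the function `K` is negative. -/
theorem kFun_of_lt_one (n : ℕ) {z : ℂ} (hz : 0 < z.re) (hi : z.im = 0) (h1 : z.re < 1) :
    (kFun n z).arg = Real.pi := by
  have hne : z ≠ 1 := by rintro rfl; simp at h1
  have him := lFun_im_of_real n hz hne hi
  rw [mob_arg_eq_pi hz hi h1] at him
  rw [← exp_lFun n hz hne, ← log_im, log_exp (by rw [him]; linarith [Real.pi_pos]) him.le, him]

theorem kFun_arg_of_mem_cutHalf {n : ℕ} (hn : 2 ≤ n) {z : ℂ} (hz : z ∈ cutHalf) :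
    (kFun n z).arg = (lFun n z).im := by
  rw [lFun_eq_log hn hz, log_im]

theorem mem_cutHalf_of_kFun {n : ℕ} {z : ℂ} (hz : 0 < z.re) (h0 : kFun n z ≠ 0)
    (h : (kFun n z).arg ≠ Real.pi) : z ∈ cutHalf := by
  refine ⟨hz, ?_⟩
  by_contra hcon
  push Not at hcon
  have h1 : z ≠ 1 := by rintro rfl; exact h0 (kFun_one n)
  refine h (kFun_of_lt_one n hz hcon.1 (lt_of_le_of_ne hcon.2 fun h' => h1 ?_))
  apply Complex.ext <;> simp [h', hcon.1]

theorem hasDerivAt_lFun {n : ℕ} (hn : 2 ≤ n) {z : ℂ} (hz : z ∈ cutHalf) :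
    HasDerivAt (lFun n) (4 / (n * hInt n z * (z ^ 2 - 1))) z := by
  have hz1 := add_one_ne_zero hz.1.le
  have h1 : HasDerivAt mob (2 / (z + 1) ^ 2) z := by
    refine (((hasDerivAt_id z).sub_const 1).fun_div ((hasDerivAt_id z).add_const 1) hz1).congr_deriv ?_
    simp only [id]
    field_simp
    ring
  refine (((h1.clog (mob_mem_slitPlane hz)).fun_add
    ((((hasDerivAt_id z).add_const 1).clog (add_one_mem_slitPlane hz.1.le)).const_mul 2)).fun_add
    ((hasDerivAt_log_hInt hz.1).const_mul (2 / n : ℂ))).congr_deriv ?_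
  have hH := hInt_deriv_eq (n := n) (by omega) hz.1
  have h0 := hInt_ne_zero n hz.1
  have hn0 : (n : ℂ) ≠ 0 := by exact_mod_cast (by omega : n ≠ 0)
  have hm := mob_ne_zero hz.1.le (ne_one_of_mem_cutHalf hz)
  have hq := sq_sub_one_ne_zero hz.1.le (ne_one_of_mem_cutHalf hz)
  have hz2 := sub_ne_zero.2 (ne_one_of_mem_cutHalf hz)
  rw [mob] at hm ⊢
  simp only [id]
  generalize hInt n z = a at *
  generalize deriv (hInt n) z = b at *
  field_simp
  linear_combination 2 * (z ^ 2 - 1) * hH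

theorem kFun_im_pos {n : ℕ} (hn : 2 ≤ n) {z : ℂ} (hz : 0 < z.re) (h : 0 < (kFun n z).im) :
    0 < z.im := by
  have h0 : kFun n z ≠ 0 := by intro h'; simp [h'] at h
  have harg := arg_mem_of_im_pos h
  have hc := mem_cutHalf_of_kFun hz h0 harg.2.ne
  rw [kFun_arg_of_mem_cutHalf hn hc] at harg
  rcases lt_trichotomy z.im 0 with h' | h' | h'
  · have := lFun_im_pos hn (z := conj z) (by simpa using hz) (by simpa using h')
    rw [lFun_conj n hc, conj_im] at this
    linarith
  · have h1 := kFun_conj n hz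
    rw [conj_eq_iff_im.2 h'] at h1
    have := conj_eq_iff_im.1 h1.symm
    linarith
  · exact h'

/-! ### Behaviour at infinity -/

/-- The extra factor $M$ on the left avoids both the exponent $m-1$ and a division by $M$. -/
theorem norm_pow_sub_pow_mul_le {a b : ℂ} {M : ℝ} (ha : ‖a‖ ≤ M) (hb : ‖b‖ ≤ M) (m : ℕ) :
    ‖a ^ m - b ^ m‖ * M ≤ m * M ^ m * ‖a - b‖ := by
  have hM : 0 ≤ M := (norm_nonneg a).trans ha
  induction m with
  | zero => simp
  | succ m ih =>
    have e : a ^ (m + 1) - b ^ (m + 1) = a ^ m * (a - b) + (a ^ m - b ^ m) * b := by ring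
    have h1 : ‖a ^ m * (a - b)‖ ≤ M ^ m * ‖a - b‖ := by
      rw [norm_mul, norm_pow]; gcongr
    have h2 : ‖(a ^ m - b ^ m) * b‖ ≤ ‖a ^ m - b ^ m‖ * M := by
      rw [norm_mul]; gcongr
    rw [e]
    calc _ ≤ (M ^ m * ‖a - b‖ + m * M ^ m * ‖a - b‖) * M := by
          gcongr
          exact (norm_add_le _ _).trans (add_le_add h1 (h2.trans ih))
      _ = _ := by push_cast; ring

/-- Two numbers of the right half-plane whose squares do not lie on strictly opposite sides of the
real axis lie in a common closed quadrant, so the angle between them is at most $\pi/2$. -/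
theorem re_mul_conj_nonneg_of_sq {a b : ℂ} (ha : 0 < a.re) (hb : 0 < b.re)
    (h : 0 ≤ (a ^ 2).im * (b ^ 2).im) : 0 ≤ (a * conj b).re := by
  have e : (a ^ 2).im * (b ^ 2).im = 4 * (a.re * b.re) * (a.im * b.im) := by
    simp [sq]; ring
  rw [e] at h
  have h1 : 0 ≤ a.im * b.im := nonneg_of_mul_nonneg_right h (by positivity)
  have h2 := mul_pos ha hb
  simp
  linarith

theorem norm_sub_le_norm_add {a b : ℂ} (h : 0 ≤ (a * conj b).re) : ‖a - b‖ ≤ ‖a + b‖ := by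
  refine le_of_sq_le_sq ?_ (norm_nonneg _)
  rw [Complex.sq_norm, Complex.sq_norm, normSq_sub, normSq_add]
  linarith

theorem norm_le_norm_add {a b : ℂ} (h : 0 ≤ (a * conj b).re) : ‖b‖ ≤ ‖a + b‖ := by
  refine le_of_sq_le_sq ?_ (norm_nonneg _)
  rw [Complex.sq_norm, Complex.sq_norm, normSq_add]
  nlinarith [normSq_nonneg a]

/-- Let $\sigma$ be the root and $\tau=-itz$. They lie in a common closed quadrant and
$(\sigma-\tau)(\sigma+\tau)=1$. From $|\sigma-\tau|\le|\sigma+\tau|$ comes the bound $1$, from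
$|\tau|\le|\sigma+\tau|$ the bound $1/(t|z|)$. The geometric mean of the two bounds is kept because
it is integrable at $t=0$. -/
theorem norm_csqrt_sub_le {z : ℂ} (hz : 0 < z.im) {t : ℝ} (ht : t ∈ Ioc (0 : ℝ) 1) :
    ‖csqrt (1 - (t : ℂ) ^ 2 * z ^ 2) - t * (-I * z)‖ ≤ 1 ∧
    ‖csqrt (1 - (t : ℂ) ^ 2 * z ^ 2) - t * (-I * z)‖ ≤ (√(t * ‖z‖))⁻¹ := by
  have hm := one_sub_mem_slitPlane (mem_slitDom_of_im hz.ne') ⟨ht.1.le, ht.2⟩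
  have hsq := csqrt_sq (slitPlane_ne_zero hm)
  have hre := csqrt_re_pos hm
  set σ := csqrt (1 - (t : ℂ) ^ 2 * z ^ 2)
  have hz0 : 0 < ‖z‖ := norm_pos_iff.2 (by rintro rfl; simp at hz)
  have hb : ((t : ℂ) * (-I * z)).re = t * z.im := by simp
  have hbsq : ((t : ℂ) * (-I * z)) ^ 2 = -((t : ℂ) ^ 2 * z ^ 2) := by
    rw [mul_pow, mul_pow, neg_sq, I_sq]; ring
  have hnn : 0 ≤ (σ * conj ((t : ℂ) * (-I * z))).re := by
    refine re_mul_conj_nonneg_of_sq hre (by rw [hb]; exact mul_pos ht.1 hz) ?_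
    rw [hsq, hbsq]
    simp only [sub_im, one_im, neg_im]
    nlinarith [sq_nonneg ((t : ℂ) ^ 2 * z ^ 2).im]
  have h1 := norm_sub_le_norm_add hnn
  have h2 := norm_le_norm_add hnn
  have hbn : ‖(t : ℂ) * (-I * z)‖ = t * ‖z‖ := by
    simp [abs_of_pos ht.1]
  rw [hbn] at h2
  have hprod : ‖σ - t * (-I * z)‖ * ‖σ + t * (-I * z)‖ = 1 := by
    rw [← norm_mul]
    have : (σ - t * (-I * z)) * (σ + t * (-I * z)) = 1 := by
      linear_combination hsq - hbsq
    rw [this, norm_one]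
  set d := ‖σ - t * (-I * z)‖
  have hd : 0 ≤ d := norm_nonneg _
  have hx : 0 < t * ‖z‖ := mul_pos ht.1 hz0
  have hd1 : d ≤ 1 := by nlinarith
  refine ⟨hd1, ?_⟩
  rw [le_inv_comm₀ (by by_contra h; have : d = 0 := le_antisymm (not_lt.1 h) hd; rw [this] at hprod; simp at hprod) (by positivity)]
  have hd0 : 0 < d := by
    by_contra h; have : d = 0 := le_antisymm (not_lt.1 h) hd; rw [this] at hprod; simp at hprod
  rw [Real.sqrt_le_left (by positivity), inv_pow, le_inv_comm₀ hx (by positivity)]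
  have h4 : d * (t * ‖z‖) ≤ 1 := by nlinarith
  rw [le_inv_comm₀ (by positivity) hx, ← one_div, le_div_iff₀ (by positivity)]
  nlinarith

/-- The main term is the integral of $z(-itz)^{n-2}$. The error in the integrand is controlled by
`norm_csqrt_sub_le` and is at most a constant times $|z|^{n-2}|z|^{-1/2}t^{-1/2}$, where $t^{-1/2}$
has integral $2$. -/
theorem norm_fInt_sub_le {n : ℕ} (hn : 2 ≤ n) {z : ℂ} (hz : 0 < z.im) (h1 : 1 ≤ ‖z‖) :
    ‖fInt n z - (-I) ^ (n - 2) * z ^ (n - 1) / (n - 1)‖ ≤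
      n * 2 ^ n * (‖z‖ ^ (n - 2) / √‖z‖) := by
  obtain ⟨m, rfl⟩ := Nat.exists_eq_add_of_le' hn
  simp only [Nat.add_sub_cancel, show m + 2 - 1 = m + 1 from rfl]
  have hz0 : 0 < ‖z‖ := by linarith
  have hmain : (-I) ^ m * z ^ (m + 1) / (((m + 2 : ℕ) : ℂ) - 1) =
      ∫ t in (0 : ℝ)..1, z * ((t : ℂ) * (-I * z)) ^ m := by
    have e : ∀ t : ℝ, z * ((t : ℂ) * (-I * z)) ^ m = (-I) ^ m * z ^ (m + 1) * ((t ^ m : ℝ) : ℂ) := by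
      intro t; push_cast; rw [mul_pow, mul_pow]; ring
    simp only [e]
    rw [intervalIntegral.integral_const_mul, intervalIntegral.integral_ofReal, integral_pow]
    push_cast
    simp
    rw [div_eq_mul_inv]
    congr 2
    ring
  have c1 : ContinuousOn (fun t : ℝ => csqrt (1 - (t : ℂ) ^ 2 * z ^ 2)) (Icc 0 1) :=
    continuousOn_fInt_base.comp (f := fun t : ℝ => (z, t)) (by fun_prop)
      fun t ht => ⟨mem_slitDom_of_im hz.ne', ht⟩
  rw [hmain, fInt, Nat.add_sub_cancel, ← intervalIntegral.integral_sub]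
  rotate_left
  · apply ContinuousOn.intervalIntegrable
    rw [uIcc_of_le zero_le_one]
    exact continuousOn_const.mul (c1.pow m)
  · apply Continuous.intervalIntegrable
    fun_prop
  have hb : ∀ t ∈ Ioc (0 : ℝ) 1, ‖z * csqrt (1 - (t : ℂ) ^ 2 * z ^ 2) ^ m -
      z * ((t : ℂ) * (-I * z)) ^ m‖ ≤ (m * 2 ^ m * ‖z‖ ^ m * (√‖z‖)⁻¹) * t ^ (-(1 / 2) : ℝ) := by
    intro t ht
    obtain ⟨ha, hb⟩ := norm_csqrt_sub_le hz ht
    have hbn : ‖(t : ℂ) * (-I * z)‖ = t * ‖z‖ := by simp [abs_of_pos ht.1]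
    set σ := csqrt (1 - (t : ℂ) ^ 2 * z ^ 2)
    have hB : ‖(t : ℂ) * (-I * z)‖ ≤ 2 * ‖z‖ := by rw [hbn]; nlinarith [ht.2]
    have hA : ‖σ‖ ≤ 2 * ‖z‖ := by
      have : σ = (σ - t * (-I * z)) + t * (-I * z) := by ring
      rw [this]
      refine (norm_add_le _ _).trans ?_
      rw [hbn]
      nlinarith [ht.2]
    have hp := norm_pow_sub_pow_mul_le hA hB m
    rw [← mul_sub, norm_mul]
    have e1 : t ^ (-(1 / 2) : ℝ) = (√t)⁻¹ := by
      rw [Real.rpow_neg ht.1.le, Real.sqrt_eq_rpow]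
    rw [Real.sqrt_mul ht.1.le, mul_inv] at hb
    rw [e1]
    have h0 : 0 ≤ ‖σ ^ m - (t * (-I * z)) ^ m‖ := norm_nonneg _
    calc ‖z‖ * ‖σ ^ m - (t * (-I * z)) ^ m‖ ≤ ‖σ ^ m - (t * (-I * z)) ^ m‖ * (2 * ‖z‖) := by
          nlinarith
      _ ≤ _ := hp
      _ ≤ m * (2 * ‖z‖) ^ m * ((√t)⁻¹ * (√‖z‖)⁻¹) := by gcongr
      _ = _ := by rw [mul_pow]; ring
  have hi : IntervalIntegrable (fun t : ℝ => (m * 2 ^ m * ‖z‖ ^ m * (√‖z‖)⁻¹) *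
      t ^ (-(1 / 2) : ℝ)) MeasureTheory.volume 0 1 :=
    (intervalIntegral.intervalIntegrable_rpow' (by norm_num)).const_mul _
  refine (intervalIntegral.norm_integral_le_of_norm_le zero_le_one
    (Eventually.of_forall hb) hi).trans ?_
  rw [intervalIntegral.integral_const_mul, integral_rpow (Or.inl (by norm_num))]
  have e2 : ((1:ℝ) ^ (-(1 / 2) + 1 : ℝ) - 0 ^ (-(1 / 2) + 1 : ℝ)) / (-(1 / 2) + 1) = 2 := by
    rw [Real.one_rpow, Real.zero_rpow (by norm_num)]; norm_num
  rw [e2]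
  have h0 : 0 ≤ ‖z‖ ^ m * (√‖z‖)⁻¹ := by positivity
  have h3 : (m : ℝ) * 2 ^ m * 2 ≤ ((m + 2 : ℕ) : ℝ) * 2 ^ (m + 2) := by
    have : (0:ℝ) < 2 ^ m := by positivity
    have hm0 : (0:ℝ) ≤ m := Nat.cast_nonneg m
    push_cast
    rw [pow_add]
    nlinarith [mul_nonneg hm0 this.le]
  calc _ = (m * 2 ^ m * 2) * (‖z‖ ^ m * (√‖z‖)⁻¹) := by ring
    _ ≤ _ := by rw [div_eq_mul_inv]; gcongr

/-- The exponential of `asyFun n z` is the quotient of `K^{n/2}` by its leading term. -/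
def asyFun (n : ℕ) (z : ℂ) : ℂ := (n / 2) * lFun n z - (n - 1) * log z - Real.log (2 / (n - 1))

/-- A bound for the relative error in the expansion of `K^{n/2}` at infinity. -/
def asyErr (n : ℕ) (r : ℝ) : ℝ := (n - 1) * (aConst n / r ^ (n - 1) + n * 2 ^ n / (r * √r))

theorem mem_cutHalf_of_norm {z : ℂ} (hz : 0 < z.re) (h : 1 < ‖z‖) : z ∈ cutHalf := by
  refine ⟨hz, ?_⟩
  by_contra hcon
  push Not at hcon
  have e : z = (z.re : ℂ) := by apply Complex.ext <;> simp [hcon.1]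
  rw [e, norm_real, Real.norm_eq_abs, abs_of_pos hz] at h
  linarith [hcon.2]

theorem exp_lFun_asymp_of_im_pos {n : ℕ} (hn : 2 ≤ n) {z : ℂ} (hz : 0 < z.re) (hi : 0 < z.im)
    (h : 1 < ‖z‖) : ‖exp ((n / 2) * lFun n z) - 2 * z ^ (n - 1) / (n - 1)‖ ≤
      2 * (aConst n + n * 2 ^ n * (‖z‖ ^ (n - 2) / √‖z‖)) := by
  have h1 := exp_lFun_sub hn hz hi
  have h2 := norm_fInt_sub_le hn hi h.le
  have e1 : exp ((n / 2) * lFun n z) = exp ((n / 2) * (lFun n z - Real.pi * I)) * I ^ n := by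
    have : I ^ n = exp (n * (Real.pi / 2 * I)) := by
      rw [exp_nat_mul, exp_pi_div_two_mul_I]
    rw [this, ← exp_add]
    congr 1
    ring
  have e2 : I ^ n * (-I) ^ (n - 2) = -1 := by
    obtain ⟨m, rfl⟩ := Nat.exists_eq_add_of_le' hn
    rw [Nat.add_sub_cancel, pow_add, mul_right_comm, ← mul_pow, I_sq]
    simp
  have e3 : exp ((n / 2) * lFun n z) - 2 * z ^ (n - 1) / (n - 1) =
      I ^ n * (2 * (aConst n - (fInt n z - (-I) ^ (n - 2) * z ^ (n - 1) / (n - 1)))) := by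
    rw [e1, h1]
    linear_combination (-2 * z ^ (n - 1) / (n - 1)) * e2
  rw [e3, norm_mul, norm_pow, norm_I, one_pow, one_mul, norm_mul]
  simp only [Complex.norm_ofNat]
  gcongr
  refine (norm_sub_le _ _).trans (add_le_add ?_ h2)
  rw [norm_real, Real.norm_eq_abs, abs_of_pos (aConst_pos n)]

/-- The primitive $F$ has its cut on $[1,\infty)$, so the estimate is available only off the real
axis. The lower half is obtained by conjugation and real points as limits from above, `lFun` being
continuous there. -/
theorem exp_lFun_asymp {n : ℕ} (hn : 2 ≤ n) {z : ℂ} (hz : 0 < z.re) (h : 1 < ‖z‖) :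
    ‖exp ((n / 2) * lFun n z) - 2 * z ^ (n - 1) / (n - 1)‖ ≤
      2 * (aConst n + n * 2 ^ n * (‖z‖ ^ (n - 2) / √‖z‖)) := by
  rcases lt_trichotomy z.im 0 with hi | hi | hi
  · have h1 := exp_lFun_asymp_of_im_pos hn (z := conj z) (by simpa using hz) (by simpa using hi)
      (by simpa using h)
    rw [lFun_conj n (mem_cutHalf_of_norm hz h), norm_conj] at h1
    rw [← norm_conj (exp _ - _)]
    convert h1 using 2
    simp only [map_sub, ← exp_conj, map_mul, map_div₀, map_ofNat, map_natCast, map_pow, map_one]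
  · have hcont : Tendsto (fun t : ℝ => z + t * I) (𝓝[>] 0) (𝓝 z) := by
      have : Continuous fun t : ℝ => z + t * I := by fun_prop
      have h1 := this.tendsto 0
      simp only [ofReal_zero, zero_mul, add_zero] at h1
      exact h1.mono_left nhdsWithin_le_nhds
    have hL := (hasDerivAt_lFun hn (mem_cutHalf_of_norm hz h)).continuousAt
    have hn0 : ‖z‖ ≠ 0 := by linarith
    refine le_of_tendsto_of_tendsto (b := 𝓝[>] (0 : ℝ))
      (f := fun t : ℝ => ‖exp ((n / 2) * lFun n (z + t * I)) - 2 * (z + t * I) ^ (n - 1) / (n - 1)‖)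
      (g := fun t : ℝ => 2 * (aConst n + n * 2 ^ n * (‖z + t * I‖ ^ (n - 2) / √‖z + t * I‖)))
      ?_ ?_ ?_
    · refine Tendsto.norm (Tendsto.sub ((continuous_exp.tendsto _).comp
        ((hL.tendsto.comp hcont).const_mul _)) (((hcont.pow _).const_mul 2).div_const _))
    · exact ((((hcont.norm.pow _).div (hcont.norm.sqrt) (by positivity)).const_mul _).const_add
        _).const_mul 2
    · have h3 : ∀ᶠ t : ℝ in 𝓝[>] 0, 1 < ‖z + t * I‖ :=
        hcont.norm.eventually (lt_mem_nhds h)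
      filter_upwards [h3, self_mem_nhdsWithin] with t ht ht0
      exact exp_lFun_asymp_of_im_pos hn (by simpa using hz) (by simpa [hi] using ht0) ht
  · exact exp_lFun_asymp_of_im_pos hn hz hi h

theorem norm_exp_asyFun_sub_one_le {n : ℕ} (hn : 2 ≤ n) {z : ℂ} (hz : 0 < z.re) (h : 1 < ‖z‖) :
    ‖exp (asyFun n z) - 1‖ ≤ asyErr n ‖z‖ := by
  have h1 := exp_lFun_asymp hn hz h
  have hz0 : z ≠ 0 := by rintro rfl; simp at hz
  have hr : 0 < ‖z‖ := norm_pos_iff.2 hz0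
  have hn1 : (0:ℝ) < n - 1 := by
    have : (2:ℝ) ≤ n := by exact_mod_cast hn
    linarith
  have hn1' : ((n : ℂ) - 1) ≠ 0 := by
    have : (((n:ℝ) - 1 : ℝ) : ℂ) ≠ 0 := by exact_mod_cast hn1.ne'
    simpa using this
  have e : exp (asyFun n z) * (2 * z ^ (n - 1) / (n - 1)) = exp ((n / 2) * lFun n z) := by
    have e1 : exp ((n - 1) * log z) = z ^ (n - 1) := by
      have := exp_nat_mul (log z) (n - 1)
      rw [exp_log hz0, Nat.cast_sub (by omega)] at this
      exact_mod_cast this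
    have e2 : exp (Real.log (2 / (n - 1)) : ℂ) = 2 / (n - 1) := by
      rw [← ofReal_exp, Real.exp_log (by positivity)]; push_cast; rfl
    rw [asyFun, exp_sub, exp_sub, e1, e2]
    have := pow_ne_zero (n - 1) hz0
    field_simp
  have e3 : exp ((n / 2) * lFun n z) - 2 * z ^ (n - 1) / (n - 1) =
      (exp (asyFun n z) - 1) * (2 * z ^ (n - 1) / (n - 1)) := by rw [sub_mul, e, one_mul]
  have e4 : ‖(2 * z ^ (n - 1) / ((n : ℂ) - 1))‖ = 2 * ‖z‖ ^ (n - 1) / (n - 1) := by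
    rw [norm_div, norm_mul, norm_pow]
    congr 1
    · simp
    · rw [show ((n : ℂ) - 1) = (((n:ℝ) - 1 : ℝ) : ℂ) by push_cast; rfl, norm_real,
        Real.norm_eq_abs, abs_of_pos hn1]
  rw [e3, norm_mul, e4] at h1
  have hp : 0 < 2 * ‖z‖ ^ (n - 1) / ((n:ℝ) - 1) := by positivity
  rw [← le_div_iff₀ hp] at h1
  refine h1.trans (le_of_eq ?_)
  rw [asyErr]
  have hs : 0 < √‖z‖ := by positivity
  have hpow : ‖z‖ ^ (n - 1) = ‖z‖ ^ (n - 2) * ‖z‖ := by rw [← pow_succ]; congr 1; omega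
  rw [hpow]
  field_simp

theorem tendsto_asyErr {n : ℕ} (hn : 2 ≤ n) : Tendsto (asyErr n) atTop (𝓝 0) := by
  have h1 : Tendsto (fun r : ℝ => aConst n / r ^ (n - 1)) atTop (𝓝 0) :=
    (tendsto_pow_atTop (by omega)).const_div_atTop _
  have h2 : Tendsto (fun r : ℝ => n * 2 ^ n / (r * √r)) atTop (𝓝 0) :=
    (tendsto_id.atTop_mul_atTop₀ Real.tendsto_sqrt_atTop).const_div_atTop _
  have := (h1.add h2).const_mul ((n:ℝ) - 1)
  simp only [add_zero, mul_zero] at this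
  exact this

/-- The contribution of $F(1)$ to $r$ times the error is of order $r^{2-n}$. It tends to $0$ only
for $n\ge3$, which is why distances are not controlled when $n=2$. -/
theorem tendsto_mul_asyErr {n : ℕ} (hn : 3 ≤ n) :
    Tendsto (fun r => r * asyErr n r) atTop (𝓝 0) := by
  have h1 : Tendsto (fun r : ℝ => aConst n / r ^ (n - 2)) atTop (𝓝 0) :=
    (tendsto_pow_atTop (by omega)).const_div_atTop _
  have h2 : Tendsto (fun r : ℝ => n * 2 ^ n / √r) atTop (𝓝 0) :=
    Real.tendsto_sqrt_atTop.const_div_atTop _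
  have := (h1.add h2).const_mul ((n:ℝ) - 1)
  simp only [add_zero, mul_zero] at this
  refine this.congr' ?_
  filter_upwards [eventually_gt_atTop 0] with r hr
  have hpow : r ^ (n - 1) = r ^ (n - 2) * r := by rw [← pow_succ]; congr 1; omega
  rw [asyErr, hpow]
  field_simp

/-! ### The logarithm of $K$ at infinity. -/

theorem isPreconnected_far (B : ℝ) (hB : 0 ≤ B) :
    IsPreconnected {z : ℂ | 0 < z.re ∧ B < ‖z‖} := by
  have e : {z : ℂ | 0 < z.re ∧ B < ‖z‖} = (fun x : ℝ × ℝ => (x.1 : ℂ) * exp (x.2 * I)) ''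
      (Ioi B ×ˢ Ioo (-(Real.pi / 2)) (Real.pi / 2)) := by
    ext z
    constructor
    · rintro ⟨hz, hb⟩
      refine ⟨(‖z‖, z.arg), ⟨hb, abs_lt.1 (abs_arg_lt_pi_div_two_iff.2 (Or.inl hz))⟩, ?_⟩
      exact norm_mul_exp_arg_mul_I z
    · rintro ⟨⟨r, θ⟩, ⟨hr, hθ⟩, rfl⟩
      have hr' : B < r := hr
      have h0 : 0 < r := by linarith
      have hc := Real.cos_pos_of_mem_Ioo hθ
      refine ⟨?_, ?_⟩
      · simp only [re_ofReal_mul, exp_ofReal_mul_I_re]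
        positivity
      · simpa [norm_exp_ofReal_mul_I, abs_of_pos h0] using hr'
  rw [e]
  exact (isPreconnected_Ioi.prod isPreconnected_Ioo).image _ (by fun_prop)

/-- The expansion of `log K` at infinity. -/
theorem exists_norm_asyFun_le {n : ℕ} (hn : 2 ≤ n) : ∃ B : ℝ, 1 < B ∧
    ∀ z : ℂ, 0 < z.re → B < ‖z‖ → ‖asyFun n z‖ ≤ 2 * asyErr n ‖z‖ := by
  obtain ⟨B₀, hB₀⟩ := eventually_atTop.1
    ((tendsto_asyErr hn).eventually (gt_mem_nhds (show (0:ℝ) < 1 / 2 by norm_num)))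
  set B := max B₀ 2
  have hB : 1 < B := lt_of_lt_of_le (by norm_num) (le_max_right _ _)
  have hsmall : ∀ z : ℂ, 0 < z.re → B < ‖z‖ → ‖exp (asyFun n z) - 1‖ ≤ 1 / 2 :=
    fun z hz h => (norm_exp_asyFun_sub_one_le hn hz (hB.trans h)).trans
      (hB₀ _ ((le_max_left _ _).trans h.le)).le
  have hre : ∀ z : ℂ, 0 < z.re → B < ‖z‖ → 0 < (exp (asyFun n z)).re := by
    intro z hz h
    have h1 := (abs_le.1 (abs_re_le_norm (exp (asyFun n z) - 1))).1
    have h2 := hsmall z hz h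
    rw [sub_re, one_re] at h1
    linarith
  have hcont : ContinuousOn (fun z => (asyFun n z).im) {z : ℂ | 0 < z.re ∧ B < ‖z‖} := by
    rintro z ⟨hz, h⟩
    have h1 := (hasDerivAt_lFun hn (mem_cutHalf_of_norm hz (hB.trans h))).continuousAt
    have h2 := continuousAt_clog (slitPlane_of_re_pos hz)
    have : ContinuousAt (fun z => asyFun n z) z :=
      ((h1.const_mul _).sub (h2.const_mul _)).sub continuousAt_const
    exact (continuous_im.continuousAt.comp this).continuousWithinAt
  -- So far `asyFun` is known only as some logarithm of a number close to $1$. Its imaginary part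
  -- has an interval as range, never meets $\pm\pi/2$ because the exponential has positive real
  -- part, and vanishes at the real point $B+1$. So it stays in $(-\pi/2,\pi/2)$ and the logarithm
  -- is the principal one.
  have hpre := (isPreconnected_far B (by linarith)).image _ hcont
  have hmem : (0:ℝ) ∈ (fun z => (asyFun n z).im) '' {z : ℂ | 0 < z.re ∧ B < ‖z‖} := by
    refine ⟨((B + 1 : ℝ) : ℂ), ⟨by rw [ofReal_re]; linarith, ?_⟩, ?_⟩
    · rw [norm_real, Real.norm_eq_abs, abs_of_pos (by linarith)]; linarith
    · have hre1 : 1 < (((B + 1 : ℝ) : ℂ)).re := by rw [ofReal_re]; linarith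
      have h1 : (lFun n ((B + 1 : ℝ) : ℂ)).im = 0 := by
        rw [lFun_im_of_real n (by linarith) (by intro h; rw [h] at hre1; simp at hre1) (ofReal_im _)]
        rw [mob, ← ofReal_one, ← ofReal_add, ← ofReal_sub, ← ofReal_div, arg_ofReal_of_nonneg]
        apply div_nonneg <;> linarith
      have h2 : (log ((B + 1 : ℝ) : ℂ)).im = 0 := log_im_eq_zero (by linarith) (ofReal_im _)
      have e1 : (n / 2 : ℂ) = ((n / 2 : ℝ) : ℂ) := by push_cast; rfl
      have e2 : ((n : ℂ) - 1) = ((n - 1 : ℝ) : ℂ) := by push_cast; rfl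
      change (asyFun n _).im = 0
      rw [asyFun, sub_im, sub_im, e1, e2, im_ofReal_mul, im_ofReal_mul, h1, h2, ofReal_im]
      simp
  have havoid : ∀ z : ℂ, 0 < z.re → B < ‖z‖ → |(asyFun n z).im| < Real.pi / 2 := by
    intro z hz h
    by_contra hcon
    push Not at hcon
    have hz' : (asyFun n z).im ∈ (fun z => (asyFun n z).im) '' {z : ℂ | 0 < z.re ∧ B < ‖z‖} :=
      ⟨z, ⟨hz, h⟩, rfl⟩
    have hbad : ∀ x ∈ (fun z => (asyFun n z).im) '' {z : ℂ | 0 < z.re ∧ B < ‖z‖},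
        Real.cos x ≠ 0 := by
      rintro x ⟨w, ⟨hw, hwB⟩, rfl⟩ h0
      have h1 := hre w hw hwB
      rw [exp_re] at h1
      simp only at h0
      rw [h0] at h1
      simp at h1
    rcases le_abs.1 hcon with h1 | h1
    · exact hbad (Real.pi / 2) (hpre.ordConnected.out hmem hz' ⟨by positivity, h1⟩)
        Real.cos_pi_div_two
    · refine hbad (-(Real.pi / 2)) (hpre.ordConnected.out hz' hmem
        ⟨by linarith, by linarith [Real.pi_pos]⟩) ?_
      rw [Real.cos_neg, Real.cos_pi_div_two]
  refine ⟨B, hB, fun z hz h => ?_⟩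
  have h1 := abs_lt.1 (havoid z hz h)
  have h2 := norm_log_one_add_half_le_self (hsmall z hz h)
  rw [add_sub_cancel, log_exp (by linarith [Real.pi_pos]) (by linarith [Real.pi_pos])] at h2
  have h3 := norm_exp_asyFun_sub_one_le hn hz (hB.trans h)
  have := norm_nonneg (exp (asyFun n z) - 1)
  linarith

/-- Uniformly in the right half-plane $\log|K|$ is
$\frac2n\left((n-1)\log|z|+\log\frac2{n-1}\right)$ up to a bounded error; the term $-2$ in the
comparison function dominates that error. This is the properness needed to determine the image of
$K$. -/
theorem norm_kFun_tendsto {n : ℕ} (hn : 2 ≤ n) (M : ℝ) : ∃ B : ℝ, 1 < B ∧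
    ∀ z : ℂ, 0 < z.re → B < ‖z‖ → M < ‖kFun n z‖ := by
  obtain ⟨B, hB, h⟩ := exists_norm_asyFun_le hn
  obtain ⟨B₁, hB₁⟩ := eventually_atTop.1
    ((tendsto_asyErr hn).eventually (gt_mem_nhds (show (0:ℝ) < 1 by norm_num)))
  have hn1 : (0:ℝ) < n - 1 := by
    have : (2:ℝ) ≤ n := by exact_mod_cast hn
    linarith
  have hn0 : (0:ℝ) < n := by linarith
  have hlim : Tendsto (fun r : ℝ => 2 / n * ((n - 1) * Real.log r + Real.log (2 / (n - 1)) - 2))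
      atTop atTop := by
    refine Tendsto.const_mul_atTop (by positivity) ?_
    refine tendsto_atTop_add_const_right _ _ (tendsto_atTop_add_const_right _ _ ?_)
    exact Real.tendsto_log_atTop.const_mul_atTop hn1
  obtain ⟨B₂, hB₂⟩ := eventually_atTop.1 ((Real.tendsto_exp_atTop.comp hlim).eventually_gt_atTop M)
  refine ⟨max B (max B₁ B₂), lt_of_lt_of_le hB (le_max_left _ _), fun z hz hb => ?_⟩
  have hb0 : B < ‖z‖ := (le_max_left _ _).trans_lt hb
  have hb1 : B₁ ≤ ‖z‖ := ((le_max_left _ _).trans (le_max_right _ _)).trans hb.le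
  have hb2 : B₂ ≤ ‖z‖ := ((le_max_right _ _).trans (le_max_right _ _)).trans hb.le
  have h1 := h z hz hb0
  have h2 := hB₁ _ hb1
  refine (hB₂ _ hb2).trans_le ?_
  have hz1 : z ≠ 1 := by rintro rfl; simp at hb0; linarith
  rw [← exp_lFun n hz hz1, norm_exp, Function.comp]
  refine Real.exp_le_exp.2 ?_
  have h3 := (abs_le.1 ((abs_re_le_norm _).trans h1)).1
  have e1 : (n / 2 : ℂ) = ((n / 2 : ℝ) : ℂ) := by push_cast; rfl
  have e2 : ((n : ℂ) - 1) = ((n - 1 : ℝ) : ℂ) := by push_cast; rfl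
  rw [asyFun, sub_re, sub_re, e1, e2, re_ofReal_mul, re_ofReal_mul, ofReal_re, log_re] at h3
  rw [div_mul_eq_mul_div, div_le_iff₀ hn0]
  linarith

/-! ### Inverses of injective holomorphic functions -/

theorem map_nhds_of_hasDerivAt {f f' : ℂ → ℂ} {D : Set ℂ} (hD : IsOpen D)
    (hf : ∀ z ∈ D, HasDerivAt f (f' z) z) (h0 : ∀ z ∈ D, f' z ≠ 0) {z : ℂ} (hz : z ∈ D) :
    Filter.map f (𝓝 z) = 𝓝 (f z) := by
  have ha : AnalyticAt ℂ f z := DifferentiableOn.analyticAt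
    (fun w hw => (hf w hw).differentiableAt.differentiableWithinAt) (hD.mem_nhds hz)
  refine ha.hasStrictDerivAt.map_nhds_eq ?_
  rw [(hf z hz).deriv]
  exact h0 z hz

theorem isOpen_image_of_hasDerivAt {f f' : ℂ → ℂ} {D : Set ℂ} (hD : IsOpen D)
    (hf : ∀ z ∈ D, HasDerivAt f (f' z) z) (h0 : ∀ z ∈ D, f' z ≠ 0) : IsOpen (f '' D) := by
  rw [isOpen_iff_mem_nhds]
  rintro _ ⟨z, hz, rfl⟩
  rw [← map_nhds_of_hasDerivAt hD hf h0 hz]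
  exact image_mem_map (hD.mem_nhds hz)

/-- Continuity of the inverse comes from the fact that $f$ maps neighbourhoods of a point onto
neighbourhoods of its image; the derivative then follows from that of $f$. -/
theorem hasDerivAt_invFunOn {f f' : ℂ → ℂ} {D : Set ℂ} (hD : IsOpen D)
    (hf : ∀ z ∈ D, HasDerivAt f (f' z) z) (h0 : ∀ z ∈ D, f' z ≠ 0) (hi : InjOn f D) {w : ℂ}
    (hw : w ∈ f '' D) :
    HasDerivAt (Function.invFunOn f D) (f' (Function.invFunOn f D w))⁻¹ w := by
  obtain ⟨z, hz, rfl⟩ := hw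
  have hl := hi.leftInvOn_invFunOn
  have e : Function.invFunOn f D (f z) = z := hl hz
  rw [e]
  refine HasDerivAt.of_local_left_inverse (f := f) ?_ (by rw [e]; exact hf z hz) (h0 z hz) ?_
  · rw [ContinuousAt, e, ← map_nhds_of_hasDerivAt hD hf h0 hz, tendsto_map'_iff]
    refine tendsto_id.congr' ?_
    filter_upwards [hD.mem_nhds hz] with x hx
    exact (hl hx).symm
  · filter_upwards [(isOpen_image_of_hasDerivAt hD hf h0).mem_nhds ⟨z, hz, rfl⟩] with x hx
    exact Function.invFunOn_eq hx

/-! ### The image of `K` -/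

theorem isOpen_range_kFun {n : ℕ} (hn : 2 ≤ n) : IsOpen (kFun n '' rightHalf) :=
  isOpen_image_of_hasDerivAt isOpen_rightHalf (fun _ hz => hasDerivAt_kFun hn hz)
    (fun _ hz => kFun_deriv_ne_zero hn hz)

/-- Twice the value of `F(1) - F` at `iy`. -/
def omegaB (n : ℕ) (y : ℝ) : ℂ := 2 * (aConst n - tInt n y * I)

theorem omegaB_re (n : ℕ) (y : ℝ) : (omegaB n y).re = 2 * aConst n := by simp [omegaB]

theorem omegaB_re_pos (n : ℕ) (y : ℝ) : 0 < (omegaB n y).re := by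
  rw [omegaB_re]; linarith [aConst_pos n]

theorem omegaB_ne_zero (n : ℕ) (y : ℝ) : omegaB n y ≠ 0 := by
  intro h
  have := omegaB_re_pos n y
  simp [h] at this

/-- The boundary value of `H` at `iy`. -/
def hB (n : ℕ) (y : ℝ) : ℂ := (((√(1 + y ^ 2) ^ n)⁻¹ : ℝ) : ℂ) * omegaB n y

theorem hB_re_pos (n : ℕ) (y : ℝ) : 0 < (hB n y).re := by
  rw [hB, re_ofReal_mul]
  have := omegaB_re_pos n y
  positivity

/-- The boundary value of `K` at `iy`. -/
def kB (n : ℕ) (y : ℝ) : ℂ := -exp ((2 / n) * log (omegaB n y))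

/-- At $iy$ the factor $z^2-1=-(1+y^2)$ is cancelled, up to sign, by the positive scalar
$(1+y^2)^{-n/2}$ contained in `hB`, raised to the power $2/n$. -/
theorem kB_eq {n : ℕ} (hn : 2 ≤ n) (y : ℝ) :
    kB n y = ((y * I) ^ 2 - 1) * exp ((2 / n) * log (hB n y)) := by
  have hr : 0 < (√(1 + y ^ 2) ^ n)⁻¹ := by positivity
  have hn0 : (n : ℂ) ≠ 0 := by exact_mod_cast (by omega : n ≠ 0)
  have hn0' : (n : ℝ) ≠ 0 := by exact_mod_cast (by omega : n ≠ 0)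
  rw [hB, log_ofReal_mul hr (omegaB_ne_zero n y), mul_add, exp_add]
  have e : exp ((2 / n : ℂ) * (Real.log (√(1 + y ^ 2) ^ n)⁻¹ : ℝ)) = (((1 + y ^ 2)⁻¹ : ℝ) : ℂ) := by
    rw [show (2 / n : ℂ) = ((2 / n : ℝ) : ℂ) by push_cast; rfl, ← ofReal_mul, ← ofReal_exp]
    congr 1
    rw [Real.log_inv, Real.log_pow, Real.log_sqrt (by positivity)]
    rw [show 2 / (n:ℝ) * -(n * (Real.log (1 + y ^ 2) / 2)) = -Real.log (1 + y ^ 2) by field_simp,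
      Real.exp_neg, Real.exp_log (by positivity)]
  rw [e, kB, mul_pow, I_sq]
  have : ((1 + y ^ 2 : ℝ) : ℂ) ≠ 0 := by
    have : (0:ℝ) < 1 + y ^ 2 := by positivity
    exact_mod_cast this.ne'
  push_cast at this ⊢
  field_simp
  ring

/-- On the imaginary axis the integral defining $H$ degenerates, its root meeting the cut. The
identity `hInt_eq` replaces $H$ by $2(F(1)-F)/(1-z^2)^{n/2}$, which is continuous across the axis.
-/
theorem tendsto_hInt {n : ℕ} (hn : 2 ≤ n) (y : ℝ) :
    Tendsto (hInt n) (𝓝[rightHalf] (y * I)) (𝓝 (hB n y)) := by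
  have hs := I_mul_mem_slitDom y
  have e2 : 1 - ((y : ℂ) * I) ^ 2 = ((1 + y ^ 2 : ℝ) : ℂ) := by
    push_cast
    rw [mul_pow, I_sq]; ring
  have hq : csqrt (1 - ((y : ℂ) * I) ^ 2) = (√(1 + y ^ 2) : ℝ) := by
    rw [e2, csqrt_ofReal (by positivity)]
  have hc : ContinuousAt (fun z => (csqrt (1 - z ^ 2) ^ n)⁻¹ * (2 * (aConst n - fInt n z)))
      ((y : ℂ) * I) := by
    have h1 : ContinuousAt (fun z : ℂ => csqrt (1 - z ^ 2)) ((y : ℂ) * I) :=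
      ContinuousAt.comp (g := csqrt) (hasDerivAt_csqrt hs).continuousAt (by fun_prop)
    exact ((h1.pow n).inv₀ (pow_ne_zero _ (csqrt_ne_zero _))).mul
      ((continuousAt_const.sub (hasDerivAt_fInt n hs).continuousAt).const_mul 2)
  have e3 : (csqrt (1 - ((y : ℂ) * I) ^ 2) ^ n)⁻¹ * (2 * (aConst n - fInt n (y * I))) = hB n y := by
    rw [hq, fInt_I_mul, hB, omegaB]; push_cast; rfl
  have hc' := hc.tendsto
  rw [e3] at hc'
  refine (hc'.mono_left nhdsWithin_le_nhds).congr' ?_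
  filter_upwards [self_mem_nhdsWithin, nhdsWithin_le_nhds (isOpen_slitDom.mem_nhds hs)] with z hz hzs
  rw [← hInt_eq hn hz hzs, inv_mul_cancel_left₀ (pow_ne_zero _ (csqrt_ne_zero _))]

theorem tendsto_log_hInt {n : ℕ} (hn : 2 ≤ n) (y : ℝ) :
    Tendsto (fun z => log (hInt n z)) (𝓝[rightHalf] (y * I)) (𝓝 (log (hB n y))) :=
  (continuousAt_clog (slitPlane_of_re_pos (hB_re_pos n y))).tendsto.comp (tendsto_hInt hn y)

theorem tendsto_kFun {n : ℕ} (hn : 2 ≤ n) (y : ℝ) :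
    Tendsto (kFun n) (𝓝[rightHalf] (y * I)) (𝓝 (kB n y)) := by
  rw [kB_eq hn]
  have h1 : Tendsto (fun z : ℂ => z ^ 2 - 1) (𝓝[rightHalf] (y * I)) (𝓝 ((y * I) ^ 2 - 1)) :=
    (Continuous.tendsto (by fun_prop) _).mono_left nhdsWithin_le_nhds
  exact h1.mul ((continuous_exp.tendsto _).comp ((tendsto_log_hInt hn y).const_mul _))

/-- Suppose $K(z)=s\,K(iy)$ with $s>1$. Let $i\eta$ be the logarithmic coordinate of $iy$, and
choose a coordinate $\zeta$ of $z$ with $g(\zeta)=g(i\eta)+\log s$. The monotonicity inequality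
between $\zeta$ and points tending to $i\eta$ gives in the limit $\log
s\cdot\operatorname{Re}\zeta\ge0$, whereas $\operatorname{Re}\zeta<0$. -/
theorem kFun_ne_mul_kB {n : ℕ} (hn : 2 ≤ n) {z : ℂ} (hz : 0 < z.re) (y : ℝ) {s : ℝ} (hs : 1 < s) :
    kFun n z ≠ s * kB n y := by
  intro h
  have hs0 : 0 < s := by linarith
  have hne1 : (y : ℂ) * I ≠ 1 := by
    intro h'
    have := congrArg re h'
    simp at this
  have hyre : 0 ≤ ((y : ℂ) * I).re := by simp
  have hkB0 : kB n y ≠ 0 := neg_ne_zero.2 (exp_ne_zero _)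
  have hz1 : z ≠ 1 := by
    rintro rfl
    rw [kFun_one, eq_comm, mul_eq_zero] at h
    exact h.elim (by exact_mod_cast hs0.ne') hkB0
  -- a boundary point of the left half-plane over `iy`
  have hnorm : ‖mob (y * I)‖ = 1 := by
    rw [mob, norm_div]
    have : ‖(y : ℂ) * I - 1‖ = ‖(y : ℂ) * I + 1‖ := by
      rw [← sq_eq_sq₀ (norm_nonneg _) (norm_nonneg _), Complex.sq_norm, Complex.sq_norm,
        normSq_apply, normSq_apply]
      simp
    rw [this, div_self (norm_ne_zero_iff.2 (add_one_ne_zero hyre))]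
  set η : ℝ := (mob (y * I)).arg
  have hexp : exp (η * I) = mob (y * I) := by
    have := norm_mul_exp_arg_mul_I (mob (y * I))
    rwa [hnorm, ofReal_one, one_mul] at this
  have hzO : zOf (η * I) = y * I := zOf_mob (add_one_ne_zero hyre) hexp
  have hden : 1 - exp ((η : ℂ) * I) ≠ 0 := by
    rw [hexp, mob]
    have := add_one_ne_zero hyre
    intro h'
    field_simp at h'
    ring_nf at h'
    norm_num at h'
  set gB : ℂ := η * I + 2 * log (y * I + 1) + (2 / n) * log (hB n y)
  have hgB : exp gB = kB n y := by
    rw [exp_add, exp_add, exp_two_mul_log (add_one_ne_zero hyre), kB_eq hn]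
    congr 1
    rw [← hzO, ← zOf_sq_sub_one hden]
  have hpath : Tendsto (fun t : ℝ => (η : ℂ) * I - t) (𝓝[>] 0) (𝓝 (η * I)) := by
    have : Continuous fun t : ℝ => (η : ℂ) * I - t := by fun_prop
    have h1 := this.tendsto 0
    simp only [ofReal_zero, sub_zero] at h1
    exact h1.mono_left nhdsWithin_le_nhds
  have hpre : ∀ᶠ t : ℝ in 𝓝[>] 0, ((η : ℂ) * I - t).re < 0 := by
    filter_upwards [self_mem_nhdsWithin] with t ht
    have : 0 < t := ht
    simpa using this
  have hzpath : Tendsto (fun t : ℝ => zOf ((η : ℂ) * I - t)) (𝓝[>] 0) (𝓝[rightHalf] (y * I)) := by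
    refine tendsto_nhdsWithin_iff.2 ⟨?_, ?_⟩
    · have := (hasDerivAt_zOf hden).continuousAt.tendsto
      rw [hzO] at this
      exact this.comp hpath
    · filter_upwards [hpre] with t ht using zOf_re_pos ht
  have hgpath : Tendsto (fun t : ℝ => gFun n ((η : ℂ) * I - t)) (𝓝[>] 0) (𝓝 gB) := by
    have h1 : Tendsto (fun z : ℂ => log (z + 1)) (𝓝[rightHalf] (y * I)) (𝓝 (log (y * I + 1))) := by
      have : ContinuousAt (fun z : ℂ => log (z + 1)) (y * I) :=
        ContinuousAt.clog (by fun_prop) (add_one_mem_slitPlane hyre)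
      exact this.tendsto.mono_left nhdsWithin_le_nhds
    exact (hpath.add ((h1.comp hzpath).const_mul 2)).add
      (((tendsto_log_hInt hn y).comp hzpath).const_mul _)
  -- a preimage with the right logarithm
  have hr := log_mob_re hz hz1
  obtain ⟨ζ, hζ, hgζ⟩ : ∃ ζ : ℂ, ζ.re < 0 ∧ gFun n ζ = gB + Real.log s := by
    have e : exp (gFun n (log (mob z))) = exp (gB + Real.log s) := by
      rw [exp_gFun n hr, zOf_log_mob hz hz1, h, exp_add, hgB, ← ofReal_exp, Real.exp_log hs0,
        mul_comm]
    obtain ⟨k, hk⟩ := exp_eq_exp_iff_exists_int.1 e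
    refine ⟨log (mob z) + (-k : ℤ) * (2 * Real.pi * I), by simpa using hr, ?_⟩
    rw [gFun_add, hk]
    push_cast
    ring
  have hlim : Tendsto (fun t : ℝ => ((gFun n ζ - gFun n ((η : ℂ) * I - t)) *
      conj (ζ - ((η : ℂ) * I - t))).re) (𝓝[>] 0)
      (𝓝 ((gFun n ζ - gB) * conj (ζ - η * I)).re) :=
    (continuous_re.tendsto _).comp ((hgpath.const_sub _).mul
      ((continuous_conj.tendsto _).comp (hpath.const_sub _)))
  have hge : 0 ≤ ((gFun n ζ - gB) * conj (ζ - η * I)).re := by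
    refine ge_of_tendsto hlim ?_
    filter_upwards [hpre] with t ht
    by_cases hne : (η : ℂ) * I - t = ζ
    · rw [hne]; simp
    · exact (gFun_mono hn ht hζ hne).le
  rw [hgζ, add_sub_cancel_left, re_ofReal_mul] at hge
  have h1 : (conj (ζ - η * I)).re = ζ.re := by simp
  rw [h1] at hge
  nlinarith [Real.log_pos hs]

/-- Since $K$ tends to infinity at infinity, the preimages of a convergent sequence of values are
eventually bounded. A subsequence converges, either inside the half-plane or to a point of the
imaginary axis, where $K$ has the boundary value `kB`. -/
theorem closure_range_kFun {n : ℕ} (hn : 2 ≤ n) {κ : ℂ} (h : κ ∈ closure (kFun n '' rightHalf)) :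
    κ ∈ kFun n '' rightHalf ∨ ∃ y, κ = kB n y := by
  obtain ⟨x, hx, hlim⟩ := mem_closure_iff_seq_limit.1 h
  choose z hz hzx using hx
  obtain ⟨B, -, hB⟩ := norm_kFun_tendsto hn (‖κ‖ + 1)
  have hbd : ∀ᶠ i in atTop, z i ∈ Metric.closedBall (0:ℂ) B := by
    filter_upwards [hlim.norm.eventually (gt_mem_nhds (lt_add_one ‖κ‖))] with i hi
    rw [mem_closedBall_zero_iff]
    by_contra hcon
    have := hB (z i) (hz i) (not_le.1 hcon)
    rw [hzx] at this
    linarith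
  obtain ⟨w, -, φ, hφ, hw⟩ := tendsto_subseq_of_frequently_bounded Metric.isBounded_closedBall
    hbd.frequently
  have hk : Tendsto (fun i => kFun n (z (φ i))) atTop (𝓝 κ) := by
    simp only [hzx]
    exact hlim.comp hφ.tendsto_atTop
  have hw0 : 0 ≤ w.re := ge_of_tendsto ((continuous_re.tendsto w).comp hw)
    (Eventually.of_forall fun i => le_of_lt (hz (φ i)))
  rcases hw0.eq_or_lt with h0 | h0
  · right
    have e : w = w.im * I := by apply Complex.ext <;> simp [← h0]
    refine ⟨w.im, tendsto_nhds_unique hk ((tendsto_kFun hn w.im).comp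
      (tendsto_nhdsWithin_iff.2 ⟨?_, Eventually.of_forall fun i => hz (φ i)⟩))⟩
    rw [← e]
    exact hw
  · left
    exact ⟨w, h0, tendsto_nhds_unique ((hasDerivAt_kFun hn h0).continuousAt.tendsto.comp hw) hk⟩

/-- The complement of the image of `K` is a union of half-lines. -/
theorem mem_range_kFun_or {n : ℕ} (hn : 2 ≤ n) (κ : ℂ) :
    κ ∈ kFun n '' rightHalf ∨ ∃ y s : ℝ, 1 ≤ s ∧ κ = s * kB n y := by
  by_contra hcon
  push Not at hcon
  obtain ⟨hκ, hray⟩ := hcon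
  -- The segment from $0=K(1)$ to $\kappa$ is followed up to the first parameter $\tau$ at which it
  -- leaves the open image. The exit point is in the closure of the image but not in it, so it is a
  -- boundary value.
  set C : Set ℝ := Icc 0 1 ∩ {t : ℝ | (t : ℂ) * κ ∉ kFun n '' rightHalf}
  have hC : IsCompact C := isCompact_Icc.inter_right
    ((isOpen_range_kFun hn).isClosed_compl.preimage (by fun_prop : Continuous fun t : ℝ => (t : ℂ) * κ))
  obtain ⟨τ, ⟨hτ, hτn⟩, hmin⟩ := hC.exists_isLeast ⟨1, by simp, by simpa using hκ⟩
  have h00 : (0:ℂ) ∈ kFun n '' rightHalf := ⟨1, by simp [rightHalf], kFun_one n⟩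
  have hτ0 : 0 < τ := by
    refine lt_of_le_of_ne hτ.1 fun h => hτn ?_
    rw [← h]; simpa using h00
  have hcl : (τ : ℂ) * κ ∈ closure (kFun n '' rightHalf) := by
    have hpath : Tendsto (fun t : ℝ => (t : ℂ) * κ) (𝓝[<] τ) (𝓝 (τ * κ)) :=
      ((by fun_prop : Continuous fun t : ℝ => (t : ℂ) * κ).tendsto τ).mono_left nhdsWithin_le_nhds
    refine mem_closure_of_tendsto hpath ?_
    filter_upwards [Ioo_mem_nhdsLT hτ0] with t ht
    by_contra hcon
    exact absurd (hmin ⟨⟨ht.1.le, ht.2.le.trans hτ.2⟩, hcon⟩) (not_le.2 ht.2)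
  rcases closure_range_kFun hn hcl with h | ⟨y, hy⟩
  · exact hτn h
  · have hτC : (τ : ℂ) ≠ 0 := by exact_mod_cast hτ0.ne'
    refine hray y τ⁻¹ ((one_le_inv₀ hτ0).2 hτ.2) ?_
    rw [← hy, ofReal_inv, inv_mul_cancel_left₀ hτC]

/-- The endpoint $s=1$ is included because the image is open: if it contained this point it would
contain slightly larger multiples. -/
theorem mul_kB_notMem {n : ℕ} (hn : 2 ≤ n) (y : ℝ) {s : ℝ} (hs : 1 ≤ s) :
    (s : ℂ) * kB n y ∉ kFun n '' rightHalf := by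
  intro h
  have hpath : Tendsto (fun t : ℝ => (t : ℂ) * kB n y) (𝓝[>] s) (𝓝 (s * kB n y)) :=
    ((by fun_prop : Continuous fun t : ℝ => (t : ℂ) * kB n y).tendsto s).mono_left
      nhdsWithin_le_nhds
  obtain ⟨t, ⟨z, hz, ht⟩, hts⟩ := ((hpath.eventually ((isOpen_range_kFun hn).mem_nhds h)).and
    self_mem_nhdsWithin).exists
  exact kFun_ne_mul_kB hn hz y (lt_of_le_of_lt hs hts) ht

/-! ### The sector contained in the image of $K$. -/

theorem abs_two_div_mul_log_im_lt {n : ℕ} (hn : 2 ≤ n) {om : ℂ} (h : 0 < om.re) :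
    |((2 / n : ℂ) * log om).im| < Real.pi / n := by
  have hn0 : (0:ℝ) < n := by exact_mod_cast (by omega : 0 < n)
  rw [two_div_mul_im, log_im, abs_mul, abs_of_pos (by positivity)]
  have := abs_arg_lt_pi_div_two_iff.2 (Or.inl h)
  calc 2 / (n:ℝ) * |om.arg| < 2 / n * (Real.pi / 2) := by gcongr
    _ = _ := by ring

/-- A missed point is a positive multiple of $-\omega^{2/n}$ with $\operatorname{Re}\omega>0$, so
its argument differs from $\pi$ by less than $\pi/n$ modulo $2\pi$. -/
theorem exp_mem_range_kFun {n : ℕ} (hn : 2 ≤ n) {w : ℂ} (hw : |w.im| ≤ Real.pi - Real.pi / n) :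
    exp w ∈ kFun n '' rightHalf := by
  rcases mem_range_kFun_or hn (exp w) with h | ⟨y, s, hs, h⟩
  · exact h
  exfalso
  have hs0 : 0 < s := by linarith
  have hθ := abs_lt.1 (abs_two_div_mul_log_im_lt hn (omegaB_re_pos n y))
  have e : exp w = exp (Real.log s + (2 / n) * log (omegaB n y) + Real.pi * I) := by
    rw [h, kB, exp_add, exp_add, exp_pi_mul_I, ← ofReal_exp, Real.exp_log hs0]; ring
  obtain ⟨k, hk⟩ := exp_eq_exp_iff_exists_int.1 e
  have him := congrArg im hk
  simp only [add_im, ofReal_im, zero_add] at him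
  have e1 : ((Real.pi : ℂ) * I).im = Real.pi := by simp
  have e2 : ((k : ℂ) * (2 * Real.pi * I)).im = k * (2 * Real.pi) := by simp
  rw [e1, e2] at him
  have hw' := abs_le.1 hw
  rcases le_or_gt 0 k with hk0 | hk0
  · have : (0:ℝ) ≤ k := by exact_mod_cast hk0
    nlinarith [Real.pi_pos]
  · have : (k:ℝ) ≤ -1 := by exact_mod_cast (by omega : k ≤ -1)
    nlinarith [Real.pi_pos]

theorem exists_lFun_eq {n : ℕ} (hn : 2 ≤ n) {w : ℂ} (hw : |w.im| ≤ Real.pi - Real.pi / n) :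
    ∃ z ∈ cutHalf, lFun n z = w := by
  obtain ⟨z, hz, h⟩ := exp_mem_range_kFun hn hw
  have hn0 : (0:ℝ) < n := by exact_mod_cast (by omega : 0 < n)
  have hpos : 0 < Real.pi / n := by positivity
  have hw' := abs_le.1 hw
  have hlog : log (exp w) = w := log_exp (by linarith) (by linarith)
  have hc : z ∈ cutHalf := by
    refine mem_cutHalf_of_kFun hz (by rw [h]; exact exp_ne_zero _) ?_
    rw [h, ← log_im, hlog]
    linarith
  exact ⟨z, hc, by rw [lFun_eq_log hn hc, h, hlog]⟩

theorem lFun_injOn {n : ℕ} (hn : 2 ≤ n) : InjOn (lFun n) cutHalf := by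
  intro z hz w hw h
  refine kFun_injOn hn hz.1 hw.1 ?_
  rw [← exp_lFun n hz.1 (ne_one_of_mem_cutHalf hz), h, exp_lFun n hw.1 (ne_one_of_mem_cutHalf hw)]

/-! #### The image of `F` -/

theorem exists_mul_omegaB (n : ℕ) {om : ℂ} (h : 0 < om.re) :
    ∃ y : ℝ, om = ((om.re / (2 * aConst n) : ℝ) : ℂ) * omegaB n y := by
  have hA := aConst_pos n
  obtain ⟨y, hy⟩ := tInt_surjective n (-(om.im * aConst n / om.re))
  refine ⟨y, ?_⟩
  rw [omegaB, hy]
  apply Complex.ext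
  · rw [re_ofReal_mul]; simp; field_simp
  · rw [im_ofReal_mul]; simp; field_simp

/-- The hypothesis places the argument of $\omega=2(F(1)-F(z))$ in $(-\pi,0)$, so
$\operatorname{Im}F>0$ and the principal logarithm of $\omega$ determines $\log K(z)$. If
$\operatorname{Re}F\le0$, then $\operatorname{Re}\omega\ge2F(1)$ and $\omega$ is a multiple $\ge1$
of some `omegaB n y`; then $K(z)$ lies on one of the missed half-lines. -/
theorem re_two_mul_sub_lt {n : ℕ} (hn : 2 ≤ n) {z : ℂ} (hz : 0 < z.re) (hi : 0 < z.im)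
    (h : Real.pi - 2 * Real.pi / n < (lFun n z).im) : 0 < (fInt n z).re ∧ 0 < (fInt n z).im := by
  have hn0 : (0:ℝ) < n := by exact_mod_cast (by omega : 0 < n)
  have hn0' : (n : ℂ) ≠ 0 := by exact_mod_cast hn0.ne'
  set om : ℂ := 2 * (aConst n - fInt n z)
  have hom : exp ((n / 2) * (lFun n z - Real.pi * I)) = om := exp_lFun_sub hn hz hi
  have hL := lFun_im_pos hn hz hi
  have him : ((n / 2 : ℂ) * (lFun n z - Real.pi * I)).im = n / 2 * ((lFun n z).im - Real.pi) := by
    rw [show (n / 2 : ℂ) = ((n / 2 : ℝ) : ℂ) by push_cast; rfl, im_ofReal_mul]; simp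
  have hm1 : -Real.pi < n / 2 * ((lFun n z).im - Real.pi) := by
    have : n / 2 * (-(2 * Real.pi / n)) < n / 2 * ((lFun n z).im - Real.pi) := by
      gcongr; linarith
    have e : (n:ℝ) / 2 * (-(2 * Real.pi / n)) = -Real.pi := by field_simp
    linarith
  have hm2 : n / 2 * ((lFun n z).im - Real.pi) < 0 :=
    mul_neg_of_pos_of_neg (by positivity) (by linarith [hL.2])
  have hlog : log om = (n / 2 : ℂ) * (lFun n z - Real.pi * I) := by
    rw [← hom, log_exp] <;> rw [him] <;> linarith [Real.pi_pos]
  have homim : om.im < 0 := by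
    rw [← arg_neg_iff, ← log_im, hlog, him]; exact hm2
  have homim' : om.im = -2 * (fInt n z).im := by simp [om]
  have homre' : om.re = 2 * (aConst n - (fInt n z).re) := by simp [om]
  refine ⟨?_, by linarith⟩
  by_contra hcon
  have hge : 2 * aConst n ≤ om.re := by rw [homre']; linarith
  have hA := aConst_pos n
  have homre : 0 < om.re := by linarith
  obtain ⟨y, hy⟩ := exists_mul_omegaB n homre
  set s := om.re / (2 * aConst n)
  have hs : 1 ≤ s := (one_le_div (by linarith)).2 hge
  have hs0 : 0 < s := by linarith
  refine mul_kB_notMem hn y (s := Real.exp (2 / n * Real.log s))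
    (Real.one_le_exp (mul_nonneg (by positivity) (Real.log_nonneg hs))) ⟨z, hz, ?_⟩
  rw [← exp_lFun n hz (ne_one_of_im hi.ne'), kB]
  have e1 : lFun n z = (2 / n) * log om + Real.pi * I := by
    rw [hlog]; field_simp; ring
  rw [e1, hy, log_ofReal_mul hs0 (omegaB_ne_zero n y), mul_add, exp_add, exp_add, exp_pi_mul_I]
  push_cast
  ring

/-- With $\omega=2(F(1)-w)$, the value of $K$ at the required point must be $-\omega^{2/n}$. If it
were missed, $\omega$ would be a multiple $\ge1$ of a point of the line $\operatorname{Re}=2F(1)$,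
contradicting $\operatorname{Re}w>0$. -/
theorem exists_fInt_eq {n : ℕ} (hn : 2 ≤ n) {w : ℂ} (hre : 0 < w.re) (him : 0 < w.im) :
    ∃ z : ℂ, 0 < z.re ∧ 0 < z.im ∧ Real.pi - 2 * Real.pi / n < (lFun n z).im ∧ fInt n z = w := by
  have hn0 : (0:ℝ) < n := by exact_mod_cast (by omega : 0 < n)
  have hn2 : (2:ℝ) ≤ n := by exact_mod_cast hn
  have hn0' : (n : ℂ) ≠ 0 := by exact_mod_cast hn0.ne'
  set om : ℂ := 2 * (aConst n - w)
  have homim : om.im < 0 := by simp [om]; exact him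
  have homre : om.re < 2 * aConst n := by simp [om]; exact hre
  have hom0 : om ≠ 0 := by intro h; rw [h] at homim; simp at homim
  have harg1 : om.arg < 0 := arg_neg_iff.2 homim
  have harg2 := neg_pi_lt_arg om
  set v : ℂ := (2 / n) * log om
  have hv : v.im = 2 / n * om.arg := by rw [two_div_mul_im, log_im]
  have hv1 : -(2 * Real.pi / n) < v.im := by
    rw [hv]
    calc -(2 * Real.pi / n) = 2 / n * (-Real.pi) := by ring
      _ < _ := by gcongr
  have hv2 : v.im < 0 := by rw [hv]; exact mul_neg_of_pos_of_neg (by positivity) harg1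
  have h2n : 2 * Real.pi / n ≤ Real.pi := by
    rw [div_le_iff₀ hn0]; nlinarith [Real.pi_pos]
  rcases mem_range_kFun_or hn (-exp v) with ⟨z, hz, h⟩ | ⟨y, s, hs, h⟩
  · have hexp : kFun n z = exp (v + Real.pi * I) := by rw [h, exp_add, exp_pi_mul_I]; ring
    have hvim : (v + Real.pi * I).im = v.im + Real.pi := by simp
    have hlog : log (kFun n z) = v + Real.pi * I := by
      rw [hexp, log_exp] <;> rw [hvim] <;> linarith [Real.pi_pos]
    have hKim : 0 < (kFun n z).im := by
      rw [hexp, exp_im, hvim]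
      have := Real.sin_pos_of_pos_of_lt_pi (x := v.im + Real.pi) (by linarith) (by linarith)
      positivity
    have hi := kFun_im_pos hn hz hKim
    have hc : z ∈ cutHalf := ⟨hz, Or.inl hi.ne'⟩
    have hL : lFun n z = v + Real.pi * I := by rw [lFun_eq_log hn hc, hlog]
    refine ⟨z, hz, hi, by rw [hL, hvim]; linarith, ?_⟩
    have h1 := exp_lFun_sub hn hz hi
    rw [hL, add_sub_cancel_right, ← mul_assoc, show (n / 2 : ℂ) * (2 / n) = 1 by field_simp,
      one_mul, exp_log hom0] at h1
    linear_combination (1 / 2 : ℂ) * h1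
  · exfalso
    have hs0 : 0 < s := by linarith
    have hθ := abs_lt.1 (abs_two_div_mul_log_im_lt hn (omegaB_re_pos n y))
    have hpn : Real.pi / n ≤ Real.pi / 2 := by gcongr
    have e : exp v = exp (Real.log s + (2 / n) * log (omegaB n y)) := by
      rw [kB] at h
      rw [exp_add, ← ofReal_exp, Real.exp_log hs0]
      linear_combination -h
    have hle : (Real.log s + (2 / n : ℂ) * log (omegaB n y)).im = ((2 / n : ℂ) * log (omegaB n y)).im := by
      simp
    have e2 := congrArg log e
    rw [log_exp (by linarith) (by linarith [Real.pi_pos]), log_exp (by rw [hle]; linarith)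
      (by rw [hle]; linarith)] at e2
    have e3 : log om = (n / 2 * Real.log s : ℝ) + log (omegaB n y) := by
      have : log om = (n / 2 : ℂ) * v := by simp only [v]; field_simp
      rw [this, e2]
      push_cast
      field_simp
    have e4 : om = (Real.exp (n / 2 * Real.log s) : ℝ) * omegaB n y := by
      rw [← exp_log hom0, e3, exp_add, exp_log (omegaB_ne_zero n y), ofReal_exp]
    have e5 := congrArg re e4
    rw [re_ofReal_mul, omegaB_re] at e5
    have h1 : 1 ≤ Real.exp (n / 2 * Real.log s) :=
      Real.one_le_exp (mul_nonneg (by positivity) (Real.log_nonneg hs))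
    nlinarith [aConst_pos n]

/-! ### Charts in which the trajectories are horizontal -/

/-- The angles of the half-lines which are the images of the branches at `1` under `K`. -/
def angA (n j : ℕ) : ℝ := -Real.pi + 2 * Real.pi * j / n

theorem angA_succ (n j : ℕ) : angA n (j + 1) = angA n j + 2 * Real.pi / n := by
  rw [angA, angA]; push_cast; ring

theorem angA_zero (n : ℕ) : angA n 0 = -Real.pi := by simp [angA]

theorem angA_self {n : ℕ} (hn : 2 ≤ n) : angA n n = Real.pi := by
  have : (n : ℝ) ≠ 0 := by exact_mod_cast (by omega : n ≠ 0)
  rw [angA]; field_simp; ring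

theorem angA_mono {n i j : ℕ} (h : i ≤ j) : angA n i ≤ angA n j := by
  have : (i:ℝ) ≤ j := by exact_mod_cast h
  have := Real.pi_pos
  unfold angA
  gcongr

theorem angA_strictMono {n : ℕ} (hn : 2 ≤ n) : StrictMono (angA n) := by
  intro i j h
  have : (i:ℝ) < j := by exact_mod_cast h
  have h0 : (0:ℝ) < n := by exact_mod_cast (by omega : 0 < n)
  have := Real.pi_pos
  unfold angA
  gcongr

theorem angA_neg {n j : ℕ} (hn : 2 ≤ n) (hj : j ≤ n) : -angA n j = angA n (n - j) := by
  have : (n : ℝ) ≠ 0 := by exact_mod_cast (by omega : n ≠ 0)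
  rw [angA, angA, Nat.cast_sub hj]; field_simp; ring

theorem angA_pred {n : ℕ} (hn : 2 ≤ n) : angA n (n - 1) = Real.pi - 2 * Real.pi / n := by
  have h := angA_succ n (n - 1)
  rw [Nat.sub_add_cancel (by omega), angA_self hn] at h
  linarith

theorem angA_pred_nonneg {n : ℕ} (hn : 2 ≤ n) : 0 ≤ angA n (n - 1) := by
  rw [angA_pred hn, sub_nonneg, div_le_iff₀ (by exact_mod_cast (by omega : 0 < n))]
  have : (2:ℝ) ≤ n := by exact_mod_cast hn
  nlinarith [Real.pi_pos]

theorem abs_angA_le {n j : ℕ} (hn : 2 ≤ n) (h1 : 1 ≤ j) (hj : j ≤ n - 1) :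
    |angA n j| ≤ Real.pi - 2 * Real.pi / n := by
  rw [← angA_pred hn, abs_le]
  refine ⟨?_, angA_mono hj⟩
  rw [neg_le, angA_neg hn (by omega)]
  exact angA_mono (by omega)

theorem exp_nat_mul_angA {n : ℕ} (hn : 2 ≤ n) (j : ℕ) :
    exp (-(n * angA n j * I)) = (-1) ^ n := by
  have hn0 : (n : ℂ) ≠ 0 := by exact_mod_cast (by omega : n ≠ 0)
  have e : -((n : ℂ) * angA n j * I) = n * (Real.pi * I) - j * (2 * Real.pi * I) := by
    rw [angA]; push_cast; field_simp; ring
  rw [e, exp_sub, exp_nat_mul, exp_pi_mul_I, exp_nat_mul, exp_two_pi_mul_I, one_pow, div_one]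

/-- The function `K(z)^{n/2}` with the branch which is positive on the `j`th branch. -/
def secE (n j : ℕ) (z : ℂ) : ℂ := exp ((n / 2) * (lFun n z - angA n j * I))

theorem half_mul_im (n : ℕ) (z : ℂ) : ((n / 2 : ℂ) * z).im = n / 2 * z.im := by
  rw [show (n / 2 : ℂ) = ((n / 2 : ℝ) : ℂ) by push_cast; rfl, im_ofReal_mul]

theorem lFun_sub_im (n j : ℕ) (z : ℂ) :
    ((n / 2 : ℂ) * (lFun n z - angA n j * I)).im = n / 2 * ((lFun n z).im - angA n j) := by
  rw [half_mul_im]; simp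

/-- The square of `secE` is $(-1)^nK^n$, the sign coming from the choice of angle. This sign turns
$(z^2-1)^n$ into $(1-z^2)^n$, so all charts have the same squared derivative, whatever the branch of
the root. -/
theorem hasDerivAt_secE {n : ℕ} (hn : 2 ≤ n) (j : ℕ) {z : ℂ} (hz : z ∈ cutHalf) :
    ∃ d, HasDerivAt (secE n j) d z ∧ d ^ 2 = 4 * (1 - z ^ 2) ^ (n - 2) := by
  have hn0 : (n : ℂ) ≠ 0 := by exact_mod_cast (by omega : n ≠ 0)
  have h0 := sq_sub_one_ne_zero hz.1.le (ne_one_of_mem_cutHalf hz)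
  have hH := hInt_ne_zero n hz.1
  refine ⟨_, (((hasDerivAt_lFun hn hz).sub_const (angA n j * I)).const_mul (n / 2 : ℂ)).cexp, ?_⟩
  have e1 : exp ((n / 2 : ℂ) * (lFun n z - angA n j * I)) ^ 2 =
      (-1) ^ n * ((z ^ 2 - 1) ^ n * hInt n z ^ 2) := by
    have hK : kFun n z ^ n = (z ^ 2 - 1) ^ n * hInt n z ^ 2 := by
      rw [kFun, mul_pow, ← exp_nat_mul]
      congr 1
      rw [show (n : ℂ) * (2 / n * log (hInt n z)) = (2 : ℕ) * log (hInt n z) by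
        push_cast; field_simp, exp_nat_mul, exp_log hH]
    rw [← hK, ← exp_lFun n hz.1 (ne_one_of_mem_cutHalf hz), ← exp_nat_mul, ← exp_nat_mul,
      ← exp_nat_mul_angA hn j, ← exp_add]
    congr 1
    push_cast
    ring
  rw [mul_pow, e1]
  have e2 : (-1 : ℂ) ^ n * (z ^ 2 - 1) ^ n = (1 - z ^ 2) ^ (n - 2) * (z ^ 2 - 1) ^ 2 := by
    rw [← mul_pow, show (z ^ 2 - 1) ^ 2 = (1 - z ^ 2) ^ 2 by ring, ← pow_add,
      Nat.sub_add_cancel hn]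
    ring
  rw [← mul_assoc, e2]
  field_simp
  ring

/-- A bijective holomorphic chart of `D` onto the upper half-plane, such that the trajectories in
`D` are the curves on which `Im E` is constant. -/
structure IsChart (n : ℕ) (D : Set ℂ) (E : ℂ → ℂ) : Prop where
  isOpen : IsOpen D
  ne : ∀ z ∈ D, 1 - z ^ 2 ≠ 0
  deriv : ∀ z ∈ D, ∃ d, HasDerivAt E d z ∧ d ^ 2 = 4 * (1 - z ^ 2) ^ (n - 2)
  injOn : InjOn E D
  image : E '' D = {w | 0 < w.im}

/-- The domain between two successive branches at `1`. -/
def secD (n j : ℕ) : Set ℂ :=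
  {z | z ∈ cutHalf ∧ angA n j < (lFun n z).im ∧ (lFun n z).im < angA n (j + 1)}

theorem continuousOn_lFun {n : ℕ} (hn : 2 ≤ n) : ContinuousOn (lFun n) cutHalf := fun _ hz =>
  (hasDerivAt_lFun hn hz).continuousAt.continuousWithinAt

theorem isOpen_secD {n : ℕ} (hn : 2 ≤ n) (j : ℕ) : IsOpen (secD n j) := by
  have : secD n j = cutHalf ∩ (lFun n) ⁻¹' (im ⁻¹' Ioo (angA n j) (angA n (j + 1))) := by
    ext; simp [secD]; tauto
  rw [this]
  exact (continuousOn_lFun hn).isOpen_inter_preimage isOpen_cutHalf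
    (isOpen_Ioo.preimage continuous_im)

theorem mem_secD_iff {n : ℕ} (hn : 2 ≤ n) {j : ℕ} {z : ℂ} : z ∈ secD n j ↔ z ∈ cutHalf ∧
    0 < ((n / 2 : ℂ) * (lFun n z - angA n j * I)).im ∧
    ((n / 2 : ℂ) * (lFun n z - angA n j * I)).im < Real.pi := by
  have hn0 : (0:ℝ) < n := by exact_mod_cast (by omega : 0 < n)
  rw [lFun_sub_im, secD, mem_ofPred_eq, angA_succ]
  have h1 : 0 < (n:ℝ) / 2 * ((lFun n z).im - angA n j) ↔ angA n j < (lFun n z).im := by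
    rw [mul_pos_iff_of_pos_left (by positivity), sub_pos]
  have h2 : (n:ℝ) / 2 * ((lFun n z).im - angA n j) < Real.pi ↔
      (lFun n z).im < angA n j + 2 * Real.pi / n := by
    rw [← lt_div_iff₀' (by positivity), sub_lt_iff_lt_add',
      show Real.pi / ((n:ℝ) / 2) = 2 * Real.pi / n by field_simp]
  rw [h1, h2]

theorem log_secE {n : ℕ} (hn : 2 ≤ n) {j : ℕ} {z : ℂ} (hz : z ∈ secD n j) :
    log (secE n j z) = (n / 2) * (lFun n z - angA n j * I) := by
  obtain ⟨-, h1, h2⟩ := (mem_secD_iff hn).1 hz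
  exact log_exp (by linarith [Real.pi_pos]) h2.le

theorem injOn_secE {n : ℕ} (hn : 2 ≤ n) (j : ℕ) : InjOn (secE n j) (secD n j) := by
  intro z hz w hw h
  have h' := congrArg log h
  rw [log_secE hn hz, log_secE hn hw] at h'
  have hn0 : (n / 2 : ℂ) ≠ 0 := by
    have : (n : ℂ) ≠ 0 := by exact_mod_cast (by omega : n ≠ 0)
    simpa using this
  exact lFun_injOn hn hz.1 hw.1 (sub_left_injective (mul_left_cancel₀ hn0 h'))

/-- The bounds on $j$ keep both sides of the sector within $|\arg|\le\pi-2\pi/n$, inside the range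
of arguments that $K$ fully covers. -/
theorem exists_secE_eq {n : ℕ} (hn : 2 ≤ n) {j : ℕ} (h1 : 1 ≤ j) (hj : j + 1 ≤ n - 1) {w : ℂ}
    (hw : 0 < w.im) : ∃ z ∈ secD n j, secE n j z = w := by
  have hn0 : (0:ℝ) < n := by exact_mod_cast (by omega : 0 < n)
  have hn0' : (n : ℂ) ≠ 0 := by exact_mod_cast hn0.ne'
  have hw0 : w ≠ 0 := by rintro rfl; simp at hw
  have ha := arg_mem_of_im_pos hw
  have him : ((2 / n : ℂ) * log w + angA n j * I).im = 2 / n * w.arg + angA n j := by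
    rw [add_im, two_div_mul_im, log_im]; simp
  have hlt : 2 / (n:ℝ) * w.arg < 2 * Real.pi / n := by
    rw [mul_div_right_comm]; gcongr; exact ha.2
  have hpos : 0 < 2 / (n:ℝ) * w.arg := mul_pos (by positivity) ha.1
  have hb1 := abs_le.1 (abs_angA_le hn h1 (by omega))
  have hb2 := abs_le.1 (abs_angA_le hn (by omega : 1 ≤ j + 1) hj)
  rw [angA_succ] at hb2
  have hle : Real.pi - 2 * Real.pi / n ≤ Real.pi - Real.pi / n := by
    have : 0 < Real.pi / n := by positivity
    have e : 2 * Real.pi / n = Real.pi / n + Real.pi / n := by ring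
    linarith
  obtain ⟨z, hz, h⟩ := exists_lFun_eq hn (w := (2 / n : ℂ) * log w + angA n j * I)
    (by rw [him, abs_le]; constructor <;> linarith)
  refine ⟨z, ⟨hz, by rw [h, him]; linarith, by rw [h, him, angA_succ]; linarith⟩, ?_⟩
  rw [secE, h, add_sub_cancel_right, ← mul_assoc, show (n / 2 : ℂ) * (2 / n) = 1 by field_simp,
    one_mul, exp_log hw0]

theorem isChart_secE {n : ℕ} (hn : 2 ≤ n) {j : ℕ} (h1 : 1 ≤ j) (hj : j + 1 ≤ n - 1) :
    IsChart n (secD n j) (secE n j) where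
  isOpen := isOpen_secD hn j
  ne z hz h := sq_sub_one_ne_zero hz.1.1.le (ne_one_of_mem_cutHalf hz.1) (by linear_combination -h)
  deriv z hz := hasDerivAt_secE hn j hz.1
  injOn := injOn_secE hn j
  image := by
    apply Subset.antisymm
    · rintro _ ⟨z, hz, rfl⟩
      obtain ⟨-, h1, h2⟩ := (mem_secD_iff hn).1 hz
      rw [mem_ofPred_eq, secE, exp_im]
      exact mul_pos (Real.exp_pos _) (Real.sin_pos_of_pos_of_lt_pi h1 h2)
    · intro w hw
      exact exists_secE_eq hn h1 hj hw

/-! #### The domain which contains the upper half of the imaginary axis -/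

/-- The domain between the last branch at `1` and the first branch at `-1`. -/
def crossD (n : ℕ) : Set ℂ :=
  {z | 0 < z.im ∧ (0 < z.re → angA n (n - 1) < (lFun n z).im) ∧
    (z.re < 0 → angA n (n - 1) < (lFun n (-conj z)).im)}

theorem neg_conj_mem_crossD {n : ℕ} {z : ℂ} (hz : z ∈ crossD n) : -conj z ∈ crossD n := by
  refine ⟨by simpa using hz.1, fun h => hz.2.2 (by simpa using h), fun h => ?_⟩
  have e : -conj (-conj z) = z := by simp
  rw [e]
  exact hz.2.1 (by simpa using h)

/-- At $iy$ the limiting argument of $K$ differs from $\pi$ by less than $\pi/n$, hence exceeds that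
of the last branch, $\pi-2\pi/n$. So the imaginary half-axis is interior to `crossD`. -/
theorem eventually_lFun_im_gt {n : ℕ} (hn : 2 ≤ n) {y : ℝ} (hy : 0 < y) :
    ∀ᶠ z in 𝓝[rightHalf] ((y : ℂ) * I), angA n (n - 1) < (lFun n z).im := by
  have hs : 1 - ((y : ℂ) * I) ^ 2 ∈ slitPlane := I_mul_mem_slitDom y
  have h1 : Tendsto (fun z : ℂ => log (1 - z ^ 2)) (𝓝[rightHalf] (y * I))
      (𝓝 (log (1 - ((y : ℂ) * I) ^ 2))) := by
    have : ContinuousAt (fun z : ℂ => log (1 - z ^ 2)) (y * I) :=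
      ContinuousAt.clog (by fun_prop) hs
    exact this.tendsto.mono_left nhdsWithin_le_nhds
  have h2 := (continuous_im.tendsto _).comp (h1.add ((tendsto_log_hInt hn y).const_mul (2 / n : ℂ)))
  have e : (log (1 - ((y : ℂ) * I) ^ 2)).im = 0 := by
    have : 1 - ((y : ℂ) * I) ^ 2 = ((1 + y ^ 2 : ℝ) : ℂ) := by
      push_cast; rw [mul_pow, I_sq]; ring
    rw [this, log_im, arg_ofReal_of_nonneg (by positivity)]
  have hlt : -(2 * Real.pi / n) <
      (log (1 - ((y : ℂ) * I) ^ 2) + (2 / n : ℂ) * log (hB n y)).im := by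
    have hn0 : (0:ℝ) < n := by exact_mod_cast (by omega : 0 < n)
    rw [add_im, e]
    have := (abs_lt.1 (abs_two_div_mul_log_im_lt hn (hB_re_pos n y))).1
    have hp : 0 < Real.pi / n := by positivity
    have e : 2 * Real.pi / n = Real.pi / n + Real.pi / n := by ring
    linarith
  filter_upwards [h2.eventually (lt_mem_nhds hlt), self_mem_nhdsWithin,
    nhdsWithin_le_nhds (isOpen_slitDom.mem_nhds (I_mul_mem_slitDom y)),
    nhdsWithin_le_nhds ((isOpen_lt continuous_const continuous_im).mem_nhds
      (show (0:ℝ) < ((y : ℂ) * I).im by simpa using hy))] with z h3 hz _ hi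
  have h4 := congrArg im (lFun_sub_pi n hz hi)
  simp only [Function.comp] at h3
  rw [← h4, sub_im] at h3
  rw [angA_pred hn]
  have : ((Real.pi : ℂ) * I).im = Real.pi := by simp
  linarith

theorem isOpen_crossD {n : ℕ} (hn : 2 ≤ n) : IsOpen (crossD n) := by
  have key : ∀ z ∈ crossD n, ∀ᶠ x in 𝓝 z, 0 < x.re → angA n (n - 1) < (lFun n x).im := by
    intro z hz
    rcases lt_trichotomy z.re 0 with h | h | h
    · filter_upwards [(isOpen_lt continuous_re continuous_const).mem_nhds h] with x hx hx'
      exact absurd hx (not_lt.2 hx'.le)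
    · have e : z = z.im * I := by apply Complex.ext <;> simp [h]
      have := eventually_lFun_im_gt hn hz.1
      rw [← e] at this
      exact eventually_nhdsWithin_iff.1 this
    · have hc : z ∈ cutHalf := ⟨h, Or.inl hz.1.ne'⟩
      have := (continuous_im.continuousAt.comp (hasDerivAt_lFun hn hc).continuousAt).eventually
        (lt_mem_nhds (hz.2.1 h))
      filter_upwards [this] with x hx _ using hx
  rw [isOpen_iff_mem_nhds]
  intro z hz
  have h2 := (by fun_prop : Continuous fun x : ℂ => -conj x).continuousAt.eventually
    (key _ (neg_conj_mem_crossD hz))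
  filter_upwards [(isOpen_lt continuous_const continuous_im).mem_nhds hz.1, key z hz, h2]
    with x h1 h2 h3
  exact ⟨h1, h2, fun h => h3 (by simpa using h)⟩

theorem fInt_of_re_pos {n : ℕ} (hn : 2 ≤ n) {z : ℂ} (hz : z ∈ crossD n) (h : 0 < z.re) :
    0 < (fInt n z).re ∧ 0 < (fInt n z).im :=
  re_two_mul_sub_lt hn h hz.1 (by rw [← angA_pred hn]; exact hz.2.1 h)

theorem fInt_neg_conj (n : ℕ) (z : ℂ) (hz : z ∈ slitDom) : fInt n (-conj z) = -conj (fInt n z) := by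
  rw [fInt_neg, fInt_conj n hz]

theorem fInt_of_re_neg {n : ℕ} (hn : 2 ≤ n) {z : ℂ} (hz : z ∈ crossD n) (h : z.re < 0) :
    (fInt n z).re < 0 ∧ 0 < (fInt n z).im := by
  have := fInt_of_re_pos hn (neg_conj_mem_crossD hz) (by simpa using h)
  rw [fInt_neg_conj n z (mem_slitDom_of_im hz.1.ne')] at this
  simpa using this

theorem fInt_of_re_zero {n : ℕ} {z : ℂ} (h : z.re = 0) :
    (fInt n z).re = 0 ∧ (fInt n z).im = tInt n z.im := by
  have e : z = z.im * I := by apply Complex.ext <;> simp [h]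
  rw [e, fInt_I_mul]
  simp

theorem fInt_im_pos {n : ℕ} (hn : 2 ≤ n) {z : ℂ} (hz : z ∈ crossD n) : 0 < (fInt n z).im := by
  rcases lt_trichotomy z.re 0 with h | h | h
  · exact (fInt_of_re_neg hn hz h).2
  · rw [(fInt_of_re_zero h).2, ← tInt_zero n]
    exact tInt_strictMono n hz.1
  · exact (fInt_of_re_pos hn hz h).2

/-- On the right half of this domain, `2 F` is a translate of the chart of a sector. -/
theorem secE_pred {n : ℕ} (hn : 2 ≤ n) {z : ℂ} (hz : 0 < z.re) (hi : 0 < z.im) :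
    secE n (n - 1) z = 2 * fInt n z - 2 * aConst n := by
  have hn0 : (n : ℂ) ≠ 0 := by exact_mod_cast (by omega : n ≠ 0)
  have h := exp_lFun_sub hn hz hi
  rw [secE, angA_pred hn]
  have : (n / 2 : ℂ) * (lFun n z - (Real.pi - 2 * Real.pi / n : ℝ) * I) =
      n / 2 * (lFun n z - Real.pi * I) + Real.pi * I := by
    push_cast; field_simp; ring
  rw [this, exp_add, h, exp_pi_mul_I]
  ring

theorem mem_secD_of_mem_crossD {n : ℕ} (hn : 2 ≤ n) {z : ℂ} (hz : z ∈ crossD n) (h : 0 < z.re) :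
    z ∈ secD n (n - 1) := by
  refine ⟨⟨h, Or.inl hz.1.ne'⟩, hz.2.1 h, ?_⟩
  rw [Nat.sub_add_cancel (by omega), angA_self hn]
  exact (lFun_im_pos hn h hz.1).2

/-- $F$ maps the right half of the domain bijectively onto the open first quadrant, the imaginary
half-axis onto itself by the increasing function `tInt`, and the left half onto the second quadrant
by the reflection $z\mapsto-\bar z$. The sign of $\operatorname{Re}F$ separates the three pieces. -/
theorem isChart_crossD {n : ℕ} (hn : 2 ≤ n) : IsChart n (crossD n) (fun z => 2 * fInt n z) where
  isOpen := isOpen_crossD hn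
  ne z hz h := by
    have hs := mem_slitDom_of_im hz.1.ne'
    rw [slitDom, mem_ofPred_eq, h] at hs
    exact slitPlane_ne_zero hs rfl
  deriv z hz := by
    refine ⟨_, (hasDerivAt_fInt n (mem_slitDom_of_im hz.1.ne')).const_mul 2, ?_⟩
    rw [mul_pow, ← pow_mul, mul_comm (n - 2) 2, pow_mul, csqrt_sq]
    · norm_num
    · exact slitPlane_ne_zero (mem_slitDom_of_im hz.1.ne')
  injOn := by
    have hpos : ∀ z ∈ crossD n, ∀ w ∈ crossD n, fInt n z = fInt n w → 0 < z.re → z = w := by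
      intro z hz w hw h hzr
      have hwr : 0 < w.re := by
        rcases lt_trichotomy w.re 0 with h' | h' | h'
        · linarith [(fInt_of_re_neg hn hw h').1, (fInt_of_re_pos hn hz hzr).1, congrArg re h]
        · linarith [(fInt_of_re_zero (n := n) h').1, (fInt_of_re_pos hn hz hzr).1, congrArg re h]
        · exact h'
      refine injOn_secE hn _ (mem_secD_of_mem_crossD hn hz hzr) (mem_secD_of_mem_crossD hn hw hwr) ?_
      rw [secE_pred hn hzr hz.1, secE_pred hn hwr hw.1, h]
    intro z hz w hw h
    have h' : fInt n z = fInt n w := mul_left_cancel₀ two_ne_zero h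
    rcases lt_trichotomy z.re 0 with hr | hr | hr
    · have := hpos _ (neg_conj_mem_crossD hz) _ (neg_conj_mem_crossD hw) (by
        rw [fInt_neg_conj n z (mem_slitDom_of_im hz.1.ne'),
          fInt_neg_conj n w (mem_slitDom_of_im hw.1.ne'), h']) (by simpa using hr)
      exact star_injective (neg_injective this)
    · have hwr : w.re = 0 := by
        have h0 := (fInt_of_re_zero (n := n) hr).1
        rw [h'] at h0
        rcases lt_trichotomy w.re 0 with h1 | h1 | h1
        · linarith [(fInt_of_re_neg hn hw h1).1]
        · exact h1
        · linarith [(fInt_of_re_pos hn hw h1).1]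
      have h0 := congrArg im h'
      rw [(fInt_of_re_zero hr).2, (fInt_of_re_zero hwr).2] at h0
      exact Complex.ext (by rw [hr, hwr]) ((tInt_strictMono n).injective h0)
    · exact hpos z hz w hw h' hr
  image := by
    have hpos : ∀ w : ℂ, 0 < w.re → 0 < w.im → ∃ z ∈ crossD n, fInt n z = w := by
      intro w h1 h2
      obtain ⟨z, hz, hi, hL, h⟩ := exists_fInt_eq hn h1 h2
      exact ⟨z, ⟨hi, fun _ => by rw [angA_pred hn]; exact hL,
        fun h => absurd h (not_lt.2 hz.le)⟩, h⟩
    apply Subset.antisymm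
    · rintro _ ⟨z, hz, rfl⟩
      have := fInt_im_pos hn hz
      simpa using this
    · intro w hw
      have hw' : 0 < (w / 2).im := by
        have : 0 < w.im := hw
        simpa using this
      obtain ⟨z, hz, h⟩ : ∃ z ∈ crossD n, fInt n z = w / 2 := by
        rcases lt_trichotomy (w / 2).re 0 with hr | hr | hr
        · obtain ⟨z, hz, h⟩ := hpos (-conj (w / 2)) (by rw [neg_re, conj_re]; linarith)
            (by rw [neg_im, conj_im]; linarith)
          refine ⟨_, neg_conj_mem_crossD hz, ?_⟩
          rw [fInt_neg_conj n z (mem_slitDom_of_im hz.1.ne'), h]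
          simp
        · obtain ⟨y, hy⟩ := tInt_surjective n (w / 2).im
          have hy0 : 0 < y := by
            rw [← (tInt_strictMono n).lt_iff_lt, tInt_zero, hy]; exact hw'
          refine ⟨y * I, ⟨by simpa using hy0, by simp, by simp⟩, ?_⟩
          rw [fInt_I_mul, hy]
          apply Complex.ext <;> simp [hr]
        · exact hpos _ hr hw'
      refine ⟨z, hz, ?_⟩
      simp only [h]
      ring

/-! ### Asymptotics of curves in the right half-plane -/

/-- Counterpart of `norm_kFun_tendsto`: by compactness and the existence of boundary values, $K$ is
bounded on bounded parts of the half-plane. Hence $|K|\to\infty$ along a curve forces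
$|z|\to\infty$. -/
theorem norm_kFun_le {n : ℕ} (hn : 2 ≤ n) (B : ℝ) :
    ∃ M : ℝ, ∀ z : ℂ, 0 < z.re → ‖z‖ ≤ B → ‖kFun n z‖ ≤ M := by
  by_contra hcon
  push Not at hcon
  choose z hz hzB hzM using fun k : ℕ => hcon k
  obtain ⟨w, -, φ, hφ, hw⟩ := tendsto_subseq_of_frequently_bounded
    (Metric.isBounded_closedBall (x := (0:ℂ)) (r := B))
    (Frequently.of_forall fun i => mem_closedBall_zero_iff.2 (hzB i) : ∃ᶠ i in atTop, z i ∈ _)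
  obtain ⟨κ, hκ⟩ : ∃ κ, Tendsto (fun i => kFun n (z (φ i))) atTop (𝓝 κ) := by
    have hw0 : 0 ≤ w.re := ge_of_tendsto ((continuous_re.tendsto w).comp hw)
      (Eventually.of_forall fun i => le_of_lt (hz (φ i)))
    rcases hw0.eq_or_lt with h0 | h0
    · have e : w = w.im * I := by apply Complex.ext <;> simp [← h0]
      refine ⟨_, (tendsto_kFun hn w.im).comp
        (tendsto_nhdsWithin_iff.2 ⟨?_, Eventually.of_forall fun i => hz (φ i)⟩)⟩
      rw [← e]
      exact hw
    · exact ⟨_, (hasDerivAt_kFun hn h0).continuousAt.tendsto.comp hw⟩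
  have h1 : Tendsto (fun i => ‖kFun n (z (φ i))‖) atTop atTop :=
    tendsto_atTop_mono (fun i => (hzM (φ i)).le)
      (tendsto_natCast_atTop_atTop.comp hφ.tendsto_atTop)
  exact not_tendsto_nhds_of_tendsto_atTop h1 _ hκ.norm

/-- Jordan's inequality gives the constant $\pi/2$, which is rounded up to $2$. -/
theorem abs_arg_le {w : ℂ} (hw : 0 < w.re) : |w.arg| ≤ 2 * (|w.im| / ‖w‖) := by
  have hw0 : w ≠ 0 := by rintro rfl; simp at hw
  have h1 := Real.mul_abs_le_abs_sin (x := w.arg)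
    (abs_arg_lt_pi_div_two_iff.2 (Or.inl hw)).le
  rw [sin_arg, abs_div, abs_norm] at h1
  have h2 : 0 ≤ |w.im| / ‖w‖ := by positivity
  rw [div_mul_eq_mul_div, div_le_iff₀ Real.pi_pos] at h1
  nlinarith [Real.pi_le_four, abs_nonneg w.arg]

theorem norm_exp_mul_I_sub_le (x y : ℝ) : ‖exp (x * I) - exp (y * I)‖ ≤ |x - y| := by
  have e : exp (x * I) - exp (y * I) = exp (y * I) * (exp (I * (x - y : ℝ)) - 1) := by
    rw [mul_sub, ← exp_add, mul_one]; congr 2; push_cast; ring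
  rw [e, norm_mul, norm_exp_ofReal_mul_I, one_mul]
  exact Real.norm_exp_I_mul_ofReal_sub_one_le

/-- A curve in the right half-plane which is asymptotic to a half-line, in terms of the function
`log K`. -/
theorem isAsymptoticToRay_of_lFun {n : ℕ} (hn : 2 ≤ n) {γ w : ℝ → ℂ} {l : Filter ℝ} {a c : ℝ}
    (h1 : ∀ᶠ s in l, γ s ∈ cutHalf ∧ lFun n (γ s) = (2 / n) * log (w s) + a * I)
    (h2 : Tendsto (fun s => (w s).re) l atTop) (h3 : ∀ᶠ s in l, |(w s).im| ≤ c) :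
    IsAsymptoticToRay n (n * a / (2 * (n - 1))) γ l := by
  have hn0 : (0:ℝ) < n := by exact_mod_cast (by omega : 0 < n)
  have hn0' : (n : ℂ) ≠ 0 := by exact_mod_cast hn0.ne'
  have hn1 : (1:ℝ) ≤ n - 1 := by
    have : (2:ℝ) ≤ n := by exact_mod_cast hn
    linarith
  set θ : ℝ := n * a / (2 * (n - 1))
  have hw : Tendsto (fun s => ‖w s‖) l atTop :=
    tendsto_atTop_mono (fun s => re_le_norm (w s)) h2
  have hγ : Tendsto (fun s => ‖γ s‖) l atTop := by
    refine tendsto_atTop.2 fun B => ?_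
    obtain ⟨M, hM⟩ := norm_kFun_le hn B
    have hK : Tendsto (fun s => Real.exp (2 / n * Real.log ‖w s‖)) l atTop :=
      Real.tendsto_exp_atTop.comp ((Real.tendsto_log_atTop.comp hw).const_mul_atTop (by positivity))
    filter_upwards [h1, hK.eventually_gt_atTop M] with s hs hs'
    by_contra hcon
    have := hM _ hs.1.1 (not_le.1 hcon).le
    rw [← exp_lFun n hs.1.1 (ne_one_of_mem_cutHalf hs.1), norm_exp, hs.2] at this
    have e : ((2 / n : ℂ) * log (w s) + a * I).re = 2 / n * Real.log ‖w s‖ := by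
      rw [show (2 / n : ℂ) = ((2 / n : ℝ) : ℂ) by push_cast; rfl, add_re, re_ofReal_mul, log_re]
      simp
    rw [e] at this
    linarith
  obtain ⟨B, hB, hasy⟩ := exists_norm_asyFun_le hn
  have hasy' : ∀ᶠ s in l, ‖asyFun n (γ s)‖ ≤ 2 * asyErr n ‖γ s‖ := by
    filter_upwards [h1, hγ.eventually_gt_atTop B] with s hs hs' using hasy _ hs.1.1 hs'
  have hasy0 : Tendsto (fun s => ‖asyFun n (γ s)‖) l (𝓝 0) := by
    have h := ((tendsto_asyErr hn).comp hγ).const_mul 2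
    rw [mul_zero] at h
    exact squeeze_zero' (Eventually.of_forall fun s => norm_nonneg _) hasy' h
  -- Solving the expansion of $\log K$ for $\log\gamma$. Imaginary parts give the limiting angle
  -- $\theta=na/(2(n-1))$, because $\arg w\to0$ when $\operatorname{Im}w$ stays bounded and
  -- $\operatorname{Re}w\to\infty$.
  have hid : ∀ᶠ s in l, ((n - 1 : ℝ) : ℂ) * log (γ s) = log (w s) + (n * a / 2 : ℝ) * I -
      Real.log (2 / (n - 1)) - asyFun n (γ s) := by
    filter_upwards [h1] with s hs
    rw [asyFun, hs.2]
    push_cast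
    field_simp
    ring
  have hargle : ∀ᶠ s in l, |(γ s).arg - θ| ≤ |(w s).arg| + ‖asyFun n (γ s)‖ := by
    filter_upwards [hid] with s hs
    have h := congrArg im hs
    rw [im_ofReal_mul, log_im, sub_im, sub_im, add_im, log_im, im_ofReal_mul, I_im, ofReal_im] at h
    have e : (n - 1) * ((γ s).arg - θ) = (w s).arg - (asyFun n (γ s)).im := by
      have : (n - 1) * θ = n * a / 2 := by
        have : (n:ℝ) - 1 ≠ 0 := by linarith
        simp only [θ]; field_simp
      linear_combination h - this
    calc |(γ s).arg - θ| ≤ |(n - 1) * ((γ s).arg - θ)| := by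
          rw [abs_mul]
          exact le_mul_of_one_le_left (abs_nonneg _) (hn1.trans (le_abs_self _))
      _ ≤ |(w s).arg| + |(asyFun n (γ s)).im| := by rw [e]; exact abs_sub _ _
      _ ≤ _ := by gcongr; exact abs_im_le_norm _
  have hargw : ∀ᶠ s in l, |(w s).arg| ≤ 2 * (c / ‖w s‖) := by
    filter_upwards [h3, h2.eventually_gt_atTop 0] with s hs hs'
    refine (abs_arg_le hs').trans ?_
    gcongr
  have hargw0 : Tendsto (fun s => |(w s).arg|) l (𝓝 0) := by
    have h := (hw.const_div_atTop c).const_mul 2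
    rw [mul_zero] at h
    exact squeeze_zero' (Eventually.of_forall fun s => abs_nonneg _) hargw h
  have harg : Tendsto (fun s => (γ s).arg) l (𝓝 θ) := by
    rw [tendsto_iff_norm_sub_tendsto_zero]
    have h := hargw0.add hasy0
    rw [add_zero] at h
    exact squeeze_zero' (Eventually.of_forall fun s => norm_nonneg _) hargle h
  refine ⟨hγ, ?_, fun h3n => ?_⟩
  · have : Continuous fun x : ℝ => exp (x * I) := by fun_prop
    refine ((this.tendsto θ).comp harg).congr' ?_
    filter_upwards [hγ.eventually_gt_atTop 0] with s hs
    have h := norm_mul_exp_arg_mul_I (γ s)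
    have hs0 : ((‖γ s‖ : ℝ) : ℂ) ≠ 0 := by exact_mod_cast hs.ne'
    rw [eq_div_iff hs0, mul_comm]
    exact h
  · have hle : ∀ᶠ s in l, Metric.infDist (γ s) (ray θ) ≤
        2 * c * (Real.exp (1 - Real.log (2 / (n - 1))) / ‖γ s‖) + 2 * (‖γ s‖ * asyErr n ‖γ s‖) := by
      filter_upwards [hargle, hargw, hasy', hid, hγ.eventually_gt_atTop 1, h3,
        hw.eventually_gt_atTop 0, hasy0.eventually (gt_mem_nhds one_pos)]
        with s a1 a2 a3 a4 a5 a6 a7 a8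
      have hc0 : 0 ≤ c := (abs_nonneg _).trans a6
      have hnorm : ‖γ s‖ / ‖w s‖ ≤ Real.exp (1 - Real.log (2 / (n - 1))) / ‖γ s‖ := by
        have h := congrArg re a4
        rw [re_ofReal_mul, log_re, sub_re, sub_re, add_re, log_re, re_ofReal_mul, I_re,
          ofReal_re] at h
        -- For $n\ge3$ one has $|\gamma|^{n-1}\ge|\gamma|^2$, so $|w|$ grows at least like
        -- $|\gamma|^2$. The angular error $2c/|w|$ therefore still tends to zero after
        -- multiplication by $|\gamma|$.
        have hsq : ‖γ s‖ ^ 2 ≤ ‖w s‖ * Real.exp (1 - Real.log (2 / (n - 1))) := by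
          rw [← Real.log_le_log_iff (by positivity) (by positivity), Real.log_pow,
            Real.log_mul a7.ne' (Real.exp_pos _).ne', Real.log_exp]
          have h4 := (abs_le.1 ((abs_re_le_norm (asyFun n (γ s))).trans a8.le)).1
          have h5 := Real.log_pos a5
          have h6 : (3:ℝ) ≤ n := by exact_mod_cast h3n
          push_cast
          nlinarith
        rw [div_le_div_iff₀ a7 (by linarith)]
        nlinarith
      have hmem : (‖γ s‖ : ℂ) * exp (θ * I) ∈ ray θ := ⟨‖γ s‖, norm_nonneg _, rfl⟩
      refine (Metric.infDist_le_dist_of_mem hmem).trans ?_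
      rw [dist_eq_norm]
      have e : γ s - ‖γ s‖ * exp (θ * I) = ‖γ s‖ * (exp ((γ s).arg * I) - exp (θ * I)) := by
        rw [mul_sub, norm_mul_exp_arg_mul_I]
      rw [e, norm_mul, norm_real, norm_norm]
      calc ‖γ s‖ * ‖exp ((γ s).arg * I) - exp (θ * I)‖
          ≤ ‖γ s‖ * (2 * (c / ‖w s‖) + 2 * asyErr n ‖γ s‖) := by
            gcongr
            exact (norm_exp_mul_I_sub_le _ _).trans (a1.trans (by gcongr))
        _ = 2 * c * (‖γ s‖ / ‖w s‖) + 2 * (‖γ s‖ * asyErr n ‖γ s‖) := by ring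
        _ ≤ _ := by gcongr
    have hlim := ((hγ.const_div_atTop (Real.exp (1 - Real.log (2 / (n - 1))))).const_mul
      (2 * c)).add (((tendsto_mul_asyErr h3n).comp hγ).const_mul 2)
    simp only [mul_zero, add_zero] at hlim
    exact squeeze_zero' (Eventually.of_forall fun s => Metric.infDist_nonneg) hle hlim

/-! ### The branches at `1` -/

/-- The inverse of `K`. -/
def kInv (n : ℕ) : ℂ → ℂ := Function.invFunOn (kFun n) rightHalf

/-- The `j`th branch at `1`. -/
def brR (n j : ℕ) (t : ℝ) : ℂ := kInv n (t * exp (angA n j * I))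

theorem kInv_mem {n : ℕ} {w : ℂ} (hw : w ∈ kFun n '' rightHalf) : 0 < (kInv n w).re :=
  Function.invFunOn_mem hw

theorem kFun_kInv {n : ℕ} {w : ℂ} (hw : w ∈ kFun n '' rightHalf) : kFun n (kInv n w) = w :=
  Function.invFunOn_eq hw

theorem kInv_kFun {n : ℕ} (hn : 2 ≤ n) {z : ℂ} (hz : 0 < z.re) : kInv n (kFun n z) = z :=
  (kFun_injOn hn).leftInvOn_invFunOn hz

theorem hasDerivAt_kInv {n : ℕ} (hn : 2 ≤ n) {w : ℂ} (hw : w ∈ kFun n '' rightHalf) :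
    HasDerivAt (kInv n) ((4 / n : ℂ) * exp ((2 / n) * log (hInt n (kInv n w))) /
      hInt n (kInv n w))⁻¹ w :=
  hasDerivAt_invFunOn (f' := fun z => (4 / n : ℂ) * exp ((2 / n) * log (hInt n z)) / hInt n z)
    isOpen_rightHalf (fun _ hz => hasDerivAt_kFun hn hz)
    (fun _ hz => kFun_deriv_ne_zero hn hz) (kFun_injOn hn) hw

theorem exp_angA_mul (n j : ℕ) {t : ℝ} (ht : 0 < t) :
    (t : ℂ) * exp (angA n j * I) = exp (Real.log t + angA n j * I) := by
  rw [exp_add, ← ofReal_exp, Real.exp_log ht]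

theorem mul_exp_angA_mem {n j : ℕ} (hn : 2 ≤ n) (h1 : 1 ≤ j) (hj : j ≤ n - 1) {t : ℝ}
    (ht : 0 ≤ t) : (t : ℂ) * exp (angA n j * I) ∈ kFun n '' rightHalf := by
  rcases ht.eq_or_lt with rfl | ht
  · exact ⟨1, by simp [rightHalf], by simp [kFun_one]⟩
  · rw [exp_angA_mul n j ht]
    refine exp_mem_range_kFun hn ?_
    have hn0 : (0:ℝ) < n := by exact_mod_cast (by omega : 0 < n)
    have hp : 0 < Real.pi / n := by positivity
    have e : 2 * Real.pi / n = Real.pi / n + Real.pi / n := by ring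
    have := abs_angA_le hn h1 hj
    simp
    linarith

theorem abs_angA_lt {n j : ℕ} (hn : 2 ≤ n) (h1 : 1 ≤ j) (hj : j ≤ n - 1) :
    |angA n j| < Real.pi := by
  have hn0 : (0:ℝ) < n := by exact_mod_cast (by omega : 0 < n)
  have hp : 0 < 2 * Real.pi / n := by positivity
  linarith [abs_angA_le hn h1 hj]

theorem kFun_brR {n j : ℕ} (hn : 2 ≤ n) (h1 : 1 ≤ j) (hj : j ≤ n - 1) {t : ℝ} (ht : 0 ≤ t) :
    kFun n (brR n j t) = t * exp (angA n j * I) := kFun_kInv (mul_exp_angA_mem hn h1 hj ht)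

theorem brR_re_pos {n j : ℕ} (hn : 2 ≤ n) (h1 : 1 ≤ j) (hj : j ≤ n - 1) {t : ℝ} (ht : 0 ≤ t) :
    0 < (brR n j t).re := kInv_mem (mul_exp_angA_mem hn h1 hj ht)

theorem brR_zero {n : ℕ} (hn : 2 ≤ n) (j : ℕ) : brR n j 0 = 1 := by
  rw [brR, ofReal_zero, zero_mul, ← kFun_one n, kInv_kFun hn (by simp)]

theorem brR_mem_cutHalf {n j : ℕ} (hn : 2 ≤ n) (h1 : 1 ≤ j) (hj : j ≤ n - 1) {t : ℝ} (ht : 0 < t) :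
    brR n j t ∈ cutHalf := by
  have hb := abs_lt.1 (abs_angA_lt hn h1 hj)
  refine mem_cutHalf_of_kFun (n := n) (brR_re_pos hn h1 hj ht.le) ?_ ?_
  · rw [kFun_brR hn h1 hj ht.le, exp_angA_mul n j ht]; exact exp_ne_zero _
  · rw [kFun_brR hn h1 hj ht.le, exp_mul_I, arg_mul_cos_add_sin_mul_I ht ⟨hb.1, hb.2.le⟩]
    exact hb.2.ne

theorem lFun_brR {n j : ℕ} (hn : 2 ≤ n) (h1 : 1 ≤ j) (hj : j ≤ n - 1) {t : ℝ} (ht : 0 < t) :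
    lFun n (brR n j t) = Real.log t + angA n j * I := by
  have hb := abs_lt.1 (abs_angA_lt hn h1 hj)
  rw [lFun_eq_log hn (brR_mem_cutHalf hn h1 hj ht), kFun_brR hn h1 hj ht.le, exp_angA_mul n j ht,
    log_exp] <;> simp <;> linarith

theorem image_brR {n j : ℕ} (hn : 2 ≤ n) (h1 : 1 ≤ j) (hj : j ≤ n - 1) :
    brR n j '' Ioi 0 = {z | z ∈ cutHalf ∧ (lFun n z).im = angA n j} := by
  apply Subset.antisymm
  · rintro _ ⟨t, ht, rfl⟩
    refine ⟨brR_mem_cutHalf hn h1 hj ht, ?_⟩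
    rw [lFun_brR hn h1 hj ht]
    simp
  · rintro z ⟨hz, h⟩
    refine ⟨Real.exp (lFun n z).re, Real.exp_pos _, ?_⟩
    rw [brR, exp_angA_mul n j (Real.exp_pos _), Real.log_exp, ← h, re_add_im,
      exp_lFun n hz.1 (ne_one_of_mem_cutHalf hz), kInv_kFun hn hz.1]

theorem contDiffOn_kInv {n : ℕ} (hn : 2 ≤ n) : ContDiffOn ℝ ∞ (kInv n) (kFun n '' rightHalf) := by
  have h : DifferentiableOn ℂ (kInv n) (kFun n '' rightHalf) := fun w hw =>
    (hasDerivAt_kInv hn hw).differentiableAt.differentiableWithinAt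
  exact (h.contDiffOn (isOpen_range_kFun hn)).restrict_scalars ℝ

theorem hasDerivAt_brR {n j : ℕ} (hn : 2 ≤ n) (h1 : 1 ≤ j) (hj : j ≤ n - 1) {t : ℝ} (ht : 0 ≤ t) :
    HasDerivAt (brR n j) (((4 / n : ℂ) * exp ((2 / n) * log (hInt n (brR n j t))) /
      hInt n (brR n j t))⁻¹ * exp (angA n j * I)) t := by
  have h := hasDerivAt_kInv hn (mul_exp_angA_mem hn h1 hj ht)
  have h2 : HasDerivAt (fun x : ℂ => x * exp (angA n j * I)) (exp (angA n j * I)) (t : ℂ) := by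
    simpa using (hasDerivAt_id (t : ℂ)).mul_const (exp (angA n j * I))
  exact (HasDerivAt.comp (t : ℂ) h h2).comp_ofReal

theorem hInt_one {n : ℕ} (hn : 2 ≤ n) : hInt n 1 = 2 / n := by
  have h := hInt_deriv_eq (n := n) (by omega : 1 ≤ n) (z := 1) (by simp)
  have hn0 : (n : ℂ) ≠ 0 := by exact_mod_cast (by omega : n ≠ 0)
  rw [eq_div_iff hn0]
  linear_combination h

/-- $K$ is holomorphic at $1$ with positive derivative, since $H(1)=2/n$. Its inverse thus preserves
directions at $0$, and the branch leaves $1$ in the direction of the half-line of which it is the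
preimage. -/
theorem hasDerivAt_brR_zero {n j : ℕ} (hn : 2 ≤ n) (h1 : 1 ≤ j) (hj : j ≤ n - 1) :
    ∃ r : ℝ, 0 < r ∧ HasDerivAt (brR n j) (r * exp (angA n j * I)) 0 := by
  have h := hasDerivAt_brR hn h1 hj le_rfl
  have hn0 : (0:ℝ) < n := by exact_mod_cast (by omega : 0 < n)
  rw [brR_zero hn, hInt_one hn] at h
  refine ⟨((4 / n : ℝ) * Real.exp ((2 / n) * Real.log (2 / n)) / (2 / n))⁻¹, by positivity, ?_⟩
  refine h.congr_deriv ?_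
  congr 1
  rw [show (2 / n : ℂ) = ((2 / n : ℝ) : ℂ) by push_cast; rfl, ← ofReal_log (by positivity),
    ← ofReal_mul, ← ofReal_exp]
  push_cast
  ring

theorem tendsto_direction {β : ℝ → ℂ} {r : ℝ} {d : ℂ} (hr : 0 < r) (hd : ‖d‖ = 1)
    (h : HasDerivAt β (r * d) 0) :
    Tendsto (fun t => (β t - β 0) / (‖β t - β 0‖ : ℂ)) (𝓝[>] 0) (𝓝 d) := by
  have h1 : Tendsto (fun t : ℝ => t⁻¹ • (β t - β 0)) (𝓝[>] 0) (𝓝 (r * d)) := by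
    have := (hasDerivAt_iff_tendsto_slope_zero.1 h).mono_left
      (nhdsWithin_mono 0 (fun t ht => ne_of_gt ht : Ioi (0:ℝ) ⊆ {0}ᶜ))
    simpa using this
  have hrd : ‖(r : ℂ) * d‖ = r := by rw [norm_mul, hd, mul_one, norm_real, Real.norm_of_nonneg hr.le]
  have hr' : ((‖(r : ℂ) * d‖ : ℝ) : ℂ) ≠ 0 := by rw [hrd]; exact_mod_cast hr.ne'
  have h2 := h1.div ((continuous_ofReal.tendsto _).comp h1.norm) hr'
  have e : (r : ℂ) * d / (‖(r : ℂ) * d‖ : ℝ) = d := by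
    rw [hrd]
    have : (r : ℂ) ≠ 0 := by exact_mod_cast hr.ne'
    field_simp
  rw [e] at h2
  refine h2.congr' ?_
  filter_upwards [self_mem_nhdsWithin] with t ht
  have ht0 : (0:ℝ) < t := ht
  have ht' : (t : ℂ) ≠ 0 := by exact_mod_cast ht0.ne'
  simp only [Pi.div_apply, Function.comp, real_smul, ofReal_inv, norm_mul, norm_inv, norm_real,
    Real.norm_of_nonneg ht0.le, ofReal_mul]
  exact mul_div_mul_left _ _ (inv_ne_zero ht')

theorem notMem_realSegment_of_mem_cutHalf {z : ℂ} (hz : z ∈ cutHalf) : z ∉ realSegment := by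
  rintro ⟨x, hx, rfl⟩
  have := hz.2
  simp at this
  linarith [hx.2]

theorem mem_cutHalf_or {z : ℂ} (hz : 0 < z.re) : z ∈ cutHalf ∨ z ∈ realSegment := by
  by_cases h : z ∈ cutHalf
  · exact Or.inl h
  · right
    have h' : ¬ (z.im ≠ 0 ∨ 1 < z.re) := fun h' => h ⟨hz, h'⟩
    push Not at h'
    refine ⟨z.re, ⟨by linarith, h'.2⟩, ?_⟩
    apply Complex.ext <;> simp [h'.1]

theorem isBranch_brR {n j : ℕ} (hn : 2 ≤ n) (h1 : 1 ≤ j) (hj : j ≤ n - 1) :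
    IsBranch n 1 (exp (angA n j * I)) (n * angA n j / (2 * (n - 1))) (brR n j) where
  start := brR_zero hn j
  continuousOn t ht := (hasDerivAt_brR hn h1 hj ht).continuousAt.continuousWithinAt
  smooth := by
    have : ContDiff ℝ ∞ fun t : ℝ => (t : ℂ) * exp (angA n j * I) :=
      ofRealCLM.contDiff.mul contDiff_const
    exact (contDiffOn_kInv hn).comp this.contDiffOn
      fun t ht => mul_exp_angA_mem hn h1 hj (le_of_lt ht)
  regular t ht := by
    rw [(hasDerivAt_brR hn h1 hj ht.le).deriv]
    exact mul_ne_zero (inv_ne_zero (kFun_deriv_ne_zero hn (brR_re_pos hn h1 hj ht.le)))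
      (exp_ne_zero _)
  injOn s hs t ht h := by
    have h' := congrArg (kFun n) h
    rw [kFun_brR hn h1 hj hs, kFun_brR hn h1 hj ht] at h'
    exact_mod_cast mul_right_cancel₀ (exp_ne_zero _) h'
  notMem_segment t ht := notMem_realSegment_of_mem_cutHalf (brR_mem_cutHalf hn h1 hj ht)
  direction := by
    obtain ⟨r, hr, h⟩ := hasDerivAt_brR_zero hn h1 hj
    have := tendsto_direction hr (norm_exp_ofReal_mul_I _) h
    rwa [brR_zero hn] at this
  asymptotic := by
    have hn0 : (0:ℝ) < n := by exact_mod_cast (by omega : 0 < n)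
    have hn0' : (n : ℂ) ≠ 0 := by exact_mod_cast hn0.ne'
    -- Here $w=t^{n/2}$ is real and positive, so the bound on its imaginary part is $0$ and
    -- $\frac2n\log w=\log t$.
    refine isAsymptoticToRay_of_lFun hn (w := fun t => (Real.exp (n / 2 * Real.log t) : ℝ)) (c := 0)
      ?_ ?_ (Eventually.of_forall fun s => by rw [ofReal_im, abs_zero])
    · filter_upwards [eventually_gt_atTop 0] with t ht
      refine ⟨brR_mem_cutHalf hn h1 hj ht, ?_⟩
      rw [lFun_brR hn h1 hj ht, ← ofReal_log (Real.exp_pos _).le, Real.log_exp]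
      push_cast
      field_simp
    · simp only [ofReal_re]
      exact Real.tendsto_exp_atTop.comp (Real.tendsto_log_atTop.const_mul_atTop (by positivity))

/-! ### Asymptotic half-lines and isometries -/

theorem IsAsymptoticToRay.map {n : ℕ} {θ θ' : ℝ} {γ : ℝ → ℂ} {l : Filter ℝ}
    (h : IsAsymptoticToRay n θ γ l) (φ : ℂ ≃ₗᵢ[ℝ] ℂ) (hφ : φ (exp (θ * I)) = exp (θ' * I)) :
    IsAsymptoticToRay n θ' (fun s => φ (γ s)) l := by
  obtain ⟨h1, h2, h3⟩ := h
  have hray : φ '' ray θ = ray θ' := by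
    ext z
    constructor
    · rintro ⟨_, ⟨r, hr, rfl⟩, rfl⟩
      exact ⟨r, hr, by rw [← hφ, ← real_smul, map_smul, real_smul]⟩
    · rintro ⟨r, hr, rfl⟩
      exact ⟨_, ⟨r, hr, rfl⟩, by rw [← hφ, ← real_smul, map_smul, real_smul]⟩
  refine ⟨by simpa using h1, ?_, fun hn => ?_⟩
  · rw [← hφ]
    refine ((φ.continuous.tendsto _).comp h2).congr fun s => ?_
    simp only [Function.comp, φ.norm_map, div_eq_inv_mul, ← ofReal_inv, ← real_smul, map_smul]
  · refine (h3 hn).congr fun s => ?_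
    rw [← hray, Metric.infDist_image φ.isometry]

theorem IsAsymptoticToRay.comp_tendsto {n : ℕ} {θ : ℝ} {γ : ℝ → ℂ} {l l' : Filter ℝ}
    (h : IsAsymptoticToRay n θ γ l) {φ : ℝ → ℝ} (hφ : Tendsto φ l' l) :
    IsAsymptoticToRay n θ (fun s => γ (φ s)) l' :=
  ⟨h.1.comp hφ, h.2.1.comp hφ, fun hn => (h.2.2 hn).comp hφ⟩

theorem IsAsymptoticToRay.mul {n : ℕ} {θ θ' : ℝ} {γ : ℝ → ℂ} {l : Filter ℝ}
    (h : IsAsymptoticToRay n θ γ l) {s : ℂ} (hs : s = 1 ∨ s = -1)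
    (he : exp (θ' * I) = s * exp (θ * I)) : IsAsymptoticToRay n θ' (fun t => s * γ t) l := by
  rcases hs with rfl | rfl
  · have := h.map (θ' := θ') (LinearIsometryEquiv.refl ℝ ℂ) (by rw [he]; simp)
    simpa using this
  · have := h.map (θ' := θ') (LinearIsometryEquiv.neg ℝ) (by rw [he]; simp)
    simpa using this

/-! ### The trajectories in a chart -/

/-- The trajectories in the domain of a chart. -/
def traj (D : Set ℂ) (E : ℂ → ℂ) (c s : ℝ) : ℂ := Function.invFunOn E D (-s + c * I)

namespace IsChart
variable {n : ℕ} {D : Set ℂ} {E : ℂ → ℂ}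

theorem mem_image (h : IsChart n D E) {c : ℝ} (hc : 0 < c) (s : ℝ) : (-s + c * I : ℂ) ∈ E '' D := by
  rw [h.image]; simpa using hc

theorem traj_mem (h : IsChart n D E) {c : ℝ} (hc : 0 < c) (s : ℝ) : traj D E c s ∈ D :=
  Function.invFunOn_mem (h.mem_image hc s)

theorem map_traj (h : IsChart n D E) {c : ℝ} (hc : 0 < c) (s : ℝ) :
    E (traj D E c s) = -s + c * I := Function.invFunOn_eq (h.mem_image hc s)

theorem traj_eq (h : IsChart n D E) {z : ℂ} (hz : z ∈ D) : traj D E (E z).im (-(E z).re) = z := by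
  rw [traj, ofReal_neg, neg_neg, re_add_im]
  exact h.injOn.leftInvOn_invFunOn hz

theorem im_pos (h : IsChart n D E) {z : ℂ} (hz : z ∈ D) : 0 < (E z).im := by
  have : E z ∈ E '' D := mem_image_of_mem _ hz
  rwa [h.image] at this

theorem range_traj (h : IsChart n D E) {c : ℝ} (hc : 0 < c) :
    range (traj D E c) = {z | z ∈ D ∧ (E z).im = c} := by
  apply Subset.antisymm
  · rintro _ ⟨s, rfl⟩
    exact ⟨h.traj_mem hc s, by rw [h.map_traj hc]; simp⟩
  · rintro z ⟨hz, rfl⟩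
    exact ⟨_, h.traj_eq hz⟩

theorem hasDerivAt (h : IsChart n D E) : ∀ z ∈ D, HasDerivAt E (_root_.deriv E z) z := fun z hz => by
  obtain ⟨d, hd, -⟩ := h.deriv z hz
  rwa [hd.deriv]

theorem deriv_sq (h : IsChart n D E) {z : ℂ} (hz : z ∈ D) :
    _root_.deriv E z ^ 2 = 4 * (1 - z ^ 2) ^ (n - 2) := by
  obtain ⟨d, hd, h2⟩ := h.deriv z hz
  rwa [hd.deriv]

theorem deriv_ne (h : IsChart n D E) : ∀ z ∈ D, _root_.deriv E z ≠ 0 := fun z hz h0 => by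
  have := h.deriv_sq hz
  rw [h0, zero_pow two_ne_zero, eq_comm] at this
  exact mul_ne_zero (by norm_num) (pow_ne_zero _ (h.ne z hz)) this

theorem hasDerivAt_traj (h : IsChart n D E) {c : ℝ} (hc : 0 < c) (s : ℝ) :
    ∃ d : ℂ, HasDerivAt (traj D E c) d s ∧ d ^ 2 * (1 - traj D E c s ^ 2) ^ (n - 2) = 1 / 4 := by
  have h1 := hasDerivAt_invFunOn h.isOpen h.hasDerivAt h.deriv_ne h.injOn (h.mem_image hc s)
  have h2 : HasDerivAt (fun x : ℂ => -x + c * I) (-1) (s : ℂ) :=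
    ((hasDerivAt_id (s : ℂ)).neg).add_const _
  refine ⟨_, (HasDerivAt.comp (s : ℂ) h1 h2).comp_ofReal, ?_⟩
  have hz := h.traj_mem hc s
  have h3 := h.deriv_sq hz
  have h4 := pow_ne_zero (n - 2) (h.ne _ hz)
  rw [traj] at h3 h4 ⊢
  rw [mul_pow, inv_pow, h3]
  field_simp

theorem contDiffOn_traj (h : IsChart n D E) :
    ContDiffOn ℝ ∞ (fun x : ℝ × ℝ => traj D E x.1 x.2) (Ioi 0 ×ˢ univ) := by
  have h1 : DifferentiableOn ℂ (Function.invFunOn E D) (E '' D) := fun w hw =>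
    (hasDerivAt_invFunOn h.isOpen h.hasDerivAt h.deriv_ne h.injOn
      hw).differentiableAt.differentiableWithinAt
  have h2 := (h1.contDiffOn (n := ∞)
    (isOpen_image_of_hasDerivAt h.isOpen h.hasDerivAt h.deriv_ne)).restrict_scalars ℝ
  have h3 : ContDiff ℝ ∞ fun x : ℝ × ℝ => (-(x.2 : ℂ) + x.1 * I) :=
    (ofRealCLM.contDiff.comp contDiff_snd).neg.add
      ((ofRealCLM.contDiff.comp contDiff_fst).mul contDiff_const)
  exact h2.comp h3.contDiffOn fun x hx => h.mem_image hx.1 x.2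

/-- The quadratic differential is even, so $z\mapsto-z$ carries charts to charts; the cells attached
to $-1$ need no separate study. -/
theorem smul (h : IsChart n D E) {s : ℂ} (hs : s = 1 ∨ s = -1) :
    IsChart n {z | s * z ∈ D} (fun z => E (s * z)) := by
  have hsq : s * s = 1 := by rcases hs with rfl | rfl <;> norm_num
  have hsq' : ∀ z : ℂ, (s * z) ^ 2 = z ^ 2 := fun z => by linear_combination z ^ 2 * hsq
  refine ⟨h.isOpen.preimage (by fun_prop), fun z hz => by rw [← hsq']; exact h.ne _ hz,
    fun z hz => ?_, fun z hz w hw hzw => ?_, ?_⟩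
  · obtain ⟨d, hd, h2⟩ := h.deriv _ hz
    have h3 : HasDerivAt (fun x : ℂ => s * x) s z := by
      simpa using (hasDerivAt_id z).const_mul s
    refine ⟨_, HasDerivAt.comp z hd h3, ?_⟩
    rw [mul_pow, h2, hsq', sq s, hsq, mul_one]
  · exact mul_left_cancel₀ (left_ne_zero_of_mul (hsq ▸ one_ne_zero)) (h.injOn hz hw hzw)
  · rw [← h.image]
    apply Subset.antisymm
    · rintro _ ⟨z, hz, rfl⟩
      exact ⟨_, hz, rfl⟩
    · rintro _ ⟨z, hz, rfl⟩
      have e : s * (s * z) = z := by rw [← mul_assoc, hsq, one_mul]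
      exact ⟨s * z, by rwa [mem_ofPred_eq, e], by simp only [e]⟩

theorem traj_smul (h : IsChart n D E) {s : ℂ} (hs : s = 1 ∨ s = -1) {c : ℝ} (hc : 0 < c) (t : ℝ) :
    traj {z | s * z ∈ D} (fun z => E (s * z)) c t = s * traj D E c t := by
  have hsq : s * s = 1 := by rcases hs with rfl | rfl <;> norm_num
  have e : s * (s * traj D E c t) = traj D E c t := by rw [← mul_assoc, hsq, one_mul]
  refine (h.smul hs).injOn ((h.smul hs).traj_mem hc t) ?_ ?_
  · rw [mem_ofPred_eq, e]; exact h.traj_mem hc t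
  · rw [(h.smul hs).map_traj hc]
    simp only [e]
    rw [h.map_traj hc]

end IsChart

/-! ### Asymptotics of the trajectories -/

theorem log_neg_of_im_pos {w : ℂ} (hw : 0 < w.im) : log (-w) = log w - Real.pi * I := by
  have hw0 : w ≠ 0 := by rintro rfl; simp at hw
  have ha := arg_mem_of_im_pos hw
  have him : (log w - Real.pi * I).im = w.arg - Real.pi := by rw [sub_im, log_im]; simp
  have e : -w = exp (log w - Real.pi * I) := by
    rw [exp_sub, exp_log hw0, exp_pi_mul_I, div_neg, div_one]
  rw [e, log_exp] <;> rw [him] <;> linarith [Real.pi_pos]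

theorem lFun_eq_log_secE {n j : ℕ} (hn : 2 ≤ n) {z : ℂ} (hz : z ∈ secD n j) :
    lFun n z = (2 / n) * log (secE n j z) + angA n j * I := by
  have hn0 : (n : ℂ) ≠ 0 := by exact_mod_cast (by omega : n ≠ 0)
  rw [log_secE hn hz]
  field_simp
  ring

/-- As $s\to-\infty$ the chart value $-s+ic$ has argument tending to $0$, so the trajectory
approaches the direction of the $j$th branch. -/
theorem sec_asymptotic_atBot {n j : ℕ} (hn : 2 ≤ n) (h1 : 1 ≤ j) (hj : j + 1 ≤ n - 1) {c : ℝ}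
    (hc : 0 < c) : IsAsymptoticToRay n (n * angA n j / (2 * (n - 1)))
      (traj (secD n j) (secE n j) c) atBot := by
  have h := isChart_secE hn h1 hj
  refine isAsymptoticToRay_of_lFun hn (w := fun s : ℝ => -s + c * I) (c := c)
    (Eventually.of_forall fun s => ⟨(h.traj_mem hc s).1, ?_⟩) ?_
    (Eventually.of_forall fun s => by simp [abs_of_pos hc])
  · rw [lFun_eq_log_secE hn (h.traj_mem hc s), h.map_traj hc]
  · simpa using tendsto_neg_atBot_atTop

/-- As $s\to+\infty$ the argument of $-s+ic$ tends to $\pi$. Replacing this value by its opposite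
costs $\pi$ in the logarithm, hence $2\pi/n$ in $\arg K$, which is the step from the $j$th branch to
the next. -/
theorem sec_asymptotic_atTop {n j : ℕ} (hn : 2 ≤ n) (h1 : 1 ≤ j) (hj : j + 1 ≤ n - 1) {c : ℝ}
    (hc : 0 < c) : IsAsymptoticToRay n (n * angA n (j + 1) / (2 * (n - 1)))
      (traj (secD n j) (secE n j) c) atTop := by
  have h := isChart_secE hn h1 hj
  refine isAsymptoticToRay_of_lFun hn (w := fun s : ℝ => -(-s + c * I)) (c := c)
    (Eventually.of_forall fun s => ⟨(h.traj_mem hc s).1, ?_⟩) ?_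
    (Eventually.of_forall fun s => by simp [abs_of_pos hc])
  · rw [lFun_eq_log_secE hn (h.traj_mem hc s), h.map_traj hc, log_neg_of_im_pos (by simpa using hc),
      angA_succ]
    push_cast
    ring
  · simp only [neg_add_rev, neg_neg, add_re, neg_re, mul_re, ofReal_re, I_re, I_im, ofReal_im,
      mul_zero, zero_mul, sub_zero, neg_zero, zero_add]
    exact tendsto_id

/-- For $s<0$ the trajectory has $\operatorname{Re}F>0$ and so lies in the right half-plane. There
the chart $2F$ differs from that of the last sector by the real constant $2F(1)$, which does not
affect the limit. -/
theorem cross_asymptotic_atBot {n : ℕ} (hn : 2 ≤ n) {c : ℝ} (hc : 0 < c) :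
    IsAsymptoticToRay n (n * angA n (n - 1) / (2 * (n - 1)))
      (traj (crossD n) (fun z => 2 * fInt n z) c) atBot := by
  have h := isChart_crossD hn
  refine isAsymptoticToRay_of_lFun hn (w := fun s : ℝ => -s + c * I - 2 * aConst n) (c := c)
    ?_ ?_ (Eventually.of_forall fun s => by simp [abs_of_pos hc])
  · filter_upwards [eventually_lt_atBot 0] with s hs
    have hm := h.traj_mem hc s
    have hE := h.map_traj hc s
    have hre : 0 < (fInt n (traj (crossD n) (fun z => 2 * fInt n z) c s)).re := by
      have := congrArg re hE
      simp at this
      linarith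
    have hzre : 0 < (traj (crossD n) (fun z => 2 * fInt n z) c s).re := by
      rcases lt_trichotomy (traj (crossD n) (fun z => 2 * fInt n z) c s).re 0 with h' | h' | h'
      · linarith [(fInt_of_re_neg hn hm h').1]
      · linarith [(fInt_of_re_zero (n := n) h').1]
      · exact h'
    refine ⟨⟨hzre, Or.inl hm.1.ne'⟩, ?_⟩
    rw [lFun_eq_log_secE hn (mem_secD_of_mem_crossD hn hm hzre), secE_pred hn hzre hm.1, hE]
  · have : Tendsto (fun s : ℝ => -s + -(2 * aConst n)) atBot atTop :=
      tendsto_atTop_add_const_right _ _ tendsto_neg_atBot_atTop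
    refine this.congr fun s => ?_
    simp
    ring

/-- The reflection $z\mapsto-\bar z$ changes $F$ into $-\bar F$, so it maps the trajectory to itself
with $s$ and $-s$ exchanged. The other end is therefore the mirror image of the first. -/
theorem cross_asymptotic_atTop {n : ℕ} (hn : 2 ≤ n) {c : ℝ} (hc : 0 < c) :
    IsAsymptoticToRay n (n * angA n 1 / (2 * (n - 1)) + Real.pi)
      (traj (crossD n) (fun z => 2 * fInt n z) c) atTop := by
  have h := isChart_crossD hn
  have h1 := ((cross_asymptotic_atBot hn hc).map
    (θ' := n * angA n 1 / (2 * (n - 1)) + Real.pi)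
    (conjLIE.trans (LinearIsometryEquiv.neg ℝ)) ?_).comp_tendsto tendsto_neg_atTop_atBot
  · convert h1 using 1
    funext s
    have hm := h.traj_mem hc (-s)
    refine h.injOn (h.traj_mem hc s) (neg_conj_mem_crossD hm) ?_
    have hE : 2 * fInt n (traj (crossD n) (fun z => 2 * fInt n z) c (-s)) = -(-s : ℝ) + c * I :=
      h.map_traj hc (-s)
    rw [h.map_traj hc]
    change _ = 2 * fInt n (-conj (traj (crossD n) (fun z => 2 * fInt n z) c (-s)))
    rw [fInt_neg_conj n _ (mem_slitDom_of_im hm.1.ne'), mul_neg,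
      show (2 : ℂ) * conj (fInt n (traj (crossD n) (fun z => 2 * fInt n z) c (-s))) =
        conj (2 * fInt n (traj (crossD n) (fun z => 2 * fInt n z) c (-s))) by
          rw [map_mul, map_ofNat], hE]
    simp [add_comm]
  · have e := angA_neg hn (j := 1) (by omega)
    rw [← e]
    simp only [LinearIsometryEquiv.trans_apply, conjLIE_apply, LinearIsometryEquiv.coe_neg]
    rw [← exp_conj, map_mul, conj_ofReal, conj_I, ofReal_add, add_mul, exp_add, exp_pi_mul_I]
    push_cast
    rw [mul_neg_one]
    congr 2
    ring

/-! ### The charts and branches at `±1` -/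

/-- The domain which follows the `j`th branch at `1`. -/
def chD (n j : ℕ) : Set ℂ := if j = n - 1 then crossD n else secD n j

/-- The chart on `chD`. -/
def chE (n j : ℕ) : ℂ → ℂ := if j = n - 1 then fun z => 2 * fInt n z else secE n j

theorem isChart_ch {n j : ℕ} (hn : 2 ≤ n) (h1 : 1 ≤ j) (hj : j ≤ n - 1) :
    IsChart n (chD n j) (chE n j) := by
  by_cases h : j = n - 1
  · rw [chD, chE, if_pos h, if_pos h]; exact isChart_crossD hn
  · rw [chD, chE, if_neg h, if_neg h]; exact isChart_secE hn h1 (by omega)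

/-- The domain which follows the `j`th branch at `s = ±1`. -/
def sD (n : ℕ) (s : ℂ) (j : ℕ) : Set ℂ := {z | s * z ∈ chD n j}

/-- The chart on `sD`. -/
def sE (n : ℕ) (s : ℂ) (j : ℕ) (z : ℂ) : ℂ := chE n j (s * z)

/-- The `j`th branch at `s = ±1`. -/
def sB (n : ℕ) (s : ℂ) (j : ℕ) (t : ℝ) : ℂ := s * brR n j t

theorem isChart_sE {n j : ℕ} (hn : 2 ≤ n) (h1 : 1 ≤ j) (hj : j ≤ n - 1) {s : ℂ}
    (hs : s = 1 ∨ s = -1) : IsChart n (sD n s j) (sE n s j) := (isChart_ch hn h1 hj).smul hs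

theorem sq_eq_one_of_or {s : ℂ} (hs : s = 1 ∨ s = -1) : s * s = 1 := by
  rcases hs with rfl | rfl <;> norm_num

theorem norm_eq_one_of_or {s : ℂ} (hs : s = 1 ∨ s = -1) : ‖s‖ = 1 := by
  rcases hs with rfl | rfl <;> norm_num

theorem mem_realSegment_mul {s : ℂ} (hs : s = 1 ∨ s = -1) {z : ℂ} :
    s * z ∈ realSegment ↔ z ∈ realSegment := by
  rcases hs with rfl | rfl
  · simp
  · simp only [neg_mul, one_mul]
    constructor
    · rintro ⟨x, hx, h⟩
      exact ⟨-x, ⟨by linarith [hx.2], by linarith [hx.1]⟩, by rw [ofReal_neg, h, neg_neg]⟩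
    · rintro ⟨x, hx, rfl⟩
      exact ⟨-x, ⟨by linarith [hx.2], by linarith [hx.1]⟩, by simp⟩

theorem isBranch_sB {n j : ℕ} (hn : 2 ≤ n) (h1 : 1 ≤ j) (hj : j ≤ n - 1) {s : ℂ}
    (hs : s = 1 ∨ s = -1) {θ : ℝ}
    (hθ : exp (θ * I) = s * exp ((n * angA n j / (2 * (n - 1)) : ℝ) * I)) :
    IsBranch n s (s * exp (angA n j * I)) θ (sB n s j) := by
  have h := isBranch_brR hn h1 hj
  have hs0 : s ≠ 0 := left_ne_zero_of_mul ((sq_eq_one_of_or hs).symm ▸ one_ne_zero)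
  refine ⟨by rw [sB, h.start, mul_one], continuousOn_const.mul h.continuousOn,
    contDiffOn_const.mul h.smooth, fun t ht => ?_, fun t ht t' ht' he => ?_, fun t ht => ?_, ?_,
    h.asymptotic.mul hs hθ⟩
  · have := (hasDerivAt_brR hn h1 hj (le_of_lt ht))
    have h3 : deriv (sB n s j) t = s * deriv (brR n j) t := by
      have := (this.const_mul s).deriv
      rwa [← (hasDerivAt_brR hn h1 hj (le_of_lt ht)).deriv] at this
    rw [h3]
    exact mul_ne_zero hs0 (h.regular t ht)
  · exact h.injOn ht ht' (mul_left_cancel₀ hs0 he)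
  · rw [sB, mem_realSegment_mul hs]
    exact h.notMem_segment t ht
  · refine (h.direction.const_mul s).congr fun t => ?_
    rw [sB, show s * brR n j t - s = s * (brR n j t - 1) by ring, norm_mul, norm_eq_one_of_or hs,
      one_mul, mul_div_assoc]

theorem sTraj_eq {n j : ℕ} (hn : 2 ≤ n) (h1 : 1 ≤ j) (hj : j ≤ n - 1) {s : ℂ}
    (hs : s = 1 ∨ s = -1) {c : ℝ} (hc : 0 < c) :
    traj (sD n s j) (sE n s j) c = fun t => s * traj (chD n j) (chE n j) c t :=
  funext fun t => (isChart_ch hn h1 hj).traj_smul hs hc t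

theorem sTraj_asymptotic_atBot {n j : ℕ} (hn : 2 ≤ n) (h1 : 1 ≤ j) (hj : j ≤ n - 1) {s : ℂ}
    (hs : s = 1 ∨ s = -1) {c : ℝ} (hc : 0 < c) {θ : ℝ}
    (hθ : exp (θ * I) = s * exp ((n * angA n j / (2 * (n - 1)) : ℝ) * I)) :
    IsAsymptoticToRay n θ (traj (sD n s j) (sE n s j) c) atBot := by
  rw [sTraj_eq hn h1 hj hs hc]
  refine IsAsymptoticToRay.mul ?_ hs hθ
  by_cases h : j = n - 1
  · rw [chD, chE, if_pos h, if_pos h, h]; exact cross_asymptotic_atBot hn hc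
  · rw [chD, chE, if_neg h, if_neg h]; exact sec_asymptotic_atBot hn h1 (by omega) hc

theorem sTraj_asymptotic_atTop {n j : ℕ} (hn : 2 ≤ n) (h1 : 1 ≤ j) (hj : j + 1 ≤ n - 1) {s : ℂ}
    (hs : s = 1 ∨ s = -1) {c : ℝ} (hc : 0 < c) {θ : ℝ}
    (hθ : exp (θ * I) = s * exp ((n * angA n (j + 1) / (2 * (n - 1)) : ℝ) * I)) :
    IsAsymptoticToRay n θ (traj (sD n s j) (sE n s j) c) atTop := by
  rw [sTraj_eq hn h1 (by omega) hs hc]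
  refine IsAsymptoticToRay.mul ?_ hs hθ
  have h : j ≠ n - 1 := by omega
  rw [chD, chE, if_neg h, if_neg h]
  exact sec_asymptotic_atTop hn h1 hj hc

theorem sTraj_asymptotic_atTop_pred {n : ℕ} (hn : 2 ≤ n) {s : ℂ}
    (hs : s = 1 ∨ s = -1) {c : ℝ} (hc : 0 < c) {θ : ℝ}
    (hθ : exp (θ * I) = -s * exp ((n * angA n 1 / (2 * (n - 1)) : ℝ) * I)) :
    IsAsymptoticToRay n θ (traj (sD n s (n - 1)) (sE n s (n - 1)) c) atTop := by
  rw [sTraj_eq hn (by omega) le_rfl hs hc]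
  refine IsAsymptoticToRay.mul (θ := n * angA n 1 / (2 * (n - 1)) + Real.pi) ?_ hs ?_
  · rw [chD, chE, if_pos rfl, if_pos rfl]
    exact cross_asymptotic_atTop hn hc
  · rw [hθ, ofReal_add, add_mul, exp_add, exp_pi_mul_I]
    ring

/-! ### The partition of the plane -/

/-- In the right half-plane a cell attached to $1$ is seen as an interval of $\arg K$. The only cell
attached to $-1$ that enters it is the one crossing the negative imaginary axis, seen as the
arguments below the first branch. Disjointness thus becomes a comparison of angles. -/
theorem mem_sD_of_re_pos {n j : ℕ} (hn : 2 ≤ n) {s : ℂ} (hs : s = 1 ∨ s = -1) {z : ℂ}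
    (hz : 0 < z.re) (h : z ∈ sD n s j) : z ∈ cutHalf ∧
      ((s = 1 ∧ angA n j < (lFun n z).im ∧ (lFun n z).im < angA n (j + 1)) ∨
        (s = -1 ∧ j = n - 1 ∧ (lFun n z).im < angA n 1)) := by
  rcases hs with rfl | rfl
  · have h' : z ∈ chD n j := by simpa [sD] using h
    by_cases hj : j = n - 1
    · rw [chD, if_pos hj] at h'
      have := mem_secD_of_mem_crossD hn h' hz
      rw [← hj] at this
      exact ⟨this.1, Or.inl ⟨rfl, this.2⟩⟩
    · rw [chD, if_neg hj] at h'
      exact ⟨h'.1, Or.inl ⟨rfl, h'.2⟩⟩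
  · have h' : -z ∈ chD n j := by simpa [sD] using h
    by_cases hj : j = n - 1
    · rw [chD, if_pos hj] at h'
      have him := h'.1
      rw [neg_im] at him
      have hc : z ∈ cutHalf := ⟨hz, Or.inl (by linarith)⟩
      have h3 := h'.2.2 (by simpa using hz)
      rw [map_neg, neg_neg, lFun_conj n hc, conj_im, ← neg_neg (angA n (n - 1)),
        angA_neg hn (Nat.sub_le n 1), Nat.sub_sub_self (by omega)] at h3
      exact ⟨hc, Or.inr ⟨rfl, hj, by linarith⟩⟩
    · rw [chD, if_neg hj] at h'
      have := h'.1.1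
      rw [neg_re] at this
      linarith

theorem neg_mem_sD {n j : ℕ} {s z : ℂ} : -z ∈ sD n s j ↔ z ∈ sD n (-s) j := by
  simp [sD]

theorem mem_sD_of_re_zero {n j : ℕ} {s : ℂ} (hs : s = 1 ∨ s = -1) {z : ℂ}
    (hz : z.re = 0) (h : z ∈ sD n s j) :
    j = n - 1 ∧ ((s = 1 ∧ 0 < z.im) ∨ (s = -1 ∧ z.im < 0)) := by
  have hj : j = n - 1 := by
    by_contra hj
    rw [sD, mem_ofPred_eq, chD, if_neg hj] at h
    have := h.1.1
    rcases hs with rfl | rfl <;> simp [hz] at this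
  refine ⟨hj, ?_⟩
  rw [sD, mem_ofPred_eq, chD, if_pos hj] at h
  have := h.1
  rcases hs with rfl | rfl
  · left; simpa using this
  · right; simpa using this

theorem lt_of_angA_lt {n i j : ℕ} (hn : 2 ≤ n) {x : ℝ} (h1 : angA n i < x) (h2 : x < angA n j) :
    i < j := (angA_strictMono hn).lt_iff_lt.1 (h1.trans h2)

theorem sD_unique {n i j : ℕ} (hn : 2 ≤ n) (hi1 : 1 ≤ i) (hj1 : 1 ≤ j) {s t : ℂ}
    (hs : s = 1 ∨ s = -1) (ht : t = 1 ∨ t = -1) {z : ℂ} (h : z ∈ sD n s i) (h' : z ∈ sD n t j) :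
    s = t ∧ i = j := by
  have key : ∀ s t z : ℂ, (s = 1 ∨ s = -1) → (t = 1 ∨ t = -1) → 0 < z.re → z ∈ sD n s i →
      z ∈ sD n t j → s = t ∧ i = j := by
    intro s t z hs ht hz h h'
    obtain ⟨-, ⟨a1, a2, a3⟩ | ⟨a1, a2, a3⟩⟩ := mem_sD_of_re_pos hn hs hz h <;>
      obtain ⟨-, ⟨b1, b2, b3⟩ | ⟨b1, b2, b3⟩⟩ := mem_sD_of_re_pos hn ht hz h'
    · have := lt_of_angA_lt hn a2 b3
      have := lt_of_angA_lt hn b2 a3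
      exact ⟨by rw [a1, b1], by omega⟩
    · have := lt_of_angA_lt hn a2 b3
      omega
    · have := lt_of_angA_lt hn b2 a3
      omega
    · exact ⟨by rw [a1, b1], by rw [a2, b2]⟩
  rcases lt_trichotomy z.re 0 with hz | hz | hz
  · have := key (-s) (-t) (-z) (by rcases hs with rfl | rfl <;> simp)
      (by rcases ht with rfl | rfl <;> simp) (by simpa using hz) (by simpa [neg_mem_sD] using h)
      (by simpa [neg_mem_sD] using h')
    exact ⟨neg_injective this.1, this.2⟩
  · obtain ⟨a, ⟨a1, a2⟩ | ⟨a1, a2⟩⟩ := mem_sD_of_re_zero hs hz h <;>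
      obtain ⟨b, ⟨b1, b2⟩ | ⟨b1, b2⟩⟩ := mem_sD_of_re_zero ht hz h' <;>
      first
      | (exfalso; linarith)
      | exact ⟨a1.trans b1.symm, a.trans b.symm⟩
  · exact key s t z hs ht hz h h'

theorem mem_sB_iff {n j : ℕ} (hn : 2 ≤ n) (h1 : 1 ≤ j) (hj : j ≤ n - 1) {s : ℂ}
    (hs : s = 1 ∨ s = -1) {z : ℂ} :
    z ∈ sB n s j '' Ioi 0 ↔ s * z ∈ cutHalf ∧ (lFun n (s * z)).im = angA n j := by
  have h := image_brR hn h1 hj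
  have hsq := sq_eq_one_of_or hs
  have e : ∀ z : ℂ, s * (s * z) = z := fun z => by rw [← mul_assoc, hsq, one_mul]
  constructor
  · rintro ⟨t, ht, rfl⟩
    rw [sB, e]
    exact h.subset (mem_image_of_mem _ ht)
  · intro h'
    obtain ⟨t, ht, h2⟩ := h.superset h'
    exact ⟨t, ht, by rw [sB, h2, e]⟩

theorem re_of_mem_sB {n j : ℕ} (hn : 2 ≤ n) (h1 : 1 ≤ j) (hj : j ≤ n - 1) {s : ℂ}
    (hs : s = 1 ∨ s = -1) {z : ℂ} (h : z ∈ sB n s j '' Ioi 0) :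
    (s = 1 ∧ 0 < z.re) ∨ (s = -1 ∧ z.re < 0) := by
  have := ((mem_sB_iff hn h1 hj hs).1 h).1.1
  rcases hs with rfl | rfl
  · left; simpa using this
  · right; simpa using this

theorem sB_unique {n i j : ℕ} (hn : 2 ≤ n) (hi1 : 1 ≤ i) (hi : i ≤ n - 1) (hj1 : 1 ≤ j)
    (hj : j ≤ n - 1) {s t : ℂ} (hs : s = 1 ∨ s = -1) (ht : t = 1 ∨ t = -1) {z : ℂ}
    (h : z ∈ sB n s i '' Ioi 0) (h' : z ∈ sB n t j '' Ioi 0) : s = t ∧ i = j := by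
  have hst : s = t := by
    rcases re_of_mem_sB hn hi1 hi hs h with ⟨a, b⟩ | ⟨a, b⟩ <;>
      rcases re_of_mem_sB hn hj1 hj ht h' with ⟨c, d⟩ | ⟨c, d⟩ <;>
      first
      | (exfalso; linarith)
      | exact a.trans c.symm
  subst hst
  refine ⟨rfl, (angA_strictMono hn).injective ?_⟩
  rw [← ((mem_sB_iff hn hi1 hi hs).1 h).2, ((mem_sB_iff hn hj1 hj hs).1 h').2]

theorem sD_disjoint_sB {n i j : ℕ} (hn : 2 ≤ n) (hj1 : 1 ≤ j)
    (hj : j ≤ n - 1) {s t : ℂ} (hs : s = 1 ∨ s = -1) (ht : t = 1 ∨ t = -1) {z : ℂ}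
    (h : z ∈ sD n s i) (h' : z ∈ sB n t j '' Ioi 0) : False := by
  have key : ∀ s z : ℂ, (s = 1 ∨ s = -1) → z ∈ sD n s i → z ∈ sB n 1 j '' Ioi 0 → False := by
    intro s z hs h h'
    rw [mem_sB_iff hn hj1 hj (Or.inl rfl), one_mul] at h'
    obtain ⟨-, ⟨a1, a2, a3⟩ | ⟨a1, a2, a3⟩⟩ := mem_sD_of_re_pos hn hs h'.1.1 h
    · rw [h'.2] at a2 a3
      have := (angA_strictMono hn).lt_iff_lt.1 a2
      have := (angA_strictMono hn).lt_iff_lt.1 a3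
      omega
    · rw [h'.2] at a3
      have := (angA_strictMono hn).lt_iff_lt.1 a3
      omega
  rcases ht with rfl | rfl
  · exact key s z hs h h'
  · refine key (-s) (-z) (by rcases hs with rfl | rfl <;> simp) (by simpa [neg_mem_sD] using h) ?_
    rw [mem_sB_iff hn hj1 hj (Or.inr rfl)] at h'
    rw [mem_sB_iff hn hj1 hj (Or.inl rfl)]
    simpa using h'

theorem notMem_realSegment_of_mem_sD {n j : ℕ} (hn : 2 ≤ n) {s : ℂ} (hs : s = 1 ∨ s = -1) {z : ℂ}
    (h : z ∈ sD n s j) : z ∉ realSegment := by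
  rcases lt_trichotomy z.re 0 with hz | hz | hz
  · have := (mem_sD_of_re_pos hn (s := -s) (z := -z) (j := j)
      (by rcases hs with rfl | rfl <;> simp) (by simpa using hz) (by simpa [neg_mem_sD] using h)).1
    have h2 := notMem_realSegment_of_mem_cutHalf this
    rwa [← neg_one_mul, mem_realSegment_mul (Or.inr rfl)] at h2
  · rintro ⟨x, hx, rfl⟩
    obtain ⟨-, ⟨-, a⟩ | ⟨-, a⟩⟩ := mem_sD_of_re_zero hs hz h <;> simp at a
  · exact notMem_realSegment_of_mem_cutHalf (mem_sD_of_re_pos hn hs hz h).1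

theorem exists_cell {n : ℕ} (hn : 2 ≤ n) {x : ℝ} (h1 : -Real.pi < x) (h2 : x < Real.pi) :
    ∃ j < n, angA n j ≤ x ∧ x < angA n (j + 1) := by
  classical
  have hex : ∃ m, x < angA n m := ⟨n, by rwa [angA_self hn]⟩
  have hm := Nat.find_spec hex
  set m := Nat.find hex
  have hm0 : m ≠ 0 := by
    intro h
    rw [h, angA_zero] at hm
    linarith
  have hmn : m ≤ n := Nat.find_min' hex (by rwa [angA_self hn])
  refine ⟨m - 1, by omega, ?_, by rwa [Nat.sub_add_cancel (by omega)]⟩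
  exact not_lt.1 (Nat.find_min hex (by omega : m - 1 < m))

theorem im_pos_of_lFun {n : ℕ} (hn : 2 ≤ n) {z : ℂ} (hz : z ∈ cutHalf) (h : 0 < (lFun n z).im) :
    0 < z.im := by
  rw [← kFun_arg_of_mem_cutHalf hn hz] at h
  refine kFun_im_pos hn hz.1 ?_
  have h1 := abs_lFun_im_lt hn hz
  rw [← kFun_arg_of_mem_cutHalf hn hz] at h1
  have h2 := (abs_lt.1 h1).2
  by_contra hcon
  rcases (not_lt.1 hcon).eq_or_lt with h3 | h3
  · rcases le_or_gt 0 (kFun n z).re with h4 | h4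
    · rw [arg_eq_zero_iff.2 ⟨h4, h3⟩] at h; exact lt_irrefl _ h
    · rw [arg_eq_pi_iff.2 ⟨h4, h3⟩] at h2; exact lt_irrefl _ h2
  · exact absurd (arg_neg_iff.2 h3) (not_lt.2 h.le)

/-- For $\operatorname{Re}z>0$ off the segment, $\arg K$ falls into one of $n$ half-open intervals,
whose left endpoint corresponds to a branch. The left half-plane follows by $z\mapsto-z$, and on the
imaginary axis only the two crossing cells and the origin occur. -/
theorem mem_partition {n : ℕ} (hn : 2 ≤ n) (z : ℂ) : z ∈ realSegment ∨
    ∃ s : ℂ, (s = 1 ∨ s = -1) ∧ ∃ j, 1 ≤ j ∧ j ≤ n - 1 ∧ (z ∈ sB n s j '' Ioi 0 ∨ z ∈ sD n s j) := by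
  have key : ∀ z : ℂ, 0 < z.re → z ∈ realSegment ∨ ∃ s : ℂ, (s = 1 ∨ s = -1) ∧
      ∃ j, 1 ≤ j ∧ j ≤ n - 1 ∧ (z ∈ sB n s j '' Ioi 0 ∨ z ∈ sD n s j) := by
    intro z hz
    rcases mem_cutHalf_or hz with hc | hc
    · right
      have hL := abs_lt.1 (abs_lFun_im_lt hn hc)
      obtain ⟨j, hj, h1, h2⟩ := exists_cell hn hL.1 hL.2
      -- The interval numbered $0$ starts at $-\pi$, where there is no branch: it belongs to the
      -- crossing cell attached to $-1$, as is seen after conjugation.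
      rcases Nat.eq_zero_or_pos j with rfl | hj0
      · refine ⟨-1, Or.inr rfl, n - 1, by omega, le_rfl, Or.inr ?_⟩
        have e := angA_neg hn (j := 1) (by omega)
        rw [zero_add] at h2
        have hnn := angA_pred_nonneg hn
        have hcc := conj_mem_cutHalf hc
        have hLc : (lFun n (conj z)).im = -(lFun n z).im := by rw [lFun_conj n hc, conj_im]
        have him := im_pos_of_lFun hn hcc (by rw [hLc]; linarith)
        rw [conj_im] at him
        rw [sD, mem_ofPred_eq, chD, if_pos rfl]
        refine ⟨by simpa using him, fun h => ?_, fun _ => ?_⟩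
        · have : z.re < 0 := by simpa using h
          linarith
        · have e2 : -conj (-1 * z) = conj z := by simp
          rw [e2, hLc, ← e]
          linarith
      · refine ⟨1, Or.inl rfl, j, hj0, by omega, ?_⟩
        rcases h1.eq_or_lt with h1 | h1
        · left
          rw [mem_sB_iff hn hj0 (by omega) (Or.inl rfl), one_mul]
          exact ⟨hc, h1.symm⟩
        · right
          rw [sD, mem_ofPred_eq, one_mul, chD]
          split_ifs with hjn
          · rw [hjn] at h1
            refine ⟨im_pos_of_lFun hn hc (lt_of_le_of_lt (angA_pred_nonneg hn) h1), fun _ => h1,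
              fun h => absurd h (not_lt.2 hz.le)⟩
          · exact ⟨hc, h1, h2⟩
    · exact Or.inl hc
  rcases lt_trichotomy z.re 0 with hz | hz | hz
  · rcases key (-z) (by simpa using hz) with h | ⟨s, hs, j, h1, hj, h⟩
    · left
      rwa [← neg_one_mul, mem_realSegment_mul (Or.inr rfl)] at h
    · refine Or.inr ⟨-s, by rcases hs with rfl | rfl <;> simp, j, h1, hj, h.imp (fun h => ?_)
        neg_mem_sD.1⟩
      rw [mem_sB_iff hn h1 hj hs] at h
      rw [mem_sB_iff hn h1 hj (by rcases hs with rfl | rfl <;> simp)]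
      simpa using h
  · rcases lt_trichotomy z.im 0 with hi | hi | hi
    · refine Or.inr ⟨-1, Or.inr rfl, n - 1, by omega, le_rfl, Or.inr ?_⟩
      rw [sD, mem_ofPred_eq, chD, if_pos rfl]
      refine ⟨by simpa using hi, ?_, ?_⟩ <;> simp [hz]
    · left
      exact ⟨0, by simp, by apply Complex.ext <;> simp [hz, hi]⟩
    · refine Or.inr ⟨1, Or.inl rfl, n - 1, by omega, le_rfl, Or.inr ?_⟩
      rw [sD, mem_ofPred_eq, chD, if_pos rfl, one_mul]
      refine ⟨hi, ?_, ?_⟩ <;> simp [hz]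
  · exact key z hz

/-! ### Leaves -/

/-- A subset of the plane which is locally the set where the imaginary part of a chart is
constant. -/
def IsLeaf (n : ℕ) (S : Set ℂ) : Prop :=
  ∀ z₀ ∈ S, ∃ E : ℂ → ℂ, ∀ᶠ z in 𝓝 z₀,
    (∃ d, HasDerivAt E d z ∧ d ^ 2 = 4 * (1 - z ^ 2) ^ (n - 2)) ∧ (z ∈ S ↔ (E z).im = (E z₀).im)

theorem IsChart.isLeaf {n : ℕ} {D : Set ℂ} {E : ℂ → ℂ} (h : IsChart n D E) {c : ℝ} (hc : 0 < c) :
    IsLeaf n (range (traj D E c)) := by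
  rw [h.range_traj hc]
  rintro z₀ ⟨hz₀, hE⟩
  refine ⟨E, ?_⟩
  filter_upwards [h.isOpen.mem_nhds hz₀] with z hz
  exact ⟨h.deriv z hz, by rw [hE]; exact and_iff_right hz⟩

theorem IsLeaf.smul {n : ℕ} {S : Set ℂ} (h : IsLeaf n S) {s : ℂ} (hs : s = 1 ∨ s = -1) :
    IsLeaf n {z | s * z ∈ S} := by
  intro z₀ hz₀
  obtain ⟨E, hE⟩ := h _ hz₀
  have hsq := sq_eq_one_of_or hs
  refine ⟨fun z => E (s * z), ?_⟩
  have hc : Continuous fun z : ℂ => s * z := by fun_prop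
  filter_upwards [hc.continuousAt.eventually hE] with z hz
  obtain ⟨⟨d, hd, h2⟩, h3⟩ := hz
  refine ⟨⟨_, HasDerivAt.comp z hd ((hasDerivAt_id z).const_mul s), ?_⟩, h3⟩
  rw [mul_one, mul_pow, h2, mul_pow, sq s, hsq, mul_one, one_mul]

/-- On the branch the exponent in `secE` is real. Nearby its imaginary part stays in $(-\pi,\pi)$,
where the sine vanishes only at $0$, so $\operatorname{Im}$ `secE` $=0$ characterizes the branch
locally. -/
theorem isLeaf_brR {n j : ℕ} (hn : 2 ≤ n) (h1 : 1 ≤ j) (hj : j ≤ n - 1) :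
    IsLeaf n (brR n j '' Ioi 0) := by
  rw [image_brR hn h1 hj]
  rintro z₀ ⟨hz₀, hL⟩
  have hn0 : (0:ℝ) < n := by exact_mod_cast (by omega : 0 < n)
  refine ⟨secE n j, ?_⟩
  have hc : ContinuousAt (fun z => ((n / 2 : ℂ) * (lFun n z - angA n j * I)).im) z₀ :=
    continuous_im.continuousAt.comp
      (continuousAt_const.mul ((hasDerivAt_lFun hn hz₀).continuousAt.sub continuousAt_const))
  have h0 : ((n / 2 : ℂ) * (lFun n z₀ - angA n j * I)).im = 0 := by
    rw [lFun_sub_im, hL, sub_self, mul_zero]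
  have hE0 : (secE n j z₀).im = 0 := by rw [secE, exp_im, h0, Real.sin_zero, mul_zero]
  have hnear := hc.eventually (Ioo_mem_nhds (a := -Real.pi) (b := Real.pi)
    ((neg_lt_zero.2 Real.pi_pos).trans_eq h0.symm) (h0.trans_lt Real.pi_pos))
  filter_upwards [isOpen_cutHalf.mem_nhds hz₀, hnear] with z hz hzn
  refine ⟨hasDerivAt_secE hn j hz, ?_⟩
  rw [hE0, secE, exp_im, mul_eq_zero, or_iff_right (Real.exp_pos _).ne',
    and_iff_right hz, Real.sin_eq_zero_iff_of_lt_of_lt hzn.1 hzn.2, lFun_sub_im, mul_eq_zero,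
    or_iff_right (by positivity), sub_eq_zero]

theorem isLeaf_sB {n j : ℕ} (hn : 2 ≤ n) (h1 : 1 ≤ j) (hj : j ≤ n - 1) {s : ℂ}
    (hs : s = 1 ∨ s = -1) : IsLeaf n (sB n s j '' Ioi 0) := by
  have h := (isLeaf_brR hn h1 hj).smul hs
  have : sB n s j '' Ioi 0 = {z | s * z ∈ brR n j '' Ioi 0} := by
    ext z
    rw [mem_sB_iff hn h1 hj hs, mem_ofPred_eq, image_brR hn h1 hj]
    rfl
  rwa [this]

/-- $F$ is real on the segment. Conversely, if $F(z)$ is real near a point of the segment, then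
$F(\bar z)=F(z)$, and local injectivity of $F$ forces $\bar z=z$. -/
theorem isLeaf_segment (n : ℕ) : IsLeaf n (ofReal '' Ioo (-1 : ℝ) 1) := by
  rintro _ ⟨x, hx, rfl⟩
  have hs : (x : ℂ) ∈ slitDom := mem_slitDom_of_re (by
    rw [ofReal_re]; exact abs_lt.2 hx)
  have hreal : ∀ z ∈ slitDom, conj z = z → (fInt n z).im = 0 := fun z hz h => by
    have := fInt_conj n hz
    rw [h] at this
    exact conj_eq_iff_im.1 this.symm
  refine ⟨fun z => 2 * fInt n z, ?_⟩
  have ha : AnalyticAt ℂ (fInt n) (x : ℂ) := DifferentiableOn.analyticAt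
    (fun w hw => (hasDerivAt_fInt n hw).differentiableAt.differentiableWithinAt)
    (isOpen_slitDom.mem_nhds hs)
  have hd := ha.hasStrictDerivAt
  rw [(hasDerivAt_fInt n hs).deriv] at hd
  have hne : csqrt (1 - (x : ℂ) ^ 2) ^ (n - 2) ≠ 0 := pow_ne_zero _ (csqrt_ne_zero _)
  have hinv := (hd.hasStrictFDerivAt_equiv hne).eventually_left_inverse
  have hinv' : ∀ᶠ z : ℂ in 𝓝 (x : ℂ), (hd.hasStrictFDerivAt_equiv hne).localInverse _ _ _
      (fInt n (conj z)) = conj z := by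
    have : Tendsto (fun z : ℂ => conj z) (𝓝 (x : ℂ)) (𝓝 (x : ℂ)) := by
      have := continuous_conj.tendsto (x : ℂ)
      rwa [conj_ofReal] at this
    exact this.eventually hinv
  have hre : ∀ᶠ z : ℂ in 𝓝 (x : ℂ), z.re ∈ Ioo (-1 : ℝ) 1 :=
    continuous_re.continuousAt.eventually (isOpen_Ioo.mem_nhds (by simpa using hx))
  filter_upwards [hinv, hinv', hre, isOpen_slitDom.mem_nhds hs] with z h1 h2 h3 hz
  refine ⟨⟨_, (hasDerivAt_fInt n hz).const_mul 2, ?_⟩, ?_⟩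
  · rw [mul_pow, ← pow_mul, mul_comm (n - 2) 2, pow_mul, csqrt_sq (slitPlane_ne_zero hz)]
    norm_num
  · have e0 : (2 * fInt n (x : ℂ)).im = 0 := by
      rw [two_mul_im, hreal _ hs (conj_ofReal x), mul_zero]
    rw [e0, two_mul_im, mul_eq_zero, or_iff_right two_ne_zero]
    constructor
    · rintro ⟨y, hy, rfl⟩
      exact hreal _ hz (conj_ofReal y)
    · intro h
      have e := conj_eq_iff_im.2 h
      rw [← fInt_conj n hz] at e
      rw [e, h1] at h2
      exact ⟨z.re, h3, conj_eq_iff_re.1 h2.symm⟩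

/-! ### Curves contained in a leaf. -/

theorem exists_sq_eq_iff (x : ℂ) : (∃ r : ℝ, 0 ≤ r ∧ x ^ 2 = r) ↔ x.im = 0 := by
  constructor
  · rintro ⟨r, hr, h⟩
    have h1 := congrArg re h
    have h2 := congrArg im h
    simp only [sq, mul_re, mul_im, ofReal_re, ofReal_im] at h1 h2
    rcases eq_or_ne x.im 0 with h3 | h3
    · exact h3
    · have h4 : x.re = 0 := by
        have : x.re * x.im = 0 := by linarith
        exact (mul_eq_zero.1 this).resolve_right h3
      rw [h4] at h1
      nlinarith [mul_self_pos.2 h3]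
  · intro h
    refine ⟨x.re ^ 2, sq_nonneg _, ?_⟩
    have : x = x.re := by apply Complex.ext <;> simp [h]
    rw [this]; simp

/-- The curves along which `γ'² (1 - γ²)^{n-2}` is positive are the regular curves contained in
the leaves. -/
theorem curve_mem_leaf_iff {n : ℕ} {𝓛 : Set (Set ℂ)} (hL : ∀ S ∈ 𝓛, IsLeaf n S)
    (hd : ∀ S ∈ 𝓛, ∀ T ∈ 𝓛, ∀ z ∈ S, z ∈ T → S = T) {γ : ℝ → ℂ} (hγ : ContDiff ℝ 1 γ)
    (hcov : ∀ s, ∃ S ∈ 𝓛, γ s ∈ S) :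
    (∀ s, ∃ r : ℝ, 0 ≤ r ∧ deriv γ s ^ 2 * (1 - γ s ^ 2) ^ (n - 2) = r) ↔
      ∃ S ∈ 𝓛, range γ ⊆ S := by
  have hγd : ∀ s, HasDerivAt γ (deriv γ s) s := fun s =>
    (hγ.differentiable one_ne_zero s).hasDerivAt
  -- The square of $(E\circ\gamma)'$ is $4\gamma'^2(1-\gamma^2)^{n-2}$. It is a nonnegative real
  -- exactly when $(E\circ\gamma)'$ is real, that is, when $\operatorname{Im}E\circ\gamma$ has zero
  -- derivative.
  have key : ∀ E : ℂ → ℂ, ∀ s : ℝ, (∃ d, HasDerivAt E d (γ s) ∧ d ^ 2 = 4 * (1 - γ s ^ 2) ^ (n - 2)) →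
      HasDerivAt (fun s => (E (γ s)).im) (deriv E (γ s) * deriv γ s).im s ∧
      ((∃ r : ℝ, 0 ≤ r ∧ deriv γ s ^ 2 * (1 - γ s ^ 2) ^ (n - 2) = r) ↔
        (deriv E (γ s) * deriv γ s).im = 0) := by
    rintro E s ⟨d, hd, h2⟩
    refine ⟨?_, ?_⟩
    · rw [hd.deriv]
      have h3 : HasDerivAt (fun s => E (γ s)) (d * deriv γ s) s := hd.comp_of_eq s (hγd s) rfl
      exact imCLM.hasFDerivAt.comp_hasDerivAt s h3
    · rw [← exists_sq_eq_iff, mul_pow, hd.deriv, h2]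
      constructor
      · rintro ⟨r, hr, h⟩
        exact ⟨4 * r, by positivity, by push_cast; rw [← h]; ring⟩
      · rintro ⟨r, hr, h⟩
        exact ⟨r / 4, by positivity, by push_cast; rw [← h]; ring⟩
  constructor
  · intro h
    -- On a small interval $\operatorname{Im}E\circ\gamma$ is constant, so the curve remains in the
    -- leaf for nearby parameters.
    have hopen : ∀ S ∈ 𝓛, IsOpen (γ ⁻¹' S) := by
      intro S hS
      rw [isOpen_iff_mem_nhds]
      intro s hs
      obtain ⟨E, hE⟩ := hL S hS _ hs
      obtain ⟨ε, hε, hb⟩ := Metric.eventually_nhds_iff_ball.1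
        (hγ.continuous.continuousAt.eventually hE)
      filter_upwards [Metric.ball_mem_nhds s hε] with t ht
      refine ((hb t ht).2).2 ?_
      have hconst := (convex_ball s ε).is_const_of_fderivWithin_eq_zero (𝕜 := ℝ)
        (f := fun s => (E (γ s)).im) ?_ ?_ ht (Metric.mem_ball_self hε)
      · exact hconst
      · intro x hx
        exact (key E x (hb x hx).1).1.differentiableAt.differentiableWithinAt
      · intro x hx
        have h4 := (key E x (hb x hx).1).1
        rw [((key E x (hb x hx).1).2).1 (h x)] at h4
        rw [fderivWithin_of_isOpen Metric.isOpen_ball hx]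
        ext
        simpa using h4.deriv
    obtain ⟨S, hS, h0⟩ := hcov 0
    refine ⟨S, hS, ?_⟩
    -- The preimages of the leaf through $\gamma(0)$ and of the union of all others are open,
    -- disjoint and cover the line, which is connected.
    have hV : IsOpen (⋃ T ∈ 𝓛 \ {S}, γ ⁻¹' T) :=
      isOpen_biUnion fun T hT => hopen T hT.1
    have hsub := isPreconnected_univ.subset_left_of_subset_union (hopen S hS) hV ?_ ?_
      ⟨0, mem_univ _, h0⟩
    · rintro _ ⟨s, rfl⟩
      exact hsub (mem_univ s)
    · rw [disjoint_left]
      intro s hs hs'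
      obtain ⟨T, hT, hsT⟩ := mem_iUnion₂.1 hs'
      exact hT.2 (hd T hT.1 S hS _ hsT hs)
    · intro s _
      obtain ⟨T, hT, hsT⟩ := hcov s
      by_cases hTS : T = S
      · left; rw [← hTS]; exact hsT
      · right; exact mem_iUnion₂.2 ⟨T, ⟨hT, hTS⟩, hsT⟩
  · rintro ⟨S, hS, hr⟩ s
    obtain ⟨E, hE⟩ := hL S hS _ (hr ⟨s, rfl⟩)
    have h1 := hγ.continuous.continuousAt.eventually hE
    have h2 := key E s h1.self_of_nhds.1
    refine h2.2.2 (h2.1.unique ?_)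
    refine (hasDerivAt_const s (E (γ s)).im).congr_of_eventuallyEq ?_
    filter_upwards [h1] with t ht
    exact ht.2.1 (hr ⟨t, rfl⟩)

/-! ### The bilinear form -/

/-- The complex bilinear form `∑ z_j v_j`. -/
def bil {n : ℕ} (z v : CSpace n) : ℂ := ∑ j, z j * v j

/-- The complex conjugate of a vector. -/
def cj {n : ℕ} (z : CSpace n) : CSpace n := WithLp.toLp 2 fun j => star (z j)

section
variable {n : ℕ}

theorem bil_comm (z v : CSpace n) : bil z v = bil v z := by
  simp only [bil, mul_comm]

theorem bil_add_left (z z' v : CSpace n) : bil (z + z') v = bil z v + bil z' v := by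
  simp [bil, add_mul, Finset.sum_add_distrib]

theorem bil_add_right (v z z' : CSpace n) : bil v (z + z') = bil v z + bil v z' := by
  simp [bil, mul_add, Finset.sum_add_distrib]

theorem bil_smul_left (c : ℂ) (z v : CSpace n) : bil (c • z) v = c * bil z v := by
  simp [bil, mul_assoc, Finset.mul_sum]

theorem bil_smul_right (c : ℂ) (z v : CSpace n) : bil z (c • v) = c * bil z v := by
  rw [bil_comm, bil_smul_left, bil_comm]

theorem bil_complexify (x y : RSpace n) : bil (complexify n x) (complexify n y) = inner ℝ x y := by
  simp [bil, complexify, PiLp.inner_apply, mul_comm]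

theorem cj_add (z v : CSpace n) : cj (z + v) = cj z + cj v := by ext j; simp [cj]

theorem cj_smul (c : ℂ) (z : CSpace n) : cj (c • z) = star c • cj z := by ext j; simp [cj]

theorem cj_complexify (x : RSpace n) : cj (complexify n x) = complexify n x := by
  ext j; simp [cj, complexify]

theorem complexify_smul (r : ℝ) (x : RSpace n) : complexify n (r • x) = (r : ℂ) • complexify n x := by
  rw [map_smul, Complex.coe_smul]

theorem complexify_injective : Function.Injective (complexify n) := by
  intro x y h
  ext j
  have := congrArg (fun z : CSpace n => z j) h
  simpa [complexify] using this

theorem mem_quadric_iff {z : CSpace n} : z ∈ quadric n ↔ bil z z = 1 := by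
  simp [quadric, bil, sq]

theorem mem_tangent_iff {z v : CSpace n} : v ∈ tangent z ↔ bil z v = 0 := Iff.rfl

theorem continuous_bil_left (v : CSpace n) : Continuous fun z : CSpace n => bil z v := by
  unfold bil
  fun_prop

theorem leviForm_eq_bil {u : ℝ → ℝ} (hu : ContDiffOn ℝ ∞ u (Set.Ioi 0)) {z : CSpace n}
    (hz : z ≠ 0) (v w : CSpace n) :
    leviForm u z v w = ((deriv u (‖z‖ ^ 2) : ℝ) : ℂ) * bil v (cj w) +
      ((deriv (deriv u) (‖z‖ ^ 2) : ℝ) : ℂ) * (bil (cj z) v * bil z (cj w)) :=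
  leviForm_eq hu hz v w

end

/-! ### The tangent planes of the ansatz -/

/-- `ι` is an isometry of `ℝⁿ` onto the orthogonal complement of the unit vector `p`. -/
structure IsFrame {n : ℕ} (p : RSpace n) (ι : EuclideanSpace ℝ (Fin n) →ₗᵢ[ℝ] RSpace n) : Prop where
  norm_eq : ‖p‖ = 1
  inner_eq : ∀ x, inner ℝ p (ι x) = 0
  surj : ∀ y, inner ℝ p y = 0 → ∃ x, ι x = y

theorem exists_isFrame {n : ℕ} {p : RSpace n} (hp : ‖p‖ = 1) : ∃ ι, IsFrame p ι := by
  have : Fact (Module.finrank ℝ (RSpace n) = n + 1) := ⟨by simp⟩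
  have hp0 : p ≠ 0 := by rintro rfl; simp at hp
  let e := OrthonormalBasis.fromOrthogonalSpanSingleton (𝕜 := ℝ) n hp0
  refine ⟨((ℝ ∙ p)ᗮ.subtypeₗᵢ).comp e.repr.symm.toLinearIsometry, hp, fun x => ?_, fun y hy => ?_⟩
  · exact Submodule.mem_orthogonal_singleton_iff_inner_right.1 (e.repr.symm x).2
  · refine ⟨e.repr ⟨y, Submodule.mem_orthogonal_singleton_iff_inner_right.2 hy⟩, ?_⟩
    simp

/-- The differential at `x` of a map `x ↦ a(|x|²) p + b(|x|²) ι(x)`, where `A`, `B` are the values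
of `a'`, `b'`. -/
def tanMap {n : ℕ} (p : RSpace n) (ι : EuclideanSpace ℝ (Fin n) →ₗᵢ[ℝ] RSpace n) (A B b : ℂ)
    (x : EuclideanSpace ℝ (Fin n)) : EuclideanSpace ℝ (Fin n) →ₗ[ℝ] CSpace n where
  toFun v := ((2 * inner ℝ x v : ℝ) * A) • complexify n p +
    ((2 * inner ℝ x v : ℝ) * B) • complexify n (ι x) + b • complexify n (ι v)
  map_add' v w := by
    simp only [inner_add_right, map_add, mul_add, ofReal_add, add_mul, add_smul, smul_add]
    abel
  map_smul' r v := by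
    simp only [inner_smul_right, map_smul, RingHom.id_apply, smul_add, ← Complex.coe_smul,
      smul_smul, ofReal_mul]
    simp only [mul_assoc, mul_left_comm _ (r : ℂ), mul_comm _ (r : ℂ)]

section
variable {n : ℕ} {p : RSpace n} {ι : EuclideanSpace ℝ (Fin n) →ₗᵢ[ℝ] RSpace n} {A B a b : ℂ}
  {x : EuclideanSpace ℝ (Fin n)}

theorem tanMap_apply (v : EuclideanSpace ℝ (Fin n)) : tanMap p ι A B b x v =
    ((2 * inner ℝ x v : ℝ) * A) • complexify n p +
      ((2 * inner ℝ x v : ℝ) * B) • complexify n (ι x) + b • complexify n (ι v) := rfl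

theorem IsFrame.bil_self (h : IsFrame p ι) : bil (complexify n p) (complexify n p) = 1 := by
  rw [bil_complexify, real_inner_self_eq_norm_sq, h.norm_eq]; simp

theorem IsFrame.bil_left (h : IsFrame p ι) (x : EuclideanSpace ℝ (Fin n)) :
    bil (complexify n p) (complexify n (ι x)) = 0 := by
  rw [bil_complexify, h.inner_eq]; simp

theorem IsFrame.bil_right (h : IsFrame p ι) (x : EuclideanSpace ℝ (Fin n)) :
    bil (complexify n (ι x)) (complexify n p) = 0 := by
  rw [bil_comm, h.bil_left]

theorem IsFrame.bil_map (x y : EuclideanSpace ℝ (Fin n)) :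
    bil (complexify n (ι x)) (complexify n (ι y)) = (inner ℝ x y : ℝ) := by
  rw [bil_complexify, ι.inner_map_map]

theorem tanMap_injective (h : IsFrame p ι) (hA : A ≠ 0) (hb : b ≠ 0) :
    Function.Injective (tanMap p ι A B b x) := by
  rw [injective_iff_map_eq_zero]
  intro v hv
  rw [tanMap_apply] at hv
  have h1 := congrArg (bil (complexify n p)) hv
  simp only [bil_add_right, bil_smul_right, h.bil_self, h.bil_left] at h1
  have h0 : bil (complexify n p) 0 = 0 := by simp [bil]
  rw [h0] at h1
  have h2 : (inner ℝ x v : ℝ) = 0 := by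
    simp [hA] at h1
    exact h1
  rw [h2] at hv
  simp only [mul_zero, ofReal_zero, zero_mul, zero_smul, zero_add] at hv
  have h3 := (smul_eq_zero.1 hv).resolve_left hb
  have h4 := complexify_injective (h3.trans (map_zero _).symm)
  exact ι.injective (h4.trans (map_zero _).symm)

/-- The bracket is the derivative in $r=|x|^2$ of $a^2+rb^2$, so tangency to the quadric is the
differentiated equation $a^2+rb^2=1$. -/
theorem bil_point_tanMap (h : IsFrame p ι) (v : EuclideanSpace ℝ (Fin n)) :
    bil (a • complexify n p + b • complexify n (ι x)) (tanMap p ι A B b x v) =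
      inner ℝ x v * (2 * a * A + b ^ 2 + 2 * (‖x‖ ^ 2 : ℝ) * b * B) := by
  simp only [tanMap_apply, bil_add_right, bil_add_left, bil_smul_right, bil_smul_left, h.bil_self,
    h.bil_left, h.bil_right, IsFrame.bil_map, real_inner_self_eq_norm_sq]
  push_cast
  ring

theorem bil_cj_tanMap (h : IsFrame p ι) (v w : EuclideanSpace ℝ (Fin n)) :
    bil (tanMap p ι A B b x v) (cj (tanMap p ι A B b x w)) =
      bil (tanMap p ι A B b x w) (cj (tanMap p ι A B b x v)) := by
  simp only [tanMap_apply, cj_add, cj_smul, cj_complexify, bil_add_right, bil_add_left,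
    bil_smul_right, bil_smul_left, h.bil_self, h.bil_left, h.bil_right, IsFrame.bil_map,
    real_inner_self_eq_norm_sq, star_mul', star_def, conj_ofReal, real_inner_comm w x,
    real_inner_comm v x, real_inner_comm w v]
  push_cast
  ring

theorem bil_cj_point_tanMap (h : IsFrame p ι) : ∃ m m' : ℂ, ∀ v : EuclideanSpace ℝ (Fin n),
    bil (cj (a • complexify n p + b • complexify n (ι x))) (tanMap p ι A B b x v) =
      inner ℝ x v * m ∧
    bil (a • complexify n p + b • complexify n (ι x)) (cj (tanMap p ι A B b x v)) =
      inner ℝ x v * m' := by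
  refine ⟨2 * star a * A + star b * b + 2 * (‖x‖ ^ 2 : ℝ) * star b * B,
    2 * a * star A + b * star b + 2 * (‖x‖ ^ 2 : ℝ) * b * star B, fun v => ⟨?_, ?_⟩⟩ <;>
  · simp only [tanMap_apply, cj_add, cj_smul, cj_complexify, bil_add_right, bil_add_left,
      bil_smul_right, bil_smul_left, h.bil_self, h.bil_left, h.bil_right, IsFrame.bil_map,
      real_inner_self_eq_norm_sq, star_mul', star_def, conj_ofReal]
    push_cast
    ring

/-- The Levi form has two parts: the Hermitian product, symmetric on these planes by rotational
symmetry, and a product of two factors each proportional to $\langle x,\cdot\rangle$. Both are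
symmetric in $v$ and $w$, so the Lagrangian condition puts no constraint on the curve. -/
theorem kahlerForm_tanMap (h : IsFrame p ι) {u : ℝ → ℝ} (hu : ContDiffOn ℝ ∞ u (Set.Ioi 0))
    (hz : a • complexify n p + b • complexify n (ι x) ≠ 0) (v w : EuclideanSpace ℝ (Fin n)) :
    kahlerForm u (a • complexify n p + b • complexify n (ι x)) (tanMap p ι A B b x v)
      (tanMap p ι A B b x w) = 0 := by
  obtain ⟨m, m', hm⟩ := bil_cj_point_tanMap (A := A) (B := B) (a := a) (b := b) (x := x) h
  rw [kahlerForm, leviForm_eq_bil hu hz, leviForm_eq_bil hu hz, bil_cj_tanMap h v w,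
    (hm v).1, (hm v).2, (hm w).1, (hm w).2]
  ring

/-! #### The volume form -/

/-- The complex matrix whose rows are the images of the standard basis under `ι`, and `p`. -/
def frameMatrix (p : RSpace n) (ι : EuclideanSpace ℝ (Fin n) →ₗᵢ[ℝ] RSpace n) :
    Matrix (Fin n ⊕ Fin 1) (Fin n ⊕ Fin 1) ℂ :=
  Matrix.of fun i c => (Sum.elim (fun k => ι (EuclideanSpace.single k 1)) (fun _ => p) i
    (finSumFinEquiv c) : ℝ)

theorem frameMatrix_det (h : IsFrame p ι) :
    (frameMatrix p ι).det = 1 ∨ (frameMatrix p ι).det = -1 := by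
  rw [← sq_eq_one_iff, sq]
  nth_rewrite 2 [← Matrix.det_transpose]
  rw [← Matrix.det_mul]
  have key : ∀ y y' : RSpace n, ∑ c : Fin n ⊕ Fin 1, ((y (finSumFinEquiv c) : ℝ) : ℂ) *
      ((y' (finSumFinEquiv c) : ℝ) : ℂ) = (inner ℝ y y' : ℝ) := by
    intro y y'
    rw [Equiv.sum_comp finSumFinEquiv fun c => ((y c : ℝ) : ℂ) * ((y' c : ℝ) : ℂ),
      PiLp.inner_apply]
    simp [mul_comm]
  have e : frameMatrix p ι * (frameMatrix p ι).transpose = 1 := by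
    ext i j
    rw [Matrix.mul_apply]
    simp only [Matrix.transpose_apply, frameMatrix, Matrix.of_apply, key]
    rcases i with i | i <;> rcases j with j | j
    · simp [ι.inner_map_map, Matrix.one_apply, EuclideanSpace.inner_single_left, eq_comm]
      split_ifs <;> simp
    · simp [real_inner_comm, h.inner_eq]
    · simp [h.inner_eq]
    · have : i = j := Subsingleton.elim _ _
      rw [this, Matrix.one_apply_eq]
      simp [h.norm_eq]
  rw [e, Matrix.det_one]

theorem sum_frame (y : EuclideanSpace ℝ (Fin n)) (c : Fin (n + 1)) :
    ((ι y c : ℝ) : ℂ) = ∑ k, (y k : ℂ) * ((ι (EuclideanSpace.single k 1) c : ℝ) : ℂ) := by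
  have e : y = ∑ k, y k • EuclideanSpace.single k (1:ℝ) := by
    ext i
    simp [Pi.single_apply]
  conv_lhs => rw [e]
  simp

/-- In the real frame formed by the images $\iota(e_k)$ and $p$, the tangent vectors and the point
give a block matrix, which is factored into block triangular matrices. This divides only by $b$,
never by $a$, which may vanish. The determinant contains $b^n(a-|x|^2\gamma)$, and the equation of
the quadric with its derivative reduces this to $-2Ab^{n-2}$. -/
theorem volForm_tanMap (hn : 2 ≤ n) (hb : b ≠ 0)
    (hab : a ^ 2 + (‖x‖ ^ 2 : ℝ) * b ^ 2 = 1)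
    (hAB : 2 * a * A + b ^ 2 + 2 * (‖x‖ ^ 2 : ℝ) * b * B = 0)
    (v : Fin n → EuclideanSpace ℝ (Fin n)) :
    volForm (a • complexify n p + b • complexify n (ι x)) (fun i => tanMap p ι A B b x (v i)) =
      -((Matrix.det (Matrix.of fun i k => v i k) : ℝ) : ℂ) * (frameMatrix p ι).det *
        (A * b ^ (n - 2)) := by
  set V : Matrix (Fin n) (Fin n) ℂ := Matrix.of fun i k => ((v i k : ℝ) : ℂ)
  have hV : V.det = ((Matrix.det (Matrix.of fun i k => v i k) : ℝ) : ℂ) := by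
    have : V = (Complex.ofRealHom).mapMatrix (Matrix.of fun i k => v i k) := by
      ext i k; simp [V]
    rw [this, ← RingHom.map_det]
    rfl
  set X : Matrix (Fin n) (Fin 1) ℂ := Matrix.of fun k _ => ((x k : ℝ) : ℂ)
  have hXX : X.transpose * X = (((‖x‖ ^ 2 : ℝ) : ℂ)) • (1 : Matrix (Fin 1) (Fin 1) ℂ) := by
    ext i j
    have hij : i = j := Subsingleton.elim _ _
    rw [Matrix.mul_apply, EuclideanSpace.norm_sq_eq]
    simp [X, hij, sq]
  -- Upper right coefficient left over once the row operation $M_2$, forced by the term $2B\,xx^T$,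
  -- has contributed $(2B/b)a$ towards the required $2A$.
  set γ : ℂ := 2 * A - 2 * B * a / b
  set M₁ : Matrix (Fin n ⊕ Fin 1) (Fin n ⊕ Fin 1) ℂ := Matrix.fromBlocks V 0 0 1
  set M₂ : Matrix (Fin n ⊕ Fin 1) (Fin n ⊕ Fin 1) ℂ := Matrix.fromBlocks 1 ((2 * B / b) • X) 0 1
  set M₃ : Matrix (Fin n ⊕ Fin 1) (Fin n ⊕ Fin 1) ℂ := Matrix.fromBlocks 1 0 X.transpose 1
  set M₄ : Matrix (Fin n ⊕ Fin 1) (Fin n ⊕ Fin 1) ℂ :=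
    Matrix.fromBlocks (b • 1) (γ • X) 0 ((a - (‖x‖ ^ 2 : ℝ) * γ) • 1)
  have hK : M₁ * (M₂ * (M₃ * M₄)) = Matrix.fromBlocks (b • V + (2 * B) • (V * X * X.transpose))
      ((2 * A) • (V * X)) (b • X.transpose) (a • 1) := by
    have h34 : M₃ * M₄ = Matrix.fromBlocks (b • 1) (γ • X) (b • X.transpose) (a • 1) := by
      simp only [M₃, M₄, Matrix.fromBlocks_multiply, Matrix.fromBlocks_inj, Matrix.one_mul,
        Matrix.mul_one, Matrix.mul_zero, add_zero, smul_zero, Matrix.mul_smul, hXX,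
        smul_smul, ← add_smul, true_and]
      congr 1
      ring
    have h24 : M₂ * (M₃ * M₄) = Matrix.fromBlocks (b • 1 + (2 * B) • (X * X.transpose))
        ((2 * A) • X) (b • X.transpose) (a • 1) := by
      rw [h34]
      simp only [M₂, Matrix.fromBlocks_multiply, Matrix.fromBlocks_inj, Matrix.one_mul,
        Matrix.mul_one, Matrix.zero_mul, zero_add, smul_zero, Matrix.mul_smul, Matrix.smul_mul,
        smul_smul, ← add_smul, and_true]
      constructor
      · congr 2
        field_simp
      · congr 1
        simp only [γ]; field_simp; ring
    rw [h24]
    simp only [M₁, Matrix.fromBlocks_multiply, Matrix.one_mul, Matrix.mul_one, Matrix.zero_mul,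
      zero_add, add_zero, smul_zero, Matrix.mul_smul, Matrix.mul_add, Matrix.mul_assoc]
  have hVX : V * X = Matrix.of fun i _ => ((inner ℝ x (v i) : ℝ) : ℂ) := by
    ext i j
    rw [Matrix.mul_apply, Matrix.of_apply, PiLp.inner_apply]
    simp [V, X]
  have hmat : (Matrix.of fun i j => (Fin.snoc (fun i => tanMap p ι A B b x (v i))
      (a • complexify n p + b • complexify n (ι x)) : Fin (n + 1) → CSpace n) i j).submatrix
        finSumFinEquiv finSumFinEquiv = M₁ * (M₂ * (M₃ * M₄)) * frameMatrix p ι := by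
    rw [hK, hVX]
    ext i c
    rw [Matrix.mul_apply, Fintype.sum_sum_type]
    rcases i with i | i
    · simp only [Matrix.submatrix_apply, finSumFinEquiv_apply_left, Matrix.of_apply]
      rw [show Fin.castAdd 1 i = Fin.castSucc i from rfl, Fin.snoc_castSucc]
      simp only [tanMap_apply, Matrix.fromBlocks_apply₁₁, Matrix.fromBlocks_apply₁₂, frameMatrix,
        Matrix.of_apply, Sum.elim_inl, Sum.elim_inr, Matrix.add_apply, Matrix.smul_apply,
        Matrix.mul_apply, smul_eq_mul, X, V, Matrix.transpose_apply, PiLp.add_apply,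
        PiLp.smul_apply, complexify, LinearMap.coe_mk, AddHom.coe_mk]
      rw [sum_frame x, sum_frame (v i), ofReal_mul]
      simp only [add_mul, Finset.sum_add_distrib, Finset.univ_unique, Finset.sum_singleton,
        ofReal_ofNat, Finset.mul_sum, mul_assoc]
      simp only [mul_left_comm B]
      ring
    · simp only [Matrix.submatrix_apply, finSumFinEquiv_apply_right, Matrix.of_apply]
      have : Fin.natAdd n i = Fin.last n := by
        rw [Subsingleton.elim i 0]; rfl
      rw [this, Fin.snoc_last]
      simp only [Matrix.fromBlocks_apply₂₁, Matrix.fromBlocks_apply₂₂, frameMatrix,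
        Matrix.of_apply, Sum.elim_inl, Sum.elim_inr, Matrix.smul_apply, smul_eq_mul, X,
        Matrix.transpose_apply, PiLp.add_apply, PiLp.smul_apply, complexify, LinearMap.coe_mk,
        AddHom.coe_mk]
      rw [sum_frame x, Finset.mul_sum, add_comm]
      simp [mul_assoc, Matrix.one_apply, Subsingleton.elim i 0]
  rw [volForm, ← Matrix.det_submatrix_equiv_self finSumFinEquiv, hmat, Matrix.det_mul,
    Matrix.det_mul, Matrix.det_mul, Matrix.det_mul]
  have d1 : M₁.det = V.det := by simp [M₁]
  have d2 : M₂.det = 1 := by simp [M₂]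
  have d3 : M₃.det = 1 := by simp [M₃]
  have d4 : M₄.det = b ^ n * (a - (‖x‖ ^ 2 : ℝ) * γ) := by
    simp [M₄, Matrix.det_fromBlocks_zero₂₁]
  have e : b ^ n = b ^ (n - 2) * b ^ 2 := by rw [← pow_add, Nat.sub_add_cancel hn]
  have e2 : b ^ 2 * (a - (‖x‖ ^ 2 : ℝ) * γ) = -2 * A := by
    simp only [γ]
    generalize ((‖x‖ ^ 2 : ℝ) : ℂ) = r at *
    field_simp
    linear_combination a * hAB - 2 * A * hab
  rw [d1, d2, d3, d4, hV, e]
  linear_combination (((Matrix.det (Matrix.of fun i k => v i k) : ℝ) : ℂ) *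
    (frameMatrix p ι).det * b ^ (n - 2) / 2) * e2

end

section
variable {n : ℕ} {p : RSpace n} {ι : EuclideanSpace ℝ (Fin n) →ₗᵢ[ℝ] RSpace n} {A B a b : ℂ}
  {x : EuclideanSpace ℝ (Fin n)}

theorem point_mem_quadric (h : IsFrame p ι) (hab : a ^ 2 + (‖x‖ ^ 2 : ℝ) * b ^ 2 = 1) :
    a • complexify n p + b • complexify n (ι x) ∈ quadric n := by
  rw [mem_quadric_iff]
  simp only [bil_add_right, bil_add_left, bil_smul_right, bil_smul_left, h.bil_self,
    h.bil_left, h.bil_right, IsFrame.bil_map, real_inner_self_eq_norm_sq]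
  linear_combination hab

/-- The tangent planes of the ansatz are special Lagrangian if and only if `a' b^{n-2}` is real. -/
theorem isSpecialLagrangianPlane_tanMap (h : IsFrame p ι) (hn : 2 ≤ n) {u : ℝ → ℝ}
    (hu : ContDiffOn ℝ ∞ u (Set.Ioi 0)) (hA : A ≠ 0) (hb : b ≠ 0)
    (hab : a ^ 2 + (‖x‖ ^ 2 : ℝ) * b ^ 2 = 1)
    (hAB : 2 * a * A + b ^ 2 + 2 * (‖x‖ ^ 2 : ℝ) * b * B = 0) :
    IsSpecialLagrangianPlane n u (a • complexify n p + b • complexify n (ι x))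
      (LinearMap.range (tanMap p ι A B b x)) ↔ (A * b ^ (n - 2)).im = 0 := by
  have hvol := fun v => volForm_tanMap (p := p) (ι := ι) hn hb hab hAB v
  constructor
  · intro hs
    have h1 := hs.special (fun i => tanMap p ι A B b x (EuclideanSpace.single i 1))
      fun i => ⟨_, rfl⟩
    rw [hvol] at h1
    have e : (Matrix.of fun i k => (EuclideanSpace.single i (1:ℝ) : EuclideanSpace ℝ (Fin n)) k) =
        (1 : Matrix (Fin n) (Fin n) ℝ) := by
      ext i k
      simp [Matrix.one_apply, eq_comm]
    rw [e, Matrix.det_one] at h1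
    rcases frameMatrix_det h with hd | hd <;> rw [hd] at h1 <;> simp at h1 ⊢ <;> linarith
  · intro hi
    refine ⟨?_, ?_, ?_, ?_⟩
    · rw [LinearMap.finrank_range_of_inj (tanMap_injective h hA hb)]
      simp
    · rintro _ ⟨v, rfl⟩
      rw [mem_tangent_iff, bil_point_tanMap h, hAB, mul_zero]
    · rintro _ ⟨v, rfl⟩ _ ⟨w, rfl⟩
      exact kahlerForm_tanMap h hu (quadric_ne (point_mem_quadric h hab)) v w
    · intro v hv
      choose y hy using hv
      have e : v = fun i => tanMap p ι A B b x (y i) := funext fun i => (hy i).symm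
      rw [e, hvol]
      rcases frameMatrix_det h with hd | hd <;> rw [hd]
      · rw [mul_one, ← ofReal_neg, im_ofReal_mul, hi, mul_zero]
      · rw [mul_neg_one, neg_neg, im_ofReal_mul, hi, mul_zero]

/-! ### The ansatz along a curve -/

/-- The difference quotient of $w$ is that of $w^2$ divided by $w(t)+w(s)$, which tends to
$2w(s)\ne0$. No choice of a branch of the root is involved. -/
theorem hasDerivAt_sqrt_of_continuous {f f' : ℂ} {F w : ℝ → ℂ} {s : ℝ} (hF : HasDerivAt F f' s)
    (hw : ContinuousAt w s) (h : ∀ t, w t ^ 2 = F t) (h0 : w s ≠ 0) (hf : f' = 2 * w s * f) :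
    HasDerivAt w f s := by
  rw [hasDerivAt_iff_tendsto_slope] at hF ⊢
  have h2 : w s + w s ≠ 0 := by rw [← two_mul]; exact mul_ne_zero two_ne_zero h0
  have h1 : Tendsto (fun t => w t + w s) (𝓝[≠] s) (𝓝 (w s + w s)) :=
    (hw.tendsto.mono_left nhdsWithin_le_nhds).add tendsto_const_nhds
  have h3 := hF.div h1 h2
  have e : f' / (w s + w s) = f := by rw [hf, ← two_mul]; field_simp
  rw [e] at h3
  refine h3.congr' ?_
  filter_upwards [h1.eventually (isOpen_ne.mem_nhds h2)] with t ht
  simp only [Pi.div_apply, slope, vsub_eq_sub, real_smul, ← h]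
  have : w t + w s ≠ 0 := ht
  field_simp
  ring

theorem sq_ansatz {n : ℕ} (d w γ : ℂ) (h : w ^ 2 = 1 - γ ^ 2) :
    (d * w ^ (n - 2)) ^ 2 = d ^ 2 * (1 - γ ^ 2) ^ (n - 2) := by
  rw [mul_pow, ← pow_mul, mul_comm (n - 2) 2, pow_mul, h]

/-- The coefficients are the derivatives at $r=1$ of $\gamma(s+\frac12\log r)$ and of
$r^{-1/2}w(s+\frac12\log r)$: the cylinder $\mathbb R\times S^{n-1}$ is viewed in polar coordinates
of $\mathbb R^n$ near the unit sphere. -/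
theorem ansatzTangent_eq (h : IsFrame p ι) {γ w : ℝ → ℂ} {s : ℝ} {γ' w' : ℂ}
    (hγ : HasDerivAt γ γ' s) (hw : HasDerivAt w w' s) (hx : ‖x‖ = 1) :
    ansatzTangent p γ w s (ι x) =
      LinearMap.range (tanMap p ι (γ' / 2) ((w' - w s) / 2) (w s) x) := by
  have hd : deriv (fun t => ansatzMap p γ w t (ι x)) s =
      γ' • complexify n p + w' • complexify n (ι x) := by
    unfold ansatzMap
    exact ((hγ.smul_const _).add (hw.smul_const _)).deriv
  have hT : ∀ v, tanMap p ι (γ' / 2) ((w' - w s) / 2) (w s) x v =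
      (inner ℝ x v : ℝ) • (γ' • complexify n p + w' • complexify n (ι x)) +
        w s • complexify n (ι (v - (inner ℝ x v : ℝ) • x)) := by
    intro v
    rw [tanMap_apply, map_sub, map_smul, map_sub, map_smul]
    simp only [smul_add, smul_sub, ← Complex.coe_smul, smul_smul]
    push_cast
    module
  rw [ansatzTangent, hd]
  apply le_antisymm
  · rw [Submodule.span_le]
    rintro z (hz | ⟨η, h1, h2, rfl⟩)
    · rw [mem_singleton_iff] at hz
      refine ⟨x, ?_⟩
      rw [hT, real_inner_self_eq_norm_sq, hx, hz]
      simp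
    · obtain ⟨v, rfl⟩ := h.surj η h1
      rw [ι.inner_map_map] at h2
      refine ⟨v, ?_⟩
      rw [hT, h2]
      simp
  · rintro _ ⟨v, rfl⟩
    rw [hT]
    refine Submodule.add_mem _ (Submodule.smul_mem _ _ (Submodule.subset_span (Or.inl rfl)))
      (Submodule.subset_span (Or.inr ⟨_, h.inner_eq _, ?_, rfl⟩))
    rw [ι.inner_map_map, inner_sub_right, inner_smul_right, real_inner_self_eq_norm_sq, hx]
    simp

theorem isSpecialLagrangianAnsatz_iff (hn : 2 ≤ n) {u : ℝ → ℝ}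
    (hu : ContDiffOn ℝ ∞ u (Set.Ioi 0)) (hp : ‖p‖ = 1) {γ w : ℝ → ℂ} (hγ : ContDiff ℝ 1 γ)
    (hγ' : ∀ s, deriv γ s ≠ 0) (hγ1 : ∀ s, γ s ≠ 1 ∧ γ s ≠ -1) (hw : Continuous w)
    (hw2 : ∀ s, w s ^ 2 = 1 - γ s ^ 2) : IsSpecialLagrangianAnsatz n u p γ w ↔
      ∀ s, ∃ r : ℝ, 0 ≤ r ∧ deriv γ s ^ 2 * (1 - γ s ^ 2) ^ (n - 2) = r := by
  obtain ⟨ι, h⟩ := exists_isFrame hp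
  have hw0 : ∀ s, w s ≠ 0 := by
    intro s h0
    have h1 := hw2 s
    rw [h0] at h1
    have : (1 - γ s) * (1 + γ s) = 0 := by linear_combination -h1
    rcases mul_eq_zero.1 this with h2 | h2
    · exact (hγ1 s).1 (by linear_combination -h2)
    · exact (hγ1 s).2 (by linear_combination h2)
  have key : ∀ (s : ℝ) (x : EuclideanSpace ℝ (Fin n)), ‖x‖ = 1 →
      (IsSpecialLagrangianPlane n u (ansatzMap p γ w s (ι x)) (ansatzTangent p γ w s (ι x)) ↔
        ∃ r : ℝ, 0 ≤ r ∧ deriv γ s ^ 2 * (1 - γ s ^ 2) ^ (n - 2) = r) := by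
    intro s x hx
    have hd : HasDerivAt γ (deriv γ s) s := (hγ.differentiable one_ne_zero s).hasDerivAt
    have hdw : HasDerivAt w (-(γ s * deriv γ s) / w s) s := by
      refine hasDerivAt_sqrt_of_continuous ((hd.fun_pow 2).const_sub 1) hw.continuousAt hw2 (hw0 s) ?_
      have := hw0 s
      field_simp
      push_cast
      ring
    rw [ansatzTangent_eq h hd hdw hx, ansatzMap, isSpecialLagrangianPlane_tanMap h hn hu
      (div_ne_zero (hγ' s) two_ne_zero) (hw0 s), ← sq_ansatz _ _ _ (hw2 s), exists_sq_eq_iff]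
    · rw [show deriv γ s / 2 * w s ^ (n - 2) = ((1 / 2 : ℝ) : ℂ) * (deriv γ s * w s ^ (n - 2)) by
        push_cast; ring, im_ofReal_mul]
      simp
    · rw [hx, hw2]; push_cast; ring
    · rw [hx]
      have := hw0 s
      push_cast
      field_simp
      ring
  constructor
  · intro hs s
    refine (key s (EuclideanSpace.single ⟨0, by omega⟩ 1) (by simp)).1 (hs s _ ?_ (h.inner_eq _))
    rw [ι.norm_map]; simp
  · intro hs s y hy hpy
    obtain ⟨x, rfl⟩ := h.surj y hpy
    exact (key s x (by rwa [ι.norm_map] at hy)).2 (hs s)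

end

/-! ### Parametrizations -/

section
variable {n : ℕ} {p : RSpace n} {ι : EuclideanSpace ℝ (Fin n) →ₗᵢ[ℝ] RSpace n}

/-- The map `x ↦ a(|x|²) p + b(|x|²) ι(x)`. -/
def radMap (p : RSpace n) (ι : EuclideanSpace ℝ (Fin n) →ₗᵢ[ℝ] RSpace n) (a b : ℝ → ℂ)
    (x : EuclideanSpace ℝ (Fin n)) : CSpace n :=
  a (‖x‖ ^ 2) • complexify n p + b (‖x‖ ^ 2) • complexify n (ι x)

theorem contDiff_complexify : ContDiff ℝ ∞ (complexify n) :=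
  (LinearMap.toContinuousLinearMap (complexify n)).contDiff

theorem range_fderiv_radMap {a b : ℝ → ℂ} {a' b' : ℂ} {x : EuclideanSpace ℝ (Fin n)}
    (ha : HasDerivAt a a' (‖x‖ ^ 2)) (hb : HasDerivAt b b' (‖x‖ ^ 2)) :
    LinearMap.range (fderiv ℝ (radMap p ι a b) x).toLinearMap =
      LinearMap.range (tanMap p ι a' b' (b (‖x‖ ^ 2)) x) := by
  have hn : HasFDerivAt (fun x : EuclideanSpace ℝ (Fin n) => ‖x‖ ^ 2) (2 • innerSL ℝ x) x :=
    (hasStrictFDerivAt_norm_sq x).hasFDerivAt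
  have hc : HasFDerivAt (fun x => complexify n (ι x))
      ((LinearMap.toContinuousLinearMap (complexify n)).comp ι.toContinuousLinearMap) x :=
    ((LinearMap.toContinuousLinearMap (complexify n)).comp ι.toContinuousLinearMap).hasFDerivAt
  have ha' := HasFDerivAt.comp x ha.hasFDerivAt hn
  have hb' := HasFDerivAt.comp x hb.hasFDerivAt hn
  have h := (ha'.smul_const (complexify n p)).add (hb'.smul hc)
  have h' : fderiv ℝ (radMap p ι a b) x = _ := h.fderiv
  congr 1
  rw [h']
  ext1 v
  rw [tanMap_apply]
  simp
  module

theorem mem_ansatzSet_singleton {γ : ℂ} {z : CSpace n} (hz : z ∈ ansatzSet p {γ}) :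
    ∃ w : ℂ, w ^ 2 = 1 - γ ^ 2 ∧ ∃ y : RSpace n, ‖y‖ = 1 ∧ inner ℝ p y = 0 ∧
      z = γ • complexify n p + w • complexify n y := by
  obtain ⟨_, rfl, h⟩ := hz
  exact h

theorem ansatzSet_subset_quadric (hp : ‖p‖ = 1) (Γ : Set ℂ) : ansatzSet p Γ ⊆ quadric n := by
  rintro _ ⟨γ, -, w, hw, y, hy, hpy, rfl⟩
  obtain ⟨ι, h⟩ := exists_isFrame hp
  obtain ⟨x, rfl⟩ := h.surj y hpy
  rw [ι.norm_map] at hy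
  exact point_mem_quadric h (by rw [hy, hw]; push_cast; ring)

/-- The sphere $|x|^2=r$ is sent to the slice $\gamma=a(r)$, with square root $\sqrt r\,b(r)$. The
opposite root gives the same slice, since the unit vector may be replaced by its opposite. -/
theorem image_radMap (h : IsFrame p ι) {a b : ℝ → ℂ} {O : Set ℝ}
    (hab : ∀ r ∈ O, a r ^ 2 + r * b r ^ 2 = 1) (hn : 1 ≤ n) :
    radMap p ι a b '' {x | ‖x‖ ^ 2 ∈ O} = ansatzSet p (a '' (O ∩ Ici 0)) := by
  apply Subset.antisymm
  · rintro _ ⟨x, hx, rfl⟩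
    refine ⟨_, ⟨_, ⟨hx, mem_Ici.2 (sq_nonneg _)⟩, rfl⟩, (‖x‖ : ℂ) * b (‖x‖ ^ 2), ?_, ?_⟩
    · have := hab _ hx
      push_cast at this
      linear_combination this
    -- At the centre the square root vanishes and any unit vector orthogonal to $p$ serves; one
    -- exists because $n\ge1$.
    · rcases eq_or_ne x 0 with rfl | hx0
      · refine ⟨ι (EuclideanSpace.single ⟨0, by omega⟩ 1), by rw [ι.norm_map]; simp,
          h.inner_eq _, ?_⟩
        simp [radMap]
      · have hx0' : ‖x‖ ≠ 0 := norm_ne_zero_iff.2 hx0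
        refine ⟨ι (‖x‖⁻¹ • x), ?_, h.inner_eq _, ?_⟩
        · rw [ι.norm_map, norm_smul, norm_inv, norm_norm, inv_mul_cancel₀ hx0']
        · have hxC : (‖x‖ : ℂ) ≠ 0 := by exact_mod_cast hx0'
          rw [radMap, map_smul, complexify_smul, smul_smul]
          congr 2
          push_cast
          field_simp
  · rintro _ ⟨_, ⟨r, ⟨hr, hr0⟩, rfl⟩, w, hw, y, hy, hpy, rfl⟩
    have hr0' : (0:ℝ) ≤ r := hr0
    have hsq : (√r) ^ 2 = r := Real.sq_sqrt hr0'
    have hw' : (w - √r * b r) * (w + √r * b r) = 0 := by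
      have := hab r hr
      have hC : ((√r : ℝ) : ℂ) ^ 2 = r := by exact_mod_cast hsq
      linear_combination hw - this - b r ^ 2 * hC
    have key : ∀ ε : ℝ, ε ^ 2 = 1 → w = ε * √r * b r →
        a r • complexify n p + w • complexify n y ∈ radMap p ι a b '' {x | ‖x‖ ^ 2 ∈ O} := by
      intro ε hε hwε
      obtain ⟨x, rfl⟩ := h.surj y hpy
      rw [ι.norm_map] at hy
      have hnorm : ‖(ε * √r) • x‖ ^ 2 = r := by
        rw [norm_smul, hy, mul_one, Real.norm_eq_abs, sq_abs, mul_pow, hε, hsq, one_mul]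
      refine ⟨(ε * √r) • x, by rw [mem_ofPred_eq, hnorm]; exact hr, ?_⟩
      rw [radMap, hnorm, map_smul, complexify_smul, smul_smul, hwε]
      push_cast
      congr 2
      ring
    rcases mul_eq_zero.1 hw' with h1 | h1
    · exact key 1 (by norm_num) (by push_cast; linear_combination h1)
    · exact key (-1) (by norm_num) (by push_cast; linear_combination h1)

/-- A set which is near each of its points of the form `{a(|x|²) p + b(|x|²) ι(x)}` is a special
Lagrangian submanifold if `a' b^{n-2}` is real. -/
theorem exists_parametrization (h : IsFrame p ι) (hn : 2 ≤ n) {u : ℝ → ℝ}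
    (hu : ContDiffOn ℝ ∞ u (Set.Ioi 0)) {a b : ℝ → ℂ} {O : Set ℝ} (hO : IsOpen O)
    (ha : ContDiffOn ℝ ∞ a O) (hb : ContDiffOn ℝ ∞ b O) (hb0 : ∀ r ∈ O, b r ≠ 0)
    (ha0 : ∀ r ∈ O, deriv a r ≠ 0) (hab : ∀ r ∈ O, a r ^ 2 + r * b r ^ 2 = 1)
    (him : ∀ r ∈ O, (deriv a r * b r ^ (n - 2)).im = 0) {ρ : ℂ → ℝ} {N : Set ℂ} (hN : IsOpen N)
    (hρ : ContinuousOn ρ N) (haN : ∀ r ∈ O, a r ∈ N ∧ ρ (a r) = r) {L U₁ : Set (CSpace n)}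
    (hU₁ : IsOpen U₁) (hL : L ∩ U₁ = ansatzSet p (a '' (O ∩ Ici 0))) {q : CSpace n} (hq : q ∈ L)
    (hqU : q ∈ U₁) : ∃ (V : Set (EuclideanSpace ℝ (Fin n)))
    (ψ : EuclideanSpace ℝ (Fin n) → CSpace n),
    IsOpen V ∧ q ∈ ψ '' V ∧ ContDiffOn ℝ ∞ ψ V ∧ Set.InjOn ψ V ∧
    (∀ V' ⊆ V, IsOpen V' → ∃ U, IsOpen U ∧ ψ '' V' = L ∩ U) ∧
    ∀ x ∈ V, IsSpecialLagrangianPlane n u (ψ x) (LinearMap.range (fderiv ℝ ψ x).toLinearMap) := by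
  set V : Set (EuclideanSpace ℝ (Fin n)) := {x | ‖x‖ ^ 2 ∈ O}
  have himg : radMap p ι a b '' V = L ∩ U₁ := by rw [hL, image_radMap h hab (by omega)]
  have hV : IsOpen V := hO.preimage (by fun_prop)
  -- a left inverse
  set pc : CSpace n → ℂ := fun z => bil z (complexify n p)
  have hpcc : Continuous pc := continuous_bil_left _
  set σ : CSpace n → EuclideanSpace ℝ (Fin n) := fun z => WithLp.toLp 2 fun k =>
    (bil z (complexify n (ι (EuclideanSpace.single k 1))) / b (ρ (pc z))).re
  have hpc : ∀ x, pc (radMap p ι a b x) = a (‖x‖ ^ 2) := by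
    intro x
    simp only [pc, radMap, bil_add_left, bil_smul_left, h.bil_self, h.bil_right]
    ring
  have hσ : ∀ x ∈ V, σ (radMap p ι a b x) = x := by
    intro x hx
    have hbx := hb0 _ hx
    ext k
    simp only [σ, hpc, (haN _ hx).2]
    simp only [radMap, bil_add_left, bil_smul_left, h.bil_left, IsFrame.bil_map, mul_zero, zero_add]
    rw [mul_div_assoc, mul_div_cancel₀ _ hbx]
    simp [EuclideanSpace.inner_single_right]
  -- The open set on which the left inverse is continuous: the component along $p$ gives $a(r)$,
  -- then $\rho$ recovers $r$, and division of the other components by $b(r)$ recovers $x$.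
  set U₂ : Set (CSpace n) := U₁ ∩ pc ⁻¹' (N ∩ ρ ⁻¹' O)
  have hU₂ : IsOpen U₂ := hU₁.inter ((hρ.isOpen_inter_preimage hN hO).preimage hpcc)
  have hσc : ContinuousOn σ U₂ := by
    have h1 : ContinuousOn (fun z => b (ρ (pc z))) U₂ := by
      refine hb.continuousOn.comp (hρ.comp hpcc.continuousOn fun z hz => hz.2.1) fun z hz => hz.2.2
    refine (PiLp.continuous_toLp 2 _).comp_continuousOn (continuousOn_pi.2 fun k => ?_)
    exact continuous_re.comp_continuousOn ((continuous_bil_left _).continuousOn.div h1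
      fun z hz => hb0 _ hz.2.2)
  refine ⟨V, radMap p ι a b, hV, by rw [himg]; exact ⟨hq, hqU⟩, ?_, ?_, ?_, ?_⟩
  · have hns : ContDiffOn ℝ ∞ (fun x : EuclideanSpace ℝ (Fin n) => ‖x‖ ^ 2) V :=
      (contDiff_norm_sq ℝ).contDiffOn
    exact ((ha.comp hns fun x hx => hx).smul contDiffOn_const).add
      ((hb.comp hns fun x hx => hx).smul
        (contDiff_complexify.comp ι.toContinuousLinearMap.contDiff).contDiffOn)
  · intro x hx y hy hxy
    rw [← hσ x hx, hxy, hσ y hy]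
  · intro V' hV' hV'o
    refine ⟨U₂ ∩ σ ⁻¹' V', hσc.isOpen_inter_preimage hU₂ hV'o, ?_⟩
    apply Subset.antisymm
    · rintro _ ⟨x, hx, rfl⟩
      have hxV := hV' hx
      have h1 : radMap p ι a b x ∈ L ∩ U₁ := himg.subset (mem_image_of_mem _ hxV)
      refine ⟨h1.1, ⟨h1.2, ?_, ?_⟩, ?_⟩
      · rw [hpc]; exact (haN _ hxV).1
      · rw [mem_preimage, hpc, (haN _ hxV).2]; exact hxV
      · rw [mem_preimage, hσ x hxV]; exact hx
    · rintro z ⟨hz, hz2, hz3⟩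
      obtain ⟨x, hx, rfl⟩ := himg.superset ⟨hz, hz2.1⟩
      rw [mem_preimage, hσ x hx] at hz3
      exact ⟨x, hz3, rfl⟩
  · intro x hx
    have hOx := hO.mem_nhds hx
    have hda : HasDerivAt a (deriv a (‖x‖ ^ 2)) (‖x‖ ^ 2) :=
      ((ha.contDiffAt hOx).differentiableAt (by simp)).hasDerivAt
    have hdb : HasDerivAt b (deriv b (‖x‖ ^ 2)) (‖x‖ ^ 2) :=
      ((hb.contDiffAt hOx).differentiableAt (by simp)).hasDerivAt
    rw [range_fderiv_radMap hda hdb, radMap]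
    refine (isSpecialLagrangianPlane_tanMap h hn hu (ha0 _ hx) (hb0 _ hx) (hab _ hx) ?_).2 (him _ hx)
    -- The tangency equation comes from differentiating $a^2+rb^2$, which is constant near $|x|^2$.
    have h1 := (hda.fun_pow 2).fun_add ((hasDerivAt_id (‖x‖ ^ 2)).ofReal_comp.fun_mul (hdb.fun_pow 2))
    have h2 : HasDerivAt (fun r : ℝ => a r ^ 2 + ((id r : ℝ) : ℂ) * b r ^ 2) 0 (‖x‖ ^ 2) := by
      refine (hasDerivAt_const _ (1:ℂ)).congr_of_eventuallyEq ?_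
      filter_upwards [hOx] with r hr using hab r hr
    have h3 := h1.unique h2
    simp only [id] at h3
    push_cast at h3 ⊢
    linear_combination h3

end

variable {n : ℕ} {p : RSpace n}

/-! ### The real sphere -/

theorem norm_complexify (x : RSpace n) : ‖complexify n x‖ = ‖x‖ := by
  rw [← sq_eq_sq₀ (norm_nonneg _) (norm_nonneg _), EuclideanSpace.norm_sq_eq,
    EuclideanSpace.norm_sq_eq]
  simp [complexify]

theorem ansatzSet_ofReal (hn : 2 ≤ n) (hp : ‖p‖ = 1) {G : Set ℝ} (hG : G ⊆ Icc (-1) 1) :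
    ansatzSet p (ofReal '' G) = {z | ∃ x : RSpace n, ‖x‖ = 1 ∧ inner ℝ p x ∈ G ∧
      z = complexify n x} := by
  apply Subset.antisymm
  · rintro _ ⟨_, ⟨g, hg, rfl⟩, w, hw, y, hy, hpy, rfl⟩
    have h1 : (0:ℝ) ≤ 1 - g ^ 2 := by nlinarith [(hG hg).1, (hG hg).2]
    have hwi := (exists_sq_eq_iff w).1 ⟨1 - g ^ 2, h1, by rw [hw]; push_cast; rfl⟩
    have hwr : w = w.re := by apply Complex.ext <;> simp [hwi]
    have hw2 : w.re ^ 2 = 1 - g ^ 2 := by rw [hwr] at hw; exact_mod_cast hw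
    refine ⟨g • p + w.re • y, ?_, ?_, ?_⟩
    · rw [← sq_eq_sq₀ (norm_nonneg _) zero_le_one, ← real_inner_self_eq_norm_sq]
      simp only [inner_add_left, inner_add_right, inner_smul_left, inner_smul_right,
        real_inner_self_eq_norm_sq, hp, hy, hpy, real_inner_comm p y]
      simp
      linear_combination hw2
    · simp only [inner_add_right, inner_smul_right, real_inner_self_eq_norm_sq, hp, hpy]
      simpa using hg
    · rw [map_add, complexify_smul, complexify_smul, ← hwr]
  · rintro _ ⟨x, hx, hg, rfl⟩
    set g : ℝ := inner ℝ p x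
    obtain ⟨ι, h⟩ := exists_isFrame hp
    set v := x - g • p
    have hpv : inner ℝ p v = 0 := by
      simp only [v, inner_sub_right, inner_smul_right, real_inner_self_eq_norm_sq, hp]
      simp [g]
    have hv : ‖v‖ ^ 2 = 1 - g ^ 2 := by
      have hxp : inner ℝ x p = g := real_inner_comm _ _
      rw [← real_inner_self_eq_norm_sq]
      simp only [v, inner_sub_right, inner_sub_left, inner_smul_right, inner_smul_left,
        real_inner_self_eq_norm_sq, hp, hx, hxp]
      simp
      ring
    have hxv : complexify n x = (g : ℂ) • complexify n p + complexify n v := by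
      rw [← complexify_smul, ← map_add]; simp [v]
    refine ⟨g, ⟨g, hg, rfl⟩, ‖v‖, by exact_mod_cast hv, ?_⟩
    rcases eq_or_ne v 0 with hv0 | hv0
    · refine ⟨ι (EuclideanSpace.single ⟨0, by omega⟩ 1), by rw [ι.norm_map]; simp,
        h.inner_eq _, ?_⟩
      rw [hxv, hv0]
      simp
    · have hn0 : ‖v‖ ≠ 0 := norm_ne_zero_iff.2 hv0
      refine ⟨‖v‖⁻¹ • v, ?_, ?_, ?_⟩
      · rw [norm_smul, norm_inv, norm_norm, inv_mul_cancel₀ hn0]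
      · rw [inner_smul_right, hpv, mul_zero]
      · rw [hxv, ← complexify_smul ‖v‖, smul_smul, mul_inv_cancel₀ hn0, one_smul]

theorem ansatzSet_realSegment (hn : 2 ≤ n) (hp : ‖p‖ = 1) :
    ansatzSet p realSegment = realSphere n := by
  rw [realSegment, ansatzSet_ofReal hn hp le_rfl]
  ext z
  constructor
  · rintro ⟨x, hx, -, rfl⟩
    exact ⟨x, hx, rfl⟩
  · rintro ⟨x, hx, rfl⟩
    have := abs_le.1 (abs_real_inner_le_norm p x)
    rw [hp, hx, one_mul] at this
    exact ⟨x, hx, this, rfl⟩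

/-- Each point of the sphere is taken as its own pole. Stereographic projection from the antipode
has $a=(1-r)/(1+r)$ and $b=2/(1+r)$; these are real, and $a$ is inverted by the same formula. The
chart covers the sphere minus the antipode. -/
theorem isSpecialLagrangian_realSphere (hn : 2 ≤ n) {u : ℝ → ℝ}
    (hu : ContDiffOn ℝ ∞ u (Set.Ioi 0)) : IsSpecialLagrangian n u (realSphere n) := by
  constructor
  · rintro _ ⟨x, hx, rfl⟩
    rw [mem_quadric_iff, bil_complexify, real_inner_self_eq_norm_sq, hx]
    simp
  rintro _ ⟨p, hp, rfl⟩
  obtain ⟨ι, h⟩ := exists_isFrame hp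
  have h1 : ∀ r ∈ Ioi (-1 : ℝ), 0 < 1 + r := fun r hr => by
    have : -1 < r := hr
    linarith
  have h1C : ∀ r ∈ Ioi (-1 : ℝ), (1 + r : ℂ) ≠ 0 := fun r hr => by exact_mod_cast (h1 r hr).ne'
  have hone : ContDiff ℝ ∞ fun r : ℝ => (1 + r : ℂ) := contDiff_const.add ofRealCLM.contDiff
  have hone' : ContDiff ℝ ∞ fun r : ℝ => (1 - r : ℂ) := contDiff_const.sub ofRealCLM.contDiff
  have hd : ∀ r ∈ Ioi (-1 : ℝ), deriv (fun r : ℝ => (1 - r : ℂ) / (1 + r)) r =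
      ((-2 / (1 + r) ^ 2 : ℝ) : ℂ) := by
    intro r hr
    have e1 : HasDerivAt (fun x : ℂ => (1 - x) / (1 + x)) _ (r : ℂ) :=
      ((hasDerivAt_id (r : ℂ)).const_sub 1).div ((hasDerivAt_id (r : ℂ)).const_add 1) (h1C r hr)
    rw [e1.comp_ofReal.deriv]
    have := h1C r hr
    push_cast
    simp only [id]
    field_simp
    ring
  have hca : ContDiffOn ℝ ∞ (fun r : ℝ => (1 - r : ℂ) / (1 + r)) (Ioi (-1)) := by
    simp only [div_eq_mul_inv]
    exact hone'.contDiffOn.mul (hone.contDiffOn.inv h1C)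
  have hcb : ContDiffOn ℝ ∞ (fun r : ℝ => 2 / (1 + r : ℂ)) (Ioi (-1)) := by
    simp only [div_eq_mul_inv]
    exact contDiffOn_const.mul (hone.contDiffOn.inv h1C)
  refine exists_parametrization h hn hu (a := fun r : ℝ => (1 - r : ℂ) / (1 + r))
    (b := fun r : ℝ => 2 / (1 + r : ℂ)) (O := Ioi (-1)) (ρ := fun z => ((1 - z) / (1 + z)).re)
    (N := {z | 1 + z ≠ 0}) (U₁ := {z | -1 < (bil z (complexify n p)).re}) isOpen_Ioi hca hcb
    (fun r hr => div_ne_zero two_ne_zero (h1C r hr)) (fun r hr => ?_) (fun r hr => ?_)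
    (fun r hr => ?_) (isOpen_ne_fun (by fun_prop) continuous_const) ?_ (fun r hr => ?_) ?_ ?_
    ⟨p, hp, rfl⟩ ?_
  · rw [hd r hr]
    have := h1 r hr
    exact_mod_cast (by
      have h2 : (-2 / (1 + r) ^ 2 : ℝ) < 0 := div_neg_of_neg_of_pos (by norm_num) (by positivity)
      exact h2.ne : (-2 / (1 + r) ^ 2 : ℝ) ≠ 0)
  · have := h1C r hr
    field_simp
    ring
  · rw [hd r hr, im_ofReal_mul, show (2 / (1 + r : ℂ)) = ((2 / (1 + r) : ℝ) : ℂ) by push_cast; rfl,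
      ← ofReal_pow, ofReal_im, mul_zero]
  · exact continuous_re.comp_continuousOn
      (ContinuousOn.div (by fun_prop) (by fun_prop) fun z hz => hz)
  · have := h1C r hr
    have e : 1 + (1 - r : ℂ) / (1 + r) = 2 / (1 + r) := by field_simp; ring
    refine ⟨by rw [mem_ofPred_eq, e]; exact div_ne_zero two_ne_zero this, ?_⟩
    have e2 : (1 - (1 - r : ℂ) / (1 + r)) / (1 + (1 - r : ℂ) / (1 + r)) = r := by
      rw [e]; field_simp; ring
    simp only [e2, ofReal_re]
  · exact isOpen_lt continuous_const (continuous_re.comp (continuous_bil_left _))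
  · have himg : (fun r : ℝ => (1 - r : ℂ) / (1 + r)) '' (Ioi (-1) ∩ Ici 0) =
        ofReal '' Ioc (-1) 1 := by
      ext z
      constructor
      · rintro ⟨r, ⟨-, hr⟩, rfl⟩
        have hr0 : (0:ℝ) ≤ r := hr
        refine ⟨(1 - r) / (1 + r), ⟨?_, ?_⟩, by push_cast; rfl⟩
        · rw [lt_div_iff₀ (by linarith)]; linarith
        · rw [div_le_one (by linarith)]; linarith
      · rintro ⟨g, hg, rfl⟩
        have hg1 : 0 < 1 + g := by linarith [hg.1]
        have hg1C : (1 + g : ℂ) ≠ 0 := by exact_mod_cast hg1.ne'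
        have h0 : 0 ≤ (1 - g) / (1 + g) := div_nonneg (by linarith [hg.2]) hg1.le
        refine ⟨(1 - g) / (1 + g), ⟨lt_of_lt_of_le (by norm_num) h0, h0⟩, ?_⟩
        have e : (1 : ℂ) + ((1 - g) / (1 + g) : ℝ) = 2 / (1 + g) := by
          push_cast; field_simp; ring
        simp only [e]
        push_cast
        field_simp
        ring
    rw [himg, ansatzSet_ofReal hn hp Ioc_subset_Icc_self]
    ext z
    constructor
    · rintro ⟨⟨x, hx, rfl⟩, hz⟩
      have hz' : -1 < (inner ℝ x p : ℝ) := by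
        have : -1 < (bil (complexify n x) (complexify n p)).re := hz
        rwa [bil_complexify, ofReal_re] at this
      rw [real_inner_comm] at hz'
      refine ⟨x, hx, ⟨hz', ?_⟩, rfl⟩
      have := (abs_le.1 (abs_real_inner_le_norm p x)).2
      rwa [hp, hx, one_mul] at this
    · rintro ⟨x, hx, hg, rfl⟩
      refine ⟨⟨x, hx, rfl⟩, ?_⟩
      rw [mem_ofPred_eq, bil_complexify, ofReal_re, real_inner_comm]
      exact hg.1
  · rw [mem_ofPred_eq, bil_complexify, real_inner_self_eq_norm_sq, hp]
    norm_num

/-! ### The submanifolds defined by the branches -/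

/-- Along a branch $K=re^{i\theta}$, so $1-z^2=-re^{i\theta}H^{-2/n}$ and the factor $r$ is
explicit. Taking $|x|^2=r$, the function $b$ is a constant times $H^{-1/n}$, smooth and nonzero
through $r=0$; this makes the pole a regular point. The product $a'b^{n-2}$ is then constant and
real. -/
theorem isSpecialLagrangian_sB (hn : 2 ≤ n) {u : ℝ → ℝ} (hu : ContDiffOn ℝ ∞ u (Set.Ioi 0))
    (hp : ‖p‖ = 1) {j : ℕ} (h1 : 1 ≤ j) (hj : j ≤ n - 1) {s : ℂ} (hs : s = 1 ∨ s = -1) :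
    IsSpecialLagrangian n u (ansatzSet p (sB n s j '' Ici 0)) := by
  refine ⟨ansatzSet_subset_quadric hp _, fun q hq => ?_⟩
  obtain ⟨ι, h⟩ := exists_isFrame hp
  have hn0 : (n : ℂ) ≠ 0 := by exact_mod_cast (by omega : n ≠ 0)
  have hss := sq_eq_one_of_or hs
  have hs0 : s ≠ 0 := left_ne_zero_of_mul (hss.symm ▸ one_ne_zero)
  have hline : ContDiff ℝ ∞ fun t : ℝ => (t : ℂ) * exp (angA n j * I) :=
    ofRealCLM.contDiff.mul contDiff_const
  -- This open set contains $[0,\infty)$ and also small negative numbers, so smoothness at the pole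
  -- is smoothness at an interior point.
  set O : Set ℝ := (fun t : ℝ => (t : ℂ) * exp (angA n j * I)) ⁻¹' (kFun n '' rightHalf)
  have hO : IsOpen O := (isOpen_range_kFun hn).preimage hline.continuous
  have hOr : ∀ r ∈ O, 0 < (brR n j r).re := fun r hr => kInv_mem hr
  have hOK : ∀ r ∈ O, kFun n (brR n j r) = r * exp (angA n j * I) := fun r hr => kFun_kInv hr
  have hbr : ContDiffOn ℝ ∞ (brR n j) O := (contDiffOn_kInv hn).comp hline.contDiffOn fun r hr => hr
  have hd : ∀ r ∈ O, deriv (fun r => s * brR n j r) r =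
      s * (((4 / n : ℂ) * exp ((2 / n) * log (hInt n (brR n j r))) /
        hInt n (brR n j r))⁻¹ * exp (angA n j * I)) := by
    intro r hr
    have e1 := hasDerivAt_kInv hn hr
    have e2 : HasDerivAt (fun x : ℂ => x * exp (angA n j * I)) (exp (angA n j * I)) (r : ℂ) := by
      simpa using (hasDerivAt_id (r : ℂ)).mul_const (exp (angA n j * I))
    exact ((HasDerivAt.comp (r : ℂ) e1 e2).comp_ofReal.const_mul s).deriv
  -- A square root of $-e^{i\theta}$ whose $n$th power is $(-1)^j$; the angles of the branches are
  -- exactly such that this power is real.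
  set κ : ℂ := exp ((angA n j + Real.pi) * I / 2)
  have hκ : κ ^ 2 = -exp (angA n j * I) := by
    rw [← exp_nat_mul, ← mul_neg_one, ← exp_pi_mul_I, ← exp_add]
    congr 1
    push_cast
    ring
  have hκn : κ ^ n = (((-1) ^ j : ℝ) : ℂ) := by
    rw [← exp_nat_mul]
    have e : (n : ℂ) * ((angA n j + Real.pi) * I / 2) = j * (Real.pi * I) := by
      rw [angA]; push_cast; field_simp; ring
    rw [e, exp_nat_mul, exp_pi_mul_I]
    push_cast
    rfl
  have hlog : ContDiffOn ℝ ∞ (fun z => log (hInt n z)) rightHalf := by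
    have : DifferentiableOn ℂ (fun z => log (hInt n z)) rightHalf := fun z hz =>
      (hasDerivAt_log_hInt hz).differentiableAt.differentiableWithinAt
    exact (this.contDiffOn isOpen_rightHalf).restrict_scalars ℝ
  have hN : IsOpen {z : ℂ | s * z ∈ rightHalf} := isOpen_rightHalf.preimage (by fun_prop)
  refine exists_parametrization h hn hu (a := fun r => s * brR n j r)
    (b := fun r => κ * exp (-(1 / n : ℂ) * log (hInt n (brR n j r)))) (O := O)
    (ρ := fun z => (kFun n (s * z) * exp (-(angA n j * I))).re)
    (N := {z | s * z ∈ rightHalf}) (U₁ := univ) hO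
    (contDiffOn_const.mul hbr)
    (contDiffOn_const.mul (contDiff_exp.comp_contDiffOn
      (contDiffOn_const.mul (hlog.comp hbr hOr))))
    (fun r hr => mul_ne_zero (exp_ne_zero _) (exp_ne_zero _)) (fun r hr => ?_) (fun r hr => ?_)
    (fun r hr => ?_) hN ?_ (fun r hr => ?_) isOpen_univ ?_ hq (mem_univ _)
  · rw [hd r hr]
    exact mul_ne_zero hs0 (mul_ne_zero (inv_ne_zero (kFun_deriv_ne_zero hn (hOr r hr)))
      (exp_ne_zero _))
  · have hK := hOK r hr
    rw [kFun] at hK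
    set l := log (hInt n (brR n j r))
    have e1 : exp (-(1 / n : ℂ) * l) ^ 2 * exp (2 / n * l) = 1 := by
      rw [← exp_nat_mul, ← exp_add]
      have : ((2 : ℕ) : ℂ) * (-(1 / n : ℂ) * l) + 2 / n * l = 0 := by push_cast; ring
      rw [this, exp_zero]
    rw [mul_pow, mul_pow, hκ, sq s, hss]
    linear_combination exp (-(1 / n : ℂ) * l) ^ 2 * hK - (brR n j r ^ 2 - 1) * e1
  · rw [hd r hr]
    have hH := hInt_ne_zero n (hOr r hr)
    set H := hInt n (brR n j r)
    set l := log H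
    have hl : exp l = H := exp_log hH
    have e1 : (exp (2 / n * l))⁻¹ * H * exp (-(1 / n : ℂ) * l) ^ (n - 2) = 1 := by
      rw [← exp_neg, ← exp_nat_mul, ← hl, ← exp_add, ← exp_add, Nat.cast_sub hn]
      have : -(2 / n * l) + l + ((n : ℂ) - (2 : ℕ)) * (-(1 / n : ℂ) * l) = 0 := by
        push_cast; field_simp; ring
      rw [this, exp_zero]
    have e2 : κ ^ n = κ ^ (n - 2) * κ ^ 2 := by rw [← pow_add, Nat.sub_add_cancel hn]
    have e3 : s * ((4 / n * exp (2 / n * l) / H)⁻¹ * exp (angA n j * I)) *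
        (κ * exp (-(1 / n : ℂ) * l)) ^ (n - 2) = -(s * (n / 4) * κ ^ n) := by
      have e4 : (4 / n * exp (2 / n * l) / H)⁻¹ = n / 4 * ((exp (2 / n * l))⁻¹ * H) := by
        have := exp_ne_zero (2 / n * l)
        field_simp
      have e5 : exp (angA n j * I) = -κ ^ 2 := by rw [hκ, neg_neg]
      rw [e4, e2, e5, mul_pow]
      linear_combination (-(s * (n / 4) * κ ^ 2 * κ ^ (n - 2))) * e1
    rw [e3, hκn]
    rcases hs with rfl | rfl
    · rw [show -((1 : ℂ) * (n / 4) * (((-1) ^ j : ℝ) : ℂ)) = ((-(n / 4 * (-1) ^ j) : ℝ) : ℂ) by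
        push_cast; ring, ofReal_im]
    · rw [show -((-1 : ℂ) * (n / 4) * (((-1) ^ j : ℝ) : ℂ)) = ((n / 4 * (-1) ^ j : ℝ) : ℂ) by
        push_cast; ring, ofReal_im]
  · refine continuous_re.comp_continuousOn (ContinuousOn.mul ?_ continuousOn_const)
    intro z hz
    exact (ContinuousAt.comp (f := fun z => s * z) (hasDerivAt_kFun hn hz).continuousAt
      (by fun_prop)).continuousWithinAt
  · have e : s * (s * brR n j r) = brR n j r := by rw [← mul_assoc, hss, one_mul]
    refine ⟨by rw [mem_ofPred_eq, e]; exact hOr r hr, ?_⟩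
    simp only [e, hOK r hr]
    rw [mul_assoc, ← exp_add, add_neg_cancel, exp_zero, mul_one, ofReal_re]
  · rw [inter_univ]
    congr 1
    have : O ∩ Ici 0 = Ici 0 := inter_eq_right.2 fun r hr => mul_exp_angA_mem hn h1 hj hr
    rw [this]
    rfl

variable {n : ℕ} {p : RSpace n}

/-! ### The submanifolds defined by the other curves -/

/-- The principal root of $1-z^2$ jumps across $[1,\infty)$, which a sector at $1$ may contain.
There $i\sqrt{z-1}\sqrt{z+1}$ is used; its only cut in the right half-plane lies along the segment
$(0,1]$. -/
theorem exists_sqrt_chD {j : ℕ} : ∃ W : ℂ → ℂ,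
    DifferentiableOn ℂ W (chD n j) ∧ ∀ z ∈ chD n j, W z ^ 2 = 1 - z ^ 2 := by
  by_cases h : j = n - 1
  · rw [chD, if_pos h]
    have hs : ∀ z ∈ crossD n, 1 - z ^ 2 ∈ slitPlane := fun z hz => mem_slitDom_of_im hz.1.ne'
    refine ⟨fun z => csqrt (1 - z ^ 2), fun z hz => ?_, fun z hz =>
      csqrt_sq (slitPlane_ne_zero (hs z hz))⟩
    exact (hasDerivAt_csqrt_comp (((hasDerivAt_id z).pow 2).const_sub 1)
      (hs z hz)).differentiableAt.differentiableWithinAt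
  · rw [chD, if_neg h]
    have h1 : ∀ z ∈ secD n j, z - 1 ∈ slitPlane := by
      rintro z ⟨hz, -⟩
      rw [mem_slitPlane_iff]
      by_contra hc
      push Not at hc
      refine notMem_realSegment_of_mem_cutHalf hz ⟨z.re, ⟨by linarith [show 0 < z.re from hz.1], ?_⟩, ?_⟩
      · have := hc.1; simp at this; exact this
      · have := hc.2
        apply Complex.ext
        · simp
        · simpa using this.symm
    have h2 : ∀ z ∈ secD n j, z + 1 ∈ slitPlane := by
      rintro z ⟨hz, -⟩
      left
      have : 0 < z.re := hz.1
      simp only [add_re, one_re]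
      linarith
    refine ⟨fun z => I * (csqrt (z - 1) * csqrt (z + 1)), fun z hz => ?_, fun z hz => ?_⟩
    · exact (((hasDerivAt_csqrt_comp ((hasDerivAt_id z).sub_const 1) (h1 z hz)).mul
        (hasDerivAt_csqrt_comp ((hasDerivAt_id z).add_const 1)
          (h2 z hz))).const_mul I).differentiableAt.differentiableWithinAt
    · rw [mul_pow, mul_pow, csqrt_sq (slitPlane_ne_zero (h1 z hz)),
        csqrt_sq (slitPlane_ne_zero (h2 z hz)), I_sq]
      ring

theorem exists_sqrt_sD {j : ℕ} {s : ℂ} (hs : s = 1 ∨ s = -1) : ∃ W : ℂ → ℂ,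
    DifferentiableOn ℂ W (sD n s j) ∧ ∀ z ∈ sD n s j, W z ^ 2 = 1 - z ^ 2 := by
  obtain ⟨W, h1, h2⟩ := exists_sqrt_chD (n := n) (j := j)
  refine ⟨fun z => W (s * z), h1.comp (by fun_prop) fun z hz => hz, fun z hz => ?_⟩
  rw [h2 _ hz, mul_pow, sq s, sq_eq_one_of_or hs, one_mul]

/-- Polar coordinates with $|x|^2=e^{2s}$ turn the cylinder into $\mathbb R^n\setminus\{0\}$, so $b$
is the root of $1-\gamma^2$ times $e^{-s}$. -/
theorem IsChart.isSpecialLagrangian_traj {D : Set ℂ} {E W : ℂ → ℂ} (hE : IsChart n D E)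
    (hn : 2 ≤ n) {u : ℝ → ℝ} (hu : ContDiffOn ℝ ∞ u (Set.Ioi 0)) (hp : ‖p‖ = 1)
    (hW : DifferentiableOn ℂ W D) (hW2 : ∀ z ∈ D, W z ^ 2 = 1 - z ^ 2) {c : ℝ} (hc : 0 < c) :
    IsSpecialLagrangian n u (ansatzSet p (range (traj D E c))) := by
  refine ⟨ansatzSet_subset_quadric hp _, fun q hq => ?_⟩
  obtain ⟨ι, h⟩ := exists_isFrame hp
  have hl : ContDiffOn ℝ ∞ (fun r : ℝ => Real.log r / 2) (Ioi 0) :=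
    (Real.contDiffOn_log.mono fun r (hr : 0 < r) => hr.ne').div_const 2
  have ha : ContDiffOn ℝ ∞ (fun r => traj D E c (Real.log r / 2)) (Ioi 0) :=
    hE.contDiffOn_traj.comp (contDiffOn_const.prodMk hl) fun r hr => ⟨hc, mem_univ _⟩
  have hD : ∀ r : ℝ, traj D E c (Real.log r / 2) ∈ D := fun r => hE.traj_mem hc _
  have hb : ContDiffOn ℝ ∞ (fun r => W (traj D E c (Real.log r / 2)) *
      (Real.exp (-(Real.log r / 2)) : ℝ)) (Ioi 0) :=
    (((hW.contDiffOn hE.isOpen).restrict_scalars ℝ).comp ha fun r _ => hD r).mul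
      (ofRealCLM.contDiff.comp_contDiffOn (Real.contDiff_exp.comp_contDiffOn hl.neg))
  have hW0 : ∀ z ∈ D, W z ≠ 0 := fun z hz h0 => hE.ne z hz (by rw [← hW2 z hz, h0]; simp)
  have hexp : ∀ r : ℝ, 0 < r → ((Real.exp (-(Real.log r / 2)) : ℝ) : ℂ) ^ 2 = (r : ℂ)⁻¹ := by
    intro r hr
    rw [← ofReal_pow, ← Real.exp_nat_mul, ← ofReal_inv]
    congr 1
    rw [show ((2 : ℕ) : ℝ) * -(Real.log r / 2) = -Real.log r by push_cast; ring, Real.exp_neg,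
      Real.exp_log hr]
  have hb2 : ∀ r : ℝ, 0 < r → (W (traj D E c (Real.log r / 2)) *
      (Real.exp (-(Real.log r / 2)) : ℝ)) ^ 2 = (1 - traj D E c (Real.log r / 2) ^ 2) / r := by
    intro r hr
    rw [mul_pow, hexp r hr, hW2 _ (hD r)]
    exact (div_eq_mul_inv _ _).symm
  have hda : ∀ r : ℝ, 0 < r → ∃ d : ℂ,
      _root_.deriv (fun r => traj D E c (Real.log r / 2)) r =
      (1 / (2 * r) : ℝ) * d ∧ d ^ 2 * (1 - traj D E c (Real.log r / 2) ^ 2) ^ (n - 2) = 1 / 4 := by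
    intro r hr
    obtain ⟨d, hd, h2⟩ := hE.hasDerivAt_traj hc (Real.log r / 2)
    refine ⟨d, ?_, h2⟩
    have h3 : HasDerivAt (fun r : ℝ => Real.log r / 2) (1 / (2 * r)) r := by
      refine ((Real.hasDerivAt_log hr.ne').div_const 2).congr_deriv ?_
      field_simp
    rw [← real_smul]
    exact (HasDerivAt.scomp r hd h3).deriv
  -- On the trajectory $\operatorname{Re}E=-s$, so $e^{-2\operatorname{Re}E}$ recovers
  -- $|x|^2=e^{2s}$.
  refine exists_parametrization h hn hu (ρ := fun z => Real.exp (-2 * (E z).re)) (N := D)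
    (U₁ := univ) isOpen_Ioi ha hb
    (fun r hr => mul_ne_zero (hW0 _ (hD r)) (ofReal_ne_zero.2 (Real.exp_ne_zero _)))
    (fun r hr => ?_) (fun r hr => ?_) (fun r hr => ?_) hE.isOpen ?_ (fun r hr => ⟨hD r, ?_⟩)
    isOpen_univ ?_ hq (mem_univ _)
  · obtain ⟨d, hd, h2⟩ := hda r hr
    have hr0 : (0:ℝ) < r := hr
    rw [hd]
    refine mul_ne_zero (ofReal_ne_zero.2 (by positivity)) fun h0 => ?_
    rw [h0] at h2
    norm_num at h2
  · have hr0 : (r : ℂ) ≠ 0 := by exact_mod_cast (show (0:ℝ) < r from hr).ne'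
    rw [hb2 r hr]
    field_simp
    ring
  · obtain ⟨d, hd, h2⟩ := hda r hr
    have hr0 : (0:ℝ) < r := hr
    have hrC : (r : ℂ) ≠ 0 := by exact_mod_cast hr0.ne'
    refine (exists_sq_eq_iff _).1 ⟨(1 / (2 * r)) ^ 2 * (1 / 4) / r ^ (n - 2), by positivity, ?_⟩
    rw [mul_pow, ← pow_mul, mul_comm (n - 2) 2, pow_mul, hb2 r hr, hd, div_pow, mul_pow]
    push_cast
    rw [← h2]
    field_simp
  · exact Real.continuous_exp.comp_continuousOn (continuousOn_const.mul
      (continuous_re.comp_continuousOn fun z hz =>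
        (hE.hasDerivAt z hz).continuousAt.continuousWithinAt))
  · simp only [hE.map_traj hc]
    rw [show -2 * (-((Real.log r / 2 : ℝ) : ℂ) + c * I).re = Real.log r by simp; ring,
      Real.exp_log hr]
  · rw [inter_univ]
    congr 1
    apply Subset.antisymm
    · rintro _ ⟨s, rfl⟩
      refine ⟨Real.exp (2 * s), ⟨Real.exp_pos _, (Real.exp_pos _).le⟩, ?_⟩
      simp
    · rintro _ ⟨r, -, rfl⟩
      exact mem_range_self _

/-! ### The poles -/

theorem bil_complexify_of_inner (hp : ‖p‖ = 1) {γ w : ℂ} {y : RSpace n} (hy : inner ℝ p y = 0) :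
    bil (γ • complexify n p + w • complexify n y) (complexify n p) = γ := by
  rw [bil_add_left, bil_smul_left, bil_smul_left, bil_complexify, bil_complexify,
    real_inner_self_eq_norm_sq, hp, real_inner_comm, hy]
  simp

/-- The bilinear product with $p$ recovers $\gamma$. A common point thus has its $\gamma$ both on
the branch and in $[-1,1]$, which leaves only the starting point, where the square root is $0$. -/
theorem ansatzSet_inter_realSphere (hn : 2 ≤ n) (hp : ‖p‖ = 1) {j : ℕ} (h1 : 1 ≤ j)
    (hj : j ≤ n - 1) {s : ℂ} (hs : s = 1 ∨ s = -1) :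
    ansatzSet p (sB n s j '' Ici 0) ∩ realSphere n = {s • complexify n p} := by
  have hB : sB n s j 0 = s := by rw [sB, (isBranch_brR hn h1 hj).start, mul_one]
  have hseg : ∀ t, 0 < t → sB n s j t ∉ realSegment := fun t ht => by
    rw [sB, mem_realSegment_mul hs]; exact (isBranch_brR hn h1 hj).notMem_segment t ht
  rw [← ansatzSet_realSegment hn hp]
  apply Subset.antisymm
  · rintro _ ⟨⟨_, ⟨t, ht, rfl⟩, w, hw, y, hy, hpy, rfl⟩, γ, hγ, w', hw', y', hy', hpy', he⟩
    have h2 := congrArg (fun z => bil z (complexify n p)) he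
    simp only [bil_complexify_of_inner hp hpy, bil_complexify_of_inner hp hpy'] at h2
    rcases eq_or_lt_of_le (show (0:ℝ) ≤ t from ht) with rfl | h0
    · rw [hB] at hw ⊢
      have : w ^ 2 = 0 := by rw [hw, sq, sq_eq_one_of_or hs, sub_self]
      rw [pow_eq_zero_iff two_ne_zero] at this
      rw [this, zero_smul, add_zero]
      rfl
    · exact absurd (h2 ▸ hγ) (hseg t h0)
  · rintro _ rfl
    obtain ⟨ι, h⟩ := exists_isFrame hp
    have hy : ‖ι (EuclideanSpace.single ⟨0, by omega⟩ 1)‖ = 1 := by rw [ι.norm_map]; simp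
    have hz : ∀ Γ : Set ℂ, s ∈ Γ → s • complexify n p ∈ ansatzSet p Γ := fun Γ hΓ =>
      ⟨s, hΓ, 0, by rw [sq s, sq_eq_one_of_or hs]; simp, _, hy, h.inner_eq _, by simp⟩
    refine ⟨hz _ ⟨0, self_mem_Ici, hB⟩, hz _ ?_⟩
    rcases hs with rfl | rfl
    · exact ⟨1, by simp, by simp⟩
    · exact ⟨-1, by simp, by simp⟩

/-! ### The ends -/

theorem norm_le_of_inner (hp : ‖p‖ = 1) {γ w : ℂ} {y : RSpace n} (hy : inner ℝ p y = 0) :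
    ‖γ‖ ≤ ‖γ • complexify n p + w • complexify n y‖ := by
  have h := norm_inner_le_norm (𝕜 := ℂ) (complexify n p) (γ • complexify n p + w • complexify n y)
  rw [norm_complexify, hp, one_mul] at h
  have e : ∀ z : CSpace n, inner ℂ (complexify n p) z = bil z (complexify n p) := fun z => by
    simp [PiLp.inner_apply, bil, complexify]
  rwa [e, bil_complexify_of_inner hp hy] at h

/-- Choose the sign of $w'$ so that $\operatorname{Re}(w\bar w')\ge0$. Then
$|w+w'|^2\ge|w|^2+|w'|^2\ge2(|\gamma|^2-1)\ge|\gamma|^2$, and the bound follows from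
$(w-w')(w+w')=-(\gamma-\beta)(\gamma+\beta)$. -/
theorem exists_sqrt_close {γ β w : ℂ} (hw : w ^ 2 = 1 - γ ^ 2) (hβ : ‖β‖ = ‖γ‖)
    (h2 : 2 ≤ ‖γ‖ ^ 2) : ∃ w' : ℂ, w' ^ 2 = 1 - β ^ 2 ∧ ‖w - w'‖ ≤ 2 * ‖γ - β‖ := by
  obtain ⟨w', hw', hre⟩ : ∃ w' : ℂ, w' ^ 2 = 1 - β ^ 2 ∧ 0 ≤ (w * conj w').re := by
    obtain ⟨v, hv⟩ := IsAlgClosed.exists_pow_nat_eq (1 - β ^ 2) two_pos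
    rcases le_total 0 (w * conj v).re with h | h
    · exact ⟨v, hv, h⟩
    · exact ⟨-v, by rw [neg_sq, hv], by rw [map_neg, mul_neg, neg_re]; linarith⟩
  refine ⟨w', hw', ?_⟩
  have hγ : 0 < ‖γ‖ := by
    by_contra h
    have : ‖γ‖ = 0 := le_antisymm (not_lt.1 h) (norm_nonneg _)
    rw [this] at h2; norm_num at h2
  have hsq : ∀ a b : ℂ, a ^ 2 = 1 - b ^ 2 → ‖b‖ ^ 2 - 1 ≤ ‖a‖ ^ 2 := by
    intro a b h
    rw [← norm_pow, ← norm_pow, h]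
    have := norm_sub_norm_le (b ^ 2) 1
    rw [norm_one, norm_sub_rev] at this
    exact this
  have h3 : ‖γ‖ ≤ ‖w + w'‖ := by
    rw [← sq_le_sq₀ (norm_nonneg _) (norm_nonneg _)]
    have e : ‖w + w'‖ ^ 2 = ‖w‖ ^ 2 + ‖w'‖ ^ 2 + 2 * (w * conj w').re := by
      rw [← normSq_eq_norm_sq, ← normSq_eq_norm_sq, ← normSq_eq_norm_sq, normSq_add]
    have a1 := hsq _ _ hw
    have a2 := hsq _ _ hw'
    rw [hβ] at a2
    linarith
  have h4 : ‖w - w'‖ * ‖w + w'‖ = ‖γ - β‖ * ‖γ + β‖ := by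
    rw [← norm_mul, ← norm_mul, ← norm_neg ((γ - β) * (γ + β))]
    congr 1
    linear_combination hw - hw'
  have h5 : ‖γ + β‖ ≤ 2 * ‖γ‖ := (norm_add_le _ _).trans (by rw [hβ]; linarith)
  refine le_of_mul_le_mul_right ?_ hγ
  calc ‖w - w'‖ * ‖γ‖ ≤ ‖w - w'‖ * ‖w + w'‖ := by gcongr
    _ = ‖γ - β‖ * ‖γ + β‖ := h4
    _ ≤ ‖γ - β‖ * (2 * ‖γ‖) := by gcongr
    _ = 2 * ‖γ - β‖ * ‖γ‖ := by ring

theorem norm_sub_lt_of_infDist_ray {θ η : ℝ} {z : ℂ} (h : Metric.infDist z (ray θ) < η) :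
    ‖z - ‖z‖ * exp (θ * I)‖ < 2 * η := by
  have hne : (ray θ).Nonempty := ⟨0, 0, le_rfl, by simp⟩
  obtain ⟨_, ⟨r, hr, rfl⟩, hlt⟩ := (Metric.infDist_lt_iff hne).1 h
  rw [dist_eq] at hlt
  have h1 : ‖(r : ℂ) * exp (θ * I)‖ = r := by
    rw [norm_mul, norm_exp_ofReal_mul_I, mul_one, norm_real, Real.norm_of_nonneg hr]
  have h2 : ‖(r : ℂ) * exp (θ * I) - ‖z‖ * exp (θ * I)‖ < η := by
    rw [← sub_mul, norm_mul, norm_exp_ofReal_mul_I, mul_one, ← ofReal_sub, norm_real,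
      Real.norm_eq_abs, abs_sub_comm]
    have := abs_norm_sub_norm_le z (r * exp (θ * I))
    rw [h1] at this
    exact this.trans_lt hlt
  calc ‖z - ‖z‖ * exp (θ * I)‖ ≤ ‖z - r * exp (θ * I)‖ + _ := norm_sub_le_norm_sub_add_norm_sub _ _ _
    _ < 2 * η := by rw [two_mul]; exact add_lt_add hlt h2

/-- By the intermediate value theorem the branch has a point with the same modulus as $\gamma(s)$.
Both points are then compared with the point of the half-line of that modulus. -/
theorem IsAsymptoticToRay.eventually_exists {θ : ℝ} {γ β : ℝ → ℂ} {l : Filter ℝ}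
    (hγ : IsAsymptoticToRay n θ γ l) (hβ : IsAsymptoticToRay n θ β atTop)
    (hc : ContinuousOn β (Ici 0)) {η : ℝ} (hη : 0 < η) : ∀ᶠ s in l, 2 ≤ ‖γ s‖ ^ 2 ∧
      ∃ t, 0 ≤ t ∧ ‖β t‖ = ‖γ s‖ ∧ ‖γ s - β t‖ ≤ η * ‖γ s‖ ∧ (3 ≤ n → ‖γ s - β t‖ ≤ η) := by
  have key : ∀ {γ : ℝ → ℂ} {l : Filter ℝ}, IsAsymptoticToRay n θ γ l →
      ∀ᶠ s in l, ‖γ s / ‖γ s‖ - exp (θ * I)‖ < η / 2 ∧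
        (3 ≤ n → Metric.infDist (γ s) (ray θ) < η / 4) := by
    rintro γ l ⟨-, h2, h3⟩
    have a := h2.eventually (Metric.ball_mem_nhds _ (half_pos hη))
    by_cases hn : 3 ≤ n
    · filter_upwards [a, (h3 hn).eventually (gt_mem_nhds (show 0 < η / 4 by linarith))]
        with s hs hs'
      exact ⟨by rw [← dist_eq]; exact hs, fun _ => hs'⟩
    · filter_upwards [a] with s hs
      exact ⟨by rw [← dist_eq]; exact hs, fun h => absurd h hn⟩
  obtain ⟨T, hT⟩ := eventually_atTop.1 ((key hβ).and (eventually_ge_atTop 0))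
  have hT0 : 0 ≤ T := (hT T le_rfl).2
  filter_upwards [key hγ, hγ.1.eventually_ge_atTop ‖β T‖, hγ.1.eventually_ge_atTop 2]
    with s hs hsT hs2
  refine ⟨by nlinarith, ?_⟩
  obtain ⟨T', hT', hTT'⟩ := ((hβ.1.eventually_ge_atTop ‖γ s‖).and (eventually_ge_atTop T)).exists
  obtain ⟨t, ht, hβt⟩ := intermediate_value_Icc hTT'
    ((hc.mono fun x hx => hT0.trans hx.1).norm) ⟨hsT, hT'⟩
  have ht' := (hT t ht.1).1
  have hβt' : ‖β t‖ = ‖γ s‖ := hβt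
  refine ⟨t, hT0.trans ht.1, hβt', ?_, fun hn => ?_⟩
  · have hR : 0 < ‖γ s‖ := by linarith
    have hRC : (‖γ s‖ : ℂ) ≠ 0 := by exact_mod_cast hR.ne'
    have e : γ s - β t = (γ s / ‖γ s‖ - β t / ‖β t‖) * ‖γ s‖ := by
      rw [hβt']; field_simp
    rw [e, norm_mul, norm_real, norm_norm]
    refine mul_le_mul_of_nonneg_right ?_ hR.le
    have h1 := norm_sub_le_norm_sub_add_norm_sub (γ s / ‖γ s‖) (exp (θ * I)) (β t / ‖β t‖)
    rw [norm_sub_rev (exp (θ * I))] at h1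
    linarith [hs.1, ht'.1]
  · have h1 := norm_sub_le_norm_sub_add_norm_sub (γ s) (‖γ s‖ * exp (θ * I)) (β t)
    have h2 := norm_sub_lt_of_infDist_ray (hs.2 hn)
    have h3 := norm_sub_lt_of_infDist_ray (ht'.2 hn)
    rw [hβt'] at h3
    rw [norm_sub_rev (_ * _)] at h1
    linarith

/-- Keeping the same unit vector $y$, the distance is at most
$|\gamma-\beta|+|w-w'|\le3|\gamma-\beta|$, whence $\varepsilon/3$. The relative bound uses
$|\gamma|\le|z|$. -/
theorem isAsymptoticTo_of_isAsymptoticToRay (hp : ‖p‖ = 1) {θ : ℝ} {γ β : ℝ → ℂ} {l : Filter ℝ}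
    (hγ : IsAsymptoticToRay n θ γ l) (hβ : IsAsymptoticToRay n θ β atTop)
    (hc : ContinuousOn β (Ici 0)) : IsAsymptoticTo n p γ l (ansatzSet p (β '' Ici 0)) := by
  intro ε hε
  filter_upwards [hγ.eventually_exists hβ hc (show 0 < ε / 3 by linarith)] with s hs z hz
  obtain ⟨h2, t, ht, hβt, h3, h4⟩ := hs
  obtain ⟨w, hw, y, hy, hpy, rfl⟩ := mem_ansatzSet_singleton hz
  obtain ⟨w', hw', hww⟩ := exists_sqrt_close hw hβt h2
  have hd : Metric.infDist (γ s • complexify n p + w • complexify n y)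
      (ansatzSet p (β '' Ici 0)) ≤ 3 * ‖γ s - β t‖ := by
    have hm : β t • complexify n p + w' • complexify n y ∈ ansatzSet p (β '' Ici 0) :=
      ⟨β t, mem_image_of_mem _ ht, w', hw', y, hy, hpy, rfl⟩
    refine (Metric.infDist_le_dist_of_mem hm).trans ?_
    rw [dist_eq_norm, add_sub_add_comm, ← sub_smul, ← sub_smul]
    refine (norm_add_le _ _).trans ?_
    rw [norm_smul, norm_smul, norm_complexify, norm_complexify, hp, hy]
    linarith
  have hz' := norm_le_of_inner (w := w) (γ := γ s) hp hpy
  refine ⟨hd.trans ?_, fun hn => hd.trans (by linarith [h4 hn])⟩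
  nlinarith

variable {n : ℕ} {p : RSpace n}

/-! ### Indices -/

/-- The branches are numbered by their half-lines; this is the number of a branch when one begins
with the first branch at `1`. -/
def idx (n : ℕ) (k : ZMod (2 * n - 2)) : ℕ := (k + (((n + 1) / 2 - 1 : ℕ) : ZMod (2 * n - 2))).val

/-- The starting point of a branch. -/
def sg (n : ℕ) (k : ZMod (2 * n - 2)) : ℂ := if idx n k < n - 1 then 1 else -1

/-- The number of a branch among those with the same starting point. -/
def ix (n : ℕ) (k : ZMod (2 * n - 2)) : ℕ :=
  if idx n k < n - 1 then idx n k + 1 else idx n k + 1 - (n - 1)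

theorem sg_or (k : ZMod (2 * n - 2)) : sg n k = 1 ∨ sg n k = -1 := by
  unfold sg; split_ifs <;> simp

theorem one_ne_neg_one : (1 : ℂ) ≠ -1 := by norm_num

theorem idx_lt (hn : 2 ≤ n) (k : ZMod (2 * n - 2)) : idx n k < 2 * n - 2 := by
  have : NeZero (2 * n - 2) := ⟨by omega⟩
  exact ZMod.val_lt _

theorem idx_injective (hn : 2 ≤ n) : Function.Injective (idx n) := fun _ _ h => by
  have : NeZero (2 * n - 2) := ⟨by omega⟩
  exact add_right_cancel (ZMod.val_injective _ h)

theorem exists_idx {N : ℕ} (hN : N < 2 * n - 2) : ∃ k, idx n k = N :=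
  ⟨(N : ZMod (2 * n - 2)) - (((n + 1) / 2 - 1 : ℕ) : ZMod (2 * n - 2)), by
    rw [idx, sub_add_cancel, ZMod.val_natCast_of_lt hN]⟩

theorem idx_add_one (hn : 2 ≤ n) (k : ZMod (2 * n - 2)) :
    idx n (k + 1) = if idx n k + 1 = 2 * n - 2 then 0 else idx n k + 1 := by
  have : NeZero (2 * n - 2) := ⟨by omega⟩
  have : Fact (1 < 2 * n - 2) := ⟨by omega⟩
  have h := idx_lt hn k
  rw [idx, add_right_comm, ZMod.val_add, ZMod.val_one]
  change (idx n k + 1) % _ = _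
  split_ifs with h'
  · rw [h', Nat.mod_self]
  · exact Nat.mod_eq_of_lt (by omega)

theorem one_le_ix (k : ZMod (2 * n - 2)) : 1 ≤ ix n k := by
  unfold ix; split_ifs <;> omega

theorem ix_le (hn : 2 ≤ n) (k : ZMod (2 * n - 2)) : ix n k ≤ n - 1 := by
  have := idx_lt hn k
  unfold ix; split_ifs <;> omega

theorem sg_ix_injective (hn : 2 ≤ n) {k l : ZMod (2 * n - 2)} (h1 : sg n k = sg n l)
    (h2 : ix n k = ix n l) : k = l := by
  apply idx_injective hn
  unfold sg at h1
  unfold ix at h2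
  split_ifs at h1 h2 with a b b
  · omega
  · exact absurd h1 one_ne_neg_one
  · exact absurd h1.symm one_ne_neg_one
  · omega

theorem exists_sg_ix {s : ℂ} (hs : s = 1 ∨ s = -1) {j : ℕ} (h1 : 1 ≤ j)
    (hj : j ≤ n - 1) : ∃ k, sg n k = s ∧ ix n k = j := by
  rcases hs with rfl | rfl
  · obtain ⟨k, hk⟩ := exists_idx (n := n) (N := j - 1) (by omega)
    have : idx n k < n - 1 := by omega
    exact ⟨k, by rw [sg, if_pos this], by rw [ix, if_pos this]; omega⟩
  · obtain ⟨k, hk⟩ := exists_idx (n := n) (N := j - 1 + (n - 1)) (by omega)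
    have : ¬ idx n k < n - 1 := by omega
    exact ⟨k, by rw [sg, if_neg this], by rw [ix, if_neg this]; omega⟩

/-- The successor of a branch starts from the same point, except after the last branch at $\pm1$:
the next one is then the first at $\mp1$, beyond the crossing cell. -/
theorem sg_ix_add_one (hn : 2 ≤ n) (k : ZMod (2 * n - 2)) :
    (ix n k + 1 ≤ n - 1 ∧ sg n (k + 1) = sg n k ∧ ix n (k + 1) = ix n k + 1) ∨
      (ix n k = n - 1 ∧ sg n (k + 1) = -sg n k ∧ ix n (k + 1) = 1) := by
  have h := idx_lt hn k
  have h1 := idx_add_one hn k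
  simp only [sg, ix]
  split_ifs at h1 with h2
  · have a : ¬ idx n k < n - 1 := by omega
    have b : 0 < n - 1 := by omega
    simp only [h1, a, b, if_true, if_false, neg_neg]
    exact Or.inr ⟨by omega, trivial, trivial⟩
  · rw [h1]
    rcases lt_trichotomy (idx n k + 1) (n - 1) with h3 | h3 | h3
    · have a : idx n k < n - 1 := by omega
      simp only [h3, a, if_true, and_true]
      exact Or.inl (by omega)
    · have a : idx n k < n - 1 := by omega
      have b : ¬ idx n k + 1 < n - 1 := by omega
      simp only [a, b, if_true, if_false, true_and]
      exact Or.inr (by omega)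
    · have a : ¬ idx n k < n - 1 := by omega
      have b : ¬ idx n k + 1 < n - 1 := by omega
      simp only [a, b, if_false, true_and]
      exact Or.inl (by omega)

theorem image_ix (hn : 2 ≤ n) {s : ℂ} (hs : s = 1 ∨ s = -1) :
    ix n '' {k | sg n k = s} = Icc 1 (n - 1) := by
  apply Subset.antisymm
  · rintro _ ⟨k, -, rfl⟩
    exact ⟨one_le_ix k, ix_le hn k⟩
  · rintro j ⟨h1, hj⟩
    exact exists_sg_ix hs h1 hj

theorem ncard_sg (hn : 2 ≤ n) {s : ℂ} (hs : s = 1 ∨ s = -1) : {k | sg n k = s}.ncard = n - 1 := by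
  have hi : InjOn (ix n) {k | sg n k = s} := fun k hk l hl h =>
    sg_ix_injective hn (Eq.trans hk hl.symm) h
  rw [← hi.ncard_image, image_ix hn hs]
  simp [← Finset.coe_Icc, ncard_coe_finset]

/-- Half-lines are spaced by $\pi/(n-1)$, and passing from $1$ to $-1$ is a half-turn, that is $n-1$
steps. So one formula in `idx` serves both starting points. The offset $\lfloor(n+1)/2\rfloor-1$
makes it agree with `rayAngle` in both parities. -/
theorem exp_rayAngle (hn : 2 ≤ n) (k : ZMod (2 * n - 2)) : exp (rayAngle n k * I) =
    sg n k * exp ((n * angA n (ix n k) / (2 * (n - 1)) : ℝ) * I) := by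
  have : NeZero (2 * n - 2) := ⟨by omega⟩
  have hn0 : (n : ℝ) ≠ 0 := by exact_mod_cast (by omega : n ≠ 0)
  have hn1 : (n : ℝ) - 1 ≠ 0 := by
    have : (2:ℝ) ≤ n := by exact_mod_cast hn
    linarith
  set m := (n + 1) / 2 - 1
  have h1 : sg n k * exp ((n * angA n (ix n k) / (2 * (n - 1)) : ℝ) * I) =
      exp (((idx n k + 1 - n / 2) * Real.pi / (n - 1) : ℝ) * I) := by
    rw [sg, ix]
    split_ifs with h
    · rw [one_mul]
      congr 3
      rw [angA]
      push_cast
      field_simp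
      ring
    · rw [← exp_pi_mul_I, ← exp_add, ← add_mul, ← ofReal_add]
      congr 3
      have e : ((idx n k + 1 - (n - 1) : ℕ) : ℝ) = idx n k + 1 - (n - 1) := by
        rw [Nat.cast_sub (by omega), Nat.cast_sub (by omega)]; push_cast; ring
      rw [angA, e]
      field_simp
      ring
  -- Reduction modulo $2n-2$ changes the angle by a multiple of $2\pi$, since $2n-2$ steps make a
  -- full turn.
  have h2 : (k.val : ℝ) + m = idx n k + (2 * n - 2) * ((k.val + m) / (2 * n - 2) : ℕ) := by
    have hi : idx n k = (k.val + m) % (2 * n - 2) := by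
      rw [idx, ← ZMod.natCast_zmod_val k, ← Nat.cast_add, ZMod.val_natCast, ZMod.natCast_zmod_val]
    have := Nat.mod_add_div (k.val + m) (2 * n - 2)
    rw [← hi] at this
    have h3 : ((2 * n - 2 : ℕ) : ℝ) = 2 * n - 2 := by rw [Nat.cast_sub (by omega)]; push_cast; ring
    rw [← h3]
    exact_mod_cast this.symm
  have h3 : rayAngle n k = (k.val + m + 1 - n / 2) * Real.pi / (n - 1) := by
    rw [rayAngle]
    split_ifs with ho
    · obtain ⟨r, hr⟩ := ho
      have hm : (m : ℝ) = (n - 1) / 2 := by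
        have h : 2 * m + 1 = n := by omega
        rw [← h]; push_cast; ring
      rw [hm]
      field_simp
      ring
    · obtain ⟨r, hr⟩ := Nat.not_odd_iff_even.1 ho
      have hm : (m : ℝ) = n / 2 - 1 := by
        have h : 2 * m + 2 = n := by omega
        rw [← h]; push_cast; ring
      rw [hm]
      field_simp
      ring
  rw [h1, h3, h2]
  set N := (k.val + m) / (2 * n - 2)
  have h4 : (((idx n k + (2 * n - 2) * N + 1 - n / 2) * Real.pi / (n - 1) : ℝ) : ℂ) * I =
      (((idx n k + 1 - n / 2) * Real.pi / (n - 1) : ℝ) : ℂ) * I + N * (2 * Real.pi * I) := by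
    have : (idx n k + (2 * n - 2) * N + 1 - n / 2) * Real.pi / (n - 1) =
      (idx n k + 1 - n / 2) * Real.pi / (n - 1) + N * (2 * Real.pi) := by
      field_simp
      ring
    rw [this]
    push_cast
    ring
  rw [h4, exp_add, exp_nat_mul_two_pi_mul_I, mul_one]

/-! ### The phase portrait -/

/-- The branch asymptotic to `arg z = rayAngle n k`. -/
def branch (n : ℕ) (k : ZMod (2 * n - 2)) : ℝ → ℂ := sB n (sg n k) (ix n k)

/-- The starting direction of a branch. -/
def startDir (n : ℕ) (k : ZMod (2 * n - 2)) : ℂ := sg n k * exp (angA n (ix n k) * I)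

/-- The domain between two successive branches. -/
def cell (n : ℕ) (k : ZMod (2 * n - 2)) : Set ℂ := sD n (sg n k) (ix n k)

/-- The chart on `cell n k`. -/
def cellChart (n : ℕ) (k : ZMod (2 * n - 2)) : ℂ → ℂ := sE n (sg n k) (ix n k)

/-- The curves between two successive branches. -/
def flow (n : ℕ) (k : ZMod (2 * n - 2)) : ℝ → ℝ → ℂ := traj (cell n k) (cellChart n k)

theorem isBranch_branch (hn : 2 ≤ n) (k : ZMod (2 * n - 2)) :
    IsBranch n (sg n k) (startDir n k) (rayAngle n k) (branch n k) :=
  isBranch_sB hn (one_le_ix k) (ix_le hn k) (sg_or k) (exp_rayAngle hn k)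

theorem isChart_cell (hn : 2 ≤ n) (k : ZMod (2 * n - 2)) : IsChart n (cell n k) (cellChart n k) :=
  isChart_sE hn (one_le_ix k) (ix_le hn k) (sg_or k)

theorem flow_asymptotic_atBot (hn : 2 ≤ n) (k : ZMod (2 * n - 2)) {c : ℝ} (hc : 0 < c) :
    IsAsymptoticToRay n (rayAngle n k) (flow n k c) atBot :=
  sTraj_asymptotic_atBot hn (one_le_ix k) (ix_le hn k) (sg_or k) hc (exp_rayAngle hn k)

theorem flow_asymptotic_atTop (hn : 2 ≤ n) (k : ZMod (2 * n - 2)) {c : ℝ} (hc : 0 < c) :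
    IsAsymptoticToRay n (rayAngle n (k + 1)) (flow n k c) atTop := by
  have h := exp_rayAngle hn (k + 1)
  rcases sg_ix_add_one hn k with ⟨h1, h2, h3⟩ | ⟨h1, h2, h3⟩
  · rw [h2, h3] at h
    exact sTraj_asymptotic_atTop hn (one_le_ix k) h1 (sg_or k) hc h
  · rw [h2, h3] at h
    rw [flow, cell, cellChart, h1]
    exact sTraj_asymptotic_atTop_pred hn (sg_or k) hc h

theorem deriv_flow_ne_zero (hn : 2 ≤ n) (k : ZMod (2 * n - 2)) {c : ℝ} (hc : 0 < c) (s : ℝ) :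
    deriv (flow n k c) s ≠ 0 := by
  obtain ⟨d, hd, h⟩ := (isChart_cell hn k).hasDerivAt_traj hc s
  rw [flow, hd.deriv]
  rintro rfl
  norm_num at h

theorem image_startDir (hn : 2 ≤ n) {s : ℂ} (hs : s = 1 ∨ s = -1) :
    startDir n '' {k | sg n k = s} =
      {e | ∃ j : ℕ, 1 ≤ j ∧ j ≤ n - 1 ∧ e = s * exp (angA n j * I)} := by
  apply Subset.antisymm
  · rintro _ ⟨k, rfl, rfl⟩
    exact ⟨ix n k, one_le_ix k, ix_le hn k, rfl⟩
  · rintro _ ⟨j, h1, hj, rfl⟩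
    obtain ⟨k, rfl, rfl⟩ := exists_sg_ix hs h1 hj
    exact ⟨k, rfl, rfl⟩

theorem exp_angA (n j : ℕ) :
    exp (angA n j * I) = -exp ((2 * j * Real.pi / n : ℝ) * I) := by
  rw [← mul_neg_one, ← exp_neg_pi_mul_I, ← exp_add, angA]
  congr 1
  push_cast
  ring

theorem startDir_add_one (hn : 2 ≤ n) {k : ZMod (2 * n - 2)} (h : sg n (k + 1) = sg n k) :
    startDir n (k + 1) = startDir n k * exp ((2 * Real.pi / n : ℝ) * I) := by
  rcases sg_ix_add_one hn k with ⟨-, h2, h3⟩ | ⟨-, h2, -⟩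
  · rw [startDir, startDir, h2, h3, angA_succ, mul_assoc, ← exp_add]
    push_cast
    ring_nf
  · have h0 : sg n k = 0 := self_eq_neg.1 (h.symm.trans h2)
    rcases sg_or k with h1 | h1 <;> simp [h1] at h0

theorem branch_unique (hn : 2 ≤ n) {k l : ZMod (2 * n - 2)} {z : ℂ}
    (h : z ∈ branch n k '' Ioi 0) (h' : z ∈ branch n l '' Ioi 0) : k = l := by
  obtain ⟨h1, h2⟩ := sB_unique hn (one_le_ix k) (ix_le hn k) (one_le_ix l) (ix_le hn l) (sg_or k)
    (sg_or l) h h'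
  exact sg_ix_injective hn h1 h2

theorem cell_unique (hn : 2 ≤ n) {k l : ZMod (2 * n - 2)} {z : ℂ} (h : z ∈ cell n k)
    (h' : z ∈ cell n l) : k = l := by
  obtain ⟨h1, h2⟩ := sD_unique hn (one_le_ix k) (one_le_ix l) (sg_or k) (sg_or l) h h'
  exact sg_ix_injective hn h1 h2

theorem notMem_branch_of_mem_cell (hn : 2 ≤ n) {k l : ZMod (2 * n - 2)} {z : ℂ}
    (h : z ∈ cell n k) : z ∉ branch n l '' Ioi 0 := fun h' =>
  sD_disjoint_sB hn (one_le_ix l) (ix_le hn l) (sg_or k) (sg_or l) h h'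

theorem notMem_realSegment_of_mem_cell (hn : 2 ≤ n) {k : ZMod (2 * n - 2)} {z : ℂ}
    (h : z ∈ cell n k) : z ∉ realSegment := notMem_realSegment_of_mem_sD hn (sg_or k) h

theorem notMem_realSegment_of_mem_branch (hn : 2 ≤ n) {k : ZMod (2 * n - 2)} {z : ℂ}
    (h : z ∈ branch n k '' Ioi 0) : z ∉ realSegment := by
  obtain ⟨t, ht, rfl⟩ := h
  exact (isBranch_branch hn k).notMem_segment t ht

theorem mem_partition_branch_cell (hn : 2 ≤ n) (z : ℂ) :
    z ∈ realSegment ∨ (∃ k, z ∈ branch n k '' Ioi 0) ∨ ∃ k, z ∈ cell n k := by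
  rcases mem_partition hn z with h | ⟨s, hs, j, h1, hj, h⟩
  · exact Or.inl h
  · obtain ⟨k, rfl, rfl⟩ := exists_sg_ix hs h1 hj
    exact Or.inr (h.imp (fun h => ⟨k, h⟩) fun h => ⟨k, h⟩)

/-- The complement of the cells. -/
theorem mem_skeleton_iff (hn : 2 ≤ n) (z : ℂ) :
    z ∈ realSegment ∪ ⋃ k, branch n k '' Ici 0 ↔ ∀ k, z ∉ cell n k := by
  constructor
  · rintro (h | h) k hk
    · exact notMem_realSegment_of_mem_cell hn hk h
    · obtain ⟨l, t, ht, rfl⟩ := mem_iUnion.1 h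
      rcases eq_or_lt_of_le (show (0:ℝ) ≤ t from ht) with rfl | h0
      · rw [(isBranch_branch hn l).start] at hk
        refine notMem_realSegment_of_mem_cell hn hk ?_
        rcases sg_or l with h1 | h1 <;> rw [h1]
        · exact ⟨1, by simp, by simp⟩
        · exact ⟨-1, by simp, by simp⟩
      · exact notMem_branch_of_mem_cell hn hk ⟨t, h0, rfl⟩
  · intro h
    rcases mem_partition_branch_cell hn z with h1 | ⟨k, t, ht, rfl⟩ | ⟨k, hk⟩
    · exact Or.inl h1
    · exact Or.inr (mem_iUnion.2 ⟨k, t, mem_Ici_of_Ioi ht, rfl⟩)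
    · exact absurd hk (h k)

theorem existsUnique_flow (hn : 2 ≤ n) {k : ZMod (2 * n - 2)} {z : ℂ} (hz : z ∈ cell n k) :
    ∃! x : ZMod (2 * n - 2) × ℝ × ℝ, 0 < x.2.1 ∧ flow n x.1 x.2.1 x.2.2 = z := by
  have h := isChart_cell hn k
  refine ⟨(k, (cellChart n k z).im, -(cellChart n k z).re), ⟨h.im_pos hz, h.traj_eq hz⟩, ?_⟩
  rintro ⟨l, c, s⟩ ⟨hc, rfl⟩
  obtain rfl : l = k := cell_unique hn ((isChart_cell hn l).traj_mem hc s) hz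
  have e : cellChart n l (flow n l c s) = -s + c * I := h.map_traj hc s
  rw [e]
  simp

/-- The curves of the phase portrait. -/
def phasePortrait (n : ℕ) : Set (Set ℂ) :=
  {S | S = ofReal '' Ioo (-1) 1 ∨ (∃ k, S = branch n k '' Ioi 0) ∨
    ∃ k c, 0 < c ∧ S = range (flow n k c)}

theorem isLeaf_phasePortrait (hn : 2 ≤ n) : ∀ S ∈ phasePortrait n, IsLeaf n S := by
  rintro _ (rfl | ⟨k, rfl⟩ | ⟨k, c, hc, rfl⟩)
  · exact isLeaf_segment n
  · exact isLeaf_sB hn (one_le_ix k) (ix_le hn k) (sg_or k)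
  · exact (isChart_cell hn k).isLeaf hc

theorem mem_cell_of_mem_range (hn : 2 ≤ n) {k : ZMod (2 * n - 2)} {c : ℝ} (hc : 0 < c) {z : ℂ}
    (h : z ∈ range (flow n k c)) : z ∈ cell n k := by
  obtain ⟨s, rfl⟩ := h
  exact (isChart_cell hn k).traj_mem hc s

theorem phasePortrait_unique (hn : 2 ≤ n) : ∀ S ∈ phasePortrait n, ∀ T ∈ phasePortrait n,
    ∀ z ∈ S, z ∈ T → S = T := by
  have hs : ofReal '' Ioo (-1 : ℝ) 1 ⊆ realSegment := image_mono Ioo_subset_Icc_self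
  rintro _ (rfl | ⟨k, rfl⟩ | ⟨k, c, hc, rfl⟩) _ (rfl | ⟨l, rfl⟩ | ⟨l, c', hc', rfl⟩) z hS hT
  · rfl
  · exact absurd (hs hS) (notMem_realSegment_of_mem_branch hn hT)
  · exact absurd (hs hS) (notMem_realSegment_of_mem_cell hn (mem_cell_of_mem_range hn hc' hT))
  · exact absurd (hs hT) (notMem_realSegment_of_mem_branch hn hS)
  · rw [branch_unique hn hS hT]
  · exact absurd hS (notMem_branch_of_mem_cell hn (mem_cell_of_mem_range hn hc' hT))
  · exact absurd (hs hT) (notMem_realSegment_of_mem_cell hn (mem_cell_of_mem_range hn hc hS))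
  · exact absurd hT (notMem_branch_of_mem_cell hn (mem_cell_of_mem_range hn hc hS))
  · obtain rfl := cell_unique hn (mem_cell_of_mem_range hn hc hS) (mem_cell_of_mem_range hn hc' hT)
    have h := isChart_cell hn k
    rw [flow, h.range_traj hc] at hS
    rw [flow, h.range_traj hc'] at hT
    rw [← hS.2, ← hT.2]

theorem exists_mem_phasePortrait (hn : 2 ≤ n) {z : ℂ} (h1 : z ≠ 1) (h2 : z ≠ -1) :
    ∃ S ∈ phasePortrait n, z ∈ S := by
  rcases mem_partition_branch_cell hn z with ⟨x, hx, rfl⟩ | ⟨k, hk⟩ | ⟨k, hk⟩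
  · refine ⟨_, Or.inl rfl, x, ⟨lt_of_le_of_ne hx.1 fun h => h2 ?_,
      lt_of_le_of_ne hx.2 fun h => h1 ?_⟩, rfl⟩
    · rw [← h]; simp
    · rw [h]; simp
  · exact ⟨_, Or.inr (Or.inl ⟨k, rfl⟩), hk⟩
  · have h := isChart_cell hn k
    exact ⟨_, Or.inr (Or.inr ⟨k, _, h.im_pos hk, rfl⟩), _, h.traj_eq hk⟩

end ComplexSphere

end

/-! ### The classification theorem. -/

theorem mainTheorem3 (n : ℕ) (hn : 2 ≤ n) :
    ∃ (a d : ZMod (2 * n - 2) → ℂ) (β : ZMod (2 * n - 2) → ℝ → ℂ)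
      (Φ : ZMod (2 * n - 2) → ℝ → ℝ → ℂ),
      -- the `2n - 2` branches, one for each of the half-lines `arg z = rayAngle n k`
      (∀ k, IsBranch n (a k) (d k) (rayAngle n k) (β k)) ∧
      (∀ j k, j ≠ k → Disjoint (β j '' Set.Ioi 0) (β k '' Set.Ioi 0)) ∧
      -- one half of them start from `1`, the other half from `-1`
      (∀ k, a k = 1 ∨ a k = -1) ∧
      {k | a k = 1}.ncard = n - 1 ∧ {k | a k = -1}.ncard = n - 1 ∧
      -- their directions at `±1`, at angles `2π/n`, the remaining direction being the segment's
      d '' {k | a k = 1} = {e | ∃ j : ℕ, 1 ≤ j ∧ j ≤ n - 1 ∧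
        e = Complex.exp ((2 * j * Real.pi / n + Real.pi : ℝ) * Complex.I)} ∧
      d '' {k | a k = -1} = {e | ∃ j : ℕ, 1 ≤ j ∧ j ≤ n - 1 ∧
        e = Complex.exp ((2 * j * Real.pi / n : ℝ) * Complex.I)} ∧
      (∀ k, a (k + 1) = a k →
        d (k + 1) = d k * Complex.exp ((2 * Real.pi / n : ℝ) * Complex.I)) ∧
      -- the other curves `Φ k c`, `c > 0`: smooth one-parameter families of smooth curves that
      -- fill the complement of the segment and of the branches; the two ends of `Φ k c` are
      -- asymptotic to two successive half-lines
      (∀ k, ContDiffOn ℝ ∞ (fun x : ℝ × ℝ => Φ k x.1 x.2) (Set.Ioi 0 ×ˢ Set.univ)) ∧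
      (∀ k c s, 0 < c → deriv (Φ k c) s ≠ 0) ∧
      (∀ k c s, 0 < c → Φ k c s ∉ realSegment ∪ ⋃ j, β j '' Set.Ici 0) ∧
      (∀ z : ℂ, z ∉ realSegment ∪ ⋃ j, β j '' Set.Ici 0 →
        ∃! x : ZMod (2 * n - 2) × ℝ × ℝ, 0 < x.2.1 ∧ Φ x.1 x.2.1 x.2.2 = z) ∧
      (∀ k c, 0 < c → IsAsymptoticToRay n (rayAngle n k) (Φ k c) Filter.atBot ∧
        IsAsymptoticToRay n (rayAngle n (k + 1)) (Φ k c) Filter.atTop) ∧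
      -- the corresponding special Lagrangians, with poles `±p`
      ∀ (u : ℝ → ℝ), IsStenzelPotential n u → ∀ p : RSpace n, ‖p‖ = 1 →
        -- first kind: the real sphere
        (ansatzSet p realSegment = realSphere n ∧ IsSpecialLagrangian n u (realSphere n)) ∧
        -- second kind: they touch the real sphere at the pole `p` or `-p`
        (∀ k, IsSpecialLagrangian n u (ansatzSet p (β k '' Set.Ici 0)) ∧
          ansatzSet p (β k '' Set.Ici 0) ∩ realSphere n = {a k • complexify n p}) ∧
        -- third kind: their two ends are asymptotic to two successive members of the second kind
        (∀ k c, 0 < c → IsSpecialLagrangian n u (ansatzSet p (Set.range (Φ k c))) ∧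
          IsAsymptoticTo n p (Φ k c) Filter.atBot (ansatzSet p (β k '' Set.Ici 0)) ∧
          IsAsymptoticTo n p (Φ k c) Filter.atTop (ansatzSet p (β (k + 1) '' Set.Ici 0))) ∧
        -- there are no others: a curve of the ansatz defines a special Lagrangian immersion if
        -- and only if it is contained in one of the curves above
        (∀ γ w : ℝ → ℂ, ContDiff ℝ 1 γ → (∀ s, deriv γ s ≠ 0) → (∀ s, γ s ≠ 1 ∧ γ s ≠ -1) →
          Continuous w → (∀ s, w s ^ 2 = 1 - γ s ^ 2) →
          (IsSpecialLagrangianAnsatz n u p γ w ↔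
            Set.range γ ⊆ Complex.ofReal '' Set.Ioo (-1) 1 ∨
            (∃ k, Set.range γ ⊆ β k '' Set.Ioi 0) ∨
            ∃ k c, 0 < c ∧ Set.range γ ⊆ Set.range (Φ k c))) := by
  refine ⟨sg n, startDir n, branch n, flow n, isBranch_branch hn, fun j k hjk => ?_, sg_or,
    ncard_sg hn (Or.inl rfl), ncard_sg hn (Or.inr rfl), ?_, ?_,
    fun k hk => startDir_add_one hn hk, fun k => (isChart_cell hn k).contDiffOn_traj,
    fun k c s hc => deriv_flow_ne_zero hn k hc s, fun k c s hc h => ?_, fun z hz => ?_,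
    fun k c hc => ⟨flow_asymptotic_atBot hn k hc, flow_asymptotic_atTop hn k hc⟩,
    fun u hu p hp => ⟨⟨ansatzSet_realSegment hn hp, isSpecialLagrangian_realSphere hn hu.smooth⟩,
      fun k => ⟨isSpecialLagrangian_sB hn hu.smooth hp (one_le_ix k) (ix_le hn k) (sg_or k),
        ansatzSet_inter_realSphere hn hp (one_le_ix k) (ix_le hn k) (sg_or k)⟩,
      fun k c hc => ⟨?_,
        isAsymptoticTo_of_isAsymptoticToRay hp (flow_asymptotic_atBot hn k hc)
          (isBranch_branch hn k).asymptotic (isBranch_branch hn k).continuousOn,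
        isAsymptoticTo_of_isAsymptoticToRay hp (flow_asymptotic_atTop hn k hc)
          (isBranch_branch hn (k + 1)).asymptotic (isBranch_branch hn (k + 1)).continuousOn⟩,
      fun γ w hγ hγ' hγ1 hw hw2 => ?_⟩⟩
  · exact Set.disjoint_left.2 fun z hj hk => hjk (branch_unique hn hj hk)
  · rw [image_startDir hn (Or.inl rfl)]
    ext e
    refine exists_congr fun j => and_congr_right fun _ => and_congr_right fun _ => ?_
    rw [one_mul, exp_angA, Complex.ofReal_add, add_mul, Complex.exp_add, Complex.exp_pi_mul_I,
      mul_neg_one]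
  · rw [image_startDir hn (Or.inr rfl)]
    ext e
    refine exists_congr fun j => and_congr_right fun _ => and_congr_right fun _ => ?_
    rw [exp_angA, neg_mul_neg, one_mul]
  · exact (mem_skeleton_iff hn _).1 h k ((isChart_cell hn k).traj_mem hc s)
  · rw [mem_skeleton_iff hn] at hz
    push Not at hz
    obtain ⟨k, hk⟩ := hz
    exact existsUnique_flow hn hk
  · obtain ⟨W, hW, hW2⟩ := exists_sqrt_sD (n := n) (j := ix n k) (sg_or k)
    exact (isChart_cell hn k).isSpecialLagrangian_traj hn hu.smooth hp hW hW2 hc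
  · rw [isSpecialLagrangianAnsatz_iff hn hu.smooth hp hγ hγ' hγ1 hw hw2,
      curve_mem_leaf_iff (isLeaf_phasePortrait hn) (phasePortrait_unique hn) hγ fun s =>
        exists_mem_phasePortrait hn (hγ1 s).1 (hγ1 s).2]
    constructor
    · rintro ⟨_, rfl | ⟨k, rfl⟩ | ⟨k, c, hc, rfl⟩, h⟩
      · exact Or.inl h
      · exact Or.inr (Or.inl ⟨k, h⟩)
      · exact Or.inr (Or.inr ⟨k, c, hc, h⟩)
    · rintro (h | ⟨k, h⟩ | ⟨k, c, hc, h⟩)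
      · exact ⟨_, Or.inl rfl, h⟩
      · exact ⟨_, Or.inr (Or.inl ⟨k, rfl⟩), h⟩
      · exact ⟨_, Or.inr (Or.inr ⟨k, c, hc, rfl⟩), h⟩
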